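/- Let $M$ be a nonempty smooth manifold (Hausdorff, second countable, without boundary) of dimension $2n+1$ with $n\ge 1$, and let $\xi=\ker\alpha$ be a contact structure on $M$ cooriented by a contact form $\alpha$ (a smooth $1$-form with $\alpha\wedge(d\alpha)^n$ nowhere vanishing). Then there exist a contact form $\lambda$ on $M$ with $\ker\lambda=\xi$, inducing the same coorientation, and a smooth complex structure $J$ on $\xi$ compatible with $d\lambda$ (that is, $d\lambda(\cdot,J\cdot)$ is symmetric and positive definite on $\xi$) such that the following holds. Let $X_\lambda$ be the Reeb vector field of $\lambda$, given by $\lambda(X_\lambda)=1$ and $d\lambda(X_\lambda,\cdot)=0$, and let $\tilde J$ be the $\mathbb{R}$-invariant almost complex structure on $\mathbb{R}\times M$ with $\tilde J\partial_a=X_\lambda$ and $\tilde J|_\xi=J$. For an open set $\Omega\subseteq\mathbb{C}$, a smooth map $\tilde u=(a,u):\Omega\to\mathbb{R}\times M$ is pseudoholomorphic if $d\tilde u\circ i=\tilde J\circ d\tilde u$, and it has finite energy if $$\sup_{\varphi}\int_{\Omega}\tilde u^*d(\varphi\lambda)<\infty ,$$ where $\varphi$ runs over the smooth functions $\mathbb{R}\to[0,1]$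 with $\varphi'\ge 0$, $\lim_{-\infty}\varphi=0$ and $\lim_{+\infty}\varphi=1$. It is called a plane if $\Omega=\mathbb{C}$, with one puncture $\infty$, and a cylinder if $\Omega=\mathbb{C}\setminus\{0\}\cong\mathbb{R}\times\mathbb{R}/\mathbb{Z}$, with the two punctures $0$ and $\infty$. The limit set of $\tilde u$ at a puncture $z_0$ is the set of all smooth loops $\gamma:\mathbb{R}/\mathbb{Z}\to M$ with $\dot\gamma=T\,X_\lambda\circ\gamma$ for a constant $T\neq 0$ for which there are a holomorphic embedding $\psi:[0,\infty)\times\mathbb{R}/\mathbb{Z}\to\Omega$ with $\lim_{s\to\infty}\psi(s,t)=z_0$ and a sequence $s_k\to\infty$ such that $u\circ\psi(s_k,\cdot)\to\gamma$ in $C^\infty(\mathbb{R}/\mathbb{Z},M)$. Then there exist, for the data $(\lambda,J)$, (1) a finite-energy pseudoholomorphic plane such that the union of the images of the orbits in its limit set at $\infty$ is a smoothly embedded $2$-torus in $M$; and (2) a finite-energy pseudoholomorphic cylinder such that, at each of its two punctures, the union of the images of the orbits in the limit set is a smoothly embedded $2$-torus in $M$. At each of these punctures the limit set contains two Reeb orbits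 with different images; so the asymptotic limit at a puncture need not be a single Reeb orbit. -/

import Mathlib

open Set Filter Topology Manifold ContDiff MeasureTheory Bundle
open scoped ENNReal

noncomputable section

/-- `ℝᵈ`, the model space of a `d`-dimensional manifold. -/
abbrev Euc (d : ℕ) : Type := EuclideanSpace ℝ (Fin d)

/-- A (not necessarily smooth) `1`-form on a `d`-manifold. -/
abbrev OneForm (d : ℕ) (M : Type*) [TopologicalSpace M] [ChartedSpace (Euc d) M] : Type _ :=
  ∀ x : M, TangentSpace (𝓡 d) x →L[ℝ] ℝ

/-- A (not necessarily smooth) field of endomorphisms of the tangent bundle. -/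
abbrev TangentEnd (d : ℕ) (M : Type*) [TopologicalSpace M] [ChartedSpace (Euc d) M] : Type _ :=
  ∀ x : M, TangentSpace (𝓡 d) x →L[ℝ] TangentSpace (𝓡 d) x

section Forms

variable {d : ℕ} {M : Type*} [TopologicalSpace M] [ChartedSpace (Euc d) M]

/-- Smoothness of a `1`-form, as a section of the bundle `Hom(TM, ℝ)`. -/
def SmoothOneForm [IsManifold (𝓡 d) ∞ M] (lam : OneForm d M) : Prop :=
  ContMDiff (𝓡 d) ((𝓡 d).prod 𝓘(ℝ, Euc d →L[ℝ] ℝ)) ∞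
    (fun x => TotalSpace.mk' (Euc d →L[ℝ] ℝ)
      (E := fun x : M => TangentSpace (𝓡 d) x →L[ℝ] Bundle.Trivial M ℝ x) x (lam x))

/-- Smoothness of a field of endomorphisms, as a section of the bundle `Hom(TM, TM)`. -/
def SmoothTangentEnd [IsManifold (𝓡 d) ∞ M] (J : TangentEnd d M) : Prop :=
  ContMDiff (𝓡 d) ((𝓡 d).prod 𝓘(ℝ, Euc d →L[ℝ] Euc d)) ∞
    (fun x => TotalSpace.mk' (Euc d →L[ℝ] Euc d)
      (E := fun x : M => TangentSpace (𝓡 d) x →L[ℝ] TangentSpace (𝓡 d) x) x (J x))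

/-- The pullback of `lam` by the inverse of the preferred chart at `x₀`: a `1`-form on an open
subset of `ℝᵈ`. -/
def chartForm (lam : OneForm d M) (x₀ : M) (y : Euc d) : Euc d →L[ℝ] ℝ :=
  (lam ((extChartAt (𝓡 d) x₀).symm y)).comp
    (mfderiv 𝓘(ℝ, Euc d) (𝓡 d) (extChartAt (𝓡 d) x₀).symm y)

/-- The exterior derivative `dλ` at `x`, computed in the preferred chart at `x` by
`dη (v, w) = D_v (η w) - D_w (η v)` for constant `v`, `w`. -/
def extD (lam : OneForm d M) (x : M) (v w : TangentSpace (𝓡 d) x) : ℝ :=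
  let D := fderiv ℝ (chartForm lam x) (extChartAt (𝓡 d) x x)
  let A : TangentSpace (𝓡 d) x →L[ℝ] Euc d := mfderiv (𝓡 d) 𝓘(ℝ, Euc d) (extChartAt (𝓡 d) x) x
  D (A v) (A w) - D (A w) (A v)

end Forms

section Contact

/-- The value of the top-degree form `λ ∧ (dλ)ⁿ` (up to a positive constant that depends on `n`
only) on the vectors `v 0, …, v (2n)`. -/
def contactVolume {n : ℕ} {M : Type*} [TopologicalSpace M] [ChartedSpace (Euc (2 * n + 1)) M]
    (lam : OneForm (2 * n + 1) M) (x : M)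
    (v : Fin (2 * n + 1) → TangentSpace (𝓡 (2 * n + 1)) x) : ℝ :=
  ∑ σ : Equiv.Perm (Fin (2 * n + 1)), ((Equiv.Perm.sign σ : ℤ) : ℝ) *
    (lam x (v (σ 0)) *
      ∏ i : Fin n, extD lam x (v (σ ⟨2 * i + 1, by omega⟩)) (v (σ ⟨2 * i + 2, by omega⟩)))

/-- A contact form: a smooth `1`-form `λ` for which `λ ∧ (dλ)ⁿ` vanishes nowhere. -/
def IsContactForm {n : ℕ} {M : Type*} [TopologicalSpace M] [ChartedSpace (Euc (2 * n + 1)) M]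
    [IsManifold (𝓡 (2 * n + 1)) ∞ M] (lam : OneForm (2 * n + 1) M) : Prop :=
  SmoothOneForm lam ∧ ∀ x, ∃ v, contactVolume lam x v ≠ 0

variable {d : ℕ} {M : Type*} [TopologicalSpace M] [ChartedSpace (Euc d) M]

/-- The Reeb vector field of a contact form `lam`: the unique vector field `R` with `λ(R) = 1` and
`dλ(R, ·) = 0`. -/
def reeb (lam : OneForm d M) (x : M) : TangentSpace (𝓡 d) x :=
  Classical.epsilon fun R => lam x R = 1 ∧ ∀ w, extD lam x R w = 0

/-- The projection of `T_x M` onto `ker λ_x` along the Reeb vector field. -/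
def xiProj (lam : OneForm d M) (x : M) (v : TangentSpace (𝓡 d) x) : TangentSpace (𝓡 d) x :=
  v - lam x v • reeb lam x

/-- `J` restricts to a smooth complex structure on `ξ = ker λ` that is compatible with `dλ`:
`J² = -1` on `ξ`, and `dλ(·, J ·)` is symmetric and positive definite on `ξ`. Only the values of
`J` on `ξ` matter. -/
structure IsCompatible [IsManifold (𝓡 d) ∞ M] (lam : OneForm d M) (J : TangentEnd d M) :
    Prop where
  smooth : SmoothTangentEnd J
  preserves : ∀ x v, lam x v = 0 → lam x (J x v) = 0
  sq : ∀ x v, lam x v = 0 → J x (J x v) = -v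
  symm : ∀ x v w, lam x v = 0 → lam x w = 0 → extD lam x v (J x w) = extD lam x w (J x v)
  pos : ∀ x v, lam x v = 0 → v ≠ 0 → 0 < extD lam x v (J x v)

/-- The `ℝ`-invariant almost complex structure `J̃` on `ℝ × M`, at a point of `ℝ × {x}`: it sends
`∂_a` to the Reeb vector, hence the Reeb vector to `-∂_a`, and it is `J` on `ξ`. -/
def symplJ (lam : OneForm d M) (J : TangentEnd d M) (x : M)
    (p : ℝ × TangentSpace (𝓡 d) x) : ℝ × TangentSpace (𝓡 d) x :=
  (-lam x p.2, p.1 • reeb lam x + J x (xiProj lam x p.2))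

end Contact

section Curves

variable {d : ℕ} {M : Type*} [TopologicalSpace M] [ChartedSpace (Euc d) M]

/-- The differential of `u : ℂ → M` at `z`. -/
def du (u : ℂ → M) (z ζ : ℂ) : TangentSpace (𝓡 d) (u z) :=
  mfderiv 𝓘(ℝ, ℂ) (𝓡 d) u z ζ

/-- `ũ = (a, u)`, defined on the open set `Ω ⊆ ℂ`, is smooth and `J̃`-holomorphic:
`dũ ∘ i = J̃ ∘ dũ`. -/
structure IsPseudoholomorphic (lam : OneForm d M) (J : TangentEnd d M) (Ω : Set ℂ)
    (a : ℂ → ℝ) (u : ℂ → M) : Prop where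
  smooth_a : ContDiffOn ℝ ∞ a Ω
  smooth_u : ContMDiffOn 𝓘(ℝ, ℂ) (𝓡 d) ∞ u Ω
  eq : ∀ z ∈ Ω, ∀ ζ : ℂ, (fderiv ℝ a z (Complex.I * ζ), du u z (Complex.I * ζ)) =
    symplJ lam J (u z) (fderiv ℝ a z ζ, du u z ζ)

/-- The set `Ξ` of smooth nondecreasing functions `ℝ → [0, 1]` with limit `0` at `-∞` and `1` at
`+∞`. -/
def Xi : Set (ℝ → ℝ) :=
  {φ | ContDiff ℝ ∞ φ ∧ (∀ s, φ s ∈ Icc (0 : ℝ) 1) ∧ (∀ s, 0 ≤ deriv φ s) ∧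
    Tendsto φ atBot (𝓝 0) ∧ Tendsto φ atTop (𝓝 1)}

/-- The coefficient of `dx ∧ dy` in the `2`-form `ũ^* d(φλ) = ũ^*(φ'(a) da ∧ λ + φ(a) dλ)`. -/
def energyDensity (lam : OneForm d M) (a : ℂ → ℝ) (u : ℂ → M) (φ : ℝ → ℝ) (z : ℂ) : ℝ :=
  deriv φ (a z) * (fderiv ℝ a z 1 * lam (u z) (du u z Complex.I) -
      fderiv ℝ a z Complex.I * lam (u z) (du u z 1)) +
    φ (a z) * extD lam (u z) (du u z 1) (du u z Complex.I)

/-- The Hofer energy. The density is nonnegative for a pseudoholomorphic map, so its integral is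
well defined in `[0, ∞]`. -/
def hoferEnergy (lam : OneForm d M) (Ω : Set ℂ) (a : ℂ → ℝ) (u : ℂ → M) : ℝ≥0∞ :=
  ⨆ φ ∈ Xi, ∫⁻ z in Ω, ENNReal.ofReal (energyDensity lam a u φ z)

/-- A finite-energy pseudoholomorphic map on `Ω` for the data `(λ, J)`. For `Ω = ℂ` it is a plane;
for `Ω = ℂ \ {0}`, which is biholomorphic to `ℝ × ℝ/ℤ`, it is a cylinder. -/
def IsFiniteEnergyCurve (lam : OneForm d M) (J : TangentEnd d M) (Ω : Set ℂ)
    (a : ℂ → ℝ) (u : ℂ → M) : Prop :=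
  IsPseudoholomorphic lam J Ω a u ∧ hoferEnergy lam Ω a u < ⊤

/-- A holomorphic cylindrical coordinate system `[0, ∞) × ℝ/ℤ ⊂ ℂ/iℤ → Ω` around the puncture
whose punctured neighbourhoods generate the filter `e` (`cocompact ℂ` for `∞`, `𝓝[≠] 0` for `0`),
written as an `i`-periodic function on the half-plane `re ≥ 0`. It is a holomorphic embedding. -/
structure IsCylindricalCoord (Ω : Set ℂ) (e : Filter ℂ) (ψ : ℂ → ℂ) : Prop where
  holo : AnalyticOnNhd ℂ ψ {w | 0 ≤ w.re}
  deriv_ne : ∀ w : ℂ, 0 ≤ w.re → deriv ψ w ≠ 0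
  mapsTo : ∀ w : ℂ, 0 ≤ w.re → ψ w ∈ Ω
  eq_iff : ∀ w w' : ℂ, 0 ≤ w.re → 0 ≤ w'.re →
    (ψ w = ψ w' ↔ ∃ k : ℤ, w' = w + k * Complex.I)
  lim : Tendsto ψ (comap Complex.re atTop) e

/-- `C^∞` convergence of loops `v k : ℝ/ℤ → M` (written as `1`-periodic functions on `ℝ`) to
`γ`: near every `t₀`, in the preferred chart at `γ t₀`, all derivatives converge uniformly. -/
def LoopsTendsto (v : ℕ → ℝ → M) (γ : ℝ → M) : Prop :=
  ∀ t₀ : ℝ, ∃ N : Set ℝ, IsOpen N ∧ t₀ ∈ N ∧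
    MapsTo γ N (extChartAt (𝓡 d) (γ t₀)).source ∧
    (∀ᶠ k in atTop, MapsTo (v k) N (extChartAt (𝓡 d) (γ t₀)).source) ∧
    ∀ m : ℕ, TendstoUniformlyOn
      (fun k => iteratedDeriv m (fun t => extChartAt (𝓡 d) (γ t₀) (v k t)))
      (iteratedDeriv m (fun t => extChartAt (𝓡 d) (γ t₀) (γ t))) atTop N

/-- `γ : ℝ/ℤ → M` is a periodic orbit of the Reeb vector field: `γ' = T • X_λ ∘ γ` for a constant
`T ≠ 0`. -/
def IsReebOrbit (lam : OneForm d M) (γ : ℝ → M) : Prop :=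
  ContMDiff 𝓘(ℝ, ℝ) (𝓡 d) ∞ γ ∧ (∀ t, γ (t + 1) = γ t) ∧
    ∃ T : ℝ, T ≠ 0 ∧ ∀ t, mfderiv 𝓘(ℝ, ℝ) (𝓡 d) γ t (1 : ℝ) = T • reeb lam (γ t)

/-- The limit set of `u` at the puncture `e`: all periodic Reeb orbits that are the `C^∞` limit of
the loops `u ∘ ψ(s_k, ·)` for a cylindrical coordinate system `ψ` and a sequence `s_k → ∞`. -/
def limitSet (lam : OneForm d M) (Ω : Set ℂ) (e : Filter ℂ) (u : ℂ → M) : Set (ℝ → M) :=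
  {γ | IsReebOrbit lam γ ∧ ∃ ψ : ℂ → ℂ, IsCylindricalCoord Ω e ψ ∧
    ∃ s : ℕ → ℝ, (∀ k, 0 ≤ s k) ∧ Tendsto s atTop atTop ∧
      LoopsTendsto (d := d) (fun k t => u (ψ (s k + t * Complex.I))) γ}

/-- `S ⊆ M` is an embedded `2`-torus: the image of a smooth embedding of `ℝ²/ℤ²`, written as a
`ℤ²`-periodic immersion of `ℝ²` that is injective modulo `ℤ²`. -/
def IsEmbeddedTorus (d : ℕ) {M : Type*} [TopologicalSpace M] [ChartedSpace (Euc d) M]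
    (S : Set M) : Prop :=
  ∃ τ : ℝ × ℝ → M, ContMDiff 𝓘(ℝ, ℝ × ℝ) (𝓡 d) ∞ τ ∧
    (∀ p, Function.Injective (mfderiv 𝓘(ℝ, ℝ × ℝ) (𝓡 d) τ p)) ∧
    (∀ p q, τ p = τ q ↔ ∃ k l : ℤ, q = (p.1 + k, p.2 + l)) ∧
    range τ = S

/-- The Reeb orbits in the limit set at the puncture `e` sweep out an embedded `2`-torus, and they
are not all reparametrizations of a single one. -/
def HasTorusLimit (lam : OneForm d M) (Ω : Set ℂ) (e : Filter ℂ) (u : ℂ → M) : Prop :=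
  IsEmbeddedTorus d (⋃ γ ∈ limitSet lam Ω e u, range γ) ∧
    ∃ γ₁ ∈ limitSet lam Ω e u, ∃ γ₂ ∈ limitSet lam Ω e u, range γ₁ ≠ range γ₂

end Curves

end

/-! The curves are built explicitly in ℂ × ℝ and then transplanted into M. On ℂ × ℝ, with
cylindrical coordinates (r, θ, z), take λ = exp(F) (dz + r² dθ) with F depending on r and z only.
Choose a curve in the (r, z) half-plane, lift it so that its velocity lies in ker λ, and rotate it
by arg ζ while s = log |ζ| runs along it. For the resulting surface the Cauchy–Riemann equations say
that a depends on s only, with a' = A, where A = λ(∂_θ) = exp(F) r² is the action of the rotation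
circle, and that J sends the velocity of the curve to ∂_θ - A X_λ, the contact component of ∂_θ. The
value of dλ on these two vectors is dA/ds. So every curve along which the action increases becomes
pseudoholomorphic once J is prescribed along the surface (`IsModelSlice.symplJ_eq`,
`IsProfile.dform_surface`). Its energy is finite: in the coordinates s + it the energy density is
the derivative of φ(a) A with respect to s, so the energy is at most 2π sup A
(`hoferEnergy_lt_top`).

The curve has to spiral onto a circle. Let (ρ, φ) be polar coordinates of the half-plane around (7,
0), with (7 - r, -z) = ρ (cos φ, sin φ), and arrange that log A = T(ρ) + M(ρ) sin(tan ρ - φ) with M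
= exp(-tan² ρ) and T' = -(1 + tan² ρ) M. The curve φ = tan ρ winds infinitely often around the
circles ρ = π/2 and ρ = 3π/2. Near these radii M is flat, so log A is smooth and all circles of the
corresponding tori are Reeb orbits. The difficulty is that J, which is dictated along the spirals,
must extend smoothly over the limit tori. On the spiral the ρ-derivative of log A vanishes, so its
gradient is purely angular and the contact component of ∂_θ is M times a smooth radial field. With
the time parameter chosen so that dρ/ds = -M cos² ρ, the velocity is M times the smooth field made
of the angular field and cos² ρ times the radial one. Dividing both vectors by M leaves a smooth
frame across the tori (`hasModelFrame_of_lt`).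

The branch π/2 < ρ < 3π/2 spirals at both ends and gives the cylinder. The branch 3π/2 < ρ < 7 is
straightened by cutoffs, and F is switched off, so that the surface ends in the flat disc ζ ↦ (ζ, 0)
on the axis. This gives the plane. For every angle φ the spiral meets the ray of angle φ at times
tending to the puncture, so every circle of the torus occurs as a limit
(`IsModelSlice.exists_mem_limitSet`); conversely the distance ρ converges, so nothing else does
(`IsModelSlice.mem_of_mem_limitSet`).

For the transplantation (`IsContactForm.exists_model_slice`) no full Darboux theorem is needed. A
flow box in the direction of a vector field in ker α yields a three-dimensional slice on which α is
a positive multiple of dz + x dy - y dx, and the contact scaling makes room for a ball of any size.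
Rescaling α, with a suitable normal derivative of the conformal factor, produces exp(F) (dz + x dy -
y dx) on the slice and a Reeb field tangent to it. Finally J is the polar isometry of λ ⊗ λ + dλ
with respect to a Riemannian metric: prescribing J on vectors of the slice amounts to linear
conditions on the metric, which survive a partition of unity (`IsContactForm.exists_isCompatible`).
-/

noncomputable section

set_option synthInstance.maxHeartbeats 400000

/-! ### Superposition operators and smooth flows -/

section Superposition

variable {K : Type*} [TopologicalSpace K] [CompactSpace K]
variable {E F : Type} [NormedAddCommGroup E] [NormedSpace ℝ E]
  [NormedAddCommGroup F] [NormedSpace ℝ F]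

/-- A bilinear map, applied pointwise to continuous functions. -/
def pointwiseCLM (K : Type*) [TopologicalSpace K] [CompactSpace K]
    {G E F : Type} [NormedAddCommGroup G] [NormedSpace ℝ G] [NormedAddCommGroup E]
    [NormedSpace ℝ E] [NormedAddCommGroup F] [NormedSpace ℝ F] (L : G →L[ℝ] E →L[ℝ] F) :
    C(K, G) →L[ℝ] C(K, E) →L[ℝ] C(K, F) :=
  LinearMap.mkContinuous₂
    (LinearMap.mk₂ ℝ (fun (A : C(K, G)) (h : C(K, E)) =>
        (⟨fun t => L (A t) (h t), by fun_prop⟩ : C(K, F)))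
      (fun _ _ _ => by ext; simp) (fun _ _ _ => by ext; simp)
      (fun _ _ _ => by ext; simp) (fun _ _ _ => by ext; simp))
    ‖L‖ (fun A h => by
      rw [ContinuousMap.norm_le _ (by positivity)]
      intro t
      refine (L.le_opNorm₂ (A t) (h t)).trans ?_
      gcongr
      · exact A.norm_coe_le_norm t
      · exact h.norm_coe_le_norm t)

/-- The superposition operator `γ ↦ f ∘ γ`. -/
def superpose (f : C(E, F)) (γ : C(K, E)) : C(K, F) := f.comp γ

/-- At the points of the compact range of γ, f' is continuous with one modulus for all nearby points
of E. The mean value inequality on balls of a fixed radius then bounds the remainder for all t at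
once. -/
lemma hasFDerivAt_superpose (f : C(E, F)) (f' : C(E, E →L[ℝ] F))
    (hf : ∀ x, HasFDerivAt f (f' x) x) (γ : C(K, E)) :
    HasFDerivAt (superpose (K := K) f) (pointwiseCLM K (ContinuousLinearMap.id ℝ (E →L[ℝ] F)) (superpose f' γ)) γ := by
  rw [hasFDerivAt_iff_isLittleO_nhds_zero, Asymptotics.isLittleO_iff]
  intro c hc
  have hK : IsCompact (range γ) := isCompact_range γ.continuous
  have hu := hK.uniformContinuousAt_of_continuousAt f' (fun x _ => f'.continuous.continuousAt)
    (Metric.dist_mem_uniformity hc)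
  obtain ⟨δ, hδ, hδ'⟩ := Metric.mem_uniformity_dist.1 hu
  filter_upwards [Metric.ball_mem_nhds (0 : C(K, E)) hδ] with h hh
  rw [mem_ball_zero_iff] at hh
  rw [ContinuousMap.norm_le _ (by positivity)]
  intro t
  have hball : ∀ y ∈ Metric.ball (γ t) δ, ‖f' y - f' (γ t)‖ ≤ c := by
    intro y hy
    have := hδ' (a := γ t) (b := y) (by rw [dist_comm]; exact hy) ⟨t, rfl⟩
    have h2 : dist (f' (γ t)) (f' y) < c := this
    rw [dist_comm, dist_eq_norm] at h2
    exact h2.le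
  have hmv := (convex_ball (γ t) δ).norm_image_sub_le_of_norm_hasFDerivWithin_le'
    (f := f) (f' := f') (φ := f' (γ t)) (C := c) (x := γ t) (y := γ t + h t)
    (fun x _ => (hf x).hasFDerivWithinAt) hball (Metric.mem_ball_self hδ)
    (by
      rw [Metric.mem_ball, dist_eq_norm, add_sub_cancel_left]
      exact (h.norm_coe_le_norm t).trans_lt hh)
  rw [add_sub_cancel_left] at hmv
  refine le_trans (le_of_eq ?_)
    (hmv.trans (mul_le_mul_of_nonneg_left (h.norm_coe_le_norm t) hc.le))
  rfl

/-- The derivative of a superposition operator is the superposition operator of f', followed by a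
bounded bilinear map. Hence the induction on the order, with the target space varying. -/
lemma contDiff_superpose_nat (n : ℕ) : ∀ {F : Type} [NormedAddCommGroup F] [NormedSpace ℝ F]
    (f : C(E, F)), ContDiff ℝ n f → ContDiff ℝ n (superpose (K := K) f) := by
  induction n with
  | zero =>
    intro F _ _ f _
    rw [Nat.cast_zero, contDiff_zero]
    exact ContinuousMap.continuous_postcomp f
  | succ n ih =>
    intro F _ _ f hf
    have hf1 : ContDiff ℝ ((n : WithTop ℕ∞) + 1) f := by exact_mod_cast hf
    have hd := contDiff_succ_iff_fderiv.1 hf1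
    let f' : C(E, E →L[ℝ] F) := ⟨fderiv ℝ f, hd.2.2.continuous⟩
    have hff : ∀ x, HasFDerivAt f (f' x) x := fun x => (hd.1 x).hasFDerivAt
    have key : ContDiff ℝ ((n : WithTop ℕ∞) + 1) (superpose (K := K) f) := by
      rw [contDiff_succ_iff_hasFDerivAt]
      refine ⟨fun γ => pointwiseCLM K (ContinuousLinearMap.id ℝ (E →L[ℝ] F)) (superpose f' γ), ?_, hasFDerivAt_superpose f f' hff⟩
      exact (pointwiseCLM K (ContinuousLinearMap.id ℝ (E →L[ℝ] F))).contDiff.comp (ih f' hd.2.2)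
    exact_mod_cast key

lemma contDiff_superpose (f : C(E, F)) (hf : ContDiff ℝ ∞ f) :
    ContDiff ℝ ∞ (superpose (K := K) f) :=
  contDiff_infty.2 fun n => contDiff_superpose_nat n f (contDiff_infty.1 hf n)

end Superposition

/-! ### Inverse function theorem with a smooth inverse -/

section InverseFunction

variable {E F : Type*} [NormedAddCommGroup E] [NormedSpace ℝ E] [CompleteSpace E]
  [NormedAddCommGroup F] [NormedSpace ℝ F]

/-- The inverse function theorem with a smooth inverse on a whole neighbourhood. -/
theorem exists_openPartialHomeomorph_of_contDiffOn {f : E → F} {U : Set E} (hU : IsOpen U)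
    (hf : ContDiffOn ℝ ∞ f U) {a : E} (ha : a ∈ U) (f' : E ≃L[ℝ] F)
    (hf' : HasFDerivAt f (f' : E →L[ℝ] F) a) :
    ∃ Φ : OpenPartialHomeomorph E F, a ∈ Φ.source ∧ Φ.source ⊆ U ∧ ⇑Φ = f ∧
      ContDiffOn ℝ ∞ Φ.symm Φ.target ∧
      ∀ x ∈ Φ.source, ∃ g : E ≃L[ℝ] F, HasFDerivAt f (g : E →L[ℝ] F) x := by
  have hfa : ContDiffAt ℝ ∞ f a := hf.contDiffAt (hU.mem_nhds ha)
  let Φ₀ := hfa.toOpenPartialHomeomorph f hf' (by simp)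
  have hcont : ContinuousOn (fderiv ℝ f) U := hf.continuousOn_fderiv_of_isOpen hU (by simp)
  -- Invertibility of the derivative is an open condition. Restricting to it makes the inverse
  -- smooth on the whole target, not only at the image of a.
  let V : Set E := U ∩ (fderiv ℝ f) ⁻¹' (range ((↑) : (E ≃L[ℝ] F) → E →L[ℝ] F))
  have hV : IsOpen V := hcont.isOpen_inter_preimage hU ContinuousLinearEquiv.isOpen
  have haV : a ∈ V := ⟨ha, by rw [mem_preimage, hf'.fderiv]; exact ⟨f', rfl⟩⟩
  refine ⟨Φ₀.restrOpen V hV, ?_, ?_, ?_, ?_, ?_⟩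
  · exact ⟨hfa.mem_toOpenPartialHomeomorph_source hf' (by simp), haV⟩
  · exact fun x hx => hx.2.1
  · rfl
  · intro y hy
    have hy' := (Φ₀.restrOpen V hV).map_target hy
    set x := (Φ₀.restrOpen V hV).symm y with hx
    obtain ⟨g, hg⟩ := hy'.2.2
    have hfx : ContDiffAt ℝ ∞ f x := hf.contDiffAt (hU.mem_nhds hy'.2.1)
    refine ContDiffAt.contDiffWithinAt
      ((Φ₀.restrOpen V hV).contDiffAt_symm (f₀' := g) hy ?_ ?_)
    · have := (hfx.differentiableAt (by simp)).hasFDerivAt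
      rw [← hg] at this
      exact this
    · exact hfx
  · intro x hx
    obtain ⟨g, hg⟩ := hx.2.2
    refine ⟨g, ?_⟩
    have := ((hf.contDiffAt (hU.mem_nhds hx.2.1)).differentiableAt (by simp)).hasFDerivAt
    rw [← hg] at this
    exact this

end InverseFunction

/-! ### Smooth flows from the inverse function theorem in path space -/

section Flow

variable {E : Type} [NormedAddCommGroup E] [NormedSpace ℝ E] [CompleteSpace E]

/-- The Volterra operator `γ ↦ ∫₀ᵗ γ` on `C([0, 1], E)`. -/
def volterra (E : Type) [NormedAddCommGroup E] [NormedSpace ℝ E] [CompleteSpace E] :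
    C(unitInterval, E) →L[ℝ] C(unitInterval, E) :=
  LinearMap.mkContinuous
    { toFun := fun γ =>
        ⟨fun t => ∫ s in (0 : ℝ)..t, γ (projIcc 0 1 zero_le_one s), by
          have hc : Continuous fun s : ℝ => γ (projIcc 0 1 zero_le_one s) :=
            γ.continuous.comp continuous_projIcc
          exact (intervalIntegral.continuous_primitive
            (fun a b => hc.intervalIntegrable a b) 0).comp continuous_subtype_val⟩
      map_add' := fun γ δ => by
        ext t
        exact intervalIntegral.integral_add
          ((γ.continuous.comp continuous_projIcc).intervalIntegrable _ _)
          ((δ.continuous.comp continuous_projIcc).intervalIntegrable _ _)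
      map_smul' := fun c γ => by
        ext t
        exact intervalIntegral.integral_smul _ _ }
    1 (fun γ => by
      rw [ContinuousMap.norm_le _ (by positivity)]
      intro t
      have h := intervalIntegral.norm_integral_le_of_norm_le_const (a := (0 : ℝ)) (b := t)
        (C := ‖γ‖) (f := fun s => γ (projIcc 0 1 zero_le_one s))
        (fun s _ => γ.norm_coe_le_norm _)
      refine h.trans ?_
      rw [sub_zero, abs_of_nonneg t.2.1, one_mul]
      exact mul_le_of_le_one_right (norm_nonneg _) t.2.2)

/-- Constant paths, as a continuous linear map. -/
def constPath (E : Type) [NormedAddCommGroup E] [NormedSpace ℝ E] :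
    E →L[ℝ] C(unitInterval, E) :=
  LinearMap.mkContinuous
    { toFun := fun x => ContinuousMap.const _ x
      map_add' := fun _ _ => rfl
      map_smul' := fun _ _ => rfl } 1 (fun x => by
      rw [ContinuousMap.norm_le _ (by positivity)]
      intro t
      rw [one_mul]
      exact le_rfl)

omit [CompleteSpace E] in
@[simp] lemma constPath_apply (x : E) (t : unitInterval) : constPath E x t = x := rfl

/-- The map whose zeros `(ε, x, γ)` are the solutions of `γ' = ε V(γ)`, `γ(0) = x` on `[0, 1]`. -/
def pathDefect (V : C(E, E)) (p : (ℝ × E) × C(unitInterval, E)) :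
    (ℝ × E) × C(unitInterval, E) :=
  (p.1, p.2 - constPath E p.1.2 - p.1.1 • volterra E (superpose V p.2))

lemma contDiff_pathDefect (V : C(E, E)) (hV : ContDiff ℝ ∞ V) :
    ContDiff ℝ ∞ (pathDefect V) := by
  unfold pathDefect
  have h1 : ContDiff ℝ ∞ fun p : (ℝ × E) × C(unitInterval, E) => volterra E (superpose V p.2) :=
    (volterra E).contDiff.comp ((contDiff_superpose V hV).comp contDiff_snd)
  have h2 : ContDiff ℝ ∞ fun p : (ℝ × E) × C(unitInterval, E) => constPath E p.1.2 :=
    (constPath E).contDiff.comp (contDiff_snd.comp contDiff_fst)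
  exact contDiff_fst.prodMk ((contDiff_snd.sub h2).sub ((contDiff_fst.comp contDiff_fst).smul h1))

/-- The shear `(p, k) ↦ (p, k - A p)`. -/
def shearEquiv {X Y : Type*} [NormedAddCommGroup X] [NormedSpace ℝ X] [NormedAddCommGroup Y]
    [NormedSpace ℝ Y] (A : X →L[ℝ] Y) : (X × Y) ≃L[ℝ] (X × Y) :=
  ContinuousLinearEquiv.equivOfInverse
    ((ContinuousLinearMap.fst ℝ X Y).prod
      (ContinuousLinearMap.snd ℝ X Y - A.comp (ContinuousLinearMap.fst ℝ X Y)))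
    ((ContinuousLinearMap.fst ℝ X Y).prod
      (ContinuousLinearMap.snd ℝ X Y + A.comp (ContinuousLinearMap.fst ℝ X Y)))
    (fun p => by simp) (fun p => by simp)

/-- At ε = 0 the factor ε kills the derivative of the nonlinear term in the path direction. What
remains is a shear, which is invertible whatever V is. -/
lemma hasFDerivAt_pathDefect (V : C(E, E)) (hV : ContDiff ℝ ∞ V) (x₀ : E) :
    HasFDerivAt (pathDefect V)
      (shearEquiv ((constPath E).comp (ContinuousLinearMap.snd ℝ ℝ E) +
        (ContinuousLinearMap.fst ℝ ℝ E).smulRight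
          (volterra E (superpose V (constPath E x₀)))) :
          ((ℝ × E) × C(unitInterval, E)) →L[ℝ] ((ℝ × E) × C(unitInterval, E)))
      ((0, x₀), constPath E x₀) := by
  have h1 : DifferentiableAt ℝ
      (fun p : (ℝ × E) × C(unitInterval, E) => volterra E (superpose V p.2))
      ((0, x₀), constPath E x₀) :=
    (((volterra E).contDiff.comp ((contDiff_superpose V hV).comp contDiff_snd)).differentiable
      (by simp)).differentiableAt
  have h2 := ((constPath E).comp ((ContinuousLinearMap.snd ℝ ℝ E).comp
    (ContinuousLinearMap.fst ℝ (ℝ × E) C(unitInterval, E)))).hasFDerivAt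
    (x := ((0, x₀), constPath E x₀))
  have h3 := ((ContinuousLinearMap.fst ℝ ℝ E).comp
    (ContinuousLinearMap.fst ℝ (ℝ × E) C(unitInterval, E))).hasFDerivAt
    (x := ((0, x₀), constPath E x₀))
  have := (hasFDerivAt_fst (𝕜 := ℝ)).prodMk
    (((hasFDerivAt_snd (𝕜 := ℝ)).sub h2).sub (h3.smul h1.hasFDerivAt))
  refine this.congr_fderiv ?_
  ext v <;> simp [shearEquiv]

/-- The local flow of a smooth vector field is smooth in time and initial value. -/
theorem exists_smooth_flow (V : E → E) (hV : ContDiff ℝ ∞ V) (x₀ : E) :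
    ∃ δ > 0, ∃ Φ : ℝ × E → E, ContDiffOn ℝ ∞ Φ (Metric.ball (0, x₀) δ) ∧
      (∀ x ∈ Metric.ball x₀ δ, Φ (0, x) = x) ∧
      ∀ x ∈ Metric.ball x₀ δ, ∀ t ∈ Metric.ball (0 : ℝ) δ,
        HasDerivAt (fun s => Φ (s, x)) (V (Φ (t, x))) t := by
  let Vc : C(E, E) := ⟨V, hV.continuous⟩
  have hVc : ContDiff ℝ ∞ Vc := hV
  obtain ⟨Ψ, haΨ, -, hΨ, hsymm, -⟩ := exists_openPartialHomeomorph_of_contDiffOn isOpen_univ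
    (contDiff_pathDefect Vc hVc).contDiffOn (mem_univ _) _ (hasFDerivAt_pathDefect Vc hVc x₀)
  have hΨ0 : Ψ ((0, x₀), constPath E x₀) = ((0, x₀), 0) := by
    rw [hΨ]; simp [pathDefect]
  obtain ⟨ρ, hρ, hρs⟩ := Metric.isOpen_iff.1 Ψ.open_source _ haΨ
  -- The solution on [0, 1] of y' = ε V(y), y(0) = x, as a smooth function of (ε, x). The flow will
  -- be its value at time 1.
  let γ : ℝ × E → C(unitInterval, E) := fun p => (Ψ.symm (p, 0)).2
  let T : Set (ℝ × E) := (fun p => (p, (0 : C(unitInterval, E)))) ⁻¹' Ψ.target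
  have hT : IsOpen T := Ψ.open_target.preimage (by fun_prop)
  have hT0 : ((0 : ℝ), x₀) ∈ T := by
    change ((0, x₀), (0 : C(unitInterval, E))) ∈ Ψ.target
    rw [← hΨ0]; exact Ψ.map_source haΨ
  have hγs : ContDiffOn ℝ ∞ γ T :=
    contDiff_snd.comp_contDiffOn (hsymm.comp (by fun_prop) (fun p hp => hp))
  have hγ0 : γ (0, x₀) = constPath E x₀ := by
    change (Ψ.symm ((0, x₀), 0)).2 = _
    rw [← hΨ0, Ψ.left_inv haΨ]
  have hev : ∀ᶠ p in 𝓝 ((0 : ℝ), x₀), p ∈ T ∧ dist (γ p) (constPath E x₀) < ρ := by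
    refine Filter.Eventually.and (hT.mem_nhds hT0) ?_
    have hc : ContinuousAt γ (0, x₀) := hγs.continuousOn.continuousAt (hT.mem_nhds hT0)
    have := hc.tendsto.eventually (Metric.ball_mem_nhds _ hρ)
    rw [hγ0] at this
    exact this
  obtain ⟨δ', hδ', hδb⟩ := Metric.eventually_nhds_iff_ball.1 hev
  let δ := min δ' ρ
  have hδ : 0 < δ := lt_min hδ' hρ
  have hmem : ∀ p : ℝ × E, p.1 ∈ Metric.ball (0 : ℝ) δ → p.2 ∈ Metric.ball x₀ δ →
      p ∈ Metric.ball ((0 : ℝ), x₀) δ := by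
    intro p h1 h2
    rw [Metric.mem_ball, Prod.dist_eq]
    exact max_lt h1 h2
  have hfix : ∀ p ∈ T, (Ψ.symm (p, 0)).1 = p ∧
      γ p = constPath E p.2 + p.1 • volterra E (superpose Vc (γ p)) := by
    intro p hp
    have h := Ψ.right_inv hp
    rw [hΨ] at h
    have h1 : (Ψ.symm (p, 0)).1 = p := congrArg Prod.fst h
    have h2 := congrArg Prod.snd h
    simp only [pathDefect, h1] at h2
    refine ⟨h1, ?_⟩
    rw [sub_sub, sub_eq_zero] at h2
    exact h2
  have hval : ∀ p ∈ T, ∀ t : unitInterval, γ p t = p.2 + p.1 • ∫ s in (0 : ℝ)..t,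
      V (γ p (projIcc 0 1 zero_le_one s)) := by
    intro p hp t
    have h := congrArg (fun c : C(unitInterval, E) => c t) (hfix p hp).2
    exact h
  -- The path for (ε, x) at time t is the path for (εt, x) at time 1: the slowed-down path is a zero
  -- of the defect with parameters (εt, x), and it stays in the ball where Ψ is injective.
  have hresc : ∀ p ∈ Metric.ball ((0 : ℝ), x₀) δ, ∀ t : unitInterval,
      γ p t = γ (p.1 * t, p.2) 1 := by
    intro p hp t
    have hpT := hδb p (Metric.ball_subset_ball (min_le_left _ _) hp)
    rw [Metric.mem_ball, Prod.dist_eq, max_lt_iff] at hp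
    let μ : C(unitInterval, E) := (γ p).comp ⟨fun s => t * s, by fun_prop⟩
    have hq : ((p.1 * t, p.2) : ℝ × E) ∈ Metric.ball ((0 : ℝ), x₀) δ := by
      refine hmem _ ?_ hp.2
      rw [mem_ball_zero_iff, norm_mul]
      have h1 : ‖(t : ℝ)‖ ≤ 1 := by
        rw [Real.norm_eq_abs, abs_of_nonneg t.2.1]; exact t.2.2
      have h2 : ‖p.1‖ < δ := by simpa using hp.1
      nlinarith [norm_nonneg p.1, norm_nonneg (t : ℝ)]
    have hsrc : (((p.1 * t, p.2) : ℝ × E), μ) ∈ Ψ.source := by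
      apply hρs
      rw [Metric.mem_ball, Prod.dist_eq]
      refine max_lt ((Metric.mem_ball.1 hq).trans_le (min_le_right _ _)) ?_
      rw [dist_eq_norm]
      refine lt_of_le_of_lt ?_ hpT.2
      rw [dist_eq_norm, ContinuousMap.norm_le _ (norm_nonneg _)]
      intro s
      exact (γ p - constPath E x₀).norm_coe_le_norm (t * s)
    have hzero : Ψ ((p.1 * t, p.2), μ) = ((p.1 * t, p.2), 0) := by
      rw [hΨ]
      refine Prod.ext rfl ?_
      ext s
      have h1 : μ s = p.2 + p.1 • ∫ s' in (0 : ℝ)..(t * s : unitInterval),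
        V (γ p (projIcc 0 1 zero_le_one s')) := hval p hpT.1 (t * s)
      have h2 : (t : ℝ) • ∫ s' in (0 : ℝ)..s, V (μ (projIcc 0 1 zero_le_one s')) =
          ∫ s' in (0 : ℝ)..(t * s : unitInterval), V (γ p (projIcc 0 1 zero_le_one s')) := by
        have h3 := intervalIntegral.smul_integral_comp_mul_left (a := (0 : ℝ)) (b := s)
          (fun s' => V (γ p (projIcc 0 1 zero_le_one s'))) (t : ℝ)
        rw [mul_zero] at h3
        rw [show ((t * s : unitInterval) : ℝ) = t * s from rfl, ← h3]
        congr 1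
        apply intervalIntegral.integral_congr
        intro s' hs'
        rw [uIcc_of_le s.2.1] at hs'
        have hs1 : s' ∈ Icc (0 : ℝ) 1 := ⟨hs'.1, hs'.2.trans s.2.2⟩
        have hs2 : (t : ℝ) * s' ∈ Icc (0 : ℝ) 1 := (t * ⟨s', hs1⟩ : unitInterval).2
        simp only [projIcc_of_mem zero_le_one hs1, projIcc_of_mem zero_le_one hs2]
        rfl
      have h4 : (pathDefect Vc ((p.1 * t, p.2), μ)).2 s =
        μ s - p.2 - (p.1 * t) • ∫ s' in (0 : ℝ)..s, V (μ (projIcc 0 1 zero_le_one s')) := rfl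
      rw [h4, mul_smul, h2, h1]
      simp
    have h5 : γ (p.1 * t, p.2) = μ := by
      change (Ψ.symm ((p.1 * t, p.2), 0)).2 = μ
      rw [← hzero, Ψ.left_inv hsrc]
    rw [h5]
    change γ p t = γ p (t * 1)
    rw [mul_one]
  have hint : ∀ x ∈ Metric.ball x₀ δ, ∀ t ∈ Metric.ball (0 : ℝ) δ,
      γ (t, x) 1 = x + ∫ s in (0 : ℝ)..t, V (γ (s, x) 1) := by
    intro x hx t ht
    have hp := hmem (t, x) ht hx
    have hpT := (hδb _ (Metric.ball_subset_ball (min_le_left _ _) hp)).1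
    rw [hval _ hpT 1]
    congr 1
    have h3 := intervalIntegral.smul_integral_comp_mul_left (a := (0 : ℝ)) (b := 1)
          (fun s => V (γ (s, x) 1)) t
    rw [mul_zero, mul_one] at h3
    rw [← h3]
    congr 1
    apply intervalIntegral.integral_congr
    intro s hs
    have hs1 : s ∈ Icc (0 : ℝ) 1 := by
      rwa [uIcc_of_le (show (0 : ℝ) ≤ ((1 : unitInterval) : ℝ) from zero_le_one)] at hs
    simp only [projIcc_of_mem zero_le_one hs1]
    rw [hresc _ hp ⟨s, hs1⟩]
  have hsm : ContDiffOn ℝ ∞ (fun p => γ p 1) (Metric.ball ((0 : ℝ), x₀) δ) := by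
    have hev1 : ContDiff ℝ ∞ fun c : C(unitInterval, E) => c 1 :=
      (ContinuousLinearMap.contDiff (𝕜 := ℝ) (E := C(unitInterval, E)) (F := E)
        (ContinuousMap.evalCLM ℝ (1 : unitInterval)))
    exact hev1.comp_contDiffOn (hγs.mono fun p hp =>
      (hδb p (Metric.ball_subset_ball (min_le_left _ _) hp)).1)
  refine ⟨δ, hδ, fun p => γ p 1, hsm, ?_, ?_⟩
  · intro x hx
    have := hint x hx 0 (Metric.mem_ball_self hδ)
    simpa using this
  · intro x hx t ht
    have hcont : ContinuousOn (fun s => V (γ (s, x) 1)) (Metric.ball (0 : ℝ) δ) :=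
      hV.continuous.comp_continuousOn
        (hsm.continuousOn.comp (by fun_prop) (fun s hs => hmem (s, x) hs hx))
    have hsub : uIcc 0 t ⊆ Metric.ball (0 : ℝ) δ :=
      (convex_ball (0 : ℝ) δ).ordConnected.uIcc_subset (Metric.mem_ball_self hδ) ht
    have hd := intervalIntegral.integral_hasDerivAt_right
      ((hcont.mono hsub).intervalIntegrable)
      (hcont.stronglyMeasurableAtFilter Metric.isOpen_ball t ht)
      (hcont.continuousAt (Metric.isOpen_ball.mem_nhds ht))
    refine (hd.const_add x).congr_of_eventuallyEq ?_
    filter_upwards [Metric.isOpen_ball.mem_nhds ht] with s hs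
    exact hint x hx s hs

end Flow

lemma contDiffAt_congr_iff {E F : Type*} [NormedAddCommGroup E] [NormedSpace ℝ E]
    [NormedAddCommGroup F] [NormedSpace ℝ F] {n : WithTop ℕ∞} {f g : E → F} {x : E}
    (h : f =ᶠ[𝓝 x] g) : ContDiffAt ℝ n f x ↔ ContDiffAt ℝ n g x :=
  ⟨fun H => H.congr_of_eventuallyEq h.symm, fun H => H.congr_of_eventuallyEq h⟩

/-! ### Smoothness of tensor fields in the preferred charts -/

section ChartExpressions

variable {d : ℕ} {M : Type*} [TopologicalSpace M] [ChartedSpace (Euc d) M]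

/-- A (not necessarily smooth) field of bilinear forms on the tangent spaces. -/
abbrev TangentBilin (d : ℕ) (M : Type*) [TopologicalSpace M] [ChartedSpace (Euc d) M] : Type _ :=
  ∀ x : M, TangentSpace (𝓡 d) x →L[ℝ] TangentSpace (𝓡 d) x →L[ℝ] ℝ

/-- The pullback of a `1`-form by a map from a vector space. -/
def pullForm {E : Type*} [NormedAddCommGroup E] [NormedSpace ℝ E] (lam : OneForm d M) (Ψ : E → M)
    (y : E) : E →L[ℝ] ℝ :=
  (lam (Ψ y)).comp (mfderiv 𝓘(ℝ, E) (𝓡 d) Ψ y)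

lemma chartForm_eq_pullForm (lam : OneForm d M) (x₀ : M) :
    chartForm lam x₀ = pullForm lam (extChartAt (𝓡 d) x₀).symm := rfl

/-- The derivative of the preferred chart at `x₀`. -/
def chartD (x₀ x : M) : Euc d →L[ℝ] Euc d :=
  mfderiv (𝓡 d) 𝓘(ℝ, Euc d) (extChartAt (𝓡 d) x₀) x

/-- The derivative of the inverse of the preferred chart at `x₀`. -/
def chartI (x₀ : M) (y : Euc d) : Euc d →L[ℝ] Euc d :=
  mfderiv 𝓘(ℝ, Euc d) (𝓡 d) (extChartAt (𝓡 d) x₀).symm y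

/-- A field of endomorphisms in the preferred chart at `x₀`. -/
def chartEnd (J : TangentEnd d M) (x₀ : M) (y : Euc d) : Euc d →L[ℝ] Euc d :=
  (chartD x₀ ((extChartAt (𝓡 d) x₀).symm y)).comp
    ((show Euc d →L[ℝ] Euc d from J ((extChartAt (𝓡 d) x₀).symm y)).comp (chartI x₀ y))

/-- A field of bilinear forms in the preferred chart at `x₀`. -/
def chartBilin (g : TangentBilin d M) (x₀ : M) (y : Euc d) : Euc d →L[ℝ] Euc d →L[ℝ] ℝ :=
  (show Euc d →L[ℝ] Euc d →L[ℝ] ℝ from g ((extChartAt (𝓡 d) x₀).symm y)).bilinearComp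
    (chartI x₀ y) (chartI x₀ y)

lemma contMDiffAt_iff_chart {F : Type*} [NormedAddCommGroup F] [NormedSpace ℝ F]
    [IsManifold (𝓡 d) ∞ M] (h : M → F) (x₀ : M) :
    ContMDiffAt (𝓡 d) 𝓘(ℝ, F) ∞ h x₀ ↔
      ContDiffAt ℝ ∞ (h ∘ (extChartAt (𝓡 d) x₀).symm) (extChartAt (𝓡 d) x₀ x₀) := by
  constructor
  · intro H
    have h1 : ContMDiffAt 𝓘(ℝ, Euc d) (𝓡 d) ∞ (extChartAt (𝓡 d) x₀).symm
        (extChartAt (𝓡 d) x₀ x₀) :=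
      (contMDiffOn_extChartAt_symm x₀).contMDiffAt (extChartAt_target_mem_nhds x₀)
    rw [← contMDiffAt_iff_contDiffAt]
    refine ContMDiffAt.comp _ ?_ h1
    rwa [extChartAt_to_inv]
  · intro H
    have h1 : ContMDiffAt (𝓡 d) 𝓘(ℝ, Euc d) ∞ (extChartAt (𝓡 d) x₀) x₀ := contMDiffAt_extChartAt
    have h2 := ContMDiffAt.comp x₀ (contMDiffAt_iff_contDiffAt.2 H) h1
    refine h2.congr_of_eventuallyEq ?_
    filter_upwards [extChartAt_source_mem_nhds (I := 𝓡 d) x₀] with x hx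
    rw [Function.comp_apply, Function.comp_apply, (extChartAt (𝓡 d) x₀).left_inv hx]

variable [IsManifold (𝓡 d) ∞ M]

lemma chartD_comp_chartI {x₀ : M} {y : Euc d} (hy : y ∈ (extChartAt (𝓡 d) x₀).target)
    (v : Euc d) : chartD x₀ ((extChartAt (𝓡 d) x₀).symm y) (chartI x₀ y v) = v := by
  have : IsManifold (𝓡 d) 1 M := IsManifold.of_le (n := ∞) (by simp)
  have h := mfderiv_extChartAt_comp_mfderivWithin_extChartAt_symm (I := 𝓡 d) (x := x₀) hy
  simp only [modelWithCornersSelf_coe, range_id, mfderivWithin_univ] at h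
  exact congrArg (fun A : Euc d →L[ℝ] Euc d => A v) h

lemma chartI_comp_chartD {x₀ : M} {x : M} (hx : x ∈ (extChartAt (𝓡 d) x₀).source)
    (v : Euc d) : chartI x₀ (extChartAt (𝓡 d) x₀ x) (chartD x₀ x v) = v := by
  have : IsManifold (𝓡 d) 1 M := IsManifold.of_le (n := ∞) (by simp)
  have h := mfderivWithin_extChartAt_symm_comp_mfderiv_extChartAt' (I := 𝓡 d) (x := x₀) hx
  simp only [modelWithCornersSelf_coe, range_id, mfderivWithin_univ] at h
  exact congrArg (fun A : Euc d →L[ℝ] Euc d => A v) h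

omit [IsManifold (𝓡 d) ∞ M] in
lemma eventually_mem_source_symm (x₀ : M) : ∀ᶠ y in 𝓝 (extChartAt (𝓡 d) x₀ x₀),
    y ∈ (extChartAt (𝓡 d) x₀).target ∧
      (extChartAt (𝓡 d) x₀).symm y ∈ (chartAt (Euc d) x₀).source := by
  filter_upwards [extChartAt_target_mem_nhds (I := 𝓡 d) x₀] with y hy
  refine ⟨hy, ?_⟩
  have := (extChartAt (𝓡 d) x₀).map_target hy
  rwa [extChartAt_source] at this

lemma symmL_eq_chartI {x₀ : M} {y : Euc d} (hy : y ∈ (extChartAt (𝓡 d) x₀).target) :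
    ((trivializationAt (Euc d) (TangentSpace (𝓡 d)) x₀).symmL ℝ ((extChartAt (𝓡 d) x₀).symm y) :
      Euc d →L[ℝ] Euc d) = chartI x₀ y := by
  have : IsManifold (𝓡 d) 1 M := IsManifold.of_le (n := ∞) (by simp)
  have h1 : (extChartAt (𝓡 d) x₀).symm y ∈ (chartAt (Euc d) x₀).source := by
    have := (extChartAt (𝓡 d) x₀).map_target hy
    rwa [extChartAt_source] at this
  have h := TangentBundle.symmL_trivializationAt (I := 𝓡 d) h1
  simp only [modelWithCornersSelf_coe, range_id, mfderivWithin_univ] at h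
  refine h.trans ?_
  rw [chartI, (extChartAt (𝓡 d) x₀).right_inv hy]

lemma clmAt_eq_chartD {x₀ x : M} (hx : x ∈ (chartAt (Euc d) x₀).source) :
    ((trivializationAt (Euc d) (TangentSpace (𝓡 d)) x₀).continuousLinearMapAt ℝ x :
      Euc d →L[ℝ] Euc d) = chartD x₀ x := by
  have : IsManifold (𝓡 d) 1 M := IsManifold.of_le (n := ∞) (by simp)
  exact TangentBundle.continuousLinearMapAt_trivializationAt (I := 𝓡 d) hx

/-- Smoothness of the section is tested in the tangent bundle trivialization at x₀, which is the
derivative of the preferred chart. Expressed in the chart, the section is therefore the pulled back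
form. -/
lemma contMDiffAt_oneForm_iff (lam : OneForm d M) (x₀ : M) :
    ContMDiffAt (𝓡 d) ((𝓡 d).prod 𝓘(ℝ, Euc d →L[ℝ] ℝ)) ∞
      (fun x => TotalSpace.mk' (Euc d →L[ℝ] ℝ)
        (E := fun x : M => TangentSpace (𝓡 d) x →L[ℝ] Bundle.Trivial M ℝ x) x (lam x)) x₀ ↔
    ContDiffAt ℝ ∞ (chartForm lam x₀) (extChartAt (𝓡 d) x₀ x₀) := by
  rw [contMDiffAt_hom_bundle]
  refine (and_iff_right contMDiffAt_id).trans ?_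
  rw [contMDiffAt_iff_chart]
  apply contDiffAt_congr_iff
  filter_upwards [eventually_mem_source_symm x₀] with y hy
  ext v
  have h := congrArg (fun A : Euc d →L[ℝ] Euc d => A v) (symmL_eq_chartI hy.1)
  simp only [Function.comp_apply, ContinuousLinearMap.inCoordinates]
  refine (congrArg (fun A : ℝ →L[ℝ] ℝ => A _)
    (Bundle.Trivial.continuousLinearMapAt_trivialization ℝ M ℝ
      ((extChartAt (𝓡 d) x₀).symm y))).trans ?_
  exact congrArg (lam ((extChartAt (𝓡 d) x₀).symm y)) h

lemma contMDiffAt_end_iff (J : TangentEnd d M) (x₀ : M) :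
    ContMDiffAt (𝓡 d) ((𝓡 d).prod 𝓘(ℝ, Euc d →L[ℝ] Euc d)) ∞
      (fun x => TotalSpace.mk' (Euc d →L[ℝ] Euc d)
        (E := fun x : M => TangentSpace (𝓡 d) x →L[ℝ] TangentSpace (𝓡 d) x) x (J x)) x₀ ↔
    ContDiffAt ℝ ∞ (chartEnd J x₀) (extChartAt (𝓡 d) x₀ x₀) := by
  rw [contMDiffAt_hom_bundle]
  refine (and_iff_right contMDiffAt_id).trans ?_
  rw [contMDiffAt_iff_chart]
  apply contDiffAt_congr_iff
  filter_upwards [eventually_mem_source_symm x₀] with y hy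
  ext1 v
  have h := congrArg (fun A : Euc d →L[ℝ] Euc d => A v) (symmL_eq_chartI hy.1)
  have h2 := clmAt_eq_chartD hy.2
  simp only [Function.comp_apply, ContinuousLinearMap.inCoordinates]
  refine (congrArg (fun A : Euc d →L[ℝ] Euc d => A _) h2).trans ?_
  exact congrArg (fun w : Euc d => chartD x₀ _ ((J ((extChartAt (𝓡 d) x₀).symm y)) w)) h

lemma contMDiffAt_bilin_iff (g : TangentBilin d M) (x₀ : M) :
    ContMDiffAt (𝓡 d) ((𝓡 d).prod 𝓘(ℝ, Euc d →L[ℝ] Euc d →L[ℝ] ℝ)) ∞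
      (fun x => TotalSpace.mk' (Euc d →L[ℝ] Euc d →L[ℝ] ℝ)
        (E := fun x : M => TangentSpace (𝓡 d) x →L[ℝ] TangentSpace (𝓡 d) x →L[ℝ]
          Bundle.Trivial M ℝ x) x (g x)) x₀ ↔
    ContDiffAt ℝ ∞ (chartBilin g x₀) (extChartAt (𝓡 d) x₀ x₀) := by
  rw [contMDiffAt_hom_bundle]
  refine (and_iff_right contMDiffAt_id).trans ?_
  rw [contMDiffAt_iff_chart]
  apply contDiffAt_congr_iff
  filter_upwards [eventually_mem_source_symm x₀] with y hy
  ext1 v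
  ext1 w
  have hb : (extChartAt (𝓡 d) x₀).symm y ∈
      (trivializationAt (Euc d) (TangentSpace (𝓡 d)) x₀).baseSet := by
    simpa using hy.2
  have h : ∀ v, ((trivializationAt (Euc d) (TangentSpace (𝓡 d)) x₀).symm
      ((extChartAt (𝓡 d) x₀).symm y) v : Euc d) = chartI x₀ y v := fun v =>
    (Trivialization.symmL_apply (R := ℝ) _ hb v).symm.trans
      (congrArg (fun A : Euc d →L[ℝ] Euc d => A v) (symmL_eq_chartI hy.1))
  simp only [Function.comp_apply]
  rw [inCoordinates_apply_eq₂ hb hb (by simp)]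
  refine (congrArg (fun A : ℝ →ₗ[ℝ] ℝ => A _)
    (Bundle.Trivial.linearMapAt_trivialization ℝ M ℝ
      ((extChartAt (𝓡 d) x₀).symm y))).trans ?_
  refine (congrArg (fun w' : Euc d => g ((extChartAt (𝓡 d) x₀).symm y) _ w') (h w)).trans ?_
  exact congrArg (fun v' : Euc d => g ((extChartAt (𝓡 d) x₀).symm y) v' (chartI x₀ y w)) (h v)

end ChartExpressions

/-! ### The exterior derivative on a vector space -/

section Dform

variable {E F : Type*} [NormedAddCommGroup E] [NormedSpace ℝ E]
  [NormedAddCommGroup F] [NormedSpace ℝ F]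

/-- The exterior derivative of a `1`-form on a vector space. -/
def dform (η : E → E →L[ℝ] ℝ) (y : E) : E →L[ℝ] E →L[ℝ] ℝ :=
  fderiv ℝ η y - (fderiv ℝ η y).flip

lemma dform_apply (η : E → E →L[ℝ] ℝ) (y v w : E) :
    dform η y v w = fderiv ℝ η y v w - fderiv ℝ η y w v := rfl

lemma dform_swap (η : E → E →L[ℝ] ℝ) (y v w : E) : dform η y v w = -dform η y w v := by
  rw [dform_apply, dform_apply, neg_sub]

lemma dform_self (η : E → E →L[ℝ] ℝ) (y v : E) : dform η y v v = 0 := sub_self _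

lemma dform_congr {η η' : E → E →L[ℝ] ℝ} {y : E} (h : η =ᶠ[𝓝 y] η') : dform η y = dform η' y := by
  rw [dform, dform, h.fderiv_eq]

lemma dform_smul {k : E → ℝ} {η : E → E →L[ℝ] ℝ} {y : E} (hk : DifferentiableAt ℝ k y)
    (hη : DifferentiableAt ℝ η y) (v w : E) :
    dform (fun y => k y • η y) y v w =
      k y * dform η y v w + (fderiv ℝ k y v * η y w - fderiv ℝ k y w * η y v) := by
  rw [dform_apply, dform_apply, fderiv_fun_smul hk hη]
  simp
  ring

/-- The terms with the second derivative of g cancel, because that derivative is symmetric. -/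
lemma dform_comp {g : E → F} {η : F → F →L[ℝ] ℝ} {y : E} (hg : ContDiffAt ℝ ∞ g y)
    (hη : DifferentiableAt ℝ η (g y)) (v w : E) :
    dform (fun y => (η (g y)).comp (fderiv ℝ g y)) y v w =
      dform η (g y) (fderiv ℝ g y v) (fderiv ℝ g y w) := by
  have hg1 : DifferentiableAt ℝ g y := hg.differentiableAt (by simp)
  have hg2 : DifferentiableAt ℝ (fderiv ℝ g) y :=
    (hg.fderiv_right (m := ∞) (by simp)).differentiableAt (by simp)
  have h1 : HasFDerivAt (fun y => η (g y)) _ y := hη.hasFDerivAt.comp y hg1.hasFDerivAt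
  have h := (h1.clm_comp hg2.hasFDerivAt).fderiv
  have hs : IsSymmSndFDerivAt ℝ g y := hg.isSymmSndFDerivAt (by
    rw [minSmoothness_of_isRCLikeNormedField]; exact ENat.LEInfty.out)
  rw [dform_apply, dform_apply, h]
  simp [hs.eq v w]

set_option synthInstance.maxHeartbeats 400000 in
lemma ContDiffAt.dform {η : E → E →L[ℝ] ℝ} {y : E} (h : ContDiffAt ℝ ∞ η y) :
    ContDiffAt ℝ ∞ (dform η) y := by
  have h1 := h.fderiv_right (m := ∞) (by simp)
  have h2 : ContDiff ℝ ∞ fun A : E →L[ℝ] E →L[ℝ] ℝ => A.flip :=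
    LinearIsometryEquiv.contDiff (𝕜 := ℝ) (E := E →L[ℝ] E →L[ℝ] ℝ) (F := E →L[ℝ] E →L[ℝ] ℝ)
      (ContinuousLinearMap.flipₗᵢ ℝ E E ℝ)
  exact h1.sub (h2.contDiffAt.comp y h1)

end Dform

/-! ### Pullbacks and the exterior derivative on the manifold -/

section Pull

variable {d : ℕ} {M : Type*} [TopologicalSpace M] [ChartedSpace (Euc d) M]
  [IsManifold (𝓡 d) ∞ M] {E : Type*} [NormedAddCommGroup E] [NormedSpace ℝ E]

lemma fderiv_chart_comp {Ψ : E → M} {y : E} (hΨ : MDifferentiableAt 𝓘(ℝ, E) (𝓡 d) Ψ y) {x₁ : M}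
    (hx : Ψ y ∈ (chartAt (Euc d) x₁).source) (v : E) :
    fderiv ℝ (extChartAt (𝓡 d) x₁ ∘ Ψ) y v =
      chartD x₁ (Ψ y) (mfderiv 𝓘(ℝ, E) (𝓡 d) Ψ y v) := by
  have : IsManifold (𝓡 d) 1 M := IsManifold.of_le (n := ∞) (by simp)
  rw [← mfderiv_eq_fderiv]
  have h := mfderiv_comp y (mdifferentiableAt_extChartAt (I := 𝓡 d) hx) hΨ
  exact congrArg (fun A : E →L[ℝ] Euc d => A v) h

/-- Going through the one chart at Ψ y₀ expresses the pullback, on a whole neighbourhood, by maps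
between fixed vector spaces. There it can be differentiated. -/
lemma pullForm_eventuallyEq (lam : OneForm d M) {Ψ : E → M} {y₀ : E}
    (hΨ : ContMDiffAt 𝓘(ℝ, E) (𝓡 d) ∞ Ψ y₀) :
    pullForm lam Ψ =ᶠ[𝓝 y₀] fun y => (chartForm lam (Ψ y₀) (extChartAt (𝓡 d) (Ψ y₀) (Ψ y))).comp
      (fderiv ℝ (extChartAt (𝓡 d) (Ψ y₀) ∘ Ψ) y) := by
  have h1 : ContMDiffAt 𝓘(ℝ, E) (𝓡 d) 1 Ψ y₀ := hΨ.of_le (by simp)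
  have h2 := (contMDiffAt_iff_contMDiffAt_nhds (by simp)).1 h1
  have h3 : ∀ᶠ y in 𝓝 y₀, Ψ y ∈ (chartAt (Euc d) (Ψ y₀)).source :=
    hΨ.continuousAt.eventually ((chartAt (Euc d) (Ψ y₀)).open_source.mem_nhds
      (mem_chart_source _ _))
  filter_upwards [h2, h3] with y hy2 hy3
  ext v
  have hs : Ψ y ∈ (extChartAt (𝓡 d) (Ψ y₀)).source := by rwa [extChartAt_source]
  have h4 := fderiv_chart_comp (hy2.mdifferentiableAt (by simp)) hy3 v
  rw [ContinuousLinearMap.comp_apply, h4]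
  have h5 := chartI_comp_chartD hs (mfderiv 𝓘(ℝ, E) (𝓡 d) Ψ y v)
  change lam (Ψ y) (mfderiv 𝓘(ℝ, E) (𝓡 d) Ψ y v) =
    lam ((extChartAt (𝓡 d) (Ψ y₀)).symm (extChartAt (𝓡 d) (Ψ y₀) (Ψ y)))
      (chartI (Ψ y₀) (extChartAt (𝓡 d) (Ψ y₀) (Ψ y)) (chartD (Ψ y₀) (Ψ y)
        (mfderiv 𝓘(ℝ, E) (𝓡 d) Ψ y v)))
  rw [(extChartAt (𝓡 d) (Ψ y₀)).left_inv hs, h5]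

set_option linter.unusedSectionVars false in
lemma contDiffAt_chart_comp {Ψ : E → M} {y₀ : E}
    (hΨ : ContMDiffAt 𝓘(ℝ, E) (𝓡 d) ∞ Ψ y₀) :
    ContDiffAt ℝ ∞ (extChartAt (𝓡 d) (Ψ y₀) ∘ Ψ) y₀ := by
  rw [← contMDiffAt_iff_contDiffAt]
  exact ContMDiffAt.comp y₀ contMDiffAt_extChartAt hΨ

lemma SmoothOneForm.contDiffAt_chartForm {lam : OneForm d M} (h : SmoothOneForm lam) (x : M) :
    ContDiffAt ℝ ∞ (chartForm lam x) (extChartAt (𝓡 d) x x) :=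
  (contMDiffAt_oneForm_iff lam x).1 (h x)

lemma SmoothOneForm.contDiffAt_pullForm {lam : OneForm d M} (h : SmoothOneForm lam)
    {Ψ : E → M} {y₀ : E} (hΨ : ContMDiffAt 𝓘(ℝ, E) (𝓡 d) ∞ Ψ y₀) :
    ContDiffAt ℝ ∞ (pullForm lam Ψ) y₀ := by
  refine ContDiffAt.congr_of_eventuallyEq ?_ (pullForm_eventuallyEq lam hΨ)
  have h1 := contDiffAt_chart_comp hΨ
  exact ((h.contDiffAt_chartForm (Ψ y₀)).comp y₀ h1).clm_comp (h1.fderiv_right (m := ∞) (by simp))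

/-- The derivative of the preferred chart at its own centre is the identity of the model space, so
the chart differential in `extD` disappears. -/
lemma extD_eq_dform (lam : OneForm d M) (x : M) (v w : Euc d) :
    extD lam x v w = dform (chartForm lam x) (extChartAt (𝓡 d) x x) v w := by
  have : IsManifold (𝓡 d) 1 M := IsManifold.of_le (n := ∞) (by simp)
  have h : (mfderiv (𝓡 d) 𝓘(ℝ, Euc d) (extChartAt (𝓡 d) x) x : Euc d →L[ℝ] Euc d) =
      ContinuousLinearMap.id ℝ (Euc d) := mfderiv_extChartAt_self
  have h' : ∀ v : Euc d, (mfderiv (𝓡 d) 𝓘(ℝ, Euc d) (extChartAt (𝓡 d) x) x :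
    Euc d →L[ℝ] Euc d) v = v := fun v => by rw [h]; rfl
  refine Eq.trans ?_ (dform_apply _ _ v w).symm
  exact congrArg₂ (fun a b : Euc d => fderiv ℝ (chartForm lam x) (extChartAt (𝓡 d) x x) a b -
    fderiv ℝ (chartForm lam x) (extChartAt (𝓡 d) x x) b a) (h' v) (h' w)

/-- The exterior derivative commutes with pullbacks. -/
lemma SmoothOneForm.extD_mfderiv {lam : OneForm d M} (h : SmoothOneForm lam)
    {Ψ : E → M} {y : E} (hΨ : ContMDiffAt 𝓘(ℝ, E) (𝓡 d) ∞ Ψ y) (v w : E) :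
    extD lam (Ψ y) (mfderiv 𝓘(ℝ, E) (𝓡 d) Ψ y v) (mfderiv 𝓘(ℝ, E) (𝓡 d) Ψ y w) =
      dform (pullForm lam Ψ) y v w := by
  have : IsManifold (𝓡 d) 1 M := IsManifold.of_le (n := ∞) (by simp)
  rw [dform_congr (pullForm_eventuallyEq lam hΨ)]
  have h1 := contDiffAt_chart_comp hΨ
  have h2 := dform_comp (η := chartForm lam (Ψ y)) h1
    ((h.contDiffAt_chartForm (Ψ y)).differentiableAt (by simp)) v w
  refine Eq.trans ?_ h2.symm
  have h3 : ∀ v, fderiv ℝ (extChartAt (𝓡 d) (Ψ y) ∘ Ψ) y v = mfderiv 𝓘(ℝ, E) (𝓡 d) Ψ y v := by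
    intro v
    rw [fderiv_chart_comp (hΨ.mdifferentiableAt (by simp)) (mem_chart_source _ _)]
    have h : (mfderiv (𝓡 d) 𝓘(ℝ, Euc d) (extChartAt (𝓡 d) (Ψ y)) (Ψ y) : Euc d →L[ℝ] Euc d) =
      ContinuousLinearMap.id ℝ (Euc d) := mfderiv_extChartAt_self
    exact congrArg (fun A : Euc d →L[ℝ] Euc d => A (mfderiv 𝓘(ℝ, E) (𝓡 d) Ψ y v)) h
  rw [h3, h3]
  exact extD_eq_dform lam (Ψ y) _ _

lemma SmoothOneForm.extD_chartI {lam : OneForm d M} (h : SmoothOneForm lam) {x₀ : M} {y : Euc d}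
    (hy : y ∈ (extChartAt (𝓡 d) x₀).target) (v w : Euc d) :
    extD lam ((extChartAt (𝓡 d) x₀).symm y) (chartI x₀ y v) (chartI x₀ y w) =
      dform (chartForm lam x₀) y v w :=
  h.extD_mfderiv ((contMDiffOn_extChartAt_symm x₀).contMDiffAt
    ((isOpen_extChartAt_target x₀).mem_nhds hy)) v w

lemma SmoothOneForm.contDiffOn_chartForm {lam : OneForm d M} (h : SmoothOneForm lam) (x₀ : M) :
    ContDiffOn ℝ ∞ (chartForm lam x₀) (extChartAt (𝓡 d) x₀).target := fun _ hy =>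
  (h.contDiffAt_pullForm ((contMDiffOn_extChartAt_symm x₀).contMDiffAt
    ((isOpen_extChartAt_target x₀).mem_nhds hy))).contDiffWithinAt

end Pull

/-! ### Linear algebra of l ∧ Bⁿ -/

section LinearContact

variable {V : Type*} [AddCommGroup V] [Module ℝ V]

/-- Each slot occurs in exactly one factor: slot 0 in l, and slots 2i + 1 and 2i + 2 in the i-th
factor of the product. -/
lemma contactTerm_update {n : ℕ} (l : V →ₗ[ℝ] ℝ) (B : V →ₗ[ℝ] V →ₗ[ℝ] ℝ)
    (m : Fin (2 * n + 1) → V) (j : Fin (2 * n + 1)) : ∃ L : V →ₗ[ℝ] ℝ, ∀ x,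
    l (Function.update m j x 0) * ∏ i : Fin n, B (Function.update m j x ⟨2 * i + 1, by omega⟩)
      (Function.update m j x ⟨2 * i + 2, by omega⟩) = L x := by
  have key : ∀ (a b : Fin (2 * n + 1)) x, a ≠ b → Function.update m a x b = m b := fun a b x h =>
    Function.update_of_ne h.symm _ _
  rcases Nat.eq_zero_or_pos j.1 with h0 | h0
  · obtain rfl : j = 0 := Fin.ext h0
    refine ⟨(∏ i : Fin n, B (m ⟨2 * i + 1, by omega⟩) (m ⟨2 * i + 2, by omega⟩)) • l, fun x => ?_⟩
    rw [Function.update_self, LinearMap.smul_apply, smul_eq_mul, mul_comm]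
    rfl
  · have hj := j.2
    -- The index of the factor containing slot j: both 2k + 1 and 2k + 2 give k after subtracting 1
    -- and halving.
    set k : Fin n := ⟨(j.1 - 1) / 2, by omega⟩ with hk
    have hne : ∀ i : Fin n, i ≠ k → ∀ x, B (Function.update m j x ⟨2 * i + 1, by omega⟩)
        (Function.update m j x ⟨2 * i + 2, by omega⟩) =
        B (m ⟨2 * i + 1, by omega⟩) (m ⟨2 * i + 2, by omega⟩) := by
      intro i hi x
      have : i.1 ≠ (j.1 - 1) / 2 := fun h => hi (Fin.ext h)
      rw [key _ _ _ (by rw [Ne, Fin.ext_iff]; simp only; omega),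
        key _ _ _ (by rw [Ne, Fin.ext_iff]; simp only; omega)]
    have hprod : ∀ x, l (Function.update m j x 0) *
        ∏ i : Fin n, B (Function.update m j x ⟨2 * i + 1, by omega⟩)
          (Function.update m j x ⟨2 * i + 2, by omega⟩) =
        (l (m 0) * ∏ i ∈ Finset.univ.erase k, B (m ⟨2 * i + 1, by omega⟩)
          (m ⟨2 * i + 2, by omega⟩)) * B (Function.update m j x ⟨2 * k + 1, by omega⟩)
          (Function.update m j x ⟨2 * k + 2, by omega⟩) := by
      intro x
      rw [key _ _ _ (by rw [Ne, Fin.ext_iff]; simp only [Fin.val_zero]; omega),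
        ← Finset.prod_erase_mul _ _ (Finset.mem_univ k), ← mul_assoc]
      congr 2
      exact Finset.prod_congr rfl fun i hi => hne i (Finset.ne_of_mem_erase hi) x
    rcases Nat.even_or_odd' (j.1 - 1) with ⟨c, hc | hc⟩
    · have h1 : (⟨2 * k + 1, by omega⟩ : Fin (2 * n + 1)) = j := by
        rw [Fin.ext_iff]; simp only [hk]; omega
      have h2 : j ≠ (⟨2 * k + 2, by omega⟩ : Fin (2 * n + 1)) := by
        rw [Ne, Fin.ext_iff]; simp only [hk]; omega
      refine ⟨(l (m 0) * ∏ i ∈ Finset.univ.erase k, B (m ⟨2 * i + 1, by omega⟩)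
          (m ⟨2 * i + 2, by omega⟩)) • B.flip (m ⟨2 * k + 2, by omega⟩), fun x => ?_⟩
      rw [hprod, h1, Function.update_self, key _ _ _ h2]
      rfl
    · have h1 : (⟨2 * k + 2, by omega⟩ : Fin (2 * n + 1)) = j := by
        rw [Fin.ext_iff]; simp only [hk]; omega
      have h2 : j ≠ (⟨2 * k + 1, by omega⟩ : Fin (2 * n + 1)) := by
        rw [Ne, Fin.ext_iff]; simp only [hk]; omega
      refine ⟨(l (m 0) * ∏ i ∈ Finset.univ.erase k, B (m ⟨2 * i + 1, by omega⟩)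
          (m ⟨2 * i + 2, by omega⟩)) • B (m ⟨2 * k + 1, by omega⟩), fun x => ?_⟩
      rw [hprod, h1, Function.update_self, key _ _ _ h2]
      rfl

/-- The multilinear map whose alternatization is `l ∧ Bⁿ`. -/
def contactMulti (n : ℕ) (l : V →ₗ[ℝ] ℝ) (B : V →ₗ[ℝ] V →ₗ[ℝ] ℝ) :
    MultilinearMap ℝ (fun _ : Fin (2 * n + 1) => V) ℝ where
  toFun v := l (v 0) * ∏ i : Fin n, B (v ⟨2 * i + 1, by omega⟩) (v ⟨2 * i + 2, by omega⟩)
  map_update_add' {dec} m j x y := by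
    obtain rfl : dec = instDecidableEqFin _ := Subsingleton.elim _ _
    obtain ⟨L, hL⟩ := contactTerm_update l B m j
    rw [hL, hL, hL, map_add]
  map_update_smul' {dec} m j c x := by
    obtain rfl : dec = instDecidableEqFin _ := Subsingleton.elim _ _
    obtain ⟨L, hL⟩ := contactTerm_update l B m j
    rw [hL, hL, map_smul]

/-- The alternating form `l ∧ Bⁿ`. -/
def contactAlt (n : ℕ) (l : V →ₗ[ℝ] ℝ) (B : V →ₗ[ℝ] V →ₗ[ℝ] ℝ) :
    AlternatingMap ℝ V ℝ (Fin (2 * n + 1)) :=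
  MultilinearMap.alternatization (contactMulti n l B)

lemma contactAlt_apply (n : ℕ) (l : V →ₗ[ℝ] ℝ) (B : V →ₗ[ℝ] V →ₗ[ℝ] ℝ)
    (v : Fin (2 * n + 1) → V) : contactAlt n l B v =
    ∑ σ : Equiv.Perm (Fin (2 * n + 1)), ((Equiv.Perm.sign σ : ℤ) : ℝ) *
      (l (v (σ 0)) * ∏ i : Fin n, B (v (σ ⟨2 * i + 1, by omega⟩)) (v (σ ⟨2 * i + 2, by omega⟩))) := by
  rw [contactAlt, MultilinearMap.alternatization_apply]
  refine Finset.sum_congr rfl fun σ _ => ?_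
  rw [Units.smul_def, zsmul_eq_mul]
  rfl

lemma exists_adapted_basis [FiniteDimensional ℝ V] {n : ℕ} (hn : Module.finrank ℝ V = 2 * n + 1)
    {l : V →ₗ[ℝ] ℝ} (hl : l ≠ 0) :
    ∃ b : Module.Basis (Fin (2 * n + 1)) ℝ V, ∀ i, i ≠ 0 → l (b i) = 0 := by
  have hr : LinearMap.range l = ⊤ := LinearMap.range_eq_top.2 (LinearMap.surjective hl)
  have h1 := LinearMap.finrank_range_add_finrank_ker l
  rw [hr, finrank_top, Module.finrank_self, hn] at h1
  obtain ⟨y, hy⟩ : ∃ y, l y = 1 := LinearMap.surjective hl 1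
  let b := Module.finBasisOfFinrankEq ℝ (LinearMap.ker l) (show _ = 2 * n by omega)
  refine ⟨Module.Basis.mkFinCons y b (fun c x hx h => ?_) (fun z => ⟨-l z, ?_⟩), fun i hi => ?_⟩
  · have := congrArg l h
    rw [map_add, map_smul, hy, (LinearMap.mem_ker.1 hx)] at this
    simpa using this
  · rw [LinearMap.mem_ker, map_add, map_smul, hy]
    simp
  · obtain ⟨j, rfl⟩ := Fin.exists_succ_eq.2 hi
    rw [Module.Basis.coe_mkFinCons, Fin.cons_succ]
    exact (b j).2

/-- If all vectors but the zeroth lie in ker l, only permutations fixing 0 contribute, and these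
evaluate B on ker l alone. The factor c comes once from l and n times from B. -/
lemma contactAlt_adapted_smul {n : ℕ} {l l' : V →ₗ[ℝ] ℝ} {B B' : V →ₗ[ℝ] V →ₗ[ℝ] ℝ} {c : ℝ}
    (hl : l' = c • l) (hB : ∀ v w, l v = 0 → l w = 0 → B' v w = c * B v w)
    {v : Fin (2 * n + 1) → V} (hv : ∀ i, i ≠ 0 → l (v i) = 0) :
    contactAlt n l' B' v = c ^ (n + 1) * contactAlt n l B v := by
  rw [contactAlt_apply, contactAlt_apply, Finset.mul_sum]
  refine Finset.sum_congr rfl fun σ _ => ?_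
  rw [hl, LinearMap.smul_apply, smul_eq_mul]
  by_cases h0 : σ 0 = 0
  · have h : ∀ i, i ≠ 0 → l (v (σ i)) = 0 := fun i hi =>
      hv _ fun h => hi (σ.injective (h.trans h0.symm))
    have h2 : ∏ i : Fin n, B' (v (σ ⟨2 * i + 1, by omega⟩)) (v (σ ⟨2 * i + 2, by omega⟩)) =
        ∏ i : Fin n, (c * B (v (σ ⟨2 * i + 1, by omega⟩)) (v (σ ⟨2 * i + 2, by omega⟩))) :=
      Finset.prod_congr rfl fun i _ => hB _ _ (h _ (by simp [Fin.ext_iff]))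
        (h _ (by simp [Fin.ext_iff]))
    rw [h2, Finset.prod_mul_distrib, Finset.prod_const, Finset.card_univ, Fintype.card_fin]
    ring
  · rw [hv _ h0]
    simp

/-- If z ≠ 0, replace by z a vector of an adapted basis along which z has a nonzero coefficient. By
alternation the value is that coefficient times the nonzero value on the basis. Yet each summand
vanishes, since either l meets a vector of its kernel or B meets z and a vector of ker l. -/
lemma contactAlt_nondegenerate [FiniteDimensional ℝ V] {n : ℕ}
    (hn : Module.finrank ℝ V = 2 * n + 1) {l : V →ₗ[ℝ] ℝ} {B : V →ₗ[ℝ] V →ₗ[ℝ] ℝ}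
    (hB : ∀ v w, B v w = -B w v) (h : contactAlt n l B ≠ 0) {z : V} (hz : l z = 0)
    (hzB : ∀ w, l w = 0 → B z w = 0) : z = 0 := by
  have hl : l ≠ 0 := by
    rintro rfl
    apply h
    ext v
    rw [contactAlt_apply]
    simp
  obtain ⟨b, hb⟩ := exists_adapted_basis hn hl
  have hTb : contactAlt n l B b ≠ 0 := ((contactAlt n l B).map_basis_ne_zero_iff b).2 h
  have hl0 : l (b 0) ≠ 0 := by
    intro h0
    apply hl
    apply b.ext
    intro i
    by_cases hi : i = 0
    · rw [hi, h0]; rfl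
    · rw [hb i hi]; rfl
  by_contra hz0
  obtain ⟨j, hj⟩ : ∃ j, b.repr z j ≠ 0 := by
    by_contra hcon
    push Not at hcon
    exact hz0 (b.repr.map_eq_zero_iff.1 (Finsupp.ext hcon))
  have hj0 : j ≠ 0 := by
    rintro rfl
    have h1 := congrArg l (b.sum_repr z)
    rw [map_sum, Finset.sum_eq_single 0 (fun i _ hi => by rw [map_smul, hb i hi, smul_zero])
      (by simp), hz, map_smul, smul_eq_mul] at h1
    rcases mul_eq_zero.1 h1 with h2 | h2
    exacts [hj h2, hl0 h2]
  have hT : contactAlt n l B (Function.update b j z) = b.repr z j * contactAlt n l B b := by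
    conv_lhs => rw [← b.sum_repr z]
    rw [AlternatingMap.map_update_sum, Finset.sum_eq_single j]
    · rw [AlternatingMap.map_update_smul, Function.update_eq_self, smul_eq_mul]
    · intro i _ hi
      rw [AlternatingMap.map_update_smul, AlternatingMap.map_update_self _ _ hi.symm, smul_zero]
    · simp
  have hT0 : contactAlt n l B (Function.update b j z) = 0 := by
    rw [contactAlt_apply]
    refine Finset.sum_eq_zero fun σ _ => ?_
    have hv : ∀ i, i ≠ 0 → l (Function.update b j z i) = 0 := by
      intro i hi
      by_cases hij : i = j
      · rw [hij, Function.update_self, hz]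
      · rw [Function.update_of_ne hij, hb i hi]
    by_cases h0 : σ 0 = 0
    · have hs : ∀ i, i ≠ 0 → l (Function.update b j z (σ i)) = 0 := fun i hi =>
        hv _ fun h => hi (σ.injective (h.trans h0.symm))
      have hne : σ.symm j ≠ 0 := fun h' => hj0 (by rw [← σ.apply_symm_apply j, h', h0])
      have hj' := (σ.symm j).2
      have hpos : (σ.symm j).1 ≠ 0 := fun h' => hne (Fin.ext h')
      rw [Finset.prod_eq_zero (i := (⟨((σ.symm j).1 - 1) / 2, by omega⟩ : Fin n))
        (Finset.mem_univ _)]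
      · simp
      rcases Nat.even_or_odd' ((σ.symm j).1 - 1) with ⟨c, hc | hc⟩
      · have h1 : (⟨2 * (((σ.symm j).1 - 1) / 2) + 1, by omega⟩ : Fin (2 * n + 1)) = σ.symm j := by
          rw [Fin.ext_iff]; simp only; omega
        simp only [h1, Equiv.apply_symm_apply, Function.update_self]
        exact hzB _ (hs _ (by simp [Fin.ext_iff]))
      · have h1 : (⟨2 * (((σ.symm j).1 - 1) / 2) + 2, by omega⟩ : Fin (2 * n + 1)) = σ.symm j := by
          rw [Fin.ext_iff]; simp only; omega
        simp only [h1, Equiv.apply_symm_apply, Function.update_self]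
        rw [hB, hzB _ (hs _ (by simp [Fin.ext_iff])), neg_zero]
    · rw [hv _ h0]
      simp
  rw [hT] at hT0
  rcases mul_eq_zero.1 hT0 with h2 | h2
  exacts [hj h2, hTb h2]

/-- The form l ⊗ l + B is nondegenerate: on (v, v) it equals l(v)², so its radical lies in ker l,
and there it is the radical of B. The Reeb vector is the one representing l through this form. -/
lemma exists_reeb_of_nondegenerate [FiniteDimensional ℝ V] {l : V →ₗ[ℝ] ℝ}
    {B : V →ₗ[ℝ] V →ₗ[ℝ] ℝ} (hB : ∀ v w, B v w = -B w v) (hl : l ≠ 0)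
    (h : ∀ v, l v = 0 → (∀ w, l w = 0 → B v w = 0) → v = 0) :
    ∃ R, l R = 1 ∧ ∀ w, B R w = 0 := by
  have hs : ∀ v, B v v = 0 := fun v => by
    have := hB v v
    linarith
  let N : V →ₗ[ℝ] Module.Dual ℝ V := l.smulRight l + B
  have hNa : ∀ v w, N v w = l v * l w + B v w := fun v w => rfl
  have hN : Function.Injective N := by
    rw [injective_iff_map_eq_zero]
    intro v hv
    have h0 : l v = 0 := by
      have := hNa v v
      rw [hv, hs, add_zero] at this
      exact mul_self_eq_zero.1 this.symm
    refine h v h0 fun w _ => ?_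
    have := hNa v w
    rw [hv, h0, zero_mul, zero_add] at this
    exact this.symm
  have hsur : Function.Surjective N :=
    (LinearMap.injective_iff_surjective_of_finrank_eq_finrank
      Subspace.dual_finrank_eq.symm).1 hN
  obtain ⟨R, hR⟩ := hsur l
  have hR' : ∀ w, l R * l w + B R w = l w := fun w => by rw [← hNa, hR]
  have h1 : l R = 1 := by
    have h2 := hR' R
    rw [hs, add_zero] at h2
    -- Inserting R into its own equation gives l(R)² = l(R). The value 0 would force R = 0, and then
    -- l = 0.
    by_cases h3 : l R = 0
    · exfalso
      have hR0 : R = 0 := h R h3 fun w hw => by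
        have := hR' w
        rwa [h3, zero_mul, zero_add, hw] at this
      apply hl
      ext v
      have := hR' v
      rw [← this, hR0]
      simp
    · exact mul_left_cancel₀ h3 (by rw [h2, mul_one])
  refine ⟨R, h1, fun w => ?_⟩
  have := hR' w
  rw [h1, one_mul] at this
  linarith

end LinearContact

/-! ### Contact forms and their Reeb fields -/

section ContactForm

variable {n : ℕ} {M : Type*} [TopologicalSpace M] [ChartedSpace (Euc (2 * n + 1)) M]
  [IsManifold (𝓡 (2 * n + 1)) ∞ M]

/-- The exterior derivative as a bilinear map. -/
def extDL {d : ℕ} {M : Type*} [TopologicalSpace M] [ChartedSpace (Euc d) M]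
    (lam : OneForm d M) (x : M) : TangentSpace (𝓡 d) x →L[ℝ] TangentSpace (𝓡 d) x →L[ℝ] ℝ :=
  show Euc d →L[ℝ] Euc d →L[ℝ] ℝ from dform (chartForm lam x) (extChartAt (𝓡 d) x x)

lemma extDL_apply {d : ℕ} {M : Type*} [TopologicalSpace M] [ChartedSpace (Euc d) M]
    [IsManifold (𝓡 d) ∞ M] (lam : OneForm d M) (x : M) (v w : TangentSpace (𝓡 d) x) :
    extDL lam x v w = extD lam x v w := (extD_eq_dform lam x v w).symm

lemma extD_swap {d : ℕ} {M : Type*} [TopologicalSpace M] [ChartedSpace (Euc d) M]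
    (lam : OneForm d M) (x : M) (v w : TangentSpace (𝓡 d) x) :
    extD lam x v w = -extD lam x w v := (neg_sub _ _).symm

/-- The exterior derivative as a bilinear map, without continuity. -/
def extDLin {d : ℕ} {M : Type*} [TopologicalSpace M] [ChartedSpace (Euc d) M]
    (lam : OneForm d M) (x : M) : Euc d →ₗ[ℝ] Euc d →ₗ[ℝ] ℝ :=
  LinearMap.mk₂ ℝ (fun v w : Euc d => dform (chartForm lam x) (extChartAt (𝓡 d) x x) v w)
    (by simp) (by simp) (by simp) (by simp)

/-- A `1`-form at a point, as a linear map on the model space. -/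
def formLin {d : ℕ} {M : Type*} [TopologicalSpace M] [ChartedSpace (Euc d) M]
    (lam : OneForm d M) (x : M) : Euc d →ₗ[ℝ] ℝ :=
  (show Euc d →L[ℝ] ℝ from lam x).toLinearMap

lemma contactVolume_eq (lam : OneForm (2 * n + 1) M) (x : M)
    (v : Fin (2 * n + 1) → Euc (2 * n + 1)) :
    contactVolume lam x v = contactAlt n (formLin lam x) (extDLin lam x) v := by
  rw [contactAlt_apply]
  refine Finset.sum_congr rfl fun σ _ => ?_
  congr 2
  exact Finset.prod_congr rfl fun i _ => extD_eq_dform lam x _ _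

lemma IsContactForm.contactAlt_ne {lam : OneForm (2 * n + 1) M} (h : IsContactForm lam) (x : M) :
    contactAlt n (formLin lam x) (extDLin lam x) ≠ 0 := by
  obtain ⟨v, hv⟩ := h.2 x
  intro h0
  exact hv ((contactVolume_eq lam x v).trans (by rw [h0]; rfl))

lemma IsContactForm.formLin_ne {lam : OneForm (2 * n + 1) M} (h : IsContactForm lam) (x : M) :
    formLin lam x ≠ 0 := by
  intro h0
  apply h.contactAlt_ne x
  ext v
  rw [contactAlt_apply, h0]
  simp

lemma IsContactForm.nondegenerate {lam : OneForm (2 * n + 1) M} (h : IsContactForm lam) {x : M}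
    {v : TangentSpace (𝓡 (2 * n + 1)) x} (hv : lam x v = 0)
    (hw : ∀ w, lam x w = 0 → extD lam x v w = 0) : v = 0 :=
  contactAlt_nondegenerate finrank_euclideanSpace_fin
    (fun v w => dform_swap _ _ v w) (h.contactAlt_ne x) hv
    fun w hlw => (extD_eq_dform lam x v w).symm.trans (hw w hlw)

/-- The bilinear form `λ ⊗ λ + dλ`. -/
def reebForm {d : ℕ} {M : Type*} [TopologicalSpace M] [ChartedSpace (Euc d) M]
    (lam : OneForm d M) : TangentBilin d M := fun x =>
  (lam x).smulRight (lam x) + extDL lam x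

lemma reebForm_apply {d : ℕ} {M : Type*} [TopologicalSpace M] [ChartedSpace (Euc d) M]
    [IsManifold (𝓡 d) ∞ M] (lam : OneForm d M) (x : M) (v w : TangentSpace (𝓡 d) x) :
    reebForm lam x v w = lam x v * lam x w + extD lam x v w := by
  rw [← extDL_apply]
  rfl

lemma IsContactForm.reebForm_injective {lam : OneForm (2 * n + 1) M} (h : IsContactForm lam)
    {x : M} {v : TangentSpace (𝓡 (2 * n + 1)) x} (hv : ∀ w, reebForm lam x v w = 0) : v = 0 := by
  have hs : extD lam x v v = 0 := by
    have := extD_swap lam x v v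
    linarith
  have h0 : lam x v = 0 := by
    have := hv v
    rw [reebForm_apply, hs, add_zero] at this
    exact mul_self_eq_zero.1 this
  refine h.nondegenerate h0 fun w _ => ?_
  have := hv w
  rwa [reebForm_apply, h0, zero_mul, zero_add] at this

lemma IsContactForm.exists_reeb {lam : OneForm (2 * n + 1) M} (h : IsContactForm lam) (x : M) :
    ∃ R, lam x R = 1 ∧ ∀ w, extD lam x R w = 0 := by
  obtain ⟨R, h1, h2⟩ := exists_reeb_of_nondegenerate (l := formLin lam x) (B := extDLin lam x)
    (fun v w => dform_swap _ _ v w) (h.formLin_ne x) fun v hv hw =>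
      h.nondegenerate (x := x) hv fun w hlw => (extD_eq_dform lam x v w).trans (hw w hlw)
  exact ⟨R, h1, fun w => (extD_eq_dform lam x R w).trans (h2 w)⟩

lemma IsContactForm.lam_reeb {lam : OneForm (2 * n + 1) M} (h : IsContactForm lam) (x : M) :
    lam x (reeb lam x) = 1 := (Classical.epsilon_spec (h.exists_reeb x)).1

lemma IsContactForm.extD_reeb {lam : OneForm (2 * n + 1) M} (h : IsContactForm lam) (x : M) :
    ∀ w, extD lam x (reeb lam x) w = 0 := (Classical.epsilon_spec (h.exists_reeb x)).2

lemma IsContactForm.eq_reeb {lam : OneForm (2 * n + 1) M} (h : IsContactForm lam) {x : M}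
    {R : TangentSpace (𝓡 (2 * n + 1)) x} (h1 : lam x R = 1) (h2 : ∀ w, extD lam x R w = 0) :
    R = reeb lam x := by
  rw [← sub_eq_zero]
  refine h.reebForm_injective fun w => ?_
  rw [map_sub, sub_apply, reebForm_apply, reebForm_apply, h1, h2, h.lam_reeb,
    h.extD_reeb, sub_self]

lemma IsContactForm.eq_reeb_of_ker {lam : OneForm (2 * n + 1) M} (h : IsContactForm lam) {x : M}
    {R : TangentSpace (𝓡 (2 * n + 1)) x} (h1 : lam x R = 1)
    (h2 : ∀ w, lam x w = 0 → extD lam x R w = 0) : R = reeb lam x := by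
  refine h.eq_reeb h1 fun w => ?_
  have h3 : lam x (w - lam x w • R) = 0 := by
    rw [map_sub, map_smul, h1, smul_eq_mul, mul_one, sub_self]
  have hs : extD lam x R R = 0 := by
    have := extD_swap lam x R R
    linarith
  have h4 := h2 _ h3
  rwa [← extDL_apply, map_sub, map_smul, extDL_apply, extDL_apply, hs, smul_zero, sub_zero] at h4

end ContactForm

/-! ### Conformal changes of a contact form -/

section Conformal

variable {d : ℕ} {M : Type*} [TopologicalSpace M] [ChartedSpace (Euc d) M]
  [IsManifold (𝓡 d) ∞ M]

lemma SmoothOneForm.smul {lam : OneForm d M} (h : SmoothOneForm lam) {k : M → ℝ}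
    (hk : ContMDiff (𝓡 d) 𝓘(ℝ, ℝ) ∞ k) : SmoothOneForm fun x => k x • lam x := fun x =>
  (contMDiffAt_oneForm_iff _ x).2
    (((contMDiffAt_iff_chart k x).1 (hk x)).smul (h.contDiffAt_chartForm x))

/-- In d(k λ) = k dλ + dk ∧ λ the second term vanishes on pairs of vectors in ker λ. -/
lemma SmoothOneForm.extD_smul {lam : OneForm d M} (h : SmoothOneForm lam) {k : M → ℝ}
    (hk : ContMDiff (𝓡 d) 𝓘(ℝ, ℝ) ∞ k) {x : M} {v w : TangentSpace (𝓡 d) x}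
    (hv : lam x v = 0) (hw : lam x w = 0) :
    extD (fun x => k x • lam x) x v w = k x * extD lam x v w := by
  have hI : chartI x (extChartAt (𝓡 d) x x) = ContinuousLinearMap.id ℝ (Euc d) := by
    ext1 v
    have h1 := chartI_comp_chartD (x₀ := x) (mem_extChartAt_source x) v
    have : IsManifold (𝓡 d) 1 M := IsManifold.of_le (n := ∞) (by simp)
    have h2 : (mfderiv (𝓡 d) 𝓘(ℝ, Euc d) (extChartAt (𝓡 d) x) x : Euc d →L[ℝ] Euc d) =
      ContinuousLinearMap.id ℝ (Euc d) := mfderiv_extChartAt_self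
    have h3 : chartD x x v = v := congrArg (fun A : Euc d →L[ℝ] Euc d => A v) h2
    rw [h3] at h1
    exact h1
  have hc : ∀ v : Euc d, chartForm lam x (extChartAt (𝓡 d) x x) v = lam x v := by
    intro v
    have h1 : chartForm lam x (extChartAt (𝓡 d) x x) v =
      lam ((extChartAt (𝓡 d) x).symm (extChartAt (𝓡 d) x x))
        (chartI x (extChartAt (𝓡 d) x x) v) := rfl
    rw [h1, hI, extChartAt_to_inv]
    rfl
  have h1 := (contMDiffAt_iff_chart k x).1 (hk x)
  rw [extD_eq_dform lam x v w, extD_eq_dform _ x v w]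
  have h2 := dform_smul (h1.differentiableAt (by simp))
    ((h.contDiffAt_chartForm x).differentiableAt (by simp)) v w
  rw [hc v, hc w] at h2
  refine h2.trans ?_
  erw [hv, hw]
  rw [Function.comp_apply, extChartAt_to_inv]
  ring

lemma IsContactForm.smul {n : ℕ} {M : Type*} [TopologicalSpace M]
    [ChartedSpace (Euc (2 * n + 1)) M] [IsManifold (𝓡 (2 * n + 1)) ∞ M]
    {lam : OneForm (2 * n + 1) M} (h : IsContactForm lam) {k : M → ℝ}
    (hk : ContMDiff (𝓡 (2 * n + 1)) 𝓘(ℝ, ℝ) ∞ k) (hk0 : ∀ x, k x ≠ 0) :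
    IsContactForm fun x => k x • lam x := by
  refine ⟨h.1.smul hk, fun x => ?_⟩
  obtain ⟨b, hb⟩ := exists_adapted_basis finrank_euclideanSpace_fin (h.formLin_ne x)
  have hT := ((contactAlt n _ _).map_basis_ne_zero_iff b).2 (h.contactAlt_ne x)
  refine ⟨b, ?_⟩
  rw [contactVolume_eq]
  refine ne_of_eq_of_ne (contactAlt_adapted_smul (c := k x) rfl (fun v w hv hw => ?_) hb)
    (mul_ne_zero (pow_ne_zero _ (hk0 x)) hT)
  have := h.1.extD_smul hk hv hw
  rwa [extD_eq_dform, extD_eq_dform] at this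

end Conformal

/-! ### The equation S N S = G for positive definite matrices -/

section MatrixPolar

open Matrix
open scoped MatrixOrder Matrix.Norms.L2Operator

variable {ι : Type*} [Fintype ι] [DecidableEq ι]

lemma Matrix.PosDef.exists_sqrt {A : Matrix ι ι ℝ} (hA : A.PosDef) :
    ∃ C : Matrix ι ι ℝ, C.PosDef ∧ C * C = A := by
  refine ⟨CFC.sqrt A, ?_, CFC.sqrt_mul_sqrt_self A hA.posSemidef.nonneg⟩
  exact (IsStrictlyPositive.sqrt A (Matrix.isStrictlyPositive_iff_posDef.2 hA)).posDef

/-- With C = √G and T = √(C N C), the matrix C T⁻¹ C is a solution. It is the geometric mean of N⁻¹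
and G. -/
lemma Matrix.PosDef.exists_mul_mul_eq {N G : Matrix ι ι ℝ} (hN : N.PosDef) (hG : G.PosDef) :
    ∃ S : Matrix ι ι ℝ, S.PosDef ∧ S * N * S = G := by
  obtain ⟨C, hC, hCG⟩ := hG.exists_sqrt
  have hCu : IsUnit C := hC.isUnit
  have hCs : Cᴴ = C := hC.1
  have hP : (C * N * C).PosDef := by
    have := (Matrix.IsUnit.posDef_star_left_conjugate_iff (x := N) hCu).2 hN
    rwa [Matrix.star_eq_conjTranspose, hCs] at this
  obtain ⟨T, hT, hTP⟩ := hP.exists_sqrt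
  have hTd : IsUnit T.det := (Matrix.isUnit_iff_isUnit_det T).1 hT.isUnit
  refine ⟨C * T⁻¹ * C, ?_, ?_⟩
  · have := (Matrix.IsUnit.posDef_star_left_conjugate_iff (x := T⁻¹) hCu).2 hT.inv
    rwa [Matrix.star_eq_conjTranspose, hCs] at this
  · calc C * T⁻¹ * C * N * (C * T⁻¹ * C) = C * (T⁻¹ * (C * N * C) * T⁻¹) * C := by
          simp only [Matrix.mul_assoc]
      _ = C * C := by
          rw [← hTP, ← Matrix.mul_assoc T⁻¹, Matrix.nonsing_inv_mul _ hTd, Matrix.one_mul,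
            Matrix.mul_nonsing_inv _ hTd, Matrix.mul_one]
      _ = G := hCG

/-- Writing N = C², cyclicity of the trace replaces N P by the positive semidefinite matrix C P C.
-/
lemma Matrix.PosDef.trace_mul_nonneg {N P : Matrix ι ι ℝ} (hN : N.PosDef) (hP : P.PosSemidef) :
    0 ≤ (N * P).trace ∧ ((N * P).trace = 0 → P = 0) := by
  obtain ⟨C, hC, hCN⟩ := hN.exists_sqrt
  have hCs : Cᴴ = C := hC.1
  have hQ : (C * P * C).PosSemidef := by
    have := hP.mul_mul_conjTranspose_same C
    rwa [hCs] at this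
  have ht : (N * P).trace = (C * P * C).trace := by
    rw [← hCN, Matrix.mul_assoc, Matrix.trace_mul_comm]
  refine ⟨ht ▸ hQ.trace_nonneg, fun h => ?_⟩
  have hz := hQ.trace_eq_zero_iff.1 (ht ▸ h)
  have hCu : IsUnit C := hC.isUnit
  exact (hCu.mul_right_eq_zero (b := P)).1 ((hCu.mul_left_eq_zero).1 hz)

/-- Multiply by S₂⁻¹ on the left and by S₁⁻¹ Dᴴ on the right. Then S₂⁻¹ (D N Dᴴ) + N (D S₁⁻¹ Dᴴ) =
0, and both terms have nonnegative trace, so D S₁⁻¹ Dᴴ = 0. This yields both the uniqueness of S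
and, with S₁ = S₂ and D arbitrary, the injectivity of the derivative of S ↦ S N S. -/
lemma Matrix.PosDef.eq_zero_of_sylvester {N S₁ S₂ D : Matrix ι ι ℝ} (hN : N.PosDef)
    (h₁ : S₁.PosDef) (h₂ : S₂.PosDef) (h : D * N * S₁ + S₂ * N * D = 0) : D = 0 := by
  have hd₁ : IsUnit S₁.det := (Matrix.isUnit_iff_isUnit_det S₁).1 h₁.isUnit
  have hd₂ : IsUnit S₂.det := (Matrix.isUnit_iff_isUnit_det S₂).1 h₂.isUnit
  have e : S₂⁻¹ * (D * N * Dᴴ) + N * (D * S₁⁻¹ * Dᴴ) = 0 := by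
    have h3 : S₂⁻¹ * (D * N * S₁ + S₂ * N * D) * (S₁⁻¹ * Dᴴ) = 0 := by
      rw [h, Matrix.mul_zero, Matrix.zero_mul]
    rw [Matrix.mul_add, Matrix.add_mul] at h3
    rw [← h3]
    congr 1
    · simp only [Matrix.mul_assoc]
      rw [← Matrix.mul_assoc S₁ S₁⁻¹, Matrix.mul_nonsing_inv _ hd₁, Matrix.one_mul]
    · simp only [Matrix.mul_assoc]
      rw [← Matrix.mul_assoc S₂⁻¹ S₂, Matrix.nonsing_inv_mul _ hd₂, Matrix.one_mul]
  have t := congrArg Matrix.trace e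
  rw [Matrix.trace_add, Matrix.trace_zero] at t
  have t1 := h₂.inv.trace_mul_nonneg (hN.posSemidef.mul_mul_conjTranspose_same D)
  have t2 := hN.trace_mul_nonneg (h₁.inv.posSemidef.mul_mul_conjTranspose_same D)
  have hz := t2.2 (by linarith [t1.1, t2.1])
  have hz' : D * S₁⁻¹ * Dᴴ = 0 := hz
  obtain ⟨C, hC, hCS⟩ := h₁.inv.exists_sqrt
  have hCs : Cᴴ = C := hC.1
  have : (D * C) * (D * C)ᴴ = 0 := by
    rw [Matrix.conjTranspose_mul, hCs, ← hz', ← hCS]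
    simp only [Matrix.mul_assoc]
  have := Matrix.self_mul_conjTranspose_eq_zero.1 this
  exact hC.isUnit.mul_left_eq_zero.1 this

end MatrixPolar

/-! ### Uniqueness and smooth dependence of S -/

section OperatorPolar

variable {d : ℕ}

/-- Symmetric positive definite operators. -/
def IsPosDefOp (S : Euc d →L[ℝ] Euc d) : Prop :=
  (∀ v w, inner ℝ v (S w) = inner ℝ w (S v)) ∧ ∀ v, v ≠ 0 → 0 < inner ℝ v (S v)

lemma isPosDefOp_iff (A : Matrix (Fin d) (Fin d) ℝ) :
    IsPosDefOp (Matrix.toEuclideanCLM (𝕜 := ℝ) A) ↔ A.PosDef := by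
  rw [Matrix.posDef_iff_dotProduct_mulVec]
  constructor
  · rintro ⟨h1, h2⟩
    refine ⟨?_, fun x hx => ?_⟩
    · ext i j
      have := h1 (EuclideanSpace.single i 1) (EuclideanSpace.single j 1)
      rw [Matrix.inner_toEuclideanCLM, Matrix.inner_toEuclideanCLM] at this
      simpa using this.symm
    · have := h2 (WithLp.toLp 2 x) (by simpa using hx)
      rw [Matrix.inner_toEuclideanCLM] at this
      simpa using this
  · rintro ⟨h1, h2⟩
    refine ⟨fun v w => ?_, fun v hv => ?_⟩
    · rw [Matrix.inner_toEuclideanCLM, Matrix.inner_toEuclideanCLM, Matrix.dotProduct_mulVec,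
        ← Matrix.mulVec_transpose, dotProduct_comm]
      have : A.transpose = A := by rw [← Matrix.conjTranspose_eq_transpose_of_trivial]; exact h1
      rw [this]
    · rw [Matrix.inner_toEuclideanCLM]
      have := h2 (x := WithLp.ofLp v) (by simpa using hv)
      simpa using this

lemma exists_matrix_eq (S : Euc d →L[ℝ] Euc d) :
    ∃ A : Matrix (Fin d) (Fin d) ℝ, Matrix.toEuclideanCLM (𝕜 := ℝ) A = S :=
  Matrix.toEuclideanCLM.surjective S

lemma IsPosDefOp.eq_zero_of_sylvester {N S₁ S₂ D : Euc d →L[ℝ] Euc d} (hN : IsPosDefOp N)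
    (h₁ : IsPosDefOp S₁) (h₂ : IsPosDefOp S₂) (h : D * N * S₁ + S₂ * N * D = 0) : D = 0 := by
  obtain ⟨N, rfl⟩ := exists_matrix_eq N
  obtain ⟨S₁, rfl⟩ := exists_matrix_eq S₁
  obtain ⟨S₂, rfl⟩ := exists_matrix_eq S₂
  obtain ⟨D, rfl⟩ := exists_matrix_eq D
  rw [isPosDefOp_iff] at hN h₁ h₂
  simp only [← map_mul, ← map_add] at h
  rw [Matrix.PosDef.eq_zero_of_sylvester hN h₁ h₂
    ((map_eq_zero_iff _ Matrix.toEuclideanCLM.injective).1 h), map_zero]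

lemma IsPosDefOp.exists_mul_mul_eq {N G : Euc d →L[ℝ] Euc d} (hN : IsPosDefOp N)
    (hG : IsPosDefOp G) : ∃ S, IsPosDefOp S ∧ S * N * S = G := by
  obtain ⟨N, rfl⟩ := exists_matrix_eq N
  obtain ⟨G, rfl⟩ := exists_matrix_eq G
  rw [isPosDefOp_iff] at hN hG
  obtain ⟨S, hS, h⟩ := hN.exists_mul_mul_eq hG
  exact ⟨Matrix.toEuclideanCLM (𝕜 := ℝ) S, (isPosDefOp_iff S).2 hS, by simp only [← map_mul, h]⟩

/-- The difference D = S₁ - S₂ satisfies D N S₁ + S₂ N D = S₁ N S₁ - S₂ N S₂. -/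
lemma IsPosDefOp.mul_mul_inj {N S₁ S₂ : Euc d →L[ℝ] Euc d} (hN : IsPosDefOp N)
    (h₁ : IsPosDefOp S₁) (h₂ : IsPosDefOp S₂) (h : S₁ * N * S₁ = S₂ * N * S₂) : S₁ = S₂ := by
  rw [← sub_eq_zero]
  refine hN.eq_zero_of_sylvester h₁ h₂ ?_
  have : (S₁ - S₂) * N * S₁ + S₂ * N * (S₁ - S₂) = S₁ * N * S₁ - S₂ * N * S₂ := by
    rw [sub_mul, sub_mul, mul_sub]
    abel
  rw [this, h, sub_self]

/-- By compactness of the unit sphere the quadratic form of S is at least c ‖v‖². A symmetric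
operator at distance less than c from S is still positive. -/
lemma IsPosDefOp.eventually {S : Euc d →L[ℝ] Euc d} (hS : IsPosDefOp S) :
    ∀ᶠ T : Euc d →L[ℝ] Euc d in 𝓝 S, (∀ v w, inner ℝ v (T w) = inner ℝ w (T v)) → IsPosDefOp T := by
  obtain ⟨c, hc, hcS⟩ : ∃ c > 0, ∀ v, c * ‖v‖ ^ 2 ≤ inner ℝ v (S v) := by
    have hcont : Continuous fun v : Euc d => inner ℝ v (S v) := by fun_prop
    rcases (Metric.sphere (0 : Euc d) 1).eq_empty_or_nonempty with he | hne
    · refine ⟨1, one_pos, fun v => ?_⟩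
      have : v = 0 := by
        by_contra hv
        have h1 : (‖v‖⁻¹ • v) ∈ Metric.sphere (0 : Euc d) 1 := by
          simp [norm_smul, inv_mul_cancel₀ (norm_ne_zero_iff.2 hv)]
        rw [he] at h1
        exact h1
      simp [this]
    · obtain ⟨u, hu, hmin⟩ := (isCompact_sphere (0 : Euc d) 1).exists_isMinOn hne hcont.continuousOn
      have hu0 : u ≠ 0 := by
        rintro rfl
        simp at hu
      refine ⟨_, hS.2 u hu0, fun v => ?_⟩
      by_cases hv : v = 0
      · simp [hv]
      have hn := norm_ne_zero_iff.2 hv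
      have h1 : (‖v‖⁻¹ • v) ∈ Metric.sphere (0 : Euc d) 1 := by
        simp [norm_smul, inv_mul_cancel₀ hn]
      have h2 := isMinOn_iff.1 hmin _ h1
      rw [map_smul, inner_smul_left, inner_smul_right] at h2
      have h3 : inner ℝ v (S v) = ‖v‖ ^ 2 * (‖v‖⁻¹ * (‖v‖⁻¹ * inner ℝ v (S v))) := by
        field_simp
      rw [h3, mul_comm]
      exact mul_le_mul_of_nonneg_left (by simpa using h2) (by positivity)
  filter_upwards [Metric.ball_mem_nhds S hc] with T hT hs
  refine ⟨hs, fun v hv => ?_⟩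
  have h1 : |inner ℝ v ((T - S) v)| ≤ ‖T - S‖ * ‖v‖ ^ 2 := by
    refine (abs_real_inner_le_norm _ _).trans ?_
    have := (T - S).le_opNorm v
    nlinarith [norm_nonneg v]
  rw [mem_ball_iff_norm] at hT
  have h2 : inner ℝ v ((T - S) v) = inner ℝ v (T v) - inner ℝ v (S v) := by
    rw [sub_apply, inner_sub_right]
  have h3 := (abs_le.1 h1).1
  have h4 : 0 < ‖v‖ ^ 2 := by positivity
  nlinarith [hcS v]

lemma isPosDefOp_eventually_eq {X : Type*} {l : Filter X} {S : X → Euc d →L[ℝ] Euc d}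
    {S₀ : Euc d →L[ℝ] Euc d} (hS : Tendsto S l (𝓝 S₀)) (h0 : IsPosDefOp S₀)
    (hs : ∀ᶠ x in l, ∀ v w, inner ℝ v (S x w) = inner ℝ w (S x v)) :
    ∀ᶠ x in l, IsPosDefOp (S x) := by
  filter_upwards [hS.eventually h0.eventually, hs] with x h1 h2 using h1 h2

/-- Keeping N as a coordinate makes the inverse function theorem produce S as a smooth function of N
and G together. The hypothesis is the injectivity of the partial derivative in S. -/
lemma exists_openPartialHomeomorph_mul_mul {A : Type*} [NormedRing A] [NormedAlgebra ℝ A]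
    [FiniteDimensional ℝ A] [CompleteSpace A] {N S : A} (h : ∀ b, b * N * S + S * N * b = 0 → b = 0) :
    ∃ Φ : OpenPartialHomeomorph (A × A) (A × A), (N, S) ∈ Φ.source ∧
      ⇑Φ = (fun p => (p.1, p.2 * p.1 * p.2)) ∧ ContDiffOn ℝ ∞ Φ.symm Φ.target := by
  let f : A × A → A × A := fun p => (p.1, p.2 * p.1 * p.2)
  have hf : ContDiff ℝ ∞ f := contDiff_fst.prodMk ((contDiff_snd.mul contDiff_fst).mul contDiff_snd)
  let p₀ : A × A := (N, S)
  have hd : HasFDerivAt f (fderiv ℝ f p₀) p₀ := (hf.differentiable (by simp) p₀).hasFDerivAt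
  have hd2 : HasFDerivAt f _ p₀ :=
    (hasFDerivAt_fst (𝕜 := ℝ) (p := p₀)).prodMk
      (((hasFDerivAt_snd (𝕜 := ℝ) (p := p₀)).mul' (hasFDerivAt_fst (𝕜 := ℝ) (p := p₀))).mul'
        (hasFDerivAt_snd (𝕜 := ℝ) (p := p₀)))
  have hinj : Function.Injective (fderiv ℝ f p₀) := by
    rw [injective_iff_map_eq_zero]
    rintro ⟨a, b⟩ hab
    rw [hd2.fderiv] at hab
    have ha : a = 0 := congrArg Prod.fst hab
    have hb : (S * N) * b + (S * a + b * N) * S = 0 := congrArg Prod.snd hab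
    rw [ha, mul_zero, zero_add, add_comm] at hb
    rw [ha, h b hb, Prod.mk_zero_zero]
  let e : (A × A) ≃L[ℝ] (A × A) :=
    (LinearEquiv.ofInjectiveEndo (fderiv ℝ f p₀).toLinearMap hinj).toContinuousLinearEquiv
  have he : HasFDerivAt f (e : A × A →L[ℝ] A × A) p₀ := by
    have : (e : A × A →L[ℝ] A × A) = fderiv ℝ f p₀ :=
      ContinuousLinearMap.ext fun x => rfl
    rw [this]
    exact hd
  obtain ⟨Φ, hp, -, hΦ, hsm, -⟩ := exists_openPartialHomeomorph_of_contDiffOn isOpen_univ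
    hf.contDiffOn (mem_univ p₀) e he
  exact ⟨Φ, hp, hΦ, hsm⟩

set_option synthInstance.maxHeartbeats 400000 in
/-- The positive definite solution `S` of `S * N * S = G` depends smoothly on `N` and `G`. -/
lemma contDiffAt_of_mul_mul_eq {X : Type*} [NormedAddCommGroup X] [NormedSpace ℝ X] {x₀ : X}
    {N G S : X → Euc d →L[ℝ] Euc d} (hN : ContDiffAt ℝ ∞ N x₀) (hG : ContDiffAt ℝ ∞ G x₀)
    (hNp : ∀ᶠ x in 𝓝 x₀, IsPosDefOp (N x)) (hGp : ∀ᶠ x in 𝓝 x₀, IsPosDefOp (G x))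
    (hSp : ∀ᶠ x in 𝓝 x₀, IsPosDefOp (S x)) (hS : ∀ᶠ x in 𝓝 x₀, S x * N x * S x = G x) :
    ContDiffAt ℝ ∞ S x₀ := by
  let A := Euc d →L[ℝ] Euc d
  let f : A × A → A × A := fun p => (p.1, p.2 * p.1 * p.2)
  let p₀ : A × A := (N x₀, S x₀)
  have hNp0 := hNp.self_of_nhds
  have hSp0 := hSp.self_of_nhds
  obtain ⟨Φ, hp, hΦ, hsm⟩ := exists_openPartialHomeomorph_mul_mul (A := Euc d →L[ℝ] Euc d)
    (N := N x₀) (S := S x₀) fun b hb => hNp0.eq_zero_of_sylvester hSp0 hSp0 hb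
  replace hp : p₀ ∈ Φ.source := hp
  have hg0 : (N x₀, G x₀) = Φ p₀ := by
    rw [hΦ]
    exact Prod.ext rfl hS.self_of_nhds.symm
  have hNG : ContDiffAt ℝ ∞ (fun x => (N x, G x)) x₀ := hN.prodMk hG
  have hsm' : ContDiffAt ℝ ∞ Φ.symm (N x₀, G x₀) :=
    hsm.contDiffAt (Φ.open_target.mem_nhds (hg0 ▸ Φ.map_source hp))
  -- A smooth candidate for S, to be identified with S without knowing that S is continuous. Its
  -- adjoint is a second solution near p₀, so by local injectivity it is symmetric. Hence it is
  -- positive definite near x₀, and uniqueness of positive definite solutions applies.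
  have hT : ContDiffAt ℝ ∞ (fun x => (Φ.symm (N x, G x)).2) x₀ :=
    contDiffAt_snd.comp x₀ (ContDiffAt.comp x₀ (g := Φ.symm) hsm' hNG)
  refine hT.congr_of_eventuallyEq ?_
  have ht0 : Φ.symm (N x₀, G x₀) = p₀ := by rw [hg0, Φ.left_inv hp]
  have htend : Tendsto (fun x => Φ.symm (N x, G x)) (𝓝 x₀) (𝓝 p₀) := by
    have := (ContinuousAt.comp (f := fun x => (N x, G x)) hsm'.continuousAt hNG.continuousAt)
    rw [ContinuousAt, Function.comp_apply, ht0] at this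
    exact this
  have htgt : ∀ᶠ x in 𝓝 x₀, (N x, G x) ∈ Φ.target :=
    hNG.continuousAt.eventually (Φ.open_target.mem_nhds (by
      change (N x₀, G x₀) ∈ Φ.target
      exact hg0 ▸ Φ.map_source hp))
  have hsa : ∀ T : A, IsPosDefOp T → ContinuousLinearMap.adjoint T = T := fun T hT =>
    ((ContinuousLinearMap.eq_adjoint_iff _ _).2 (fun v w => by
      rw [real_inner_comm, hT.1])).symm
  have hmul : ∀ T T' : A, ContinuousLinearMap.adjoint (T * T') =
      ContinuousLinearMap.adjoint T' * ContinuousLinearMap.adjoint T := fun T T' =>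
    ContinuousLinearMap.adjoint_comp T T'
  have hstar : Tendsto (fun x => (N x, ContinuousLinearMap.adjoint (Φ.symm (N x, G x)).2)) (𝓝 x₀) (𝓝 p₀) := by
    have h1 : Tendsto (fun x => ContinuousLinearMap.adjoint (Φ.symm (N x, G x)).2) (𝓝 x₀) (𝓝 (ContinuousLinearMap.adjoint p₀.2)) :=
      (ContinuousLinearMap.adjoint.continuous.tendsto _).comp ((continuous_snd.tendsto _).comp htend)
    have h2 := hN.continuousAt.tendsto.prodMk_nhds h1
    rwa [show (N x₀, ContinuousLinearMap.adjoint p₀.2) = p₀ from Prod.ext rfl (hsa _ hSp0)] at h2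
  have key : ∀ᶠ x in 𝓝 x₀, (Φ.symm (N x, G x)).1 = N x ∧
      (Φ.symm (N x, G x)).2 * N x * (Φ.symm (N x, G x)).2 = G x ∧
      ContinuousLinearMap.adjoint (Φ.symm (N x, G x)).2 = (Φ.symm (N x, G x)).2 := by
    filter_upwards [htgt, hstar.eventually (Φ.open_source.mem_nhds hp), hNp, hGp]
      with x h1 h2 h3 h4
    have h5 : f (Φ.symm (N x, G x)) = (N x, G x) := by
      change (fun p : A × A => (p.1, p.2 * p.1 * p.2)) (Φ.symm (N x, G x)) = _
      rw [← hΦ, Φ.right_inv h1]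
    have h6 : (Φ.symm (N x, G x)).1 = N x := congrArg Prod.fst h5
    have h7 : (Φ.symm (N x, G x)).2 * N x * (Φ.symm (N x, G x)).2 = G x := by
      have := congrArg Prod.snd h5
      rwa [show (f (Φ.symm (N x, G x))).2 = (Φ.symm (N x, G x)).2 * (Φ.symm (N x, G x)).1 *
        (Φ.symm (N x, G x)).2 from rfl, h6] at this
    refine ⟨h6, h7, ?_⟩
    have h8 := congrArg ContinuousLinearMap.adjoint h7
    rw [hmul, hmul, hsa _ h3, hsa _ h4, ← mul_assoc] at h8
    have h9 : Φ (N x, ContinuousLinearMap.adjoint (Φ.symm (N x, G x)).2) = Φ (Φ.symm (N x, G x)) := by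
      rw [Φ.right_inv h1, hΦ]
      exact Prod.ext rfl h8
    exact congrArg Prod.snd (Φ.injOn h2 (Φ.map_target h1) h9)
  have hpos : ∀ᶠ x in 𝓝 x₀, IsPosDefOp (Φ.symm (N x, G x)).2 := by
    refine isPosDefOp_eventually_eq ((continuous_snd.tendsto _).comp htend) hSp0 ?_
    filter_upwards [key] with x hx v w
    have h1 := hx.2.2
    change inner ℝ v ((Φ.symm (N x, G x)).2 w) = inner ℝ w ((Φ.symm (N x, G x)).2 v)
    rw [← ContinuousLinearMap.adjoint_inner_left, h1, real_inner_comm]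
  filter_upwards [key, hpos, hSp, hS, hNp] with x h1 h2 h3 h4 h5
  exact h5.mul_mul_inj h3 h2 (h4.trans h1.2.1.symm)

end OperatorPolar

/-! ### Polar isometries of a bilinear form -/

section BilinPolar

variable {d : ℕ}

/-- The operator representing a bilinear form on `ℝᵈ`. -/
def bilinOp (B : Euc d →L[ℝ] Euc d →L[ℝ] ℝ) : Euc d →L[ℝ] Euc d :=
  ∑ i, (B (EuclideanSpace.basisFun (Fin d) ℝ i)).smulRight (EuclideanSpace.basisFun (Fin d) ℝ i)

lemma inner_bilinOp (B : Euc d →L[ℝ] Euc d →L[ℝ] ℝ) (v w : Euc d) :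
    inner ℝ v (bilinOp B w) = B v w := by
  have h : bilinOp B w = ∑ i, B (EuclideanSpace.basisFun (Fin d) ℝ i) w •
      EuclideanSpace.basisFun (Fin d) ℝ i := by
    simp [bilinOp]
  rw [h, inner_sum]
  conv_rhs => rw [← (EuclideanSpace.basisFun (Fin d) ℝ).sum_repr' v]
  rw [map_sum, sum_apply]
  refine Finset.sum_congr rfl fun i _ => ?_
  rw [inner_smul_right, map_smul, smul_apply, smul_eq_mul, real_inner_comm,
    mul_comm]

lemma contDiff_bilinOp : ContDiff ℝ ∞ (bilinOp (d := d)) := by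
  unfold bilinOp
  refine ContDiff.sum fun i _ => ?_
  exact (contDiff_id.clm_apply contDiff_const).smulRight contDiff_const

/-- `Q` is the isometry of the inner product `g` for which `B(·, Q ·)` is an inner product. -/
structure IsPolar {E : Type*} [NormedAddCommGroup E] [NormedSpace ℝ E]
    (g B : E →L[ℝ] E →L[ℝ] ℝ) (Q : E →L[ℝ] E) : Prop where
  isom : ∀ v w, g (Q v) (Q w) = g v w
  symm : ∀ v w, B v (Q w) = B w (Q v)
  pos : ∀ v, v ≠ 0 → 0 < B v (Q v)

/-- Symmetric positive definite bilinear forms. -/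
def IsInnerForm {E : Type*} [NormedAddCommGroup E] [NormedSpace ℝ E]
    (g : E →L[ℝ] E →L[ℝ] ℝ) : Prop :=
  (∀ v w, g v w = g w v) ∧ ∀ v, v ≠ 0 → 0 < g v v

lemma isPosDefOp_bilinOp {g : Euc d →L[ℝ] Euc d →L[ℝ] ℝ} (hg : IsInnerForm g) :
    IsPosDefOp (bilinOp g) :=
  ⟨fun v w => by rw [inner_bilinOp, inner_bilinOp, hg.1],
    fun v hv => by rw [inner_bilinOp]; exact hg.2 v hv⟩

lemma isUnit_bilinOp {B : Euc d →L[ℝ] Euc d →L[ℝ] ℝ} (hB : ∀ v, (∀ w, B w v = 0) → v = 0) :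
    IsUnit (bilinOp B) := by
  have hi : Function.Injective (bilinOp B) := by
    rw [injective_iff_map_eq_zero]
    intro v hv
    exact hB v fun w => by rw [← inner_bilinOp, hv, inner_zero_right]
  let e := (LinearEquiv.ofInjectiveEndo (bilinOp B).toLinearMap hi).toContinuousLinearEquiv
  refine ⟨⟨(e : Euc d →L[ℝ] Euc d), e.symm, ?_, ?_⟩, ContinuousLinearMap.ext fun x => rfl⟩
  · ext1 x
    exact e.apply_symm_apply x
  · ext1 x
    exact e.symm_apply_apply x

lemma bilin_ext_op {S T : Euc d →L[ℝ] Euc d} (h : ∀ v w, inner ℝ v (S w) = inner ℝ v (T w)) :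
    S = T := by
  ext1 w
  exact ext_inner_left ℝ fun v => h v w

/-- The operator `N` for which a polar isometry `Q` is given by a solution of `S N S = G`. -/
def polarN (g B : Euc d →L[ℝ] Euc d →L[ℝ] ℝ) : Euc d →L[ℝ] Euc d :=
  ContinuousLinearMap.adjoint (Ring.inverse (bilinOp B)) * bilinOp g * Ring.inverse (bilinOp B)

lemma isPosDefOp_polarN {g B : Euc d →L[ℝ] Euc d →L[ℝ] ℝ} (hg : IsInnerForm g)
    (hB : ∀ v, (∀ w, B w v = 0) → v = 0) : IsPosDefOp (polarN g B) := by
  have h : ∀ v w, inner ℝ v (polarN g B w) =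
      g (Ring.inverse (bilinOp B) v) (Ring.inverse (bilinOp B) w) := by
    intro v w
    rw [← inner_bilinOp, ← ContinuousLinearMap.adjoint_inner_right]
    rfl
  refine ⟨fun v w => by rw [h, h, hg.1], fun v hv => ?_⟩
  rw [h]
  refine hg.2 _ fun h0 => hv ?_
  have := congrArg (fun A : Euc d →L[ℝ] Euc d => A v)
    (Ring.mul_inverse_cancel _ (isUnit_bilinOp hB))
  simp only [mul_apply_eq_comp, h0, map_zero, one_apply_eq_self] at this
  exact this.symm

/-- Let b = `bilinOp B` and S = b Q. The conditions on B(·, Q ·) say that S is symmetric and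
positive definite, and then Q = b⁻¹ S preserves g if and only if S (b⁻ᵀ g b⁻¹) S = g, an equation of
the form S N S = G. -/
lemma isPolar_iff {g B : Euc d →L[ℝ] Euc d →L[ℝ] ℝ} (hB : ∀ v, (∀ w, B w v = 0) → v = 0)
    (Q : Euc d →L[ℝ] Euc d) : IsPolar g B Q ↔ IsPosDefOp (bilinOp B * Q) ∧
      bilinOp B * Q * polarN g B * (bilinOp B * Q) = bilinOp g := by
  have h1 : ∀ v w, inner ℝ v ((bilinOp B * Q) w) = B v (Q w) := fun v w => by
    rw [← inner_bilinOp]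
    rfl
  have hu := isUnit_bilinOp hB
  have hQ : Ring.inverse (bilinOp B) * (bilinOp B * Q) = Q :=
    Ring.inverse_mul_cancel_left _ _ hu
  have h2 : (∀ v w, inner ℝ v ((bilinOp B * Q) w) = inner ℝ w ((bilinOp B * Q) v)) →
      ∀ v w, inner ℝ v ((bilinOp B * Q * polarN g B * (bilinOp B * Q)) w) = g (Q v) (Q w) := by
    intro hs v w
    have e1 : (bilinOp B * Q * polarN g B * (bilinOp B * Q)) w = (bilinOp B * Q)
      (ContinuousLinearMap.adjoint (Ring.inverse (bilinOp B)) (bilinOp g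
        ((Ring.inverse (bilinOp B) * (bilinOp B * Q)) w))) := rfl
    rw [e1, hs, real_inner_comm, ContinuousLinearMap.adjoint_inner_right, hQ]
    have e2 : Ring.inverse (bilinOp B) ((bilinOp B * Q) v) = Q v :=
      congrArg (fun A : Euc d →L[ℝ] Euc d => A v) hQ
    rw [e2, inner_bilinOp]
  constructor
  · intro h
    have hs : ∀ v w, inner ℝ v ((bilinOp B * Q) w) = inner ℝ w ((bilinOp B * Q) v) :=
      fun v w => by rw [h1, h1, h.symm]
    exact ⟨⟨hs, fun v hv => by rw [h1]; exact h.pos v hv⟩,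
      bilin_ext_op fun v w => by rw [h2 hs, inner_bilinOp, h.isom]⟩
  · rintro ⟨h3, h4⟩
    exact ⟨fun v w => by rw [← h2 h3.1, h4, inner_bilinOp],
      fun v w => by rw [← h1, ← h1, h3.1], fun v hv => by rw [← h1]; exact h3.2 v hv⟩

lemma exists_isPolar {g B : Euc d →L[ℝ] Euc d →L[ℝ] ℝ} (hg : IsInnerForm g)
    (hB : ∀ v, (∀ w, B w v = 0) → v = 0) : ∃ Q, IsPolar g B Q := by
  obtain ⟨S, hS, h⟩ := (isPosDefOp_polarN hg hB).exists_mul_mul_eq (isPosDefOp_bilinOp hg)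
  refine ⟨Ring.inverse (bilinOp B) * S, (isPolar_iff hB _).2 ?_⟩
  rw [Ring.mul_inverse_cancel_left _ _ (isUnit_bilinOp hB)]
  exact ⟨hS, h⟩

lemma IsPolar.unique {g B : Euc d →L[ℝ] Euc d →L[ℝ] ℝ} (hg : IsInnerForm g)
    (hB : ∀ v, (∀ w, B w v = 0) → v = 0) {Q Q' : Euc d →L[ℝ] Euc d} (h : IsPolar g B Q)
    (h' : IsPolar g B Q') : Q = Q' := by
  obtain ⟨h1, h2⟩ := (isPolar_iff hB Q).1 h
  obtain ⟨h3, h4⟩ := (isPolar_iff hB Q').1 h'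
  have := (isPosDefOp_polarN hg hB).mul_mul_inj h1 h3 (h2.trans h4.symm)
  exact (isUnit_bilinOp hB).mul_left_cancel this

/-- Both sides of S N S = G depend smoothly on the data, hence so does S = b Q, and so does Q = b⁻¹
S. -/
lemma contDiffAt_of_isPolar {X : Type*} [NormedAddCommGroup X] [NormedSpace ℝ X] {x₀ : X}
    {g B : X → Euc d →L[ℝ] Euc d →L[ℝ] ℝ} {Q : X → Euc d →L[ℝ] Euc d}
    (hgs : ContDiffAt ℝ ∞ g x₀) (hBs : ContDiffAt ℝ ∞ B x₀)
    (hg : ∀ᶠ x in 𝓝 x₀, IsInnerForm (g x)) (hB : ∀ᶠ x in 𝓝 x₀, ∀ v, (∀ w, B x w v = 0) → v = 0)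
    (hQ : ∀ᶠ x in 𝓝 x₀, IsPolar (g x) (B x) (Q x)) : ContDiffAt ℝ ∞ Q x₀ := by
  have hG : ContDiffAt ℝ ∞ (fun x => bilinOp (g x)) x₀ := contDiff_bilinOp.contDiffAt.comp x₀ hgs
  have hb : ContDiffAt ℝ ∞ (fun x => bilinOp (B x)) x₀ := contDiff_bilinOp.contDiffAt.comp x₀ hBs
  have hbi : ContDiffAt ℝ ∞ (fun x => Ring.inverse (bilinOp (B x))) x₀ := by
    obtain ⟨u, hu⟩ := isUnit_bilinOp hB.self_of_nhds
    have h1 : ContDiffAt ℝ ∞ Ring.inverse (bilinOp (B x₀)) := hu ▸ contDiffAt_ringInverse ℝ u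
    exact ContDiffAt.comp x₀ h1 hb
  have had : ContDiffAt ℝ ∞ (fun x => ContinuousLinearMap.adjoint
      (Ring.inverse (bilinOp (B x)))) x₀ := by
    have h1 : ContDiff ℝ ∞ (fun T : Euc d →L[ℝ] Euc d => ContinuousLinearMap.adjoint T) := by
      let L : (Euc d →L[ℝ] Euc d) →ₗ[ℝ] (Euc d →L[ℝ] Euc d) :=
        { toFun := fun T => ContinuousLinearMap.adjoint T
          map_add' := fun T T' => map_add _ T T'
          map_smul' := fun c T => by simp }
      exact L.toContinuousLinearMap.contDiff
    exact h1.contDiffAt.comp x₀ hbi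
  have hN : ContDiffAt ℝ ∞ (fun x => polarN (g x) (B x)) x₀ := (had.mul hG).mul hbi
  have hS := contDiffAt_of_mul_mul_eq (S := fun x => bilinOp (B x) * Q x) hN hG
    (by filter_upwards [hg, hB] with x h1 h2 using isPosDefOp_polarN h1 h2)
    (by filter_upwards [hg] with x h1 using isPosDefOp_bilinOp h1)
    (by filter_upwards [hB, hQ] with x h2 h3 using ((isPolar_iff h2 _).1 h3).1)
    (by filter_upwards [hB, hQ] with x h2 h3 using ((isPolar_iff h2 _).1 h3).2)
  refine (hbi.mul hS).congr_of_eventuallyEq ?_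
  filter_upwards [hB] with x h
  exact (Ring.inverse_mul_cancel_left _ _ (isUnit_bilinOp h)).symm

/-- Naturality under linear isomorphisms, used to pass from the tangent spaces to a chart. -/
lemma IsPolar.conj {E F : Type*} [NormedAddCommGroup E] [NormedSpace ℝ E]
    [NormedAddCommGroup F] [NormedSpace ℝ F] {g B : E →L[ℝ] E →L[ℝ] ℝ} {Q : E →L[ℝ] E}
    (h : IsPolar g B Q) {I : F →L[ℝ] E} {D : E →L[ℝ] F} (hDI : ∀ v, D (I v) = v)
    (hID : ∀ v, I (D v) = v) :
    IsPolar (g.bilinearComp I I) (B.bilinearComp I I) (D.comp (Q.comp I)) := by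
  refine ⟨fun v w => ?_, fun v w => ?_, fun v hv => ?_⟩
  · simp only [ContinuousLinearMap.bilinearComp_apply, ContinuousLinearMap.comp_apply, hID, h.isom]
  · simp only [ContinuousLinearMap.bilinearComp_apply, ContinuousLinearMap.comp_apply, hID]
    exact h.symm _ _
  · simp only [ContinuousLinearMap.bilinearComp_apply, ContinuousLinearMap.comp_apply, hID]
    refine h.pos _ fun h0 => hv ?_
    rw [← hDI v, h0, map_zero]

end BilinPolar

/-! ### From polar isometries to complex structures -/

section PolarContact

variable {d : ℕ} {g B : Euc d →L[ℝ] Euc d →L[ℝ] ℝ} {Q : Euc d →L[ℝ] Euc d} {l : Euc d →L[ℝ] ℝ}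
  {R : Euc d}

/-- The algebraic data from which a compatible complex structure on `ker l` is built. -/
structure IsAdaptedForm (l : Euc d →L[ℝ] ℝ) (η : Euc d →L[ℝ] Euc d →L[ℝ] ℝ) (R : Euc d)
    (g B : Euc d →L[ℝ] Euc d →L[ℝ] ℝ) : Prop where
  inner : IsInnerForm g
  skew : ∀ v w, η v w = -η w v
  reeb_one : l R = 1
  reeb_zero : ∀ w, η R w = 0
  metric_reeb : ∀ w, g R w = l w
  apply : ∀ v w, B v w = l v * l w + η v w
  nondeg : ∀ v, (∀ w, B w v = 0) → v = 0

/-- The reflection ε v = 2 l(v) R - v preserves g and transposes B, in the sense that B(v, ε w) =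
B(w, v). Therefore ε Q⁻¹ is a polar isometry as well, and uniqueness gives Q = ε Q⁻¹, that is, Q² =
ε. -/
lemma IsAdaptedForm.comp_self {η : Euc d →L[ℝ] Euc d →L[ℝ] ℝ} (h : IsAdaptedForm l η R g B)
    (hQ : IsPolar g B Q) (v : Euc d) : Q (Q v) = (2 * l v) • R - v := by
  let ε : Euc d →L[ℝ] Euc d := (2 : ℝ) • l.smulRight R - ContinuousLinearMap.id ℝ (Euc d)
  have hε : ∀ v, ε v = (2 * l v) • R - v := fun v => by
    simp [ε, smul_smul]
  have hlε : ∀ v, l (ε v) = l v := fun v => by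
    rw [hε, map_sub, map_smul, h.reeb_one, smul_eq_mul]; ring
  have hεε : ∀ v, ε (ε v) = v := fun v => by
    rw [hε (ε v), hlε, hε]; abel
  have hηR : ∀ w, η w R = 0 := fun w => by rw [h.skew, h.reeb_zero, neg_zero]
  have hBε : ∀ v w, B v (ε w) = B w v := fun v w => by
    rw [h.apply, h.apply, hlε, hε, map_sub, map_smul, hηR, h.skew w v, smul_zero, zero_sub]
    ring
  have hgε : ∀ v w, g (ε v) (ε w) = g v w := fun v w => by
    have h1 : ∀ v, g v R = l v := fun v => by rw [h.inner.1, h.metric_reeb]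
    rw [hε, hε]
    simp only [map_sub, map_smul, sub_apply, smul_apply, h1, h.metric_reeb,
      h.reeb_one, smul_eq_mul]
    ring
  have hinj : Function.Injective Q := by
    rw [injective_iff_map_eq_zero]
    intro v hv
    by_contra h0
    have := hQ.pos v h0
    rw [hv, map_zero] at this
    exact lt_irrefl _ this
  let e := (LinearEquiv.ofInjectiveEndo Q.toLinearMap hinj).toContinuousLinearEquiv
  have he : ∀ v, e v = Q v := fun v => rfl
  have he' : ∀ v, Q (e.symm v) = v := fun v => e.apply_symm_apply v
  have hQ' : IsPolar g B (ε.comp (e.symm : Euc d →L[ℝ] Euc d)) := by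
    refine ⟨fun v w => ?_, fun v w => ?_, fun v hv => ?_⟩
    · simp only [ContinuousLinearMap.comp_apply, hgε]
      rw [← hQ.isom]
      exact congrArg₂ (fun a b => g a b) (he' v) (he' w)
    · simp only [ContinuousLinearMap.comp_apply, hBε]
      have := hQ.symm (e.symm w) (e.symm v)
      rwa [he', he'] at this
    · simp only [ContinuousLinearMap.comp_apply, hBε]
      have := hQ.pos (e.symm v) (by simpa using hv)
      rwa [he'] at this
  have hu := hQ.unique h.inner h.nondeg hQ'
  have h1 : Q (Q v) = ε (e.symm (Q v)) := congrArg (fun A : Euc d →L[ℝ] Euc d => A (Q v)) hu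
  rw [h1, ← he, e.symm_apply_apply, hε]

lemma IsAdaptedForm.comp_self_of_ker {η : Euc d →L[ℝ] Euc d →L[ℝ] ℝ}
    (h : IsAdaptedForm l η R g B) (hQ : IsPolar g B Q) {v : Euc d} (hv : l v = 0) :
    Q (Q v) = -v := by
  rw [h.comp_self hQ, hv, mul_zero, zero_smul, zero_sub]

/-- Compute Q³ v in two ways: as Q² applied to Q v, and as Q applied to Q² v = -v. The difference is
2 l(Q v) R. -/
lemma IsAdaptedForm.apply_polar {η : Euc d →L[ℝ] Euc d →L[ℝ] ℝ} (h : IsAdaptedForm l η R g B)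
    (hQ : IsPolar g B Q) {v : Euc d} (hv : l v = 0) : l (Q v) = 0 := by
  have h1 := h.comp_self hQ (Q v)
  rw [h.comp_self hQ v, hv, mul_zero, zero_smul, zero_sub, map_neg] at h1
  have h2 := congrArg l h1
  rw [map_neg, map_sub, map_smul, h.reeb_one, smul_eq_mul] at h2
  linarith

/-- This is how prescribed values of J become linear conditions on the metric. The vector X = Q a -
b satisfies g(Q w, X) = -η(w, X) for w in ker l. For w = -Q X this reads g(X, X) = -B(X, Q X), which
is impossible unless X = 0. -/
lemma IsAdaptedForm.polar_eq {η : Euc d →L[ℝ] Euc d →L[ℝ] ℝ} (h : IsAdaptedForm l η R g B)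
    (hQ : IsPolar g B Q) {a b : Euc d} (ha : l a = 0) (hb : l b = 0)
    (hab : ∀ w, g w a = B w b) (hba : ∀ w, g w b = -B w a) : Q a = b := by
  have hX : l (Q a - b) = 0 := by rw [map_sub, h.apply_polar hQ ha, hb, sub_zero]
  rw [← sub_eq_zero]
  set X := Q a - b with hXdef
  have hη : ∀ w, l w = 0 → g (Q w) X = -η w X := by
    intro w hw
    have e1 : g (Q w) (Q a) = η w b := by rw [hQ.isom, hab, h.apply, hb, mul_zero, zero_add]
    have e2 : g (Q w) b = η w (Q a) := by
      have e3 : B (Q w) a = η (Q w) a := by rw [h.apply, ha, mul_zero, zero_add]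
      have hneg : η (-w) (Q a) = -η w (Q a) := by
        rw [h.skew, map_neg, neg_neg, h.skew w, neg_neg]
      have e4 : B a (Q (Q (Q w))) = B (Q (Q w)) (Q a) := hQ.symm _ _
      rw [h.comp_self hQ (Q w), h.apply_polar hQ hw, mul_zero, zero_smul, zero_sub,
        h.comp_self hQ w, hw, mul_zero, zero_smul, zero_sub, h.apply, h.apply, ha, zero_mul,
        zero_add, map_neg, map_neg, hneg, hw, neg_zero, zero_mul, zero_add] at e4
      rw [hba, e3, h.skew]
      linarith
    rw [hXdef, map_sub, map_sub, e1, e2]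
    ring
  by_contra h0
  have h1 := hη (-Q X) (by rw [map_neg, h.apply_polar hQ hX, neg_zero])
  rw [map_neg, h.comp_self hQ X, hX, mul_zero, zero_smul, zero_sub, neg_neg, h.skew, map_neg,
    neg_neg] at h1
  have h2 := hQ.pos X h0
  rw [h.apply, hX, zero_mul, zero_add] at h2
  have h3 := h.inner.2 X h0
  linarith

end PolarContact

/-! ### Metrics adapted to a frame of a plane field -/

section ModelMetric

variable {d : ℕ}

/-- The vector representing a linear form on `ℝᵈ`. -/
def formVec (l : Euc d →L[ℝ] ℝ) : Euc d :=
  ∑ i, l (EuclideanSpace.basisFun (Fin d) ℝ i) • EuclideanSpace.basisFun (Fin d) ℝ i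

lemma inner_formVec (l : Euc d →L[ℝ] ℝ) (v : Euc d) : inner ℝ v (formVec l) = l v := by
  rw [formVec, inner_sum]
  conv_rhs => rw [← (EuclideanSpace.basisFun (Fin d) ℝ).sum_repr' v]
  rw [map_sum]
  refine Finset.sum_congr rfl fun i _ => ?_
  rw [inner_smul_right, map_smul, smul_eq_mul, real_inner_comm, mul_comm]

lemma contDiff_formVec : ContDiff ℝ ∞ (formVec (d := d)) := by
  unfold formVec
  exact ContDiff.sum fun i _ => (contDiff_id.clm_apply contDiff_const).smul contDiff_const

/-- The sum of the squares of the coordinates of `P`. -/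
def pullMetric (P : Euc d →L[ℝ] Euc d) : Euc d →L[ℝ] Euc d →L[ℝ] ℝ :=
  ∑ i, ((EuclideanSpace.proj (𝕜 := ℝ) i : Euc d →L[ℝ] ℝ).comp P).smulRight
    ((EuclideanSpace.proj (𝕜 := ℝ) i : Euc d →L[ℝ] ℝ).comp P)

lemma pullMetric_apply (P : Euc d →L[ℝ] Euc d) (v w : Euc d) :
    pullMetric P v w = inner ℝ (P v) (P w) := by
  simp [pullMetric, PiLp.inner_apply, mul_comm]

lemma contDiff_pullMetric : ContDiff ℝ ∞ (pullMetric (d := d)) := by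
  unfold pullMetric
  refine ContDiff.sum fun i _ => ?_
  exact (contDiff_const.clm_comp contDiff_id).smulRight (contDiff_const.clm_comp contDiff_id)

/-- The projection along `R` onto `ker l`. -/
def reebProj (l : Euc d →L[ℝ] ℝ) (R : Euc d) : Euc d →L[ℝ] Euc d :=
  ContinuousLinearMap.id ℝ (Euc d) - l.smulRight R

/-- The metric for which `R` is a unit normal of `ker l`. -/
def plainMetric (l : Euc d →L[ℝ] ℝ) (R : Euc d) : Euc d →L[ℝ] Euc d →L[ℝ] ℝ :=
  l.smulRight l + pullMetric (reebProj l R)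

/-- The coordinates of the `η`-projection onto the plane spanned by `e₁` and `e₂`. -/
def frameCoord₁ (η : Euc d →L[ℝ] Euc d →L[ℝ] ℝ) (e₁ e₂ : Euc d) : Euc d →L[ℝ] ℝ :=
  -((η e₁ e₂)⁻¹ • η e₂)

/-- See `frameCoord₁`. -/
def frameCoord₂ (η : Euc d →L[ℝ] Euc d →L[ℝ] ℝ) (e₁ e₂ : Euc d) : Euc d →L[ℝ] ℝ :=
  (η e₁ e₂)⁻¹ • η e₁

/-- The projection onto the `η`-complement of the span of `R`, `e₁`, `e₂`. -/
def frameProj (l : Euc d →L[ℝ] ℝ) (η : Euc d →L[ℝ] Euc d →L[ℝ] ℝ) (R e₁ e₂ : Euc d) :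
    Euc d →L[ℝ] Euc d :=
  reebProj l R - (frameCoord₁ η e₁ e₂).smulRight (e₁ - l e₁ • R) -
    (frameCoord₂ η e₁ e₂).smulRight (e₂ - l e₂ • R)

/-- A metric for which `R` is a unit normal of `ker l`, and `η` is `η (e₁, e₂)` times the area form
on the plane spanned by `e₁` and `e₂`. -/
def frameMetric (l : Euc d →L[ℝ] ℝ) (η : Euc d →L[ℝ] Euc d →L[ℝ] ℝ) (R e₁ e₂ : Euc d) :
    Euc d →L[ℝ] Euc d →L[ℝ] ℝ :=
  l.smulRight l + η e₁ e₂ • ((frameCoord₁ η e₁ e₂).smulRight (frameCoord₁ η e₁ e₂) +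
    (frameCoord₂ η e₁ e₂).smulRight (frameCoord₂ η e₁ e₂)) + pullMetric (frameProj l η R e₁ e₂)

variable {l : Euc d →L[ℝ] ℝ} {η : Euc d →L[ℝ] Euc d →L[ℝ] ℝ} {R e₁ e₂ : Euc d}

lemma reebProj_apply (v : Euc d) : reebProj l R v = v - l v • R := rfl

lemma plainMetric_apply (v w : Euc d) : plainMetric l R v w =
    l v * l w + inner ℝ (reebProj l R v) (reebProj l R w) := by
  rw [← pullMetric_apply]
  rfl

lemma frameMetric_apply (v w : Euc d) : frameMetric l η R e₁ e₂ v w =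
    l v * l w + η e₁ e₂ * (frameCoord₁ η e₁ e₂ v * frameCoord₁ η e₁ e₂ w +
      frameCoord₂ η e₁ e₂ v * frameCoord₂ η e₁ e₂ w) +
      inner ℝ (frameProj l η R e₁ e₂ v) (frameProj l η R e₁ e₂ w) := by
  rw [← pullMetric_apply]
  rfl

lemma isInnerForm_plainMetric : IsInnerForm (plainMetric l R) := by
  refine ⟨fun v w => ?_, fun v hv => ?_⟩
  · rw [plainMetric_apply, plainMetric_apply, real_inner_comm]; ring
  · rw [plainMetric_apply]
    have h2 : 0 ≤ inner ℝ (reebProj l R v) (reebProj l R v) := real_inner_self_nonneg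
    have h1 := mul_self_nonneg (l v)
    by_contra hcon
    have h3 : l v = 0 := mul_self_eq_zero.1 (by linarith)
    have h4 := (inner_self_eq_zero (𝕜 := ℝ)).1 (show inner ℝ (reebProj l R v) _ = 0 by linarith)
    rw [reebProj_apply, h3, zero_smul, sub_zero] at h4
    exact hv h4

lemma plainMetric_reeb (hR : l R = 1) (w : Euc d) : plainMetric l R R w = l w := by
  rw [plainMetric_apply, reebProj_apply R, hR, one_smul, sub_self, inner_zero_left, one_mul,
    add_zero]

lemma isInnerForm_frameMetric (he : 0 < η e₁ e₂) : IsInnerForm (frameMetric l η R e₁ e₂) := by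
  refine ⟨fun v w => ?_, fun v hv => ?_⟩
  · rw [frameMetric_apply, frameMetric_apply, real_inner_comm]; ring
  · rw [frameMetric_apply]
    have h2 : 0 ≤ inner ℝ (frameProj l η R e₁ e₂ v) (frameProj l η R e₁ e₂ v) :=
      real_inner_self_nonneg
    have h1 := mul_self_nonneg (l v)
    have h3 := mul_self_nonneg (frameCoord₁ η e₁ e₂ v)
    have h4 := mul_self_nonneg (frameCoord₂ η e₁ e₂ v)
    by_contra hcon
    have h5 : 0 ≤ η e₁ e₂ * (frameCoord₁ η e₁ e₂ v * frameCoord₁ η e₁ e₂ v +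
      frameCoord₂ η e₁ e₂ v * frameCoord₂ η e₁ e₂ v) := mul_nonneg he.le (add_nonneg h3 h4)
    have h6 : l v = 0 := mul_self_eq_zero.1 (by linarith)
    have h7 : frameCoord₁ η e₁ e₂ v * frameCoord₁ η e₁ e₂ v +
      frameCoord₂ η e₁ e₂ v * frameCoord₂ η e₁ e₂ v = 0 :=
      (mul_eq_zero.1 (show η e₁ e₂ * _ = 0 by linarith)).resolve_left he.ne'
    have h8 : frameCoord₁ η e₁ e₂ v = 0 := mul_self_eq_zero.1 (by linarith)
    have h9 : frameCoord₂ η e₁ e₂ v = 0 := mul_self_eq_zero.1 (by linarith)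
    have h10 := (inner_self_eq_zero (𝕜 := ℝ)).1
      (show inner ℝ (frameProj l η R e₁ e₂ v) _ = 0 by linarith)
    have h11 : frameProj l η R e₁ e₂ v = v - l v • R -
      frameCoord₁ η e₁ e₂ v • (e₁ - l e₁ • R) - frameCoord₂ η e₁ e₂ v • (e₂ - l e₂ • R) := rfl
    rw [h11, h6, h8, h9] at h10
    simp only [zero_smul, sub_zero] at h10
    exact hv h10

lemma frameMetric_reeb (hs : ∀ v w, η v w = -η w v) (hR : l R = 1) (hη : ∀ w, η R w = 0)
    (w : Euc d) : frameMetric l η R e₁ e₂ R w = l w := by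
  have h1 : frameCoord₁ η e₁ e₂ R = 0 := by
    have : frameCoord₁ η e₁ e₂ R = -((η e₁ e₂)⁻¹ * η e₂ R) := rfl
    rw [this, hs _ R, hη]; simp
  have h2 : frameCoord₂ η e₁ e₂ R = 0 := by
    have : frameCoord₂ η e₁ e₂ R = (η e₁ e₂)⁻¹ * η e₁ R := rfl
    rw [this, hs _ R, hη]; simp
  have h3 : frameProj l η R e₁ e₂ R = 0 := by
    have : frameProj l η R e₁ e₂ R = R - l R • R -
      frameCoord₁ η e₁ e₂ R • (e₁ - l e₁ • R) - frameCoord₂ η e₁ e₂ R • (e₂ - l e₂ • R) := rfl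
    rw [this, h1, h2, hR]; simp
  rw [frameMetric_apply, h1, h2, h3, hR, inner_zero_left]; ring

/-- On the plane of the frame the metric is η(e₁, e₂) times the coordinate metric, so a quarter turn
represents g through η. The kernel condition concerns only the combination: off the slice, the
extension of the frame need not stay in ker l. -/
lemma frameMetric_frame (hs : ∀ v w, η v w = -η w v) (he : 0 < η e₁ e₂) {c₁ c₂ : ℝ} (h0 : l (c₁ • e₁ + c₂ • e₂) = 0) (w : Euc d) :
    frameMetric l η R e₁ e₂ w (c₁ • e₁ + c₂ • e₂) = η w (c₁ • e₂ - c₂ • e₁) := by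
  have hself : ∀ v, η v v = 0 := fun v => by
    have := hs v v
    linarith
  have h1 : ∀ v, frameCoord₁ η e₁ e₂ v = (η e₁ e₂)⁻¹ * η v e₂ := fun v => by
    have : frameCoord₁ η e₁ e₂ v = -((η e₁ e₂)⁻¹ * η e₂ v) := rfl
    rw [this, hs v e₂]; ring
  have h2 : ∀ v, frameCoord₂ η e₁ e₂ v = -((η e₁ e₂)⁻¹ * η v e₁) := fun v => by
    have : frameCoord₂ η e₁ e₂ v = (η e₁ e₂)⁻¹ * η e₁ v := rfl
    rw [this, hs v e₁]; ring
  have e1 : frameCoord₁ η e₁ e₂ (c₁ • e₁ + c₂ • e₂) = c₁ := by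
    rw [h1]
    simp only [map_add, map_smul, add_apply, smul_apply, smul_eq_mul, hself]
    field_simp
    ring
  have e2 : frameCoord₂ η e₁ e₂ (c₁ • e₁ + c₂ • e₂) = c₂ := by
    rw [h2]
    simp only [map_add, map_smul, add_apply, smul_apply, smul_eq_mul, hself, hs e₂ e₁]
    field_simp
    ring
  have e3 : frameProj l η R e₁ e₂ (c₁ • e₁ + c₂ • e₂) = 0 := by
    have : frameProj l η R e₁ e₂ (c₁ • e₁ + c₂ • e₂) = (c₁ • e₁ + c₂ • e₂) -
      l (c₁ • e₁ + c₂ • e₂) • R - frameCoord₁ η e₁ e₂ (c₁ • e₁ + c₂ • e₂) • (e₁ - l e₁ • R) -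
        frameCoord₂ η e₁ e₂ (c₁ • e₁ + c₂ • e₂) • (e₂ - l e₂ • R) := rfl
    rw [this, e1, e2, h0, zero_smul, sub_zero]
    have h3 : (c₁ • e₁ + c₂ • e₂) - c₁ • (e₁ - l e₁ • R) - c₂ • (e₂ - l e₂ • R) =
      (c₁ * l e₁ + c₂ * l e₂) • R := by
      module
    rw [h3]
    rw [map_add, map_smul, map_smul, smul_eq_mul, smul_eq_mul] at h0
    rw [h0, zero_smul]
  rw [frameMetric_apply, e1, e2, e3, h0, inner_zero_right, h1, h2, map_sub, map_smul, map_smul,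
    smul_eq_mul, smul_eq_mul]
  field_simp
  ring

variable {X : Type*} [NormedAddCommGroup X] [NormedSpace ℝ X] {x₀ : X}

lemma contDiffAt_plainMetric {l : X → Euc d →L[ℝ] ℝ} {R : X → Euc d} (hl : ContDiffAt ℝ ∞ l x₀)
    (hR : ContDiffAt ℝ ∞ R x₀) : ContDiffAt ℝ ∞ (fun x => plainMetric (l x) (R x)) x₀ :=
  (hl.smulRight hl).add (contDiff_pullMetric.contDiffAt.comp x₀
    (contDiffAt_const.sub (hl.smulRight hR)))

lemma contDiffAt_frameMetric {l : X → Euc d →L[ℝ] ℝ} {η : X → Euc d →L[ℝ] Euc d →L[ℝ] ℝ}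
    {R e₁ e₂ : X → Euc d} (hl : ContDiffAt ℝ ∞ l x₀) (hη : ContDiffAt ℝ ∞ η x₀)
    (hR : ContDiffAt ℝ ∞ R x₀) (h₁ : ContDiffAt ℝ ∞ e₁ x₀) (h₂ : ContDiffAt ℝ ∞ e₂ x₀)
    (he : η x₀ (e₁ x₀) (e₂ x₀) ≠ 0) :
    ContDiffAt ℝ ∞ (fun x => frameMetric (l x) (η x) (R x) (e₁ x) (e₂ x)) x₀ := by
  have hk : ContDiffAt ℝ ∞ (fun x => η x (e₁ x) (e₂ x)) x₀ := (hη.clm_apply h₁).clm_apply h₂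
  have hki : ContDiffAt ℝ ∞ (fun x => (η x (e₁ x) (e₂ x))⁻¹) x₀ := hk.inv he
  have c1 : ContDiffAt ℝ ∞ (fun x => frameCoord₁ (η x) (e₁ x) (e₂ x)) x₀ :=
    (hki.smul (hη.clm_apply h₂)).neg
  have c2 : ContDiffAt ℝ ∞ (fun x => frameCoord₂ (η x) (e₁ x) (e₂ x)) x₀ :=
    hki.smul (hη.clm_apply h₁)
  have hP : ContDiffAt ℝ ∞ (fun x => frameProj (l x) (η x) (R x) (e₁ x) (e₂ x)) x₀ :=
    ((contDiffAt_const.sub (hl.smulRight hR)).sub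
      (c1.smulRight (h₁.sub ((hl.clm_apply h₁).smul hR)))).sub
      (c2.smulRight (h₂.sub ((hl.clm_apply h₂).smul hR)))
  exact ((hl.smulRight hl).add (hk.smul ((c1.smulRight c1).add (c2.smulRight c2)))).add
    (contDiff_pullMetric.contDiffAt.comp x₀ hP)

lemma ContDiffAt.bilinearComp {A : X → Euc d →L[ℝ] Euc d →L[ℝ] ℝ} {L L' : X → Euc d →L[ℝ] Euc d}
    (hA : ContDiffAt ℝ ∞ A x₀) (hL : ContDiffAt ℝ ∞ L x₀) (hL' : ContDiffAt ℝ ∞ L' x₀) :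
    ContDiffAt ℝ ∞ (fun x => (A x).bilinearComp (L x) (L' x)) x₀ := by
  have h1 : ContDiffAt ℝ ∞ (fun x => (ContinuousLinearMap.compL ℝ (Euc d) (Euc d) ℝ).flip (L' x))
      x₀ := contDiffAt_const.clm_apply hL'
  refine (h1.clm_comp (hA.clm_comp hL)).congr_of_eventuallyEq (Eventually.of_forall fun x => ?_)
  ext v w
  rfl

end ModelMetric

/-! ### The Reeb field in charts -/

section GlobalMetric

variable {n : ℕ} {M : Type*} [TopologicalSpace M] [ChartedSpace (Euc (2 * n + 1)) M]
  [IsManifold (𝓡 (2 * n + 1)) ∞ M]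

/-- The Reeb vector field in the preferred chart at `x₀`. -/
def chartReeb {d : ℕ} {M : Type*} [TopologicalSpace M] [ChartedSpace (Euc d) M]
    (lam : OneForm d M) (x₀ : M) (y : Euc d) : Euc d :=
  chartD x₀ ((extChartAt (𝓡 d) x₀).symm y) (reeb lam ((extChartAt (𝓡 d) x₀).symm y))

lemma chartBilin_reebForm {d : ℕ} {M : Type*} [TopologicalSpace M] [ChartedSpace (Euc d) M]
    [IsManifold (𝓡 d) ∞ M] {lam : OneForm d M} (h : SmoothOneForm lam) {x₀ : M} {y : Euc d}
    (hy : y ∈ (extChartAt (𝓡 d) x₀).target) :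
    chartBilin (reebForm lam) x₀ y =
      (chartForm lam x₀ y).smulRight (chartForm lam x₀ y) + dform (chartForm lam x₀) y := by
  ext v w
  have h1 := h.extD_chartI hy v w
  have h2 : chartBilin (reebForm lam) x₀ y v w = reebForm lam ((extChartAt (𝓡 d) x₀).symm y)
    (chartI x₀ y v) (chartI x₀ y w) := rfl
  have h3 := reebForm_apply lam ((extChartAt (𝓡 d) x₀).symm y) (chartI x₀ y v) (chartI x₀ y w)
  rw [h2, h3, h1]
  rfl

section

variable {lam : OneForm (2 * n + 1) M} (h : IsContactForm lam) {x₀ : M} {y : Euc (2 * n + 1)}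
include h

lemma IsContactForm.chartForm_chartReeb (hy : y ∈ (extChartAt (𝓡 (2 * n + 1)) x₀).target) :
    chartForm lam x₀ y (chartReeb lam x₀ y) = 1 := by
  have h1 := chartI_comp_chartD ((extChartAt (𝓡 (2 * n + 1)) x₀).map_target hy)
    (reeb lam ((extChartAt (𝓡 (2 * n + 1)) x₀).symm y))
  rw [(extChartAt (𝓡 (2 * n + 1)) x₀).right_inv hy] at h1
  have h2 : chartForm lam x₀ y (chartReeb lam x₀ y) =
    lam ((extChartAt (𝓡 (2 * n + 1)) x₀).symm y) (chartI x₀ y (chartReeb lam x₀ y)) := rfl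
  rw [h2, chartReeb, h1]
  exact h.lam_reeb _

lemma IsContactForm.dform_chartReeb (hy : y ∈ (extChartAt (𝓡 (2 * n + 1)) x₀).target)
    (w : Euc (2 * n + 1)) : dform (chartForm lam x₀) y (chartReeb lam x₀ y) w = 0 := by
  have h1 := chartI_comp_chartD ((extChartAt (𝓡 (2 * n + 1)) x₀).map_target hy)
    (reeb lam ((extChartAt (𝓡 (2 * n + 1)) x₀).symm y))
  rw [(extChartAt (𝓡 (2 * n + 1)) x₀).right_inv hy] at h1
  rw [← h.1.extD_chartI hy, chartReeb, h1]
  exact h.extD_reeb _ _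

lemma IsContactForm.reebForm_nondegenerate {x : M} {v : Euc (2 * n + 1)}
    (hv : ∀ w : Euc (2 * n + 1), reebForm lam x w v = 0) : v = 0 := by
  have hs : extD lam x v v = 0 := by
    have := extD_swap lam x v v
    linarith
  have h0 : lam x v = 0 := by
    have := hv v
    rw [reebForm_apply lam x v v, hs, add_zero] at this
    exact mul_self_eq_zero.1 this
  refine h.nondegenerate (x := x) h0 fun w _ => ?_
  have := hv w
  rw [reebForm_apply lam x w v] at this
  erw [h0] at this
  rw [mul_zero, zero_add] at this
  exact (extD_swap lam x v w).trans (neg_eq_zero.2 this)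

lemma IsContactForm.chartBilin_nondegenerate (hy : y ∈ (extChartAt (𝓡 (2 * n + 1)) x₀).target)
    {v : Euc (2 * n + 1)} (hv : ∀ w, chartBilin (reebForm lam) x₀ y w v = 0) : v = 0 := by
  have h1 : chartI x₀ y v = 0 := by
    refine h.reebForm_nondegenerate (x := (extChartAt (𝓡 (2 * n + 1)) x₀).symm y) fun w => ?_
    have h2 := hv (chartD x₀ ((extChartAt (𝓡 (2 * n + 1)) x₀).symm y) w)
    have h3 := chartI_comp_chartD ((extChartAt (𝓡 (2 * n + 1)) x₀).map_target hy) w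
    rw [(extChartAt (𝓡 (2 * n + 1)) x₀).right_inv hy] at h3
    have h4 : chartBilin (reebForm lam) x₀ y
      (chartD x₀ ((extChartAt (𝓡 (2 * n + 1)) x₀).symm y) w) v =
      reebForm lam ((extChartAt (𝓡 (2 * n + 1)) x₀).symm y)
        (chartI x₀ y (chartD x₀ ((extChartAt (𝓡 (2 * n + 1)) x₀).symm y) w)) (chartI x₀ y v) := rfl
    rw [h4, h3] at h2
    exact h2
  rw [← chartD_comp_chartI hy v, h1, map_zero]

omit h in
lemma SmoothOneForm.contDiffAt_chartBilin {d : ℕ} {M : Type*} [TopologicalSpace M]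
    [ChartedSpace (Euc d) M] [IsManifold (𝓡 d) ∞ M] {lam : OneForm d M} (h : SmoothOneForm lam)
    {x₀ : M} {y : Euc d} (hy : y ∈ (extChartAt (𝓡 d) x₀).target) :
    ContDiffAt ℝ ∞ (chartBilin (reebForm lam) x₀) y := by
  have ht := (isOpen_extChartAt_target (I := 𝓡 d) x₀).mem_nhds hy
  have h1 : ContDiffAt ℝ ∞ (chartForm lam x₀) y := (h.contDiffOn_chartForm x₀).contDiffAt ht
  refine ((h1.smulRight h1).add h1.dform).congr_of_eventuallyEq ?_
  filter_upwards [ht] with z hz using chartBilin_reebForm h hz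

/-- The Reeb field solves a linear equation with smooth coefficients: it represents λ through the
nondegenerate form λ ⊗ λ + dλ. Inversion of operators is smooth. -/
lemma IsContactForm.contDiffAt_chartReeb (hy : y ∈ (extChartAt (𝓡 (2 * n + 1)) x₀).target) :
    ContDiffAt ℝ ∞ (chartReeb lam x₀) y := by
  have ht := (isOpen_extChartAt_target (I := 𝓡 (2 * n + 1)) x₀).mem_nhds hy
  have h1 : ContDiffAt ℝ ∞ (chartForm lam x₀) y := (h.1.contDiffOn_chartForm x₀).contDiffAt ht
  have hB := h.1.contDiffAt_chartBilin hy
  have hb : ContDiffAt ℝ ∞ (fun z => bilinOp (chartBilin (reebForm lam) x₀ z)) y :=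
    contDiff_bilinOp.contDiffAt.comp y hB
  have hbi : ContDiffAt ℝ ∞ (fun z => Ring.inverse (bilinOp (chartBilin (reebForm lam) x₀ z))) y := by
    obtain ⟨u, hu⟩ := isUnit_bilinOp fun v => h.chartBilin_nondegenerate (v := v) hy
    have h2 : ContDiffAt ℝ ∞ Ring.inverse (bilinOp (chartBilin (reebForm lam) x₀ y)) :=
      hu ▸ contDiffAt_ringInverse ℝ u
    exact ContDiffAt.comp y h2 hb
  refine (hbi.clm_apply (contDiff_formVec.contDiffAt.comp y h1)).congr_of_eventuallyEq ?_
  filter_upwards [ht] with z hz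
  have hu := isUnit_bilinOp fun v => h.chartBilin_nondegenerate (v := v) hz
  have h3 : bilinOp (chartBilin (reebForm lam) x₀ z) (chartReeb lam x₀ z) =
      formVec (chartForm lam x₀ z) := by
    refine ext_inner_left ℝ fun v => ?_
    rw [inner_bilinOp, inner_formVec, chartBilin_reebForm h.1 hz]
    have h4 := h.dform_chartReeb hz v
    rw [dform_swap, neg_eq_zero] at h4
    change chartForm lam x₀ z v * chartForm lam x₀ z (chartReeb lam x₀ z) +
      dform (chartForm lam x₀) z v (chartReeb lam x₀ z) = _
    rw [h4, h.chartForm_chartReeb hz, mul_one, add_zero]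
  rw [Function.comp_apply, ← h3]
  exact (congrArg (fun A : Euc (2 * n + 1) →L[ℝ] Euc (2 * n + 1) => A (chartReeb lam x₀ z))
    (Ring.inverse_mul_cancel _ hu)).symm

end

end GlobalMetric

/-! ### Compatible complex structures with prescribed values -/

section GlobalJ

variable {n : ℕ} {M : Type*} [TopologicalSpace M] [ChartedSpace (Euc (2 * n + 1)) M]
  [IsManifold (𝓡 (2 * n + 1)) ∞ M]

/-- Near `x₀`, the prescribed pairs `(a, b)` with `J a = b` lie in a plane field with a frame, and
`b` is obtained from `a` by the rotation given by this frame. -/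
def HasAdaptedFrame (lam : OneForm (2 * n + 1) M)
    (C : M → Set (Euc (2 * n + 1) × Euc (2 * n + 1))) (x₀ : M) : Prop :=
  (∀ᶠ x in 𝓝 x₀, C x = ∅) ∨ ∃ e₁ e₂ : Euc (2 * n + 1) → Euc (2 * n + 1),
    0 < dform (chartForm lam x₀) (extChartAt (𝓡 (2 * n + 1)) x₀ x₀)
      (e₁ (extChartAt (𝓡 (2 * n + 1)) x₀ x₀)) (e₂ (extChartAt (𝓡 (2 * n + 1)) x₀ x₀)) ∧
    ∀ᶠ y in 𝓝 (extChartAt (𝓡 (2 * n + 1)) x₀ x₀), ContDiffAt ℝ ∞ e₁ y ∧ ContDiffAt ℝ ∞ e₂ y ∧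
      ∀ p ∈ C ((extChartAt (𝓡 (2 * n + 1)) x₀).symm y),
        lam ((extChartAt (𝓡 (2 * n + 1)) x₀).symm y) p.1 = 0 ∧
        lam ((extChartAt (𝓡 (2 * n + 1)) x₀).symm y) p.2 = 0 ∧
        ∃ c₁ c₂ : ℝ, p.1 = chartI x₀ y (c₁ • e₁ y + c₂ • e₂ y) ∧
          p.2 = chartI x₀ y (c₁ • e₂ y - c₂ • e₁ y)

/-- The conditions on a metric at a point under which the associated complex structure has the
prescribed values. -/
def metricCond (lam : OneForm (2 * n + 1) M)
    (C : M → Set (Euc (2 * n + 1) × Euc (2 * n + 1))) (x : M) :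
    Set (Euc (2 * n + 1) →L[ℝ] Euc (2 * n + 1) →L[ℝ] ℝ) :=
  {g | IsInnerForm g ∧ (∀ w : Euc (2 * n + 1), g (reeb lam x) w = lam x w) ∧
    ∀ p ∈ C x, ∀ w : Euc (2 * n + 1), g w p.1 = reebForm lam x w p.2 ∧
      g w p.2 = -reebForm lam x w p.1}

-- Apart from positivity, which is a convex condition, everything asked of the metric is affine in
-- it. So local metrics can be glued by a partition of unity, whereas complex structures could not
-- be averaged.
omit [IsManifold (𝓡 (2 * n + 1)) ∞ M] in
lemma convex_metricCond (lam : OneForm (2 * n + 1) M)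
    (C : M → Set (Euc (2 * n + 1) × Euc (2 * n + 1))) (x : M) : Convex ℝ (metricCond lam C x) := by
  rintro g ⟨⟨g1, g2⟩, g3, g4⟩ g' ⟨⟨h1, h2⟩, h3, h4⟩ a b ha hb hab
  have e : ∀ v w, (a • g + b • g') v w = a * g v w + b * g' v w := fun v w => rfl
  refine ⟨⟨fun v w => by rw [e, e, g1, h1], fun v hv => ?_⟩, fun w => ?_, fun p hp w => ⟨?_, ?_⟩⟩
  · rw [e]
    have := g2 v hv
    have := h2 v hv
    rcases ha.eq_or_lt with rfl | ha
    · have : b = 1 := by linarith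
      subst this
      linarith
    · have := mul_pos ha (g2 v hv)
      have := mul_nonneg hb (h2 v hv).le
      linarith
  · refine (e _ _).trans ?_
    rw [g3, h3, ← add_mul, hab, one_mul]
  · refine (e _ _).trans ?_
    rw [(g4 p hp w).1, (h4 p hp w).1, ← add_mul, hab, one_mul]
  · refine (e _ _).trans ?_
    rw [(g4 p hp w).2, (h4 p hp w).2, ← add_mul, hab, one_mul]

lemma IsInnerForm.bilinearComp {E F : Type*} [NormedAddCommGroup E] [NormedSpace ℝ E]
    [NormedAddCommGroup F] [NormedSpace ℝ F] {g : E →L[ℝ] E →L[ℝ] ℝ} (hg : IsInnerForm g)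
    {L : F →L[ℝ] E} (hL : ∀ v, L v = 0 → v = 0) : IsInnerForm (g.bilinearComp L L) :=
  ⟨fun _ _ => hg.1 _ _, fun v hv => hg.2 _ fun h => hv (hL v h)⟩

section

variable {lam : OneForm (2 * n + 1) M} (h : IsContactForm lam) {x₀ : M} {y : Euc (2 * n + 1)}

omit [IsManifold (𝓡 (2 * n + 1)) ∞ M] in
lemma chartI_comp_chartD' [IsManifold (𝓡 (2 * n + 1)) ∞ M]
    (hy : y ∈ (extChartAt (𝓡 (2 * n + 1)) x₀).target) (v : Euc (2 * n + 1)) :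
    chartI x₀ y (chartD x₀ ((extChartAt (𝓡 (2 * n + 1)) x₀).symm y) v) = v := by
  have h1 := chartI_comp_chartD ((extChartAt (𝓡 (2 * n + 1)) x₀).map_target hy) v
  rwa [(extChartAt (𝓡 (2 * n + 1)) x₀).right_inv hy] at h1

lemma chartForm_chartD (hy : y ∈ (extChartAt (𝓡 (2 * n + 1)) x₀).target) (v : Euc (2 * n + 1)) :
    chartForm lam x₀ y (chartD x₀ ((extChartAt (𝓡 (2 * n + 1)) x₀).symm y) v) =
      lam ((extChartAt (𝓡 (2 * n + 1)) x₀).symm y) v :=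
  congrArg (lam ((extChartAt (𝓡 (2 * n + 1)) x₀).symm y)) (chartI_comp_chartD' hy v)

lemma SmoothOneForm.dform_chartD (hs : SmoothOneForm lam)
    (hy : y ∈ (extChartAt (𝓡 (2 * n + 1)) x₀).target) (v w : Euc (2 * n + 1)) :
    dform (chartForm lam x₀) y (chartD x₀ ((extChartAt (𝓡 (2 * n + 1)) x₀).symm y) v)
      (chartD x₀ ((extChartAt (𝓡 (2 * n + 1)) x₀).symm y) w) =
      extD lam ((extChartAt (𝓡 (2 * n + 1)) x₀).symm y) v w := by
  rw [← hs.extD_chartI hy, chartI_comp_chartD' hy, chartI_comp_chartD' hy]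

include h in
lemma metric_mem_metricCond {C : M → Set (Euc (2 * n + 1) × Euc (2 * n + 1))}
    (hy : y ∈ (extChartAt (𝓡 (2 * n + 1)) x₀).target)
    {G : Euc (2 * n + 1) →L[ℝ] Euc (2 * n + 1) →L[ℝ] ℝ} (hG : IsInnerForm G)
    (hR : ∀ w, G (chartReeb lam x₀ y) w = chartForm lam x₀ y w)
    (hC : ∀ p ∈ C ((extChartAt (𝓡 (2 * n + 1)) x₀).symm y),
      lam ((extChartAt (𝓡 (2 * n + 1)) x₀).symm y) p.1 = 0 ∧
      lam ((extChartAt (𝓡 (2 * n + 1)) x₀).symm y) p.2 = 0 ∧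
      ∀ w, G w (chartD x₀ ((extChartAt (𝓡 (2 * n + 1)) x₀).symm y) p.1) =
        dform (chartForm lam x₀) y w (chartD x₀ ((extChartAt (𝓡 (2 * n + 1)) x₀).symm y) p.2) ∧
        G w (chartD x₀ ((extChartAt (𝓡 (2 * n + 1)) x₀).symm y) p.2) =
        -dform (chartForm lam x₀) y w
          (chartD x₀ ((extChartAt (𝓡 (2 * n + 1)) x₀).symm y) p.1)) :
    G.bilinearComp (chartD x₀ ((extChartAt (𝓡 (2 * n + 1)) x₀).symm y))
      (chartD x₀ ((extChartAt (𝓡 (2 * n + 1)) x₀).symm y)) ∈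
      metricCond lam C ((extChartAt (𝓡 (2 * n + 1)) x₀).symm y) := by
  refine ⟨hG.bilinearComp fun v hv => ?_, fun w => ?_, fun p hp w => ⟨?_, ?_⟩⟩
  · rw [← chartI_comp_chartD' hy v, hv, map_zero]
  · exact (hR _).trans (chartForm_chartD hy w)
  · obtain ⟨h1, h2, h3⟩ := hC p hp
    refine ((h3 _).1.trans (h.1.dform_chartD hy w p.2)).trans ?_
    refine Eq.trans ?_ (reebForm_apply lam _ w p.2).symm
    erw [h2]
    rw [mul_zero, zero_add]
  · obtain ⟨h1, h2, h3⟩ := hC p hp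
    refine ((h3 _).2.trans (congrArg _ (h.1.dform_chartD hy w p.1))).trans (congrArg _ ?_)
    refine Eq.trans ?_ (reebForm_apply lam _ w p.1).symm
    erw [h1]
    rw [mul_zero, zero_add]

end

/-- Where nothing is prescribed, any metric with R as unit normal of the kernel will do. Elsewhere
the frame metric turns the prescribed rotation into the required linear relations between g and dλ.
-/
lemma exists_chart_metric {lam : OneForm (2 * n + 1) M} (h : IsContactForm lam)
    {C : M → Set (Euc (2 * n + 1) × Euc (2 * n + 1))} {x₀ : M} (hC : HasAdaptedFrame lam C x₀) :
    ∃ G : Euc (2 * n + 1) → Euc (2 * n + 1) →L[ℝ] Euc (2 * n + 1) →L[ℝ] ℝ,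
      ∀ᶠ y in 𝓝 (extChartAt (𝓡 (2 * n + 1)) x₀ x₀), ContDiffAt ℝ ∞ G y ∧
        (G y).bilinearComp (chartD x₀ ((extChartAt (𝓡 (2 * n + 1)) x₀).symm y))
          (chartD x₀ ((extChartAt (𝓡 (2 * n + 1)) x₀).symm y)) ∈
          metricCond lam C ((extChartAt (𝓡 (2 * n + 1)) x₀).symm y) := by
  have ht : ∀ᶠ y in 𝓝 (extChartAt (𝓡 (2 * n + 1)) x₀ x₀),
    y ∈ (extChartAt (𝓡 (2 * n + 1)) x₀).target := extChartAt_target_mem_nhds x₀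
  have hl : ∀ y ∈ (extChartAt (𝓡 (2 * n + 1)) x₀).target, ContDiffAt ℝ ∞ (chartForm lam x₀) y :=
    fun y hy => (h.1.contDiffOn_chartForm x₀).contDiffAt
      ((isOpen_extChartAt_target x₀).mem_nhds hy)
  rcases hC with hC | ⟨e₁, e₂, hpos, hC⟩
  · refine ⟨fun y => plainMetric (chartForm lam x₀ y) (chartReeb lam x₀ y), ?_⟩
    have hC' : ∀ᶠ y in 𝓝 (extChartAt (𝓡 (2 * n + 1)) x₀ x₀),
        C ((extChartAt (𝓡 (2 * n + 1)) x₀).symm y) = ∅ := by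
      have := continuousAt_extChartAt_symm (I := 𝓡 (2 * n + 1)) x₀
      rw [ContinuousAt, extChartAt_to_inv] at this
      exact this.eventually hC
    filter_upwards [ht, hC'] with y hy hCy
    refine ⟨contDiffAt_plainMetric (hl y hy) (h.contDiffAt_chartReeb hy), ?_⟩
    refine metric_mem_metricCond h hy isInnerForm_plainMetric
      (plainMetric_reeb (h.chartForm_chartReeb hy)) fun p hp => ?_
    rw [hCy] at hp
    exact hp.elim
  · refine ⟨fun y => frameMetric (chartForm lam x₀ y) (dform (chartForm lam x₀) y)
      (chartReeb lam x₀ y) (e₁ y) (e₂ y), ?_⟩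
    have hd : ∀ y ∈ (extChartAt (𝓡 (2 * n + 1)) x₀).target,
      ContDiffAt ℝ ∞ (dform (chartForm lam x₀)) y := fun y hy => (hl y hy).dform
    have hpos' : ∀ᶠ y in 𝓝 (extChartAt (𝓡 (2 * n + 1)) x₀ x₀),
        0 < dform (chartForm lam x₀) y (e₁ y) (e₂ y) := by
      have h1 := (hd _ ht.self_of_nhds).clm_apply hC.self_of_nhds.1
      exact (h1.clm_apply hC.self_of_nhds.2.1).continuousAt.eventually (lt_mem_nhds hpos)
    filter_upwards [ht, hC, hpos'] with y hy hCy hp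
    refine ⟨contDiffAt_frameMetric (hl y hy) (hd y hy) (h.contDiffAt_chartReeb hy) hCy.1 hCy.2.1
      hp.ne', ?_⟩
    refine metric_mem_metricCond h hy (isInnerForm_frameMetric hp)
      (frameMetric_reeb (dform_swap _ _) (h.chartForm_chartReeb hy) (h.dform_chartReeb hy))
      fun p hpC => ?_
    obtain ⟨h1, h2, c₁, c₂, h3, h4⟩ := hCy.2.2 p hpC
    have h5 : chartD x₀ ((extChartAt (𝓡 (2 * n + 1)) x₀).symm y) p.1 = c₁ • e₁ y + c₂ • e₂ y := by
      rw [h3, chartD_comp_chartI hy]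
    have h6 : chartD x₀ ((extChartAt (𝓡 (2 * n + 1)) x₀).symm y) p.2 =
        (-c₂) • e₁ y + c₁ • e₂ y := by
      rw [h4, chartD_comp_chartI hy]
      module
    have h7 := chartForm_chartD (lam := lam) hy p.1
    have h8 := chartForm_chartD (lam := lam) hy p.2
    rw [h5, h1] at h7
    rw [h6, h2] at h8
    refine ⟨h1, h2, fun w => ⟨?_, ?_⟩⟩
    · rw [h5, h6, frameMetric_frame (dform_swap _ _) hp h7]
      congr 1
      module
    · rw [h5, h6, frameMetric_frame (dform_swap _ _) hp h8, ← map_neg]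
      congr 1
      module

lemma exists_local_metric {lam : OneForm (2 * n + 1) M} (h : IsContactForm lam)
    {C : M → Set (Euc (2 * n + 1) × Euc (2 * n + 1))} {x₀ : M} (hC : HasAdaptedFrame lam C x₀) :
    ∃ U ∈ 𝓝 x₀, ∃ g : TangentBilin (2 * n + 1) M,
      ContMDiffOn (𝓡 (2 * n + 1)) ((𝓡 (2 * n + 1)).prod
        𝓘(ℝ, Euc (2 * n + 1) →L[ℝ] Euc (2 * n + 1) →L[ℝ] ℝ)) ∞
      (fun x => TotalSpace.mk' (Euc (2 * n + 1) →L[ℝ] Euc (2 * n + 1) →L[ℝ] ℝ)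
        (E := fun x : M => TangentSpace (𝓡 (2 * n + 1)) x →L[ℝ] TangentSpace (𝓡 (2 * n + 1)) x →L[ℝ]
          Bundle.Trivial M ℝ x) x (g x)) U ∧ ∀ x ∈ U, g x ∈ metricCond lam C x := by
  obtain ⟨G, hG⟩ := exists_chart_metric h hC
  have hG' := (continuousAt_extChartAt (I := 𝓡 (2 * n + 1)) x₀).eventually hG
  let g : TangentBilin (2 * n + 1) M := fun x =>
    (G (extChartAt (𝓡 (2 * n + 1)) x₀ x)).bilinearComp (chartD x₀ x) (chartD x₀ x)
  refine ⟨_, inter_mem hG' (extChartAt_source_mem_nhds (I := 𝓡 (2 * n + 1)) x₀), g,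
    fun x₁ hx₁ => ?_, fun x hx => ?_⟩
  · refine ((contMDiffAt_bilin_iff g x₁).2 ?_).contMDiffWithinAt
    obtain ⟨⟨hx1, -⟩, hx2⟩ := hx₁
    rw [extChartAt_source] at hx2
    have hΨ : ContMDiffAt 𝓘(ℝ, Euc (2 * n + 1)) (𝓡 (2 * n + 1)) ∞
        (extChartAt (𝓡 (2 * n + 1)) x₁).symm (extChartAt (𝓡 (2 * n + 1)) x₁ x₁) :=
      (contMDiffOn_extChartAt_symm x₁).contMDiffAt (extChartAt_target_mem_nhds x₁)
    have hτ : ContDiffAt ℝ ∞ (extChartAt (𝓡 (2 * n + 1)) x₀ ∘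
        (extChartAt (𝓡 (2 * n + 1)) x₁).symm) (extChartAt (𝓡 (2 * n + 1)) x₁ x₁) := by
      rw [← contMDiffAt_iff_contDiffAt]
      refine ContMDiffAt.comp _ (contMDiffAt_extChartAt' ?_) hΨ
      rwa [extChartAt_to_inv]
    have hτ' := hτ.fderiv_right (m := ∞) (by simp)
    have hGτ : ContDiffAt ℝ ∞ (fun y => G (extChartAt (𝓡 (2 * n + 1)) x₀
        ((extChartAt (𝓡 (2 * n + 1)) x₁).symm y))) (extChartAt (𝓡 (2 * n + 1)) x₁ x₁) := by
      refine ContDiffAt.comp (g := G) _ ?_ hτ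
      rwa [extChartAt_to_inv]
    refine (hGτ.bilinearComp hτ' hτ').congr_of_eventuallyEq ?_
    have hsrc : ∀ᶠ y in 𝓝 (extChartAt (𝓡 (2 * n + 1)) x₁ x₁),
        (extChartAt (𝓡 (2 * n + 1)) x₁).symm y ∈ (chartAt (Euc (2 * n + 1)) x₀).source := by
      refine hΨ.continuousAt.eventually ((chartAt (Euc (2 * n + 1)) x₀).open_source.mem_nhds ?_)
      rwa [extChartAt_to_inv]
    filter_upwards [hsrc, extChartAt_target_mem_nhds (I := 𝓡 (2 * n + 1)) x₁] with y hy1 hy2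
    have hmd : MDifferentiableAt 𝓘(ℝ, Euc (2 * n + 1)) (𝓡 (2 * n + 1))
        (extChartAt (𝓡 (2 * n + 1)) x₁).symm y :=
      ((contMDiffOn_extChartAt_symm (n := ∞) x₁).contMDiffAt
        ((isOpen_extChartAt_target x₁).mem_nhds hy2)).mdifferentiableAt (by simp)
    have hf := fderiv_chart_comp hmd hy1
    ext v w
    rw [ContinuousLinearMap.bilinearComp_apply, hf, hf]
    rfl
  · obtain ⟨⟨-, h1⟩, h2⟩ := hx
    rw [(extChartAt (𝓡 (2 * n + 1)) x₀).left_inv h2] at h1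
    exact h1

set_option maxHeartbeats 1600000 in
theorem exists_metric [T2Space M] [SigmaCompactSpace M] {lam : OneForm (2 * n + 1) M}
    (h : IsContactForm lam)
    {C : M → Set (Euc (2 * n + 1) × Euc (2 * n + 1))} (hC : ∀ x, HasAdaptedFrame lam C x) :
    ∃ g : TangentBilin (2 * n + 1) M, (∀ x₀, ContDiffAt ℝ ∞ (chartBilin g x₀)
      (extChartAt (𝓡 (2 * n + 1)) x₀ x₀)) ∧ ∀ x, g x ∈ metricCond lam C x := by
  have hconv : ∀ x, Convex ℝ (show Set (TangentSpace (𝓡 (2 * n + 1)) x →L[ℝ]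
      TangentSpace (𝓡 (2 * n + 1)) x →L[ℝ] Bundle.Trivial M ℝ x) from metricCond lam C x) :=
    fun x g hg g' hg' a b ha hb hab => convex_metricCond lam C x hg hg' ha hb hab
  obtain ⟨s, hs⟩ := exists_contMDiffSection_forall_mem_convex_of_local (n := (⊤ : ℕ∞))
    (F_fiber := Euc (2 * n + 1) →L[ℝ] Euc (2 * n + 1) →L[ℝ] ℝ) (𝓡 (2 * n + 1))
    (fun x : M => TangentSpace (𝓡 (2 * n + 1)) x →L[ℝ] TangentSpace (𝓡 (2 * n + 1)) x →L[ℝ]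
          Bundle.Trivial M ℝ x) _ hconv
    (fun x₀ => by
      obtain ⟨U, hU, g, h1, h2⟩ := exists_local_metric h (hC x₀)
      exact ⟨U, hU, g, h1, h2⟩)
  exact ⟨fun x => s x, fun x₀ => (contMDiffAt_bilin_iff _ x₀).1 (s.contMDiff x₀), hs⟩

/-- A contact form has a compatible complex structure with prescribed values, as soon as it has one
locally. -/
theorem IsContactForm.exists_isCompatible [T2Space M] [SigmaCompactSpace M]
    {lam : OneForm (2 * n + 1) M} (h : IsContactForm lam)
    {C : M → Set (Euc (2 * n + 1) × Euc (2 * n + 1))} (hC : ∀ x, HasAdaptedFrame lam C x)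
    (hC0 : ∀ x, ∀ p ∈ C x, lam x p.1 = 0 ∧ lam x p.2 = 0) :
    ∃ J : TangentEnd (2 * n + 1) M, IsCompatible lam J ∧ ∀ x, ∀ p ∈ C x, J x p.1 = p.2 := by
  obtain ⟨g, hgs, hg⟩ := exists_metric h hC
  have hnd : ∀ (x : M) (v : Euc (2 * n + 1)), (∀ w : Euc (2 * n + 1), reebForm lam x w v = 0) →
    v = 0 := fun x v hv => h.reebForm_nondegenerate hv
  have hQ : ∀ x, ∃ Q : Euc (2 * n + 1) →L[ℝ] Euc (2 * n + 1), IsPolar (g x) (reebForm lam x) Q :=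
    fun x => exists_isPolar (hg x).1 (hnd x)
  -- A pointwise choice is enough: polar isometries are unique, and `contDiffAt_of_isPolar` gives
  -- smoothness afterwards.
  choose J hJ using hQ
  have had : ∀ x, IsAdaptedForm (lam x) (dform (chartForm lam x) (extChartAt (𝓡 (2 * n + 1)) x x))
      (reeb lam x) (g x) (reebForm lam x) := fun x =>
    ⟨(hg x).1, fun v w => dform_swap _ _ v w, h.lam_reeb x,
      fun w => (extD_eq_dform lam x (reeb lam x) w).symm.trans (h.extD_reeb x w), (hg x).2.1,
      fun v w => rfl, hnd x⟩
  have hker : ∀ x v, lam x v = 0 → lam x (J x v) = 0 := fun x v hv => (had x).apply_polar (hJ x) hv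
  have hB : ∀ x v w, lam x v = 0 → extD lam x v w = reebForm lam x v w := fun x v w hv => by
    rw [reebForm_apply, hv, zero_mul, zero_add]
  refine ⟨J, ⟨fun x₀ => (contMDiffAt_end_iff J x₀).2 ?_, hker, fun x v hv => ?_,
    fun x v w hv hw => ?_, fun x v hv h0 => ?_⟩, fun x p hp => ?_⟩
  · have ht : ∀ᶠ y in 𝓝 (extChartAt (𝓡 (2 * n + 1)) x₀ x₀),
      y ∈ (extChartAt (𝓡 (2 * n + 1)) x₀).target := extChartAt_target_mem_nhds x₀
    refine contDiffAt_of_isPolar (hgs x₀) (h.1.contDiffAt_chartBilin ht.self_of_nhds) ?_ ?_ ?_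
    · filter_upwards [ht] with y hy
      refine IsInnerForm.bilinearComp (hg _).1 fun v hv => ?_
      rw [← chartD_comp_chartI hy v, hv, map_zero]
    · filter_upwards [ht] with y hy v hv using h.chartBilin_nondegenerate hy hv
    · filter_upwards [ht] with y hy
      exact (hJ _).conj (chartD_comp_chartI hy) (chartI_comp_chartD' hy)
  · exact (had x).comp_self_of_ker (hJ x) hv
  · rw [hB x v _ hv, hB x w _ hw]
    exact (hJ x).symm v w
  · rw [hB x v _ hv]
    exact (hJ x).pos v h0
  · exact (had x).polar_eq (hJ x) (hC0 x p hp).1 (hC0 x p hp).2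
      (fun w => ((hg x).2.2 p hp w).1) (fun w => ((hg x).2.2 p hp w).2)

end GlobalJ

/-- The standard contact form `dz + x dy - y dx` on `ℂ × ℝ`. -/
def stdForm (p : ℂ × ℝ) : ℂ × ℝ →L[ℝ] ℝ :=
  ContinuousLinearMap.snd ℝ ℂ ℝ + (p.1.re • Complex.imCLM - p.1.im • Complex.reCLM).comp
    (ContinuousLinearMap.fst ℝ ℂ ℝ)

lemma stdForm_apply (p v : ℂ × ℝ) : stdForm p v = v.2 + (p.1.re * v.1.im - p.1.im * v.1.re) := rfl

lemma exists_contDiff_eventuallyEq {E F : Type*} [NormedAddCommGroup E] [NormedSpace ℝ E]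
    [FiniteDimensional ℝ E] [NormedAddCommGroup F] [NormedSpace ℝ F] {f : E → F} {x₀ : E}
    (hf : ∀ᶠ x in 𝓝 x₀, ContDiffAt ℝ ∞ f x) : ∃ g : E → F, ContDiff ℝ ∞ g ∧ g =ᶠ[𝓝 x₀] f := by
  obtain ⟨r, hr, hrf⟩ := Metric.eventually_nhds_iff_ball.1 hf
  let χ : ContDiffBump x₀ := ⟨r / 4, r / 2, by positivity, by linarith⟩
  refine ⟨fun x => χ x • f x, contDiff_iff_contDiffAt.2 fun x => ?_, ?_⟩
  · by_cases hx : x ∈ Metric.ball x₀ r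
    · exact χ.contDiff.contDiffAt.smul (hrf x hx)
    · have h0 : (fun x => χ x • f x) =ᶠ[𝓝 x] fun _ => 0 := by
        have : x ∉ tsupport χ := by
          rw [χ.tsupport_eq]
          intro h
          exact hx (Metric.closedBall_subset_ball (by linarith : r / 2 < r) h)
        filter_upwards [notMem_tsupport_iff_eventuallyEq.1 this] with y hy
        rw [hy, Pi.zero_apply, zero_smul]
      exact contDiffAt_const.congr_of_eventuallyEq h0
  · filter_upwards [χ.eventuallyEq_one] with x hx
    rw [hx, Pi.one_apply, one_smul]

/-! ### Conformal normal form of a contact form on a three-dimensional slice -/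

section Slice

variable {E : Type} [NormedAddCommGroup E] [NormedSpace ℝ E] [FiniteDimensional ℝ E]

/-- Near a contact point, a `1`-form has a flow box with three parameters, the first of which
moves in its kernel. -/
lemma exists_flow_slice {η : E → E →L[ℝ] ℝ} {y₀ a b c : E}
    (hη : ∀ᶠ y in 𝓝 y₀, ContDiffAt ℝ ∞ η y) (ha : η y₀ a = 0) (hc : η y₀ c = 1) :
    ∃ G : ℝ × ℝ × ℝ → E, G 0 = y₀ ∧ fderiv ℝ G 0 (1, 0, 0) = a ∧ fderiv ℝ G 0 (0, 1, 0) = b ∧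
      fderiv ℝ G 0 (0, 0, 1) = c ∧ ∀ᶠ x in 𝓝 0, ContDiffAt ℝ ∞ G x ∧
        η (G x) (fderiv ℝ G x (1, 0, 0)) = 0 := by
  have hce : ∀ᶠ y in 𝓝 y₀, η y c ≠ 0 := by
    have h1 : ContinuousAt (fun y => η y c) y₀ :=
      (hη.self_of_nhds.continuousAt).clm_apply continuousAt_const
    exact h1.eventually (isOpen_ne.mem_nhds (by simp [hc]))
  -- The constant field a, projected to ker η along c. Only its germ at y₀ matters, so it may be
  -- replaced by a globally defined smooth field.
  obtain ⟨V, hV, hVe⟩ := exists_contDiff_eventuallyEq (f := fun y => a - (η y a / η y c) • c)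
    (x₀ := y₀) (by
      filter_upwards [hη, hce] with y h1 h2
      exact contDiffAt_const.sub (((h1.clm_apply contDiffAt_const).div
        (h1.clm_apply contDiffAt_const) h2).smul contDiffAt_const))
  obtain ⟨δ, hδ, Fl, hFl, hFl0, hFld⟩ := exists_smooth_flow V hV y₀
  let L : ℝ × ℝ × ℝ → ℝ × E := fun x => (x.1, y₀ + x.2.1 • b + x.2.2 • c)
  have hL : ContDiff ℝ ∞ L := by fun_prop
  have hL0 : L 0 = (0, y₀) := by simp [L]
  have hLb : ∀ᶠ x in 𝓝 0, L x ∈ Metric.ball ((0 : ℝ), y₀) δ := by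
    have h1 : ContinuousAt L 0 := hL.continuous.continuousAt
    exact h1.eventually (by rw [hL0]; exact Metric.ball_mem_nhds _ hδ)
  have hG : ∀ᶠ x in 𝓝 0, ContDiffAt ℝ ∞ (Fl ∘ L) x := by
    filter_upwards [hLb] with x hx
    exact (hFl.contDiffAt (Metric.isOpen_ball.mem_nhds hx)).comp x hL.contDiffAt
  have hG0 : (Fl ∘ L) 0 = y₀ := by rw [Function.comp_apply, hL0, hFl0 _ (Metric.mem_ball_self hδ)]
  have hGs : ∀ᶠ x in 𝓝 0, fderiv ℝ (Fl ∘ L) x (1, 0, 0) = V ((Fl ∘ L) x) := by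
    filter_upwards [hLb, hG] with x hx hGx
    have h1 : HasDerivAt (fun s : ℝ => x + s • ((1 : ℝ), (0 : ℝ), (0 : ℝ)))
        ((1 : ℝ), (0 : ℝ), (0 : ℝ)) 0 := by
      simpa using ((hasDerivAt_id (0 : ℝ)).smul_const ((1 : ℝ), (0 : ℝ), (0 : ℝ))).const_add x
    have h2 : HasFDerivAt (Fl ∘ L) (fderiv ℝ (Fl ∘ L) x)
        (x + (0 : ℝ) • ((1 : ℝ), (0 : ℝ), (0 : ℝ))) := by
      simpa using (hGx.differentiableAt (by simp)).hasFDerivAt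
    have h3 := h2.comp_hasDerivAt (0 : ℝ) h1
    rw [← ball_prod_same] at hx
    have h4 : HasDerivAt (fun s => Fl (s, (L x).2)) (V (Fl (L x))) (L x).1 :=
      hFld _ hx.2 _ hx.1
    have h5 : HasDerivAt (fun s : ℝ => x.1 + s) 1 0 := by
      simpa using (hasDerivAt_id (0 : ℝ)).const_add x.1
    have h6 := HasDerivAt.scomp (0 : ℝ) (g₁ := fun s => Fl (s, (L x).2)) (h := fun s : ℝ => x.1 + s)
      (by simpa using h4) h5
    have h7 : (fun s : ℝ => Fl (s, (L x).2)) ∘ (fun s : ℝ => x.1 + s) =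
        (Fl ∘ L) ∘ fun s : ℝ => x + s • ((1 : ℝ), (0 : ℝ), (0 : ℝ)) := by
      ext1 s
      simp [L]
    rw [h7, one_smul] at h6
    exact h3.unique h6
  have hyz : ∀ β γ : ℝ, fderiv ℝ (Fl ∘ L) 0 (0, β, γ) = β • b + γ • c := by
    intro β γ
    have h1 : HasDerivAt (fun s : ℝ => s • ((0 : ℝ), β, γ)) ((0 : ℝ), β, γ) 0 := by
      simpa using ((hasDerivAt_id (0 : ℝ)).smul_const ((0 : ℝ), β, γ))
    have h2 : HasFDerivAt (Fl ∘ L) (fderiv ℝ (Fl ∘ L) 0) ((0 : ℝ) • ((0 : ℝ), β, γ)) := by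
      rw [zero_smul]
      exact (hG.self_of_nhds.differentiableAt (by simp)).hasFDerivAt
    have h3 := h2.comp_hasDerivAt (0 : ℝ) h1
    have h4 : HasDerivAt (fun s : ℝ => y₀ + s • (β • b + γ • c)) (β • b + γ • c) 0 := by
      simpa using ((hasDerivAt_id (0 : ℝ)).smul_const (β • b + γ • c)).const_add y₀
    have h5 : HasDerivAt ((Fl ∘ L) ∘ fun s : ℝ => s • ((0 : ℝ), β, γ)) (β • b + γ • c) 0 := by
      refine h4.congr_of_eventuallyEq ?_
      have : ∀ᶠ s : ℝ in 𝓝 0, y₀ + s • (β • b + γ • c) ∈ Metric.ball y₀ δ := by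
        refine h4.continuousAt.eventually (Metric.isOpen_ball.mem_nhds ?_)
        simpa using hδ
      filter_upwards [this] with s hs
      have : L (s • ((0 : ℝ), β, γ)) = (0, y₀ + s • (β • b + γ • c)) := by
        simp [L, smul_smul, add_assoc]
      rw [Function.comp_apply, Function.comp_apply, this, hFl0 _ hs]
    exact h3.unique h5
  refine ⟨Fl ∘ L, hG0, ?_, by simp [hyz], by simp [hyz], ?_⟩
  · rw [hGs.self_of_nhds, hG0, hVe.self_of_nhds]
    simp [ha]
  · have hcont : ContinuousAt (Fl ∘ L) 0 := hG.self_of_nhds.continuousAt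
    rw [ContinuousAt, hG0] at hcont
    filter_upwards [hG, hGs, hcont.eventually (hVe.and hce)] with x h1 h2 h3
    refine ⟨h1, ?_⟩
    rw [h2, h3.1, map_sub, map_smul, smul_eq_mul, div_mul_cancel₀ _ h3.2, sub_self]

/-- A contact form is a multiple of the standard contact form in suitable coordinates on a
three-dimensional slice. -/
lemma exists_contact_slice {η : E → E →L[ℝ] ℝ} {y₀ a b c : E}
    (hη : ∀ᶠ y in 𝓝 y₀, ContDiffAt ℝ ∞ η y) (ha : η y₀ a = 0) (hb : η y₀ b = 0)
    (hc : η y₀ c = 1) (hab : dform η y₀ a b ≠ 0) :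
    ∃ ψ : ℂ × ℝ → E, ψ 0 = y₀ ∧ Function.Injective (fderiv ℝ ψ 0) ∧
      ∀ᶠ p in 𝓝 0, ContDiffAt ℝ ∞ ψ p ∧ ∃ m > 0, ∀ v, η (ψ p) (fderiv ℝ ψ p v) =
        m * stdForm p v := by
  obtain ⟨G, hG0, hGa, hGb, hGc, hG⟩ := exists_flow_slice (b := b) hη ha hc
  let X := ℝ × ℝ × ℝ
  have hGt : Tendsto G (𝓝 0) (𝓝 y₀) := by
    have := hG.self_of_nhds.1.continuousAt
    rwa [ContinuousAt, hG0] at this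
  let ζ : X → X →L[ℝ] ℝ := fun x => (η (G x)).comp (fderiv ℝ G x)
  have hζs : ∀ᶠ x in 𝓝 0, ContDiffAt ℝ ∞ ζ x := by
    filter_upwards [hG, hGt.eventually hη] with x h1 h2
    exact (ContDiffAt.comp (g := η) x (show ContDiffAt ℝ ∞ η (G x) from h2) h1.1).clm_comp (h1.1.fderiv_right (m := ∞) (by simp))
  let A : X → ℝ := fun x => ζ x (0, 1, 0)
  let B : X → ℝ := fun x => ζ x (0, 0, 1)
  have hA0 : A 0 = 0 := by
    change η (G 0) (fderiv ℝ G 0 (0, 1, 0)) = 0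
    rw [hGb, hG0, hb]
  have hB0 : B 0 = 1 := by
    change η (G 0) (fderiv ℝ G 0 (0, 0, 1)) = 1
    rw [hGc, hG0, hc]
  have hAs : ∀ᶠ x in 𝓝 0, ContDiffAt ℝ ∞ A x := by
    filter_upwards [hζs] with x h using h.clm_apply contDiffAt_const
  have hBs : ∀ᶠ x in 𝓝 0, ContDiffAt ℝ ∞ B x := by
    filter_upwards [hζs] with x h using h.clm_apply contDiffAt_const
  have hBp : ∀ᶠ x in 𝓝 0, 0 < B x :=
    hBs.self_of_nhds.continuousAt.eventually (lt_mem_nhds (by rw [hB0]; exact one_pos))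
  -- The contact condition enters here. The pulled back form vanishes on the first coordinate field,
  -- so dη(a, b) is just the derivative of A in that direction.
  have hA' : fderiv ℝ A 0 (1, 0, 0) ≠ 0 := by
    have h1 := dform_comp (g := G) (η := η) (y := (0 : X)) hG.self_of_nhds.1
      (by rw [hG0]; exact hη.self_of_nhds.differentiableAt (by simp)) (1, 0, 0) (0, 1, 0)
    rw [hGa, hGb, hG0] at h1
    have hd : DifferentiableAt ℝ ζ 0 := hζs.self_of_nhds.differentiableAt (by simp)
    have h2 : ∀ u w, fderiv ℝ ζ 0 u w = fderiv ℝ (fun x => ζ x w) 0 u := by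
      intro u w
      rw [fderiv_clm_apply hd (differentiableAt_const w)]
      simp
    have h3 : fderiv ℝ (fun x => ζ x (1, 0, 0)) 0 = 0 := by
      have : (fun x => ζ x (1, 0, 0)) =ᶠ[𝓝 0] fun _ => (0 : ℝ) := by
        filter_upwards [hG] with x hx using hx.2
      rw [this.fderiv_eq, fderiv_const_apply]
    have h4 : dform ζ 0 (1, 0, 0) (0, 1, 0) = dform η y₀ a b := h1
    rw [dform_apply, h2, h2, h3] at h4
    intro h5
    apply hab
    rw [← h4]
    change fderiv ℝ A 0 (1, 0, 0) - 0 = 0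
    rw [h5, sub_zero]
  -- In the flow box the form is A dy + B dz = B (dz + 2 ξ dy). In the coordinates (ξ + i y, z + ξ
  -- y) the standard form is d(z + ξ y) + ξ dy - y dξ = dz + 2 ξ dy.
  let ξ : X → ℝ := fun x => A x / (2 * B x)
  have hξs : ∀ᶠ x in 𝓝 0, ContDiffAt ℝ ∞ ξ x := by
    filter_upwards [hAs, hBs, hBp] with x h1 h2 h3
    exact h1.div (contDiffAt_const.mul h2) (by positivity)
  have hξ0 : ξ 0 = 0 := by simp [ξ, hA0]
  have hξ' : fderiv ℝ ξ 0 (1, 0, 0) ≠ 0 := by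
    have h1 : A =ᶠ[𝓝 0] fun x => ξ x * (2 * B x) := by
      filter_upwards [hBp] with x hx
      simp only [ξ]
      field_simp
    have h2 : DifferentiableAt ℝ ξ 0 := hξs.self_of_nhds.differentiableAt (by simp)
    have h3 : DifferentiableAt ℝ B 0 := hBs.self_of_nhds.differentiableAt (by simp)
    intro h0
    apply hA'
    rw [h1.fderiv_eq, fderiv_fun_mul h2 (h3.const_mul 2), hξ0, zero_smul, zero_add, smul_apply, h0,
      smul_zero]
  let H : X → ℂ × ℝ := fun x => ((ξ x : ℂ) + x.2.1 * Complex.I, x.2.2 + ξ x * x.2.1)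
  have hHd : ∀ x, DifferentiableAt ℝ ξ x → ∃ D : X →L[ℝ] ℂ × ℝ, HasFDerivAt H D x ∧ ∀ u, D u =
      ((fderiv ℝ ξ x u : ℂ) + u.2.1 * Complex.I, u.2.2 + (ξ x * u.2.1 + x.2.1 * fderiv ℝ ξ x u)) := by
    intro x hx
    let py : X →L[ℝ] ℝ := (ContinuousLinearMap.fst ℝ ℝ ℝ).comp (ContinuousLinearMap.snd ℝ ℝ (ℝ × ℝ))
    let pz : X →L[ℝ] ℝ := (ContinuousLinearMap.snd ℝ ℝ ℝ).comp (ContinuousLinearMap.snd ℝ ℝ (ℝ × ℝ))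
    have h1 : HasFDerivAt (fun x => (ξ x : ℂ)) (Complex.ofRealCLM.comp (fderiv ℝ ξ x)) x :=
      Complex.ofRealCLM.hasFDerivAt.comp x hx.hasFDerivAt
    have h2 : HasFDerivAt (fun x : X => (x.2.1 : ℂ) * Complex.I)
        ((Complex.ofRealCLM.comp py).smulRight Complex.I) x :=
      ((Complex.ofRealCLM.comp py).smulRight Complex.I).hasFDerivAt
    have h3 : HasFDerivAt (fun x : X => x.2.2 + ξ x * x.2.1)
        (pz + (ξ x • py + x.2.1 • fderiv ℝ ξ x)) x :=
      pz.hasFDerivAt.add (hx.hasFDerivAt.mul py.hasFDerivAt)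
    exact ⟨_, (h1.add h2).prodMk h3, fun u => rfl⟩
  obtain ⟨U, hU, hUo, hU0⟩ := eventually_nhds_iff.1 hξs
  have hHs : ContDiffOn ℝ ∞ H U := by
    intro x hx
    have h1 := hU x hx
    have h2 : ContDiffAt ℝ ∞ (fun x => (ξ x : ℂ)) x := Complex.ofRealCLM.contDiff.contDiffAt.comp x h1
    have h3 : ContDiff ℝ ∞ fun x : X => (x.2.1 : ℂ) * Complex.I :=
      (Complex.ofRealCLM.contDiff.comp (contDiff_fst.comp contDiff_snd)).mul contDiff_const
    have h4 : ContDiff ℝ ∞ fun x : X => x.2.1 := contDiff_fst.comp contDiff_snd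
    have h5 : ContDiff ℝ ∞ fun x : X => x.2.2 := contDiff_snd.comp contDiff_snd
    exact ((h2.add h3.contDiffAt).prodMk
      (h5.contDiffAt.add (h1.mul h4.contDiffAt))).contDiffWithinAt
  have hH0 : H 0 = 0 := by simp [H, hξ0]
  have hdec : ∀ u : X, u = u.1 • ((1 : ℝ), (0 : ℝ), (0 : ℝ)) + u.2.1 • ((0 : ℝ), (1 : ℝ), (0 : ℝ)) +
      u.2.2 • ((0 : ℝ), (0 : ℝ), (1 : ℝ)) := fun u => by ext <;> simp
  obtain ⟨D₀, hD₀, hD₀a⟩ := hHd 0 (hξs.self_of_nhds.differentiableAt (by simp))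
  have hD₀i : Function.Injective D₀ := by
    rw [injective_iff_map_eq_zero]
    intro u hu
    rw [hD₀a, Prod.mk_eq_zero] at hu
    obtain ⟨h1, h2⟩ := hu
    have h3 := congrArg Complex.re h1
    have h4 := congrArg Complex.im h1
    simp only [Complex.add_re, Complex.ofReal_re, Complex.mul_re, Complex.I_re, Complex.ofReal_im,
      Complex.I_im, Complex.zero_re, Complex.add_im, Complex.mul_im, Complex.zero_im, mul_zero,
      mul_one, sub_zero, add_zero, zero_add] at h3 h4
    rw [h3, h4, mul_zero, mul_zero, add_zero, add_zero] at h2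
    have h5 := congrArg (fderiv ℝ ξ 0) (hdec u)
    rw [h3, h4, h2, zero_smul, zero_smul, add_zero, add_zero, map_smul, smul_eq_mul] at h5
    have h6 : u.1 = 0 := (mul_eq_zero.1 h5.symm).resolve_right hξ'
    exact Prod.ext h6 (Prod.ext h4 h2)
  have hfr : Module.finrank ℝ X = Module.finrank ℝ (ℂ × ℝ) := by
    simp [X, Module.finrank_prod, Complex.finrank_real_complex]
  let e : X ≃L[ℝ] ℂ × ℝ :=
    (LinearMap.linearEquivOfInjective D₀.toLinearMap hD₀i hfr).toContinuousLinearEquiv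
  have he : HasFDerivAt H (e : X →L[ℝ] ℂ × ℝ) 0 := by
    have : (e : X →L[ℝ] ℂ × ℝ) = D₀ := ContinuousLinearMap.ext fun u => rfl
    rwa [this]
  obtain ⟨Ψ, hΨ0, hΨU, hΨ, hΨs, hΨd⟩ :=
    exists_openPartialHomeomorph_of_contDiffOn hUo hHs hU0 e he
  have hΨt0 : (0 : ℂ × ℝ) ∈ Ψ.target := by
    have := Ψ.map_source hΨ0
    rwa [hΨ, hH0] at this
  have hΨs0 : Ψ.symm 0 = 0 := by
    have := Ψ.left_inv hΨ0
    rwa [hΨ, hH0] at this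
  have hΨtend : Tendsto Ψ.symm (𝓝 0) (𝓝 0) := by
    have := (Ψ.continuousAt_symm hΨt0)
    rwa [ContinuousAt, hΨs0] at this
  have hψd : ∀ p ∈ Ψ.target, ContDiffAt ℝ ∞ G (Ψ.symm p) → ∃ g : X ≃L[ℝ] ℂ × ℝ,
      HasFDerivAt H (g : X →L[ℝ] ℂ × ℝ) (Ψ.symm p) ∧
        ∀ v, fderiv ℝ (G ∘ Ψ.symm) p v = fderiv ℝ G (Ψ.symm p) (g.symm v) := by
    intro p hp hGp
    obtain ⟨g, hg⟩ := hΨd _ (Ψ.map_target hp)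
    refine ⟨g, hg, fun v => ?_⟩
    have h1 : HasFDerivAt Ψ.symm (g.symm : ℂ × ℝ →L[ℝ] X) p :=
      Ψ.hasFDerivAt_symm hp (by rw [hΨ]; exact hg)
    have h2 : HasFDerivAt (G ∘ Ψ.symm) _ p :=
      (hGp.differentiableAt (by simp)).hasFDerivAt.comp p h1
    rw [h2.fderiv]
    rfl
  refine ⟨G ∘ Ψ.symm, by rw [Function.comp_apply, hΨs0, hG0], ?_, ?_⟩
  · obtain ⟨g, -, hg⟩ := hψd 0 hΨt0 (by rw [hΨs0]; exact hG.self_of_nhds.1)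
    rw [injective_iff_map_eq_zero]
    intro v hv
    rw [hg, hΨs0, hdec (g.symm v)] at hv
    simp only [map_add, map_smul, hGa, hGb, hGc] at hv
    have h1 := congrArg (η y₀) hv
    simp only [map_add, map_smul, ha, hb, hc, smul_eq_mul, mul_zero, zero_add, mul_one,
      map_zero] at h1
    rw [h1, zero_smul, add_zero] at hv
    have h2 := congrArg (dform η y₀ a) hv
    simp only [map_add, map_smul, dform_self, smul_eq_mul, mul_zero, zero_add, map_zero] at h2
    have h3 : (g.symm v).2.1 = 0 := (mul_eq_zero.1 h2).resolve_right hab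
    rw [h3, zero_smul, add_zero] at hv
    have ha0 : a ≠ 0 := by
      rintro rfl
      simp at hab
    have h4 : (g.symm v).1 = 0 := (smul_eq_zero.1 hv).resolve_right ha0
    have h5 : g.symm v = 0 := Prod.ext h4 (Prod.ext h3 h1)
    simpa using h5
  · filter_upwards [Ψ.open_target.mem_nhds hΨt0, hΨtend.eventually hG, hΨtend.eventually hBp,
      hΨtend.eventually hξs] with p hp hGp hBpp hξp
    refine ⟨hGp.1.comp p (hΨs.contDiffAt (Ψ.open_target.mem_nhds hp)), B (Ψ.symm p), hBpp,
      fun v => ?_⟩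
    obtain ⟨g, hgH, hg⟩ := hψd p hp hGp.1
    obtain ⟨D, hD, hDa⟩ := hHd (Ψ.symm p) (hξp.differentiableAt (by simp))
    set x := Ψ.symm p with hx
    set u := g.symm v with hu
    have hv : v = D u := by
      rw [hD.unique hgH, hu]
      exact (g.apply_symm_apply v).symm
    have hp' : p = H x := by rw [hx, ← hΨ, Ψ.right_inv hp]
    have e1 : η ((G ∘ Ψ.symm) p) (fderiv ℝ (G ∘ Ψ.symm) p v) = ζ x u := by
      rw [hg]
      rfl
    have e2 : ζ x u = u.2.1 * A x + u.2.2 * B x := by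
      have : ζ x (1, 0, 0) = 0 := hGp.2
      have h3 := congrArg (ζ x) (hdec u)
      rw [map_add, map_add, map_smul, map_smul, map_smul, this, smul_zero, zero_add] at h3
      exact h3
    have e3 : A x = 2 * ξ x * B x := by
      have : B x ≠ 0 := hBpp.ne'
      simp only [ξ]
      field_simp
    have e4 : stdForm p v = u.2.2 + 2 * ξ x * u.2.1 := by
      rw [stdForm_apply, hv, hDa, hp']
      simp [H]
      ring
    rw [e1, e2, e3, e4]
    ring

end Slice

section

variable {d : ℕ} {M : Type*} [TopologicalSpace M] [ChartedSpace (Euc d) M]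
  {E F : Type*} [NormedAddCommGroup E] [NormedSpace ℝ E] [NormedAddCommGroup F] [NormedSpace ℝ F]

lemma mfderiv_comp_vec {Ψ : F → M} {g : E → F} {y : E}
    (hΨ : MDifferentiableAt 𝓘(ℝ, F) (𝓡 d) Ψ (g y)) (hg : DifferentiableAt ℝ g y) (v : E) :
    mfderiv 𝓘(ℝ, E) (𝓡 d) (Ψ ∘ g) y v = mfderiv 𝓘(ℝ, F) (𝓡 d) Ψ (g y) (fderiv ℝ g y v) := by
  have h := mfderiv_comp y hΨ hg.mdifferentiableAt
  have h2 := congrArg (fun A : E →L[ℝ] Euc d => A v) h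
  refine h2.trans ?_
  rw [← mfderiv_eq_fderiv]
  rfl

lemma pullForm_comp (lam : OneForm d M) {Ψ : F → M} {g : E → F} {y : E}
    (hΨ : MDifferentiableAt 𝓘(ℝ, F) (𝓡 d) Ψ (g y)) (hg : DifferentiableAt ℝ g y) (v : E) :
    pullForm lam (Ψ ∘ g) y v = pullForm lam Ψ (g y) (fderiv ℝ g y v) :=
  congrArg (lam (Ψ (g y))) (mfderiv_comp_vec hΨ hg v)

end

/-- The contact scaling of `ℂ × ℝ`, times the identity. -/
def scaleEquiv (W : Type*) [NormedAddCommGroup W] [NormedSpace ℝ W] (κ : ℝ) (hκ : κ ≠ 0) :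
    ((ℂ × ℝ) × W) ≃L[ℝ] ((ℂ × ℝ) × W) :=
  ((ContinuousLinearEquiv.smulLeft (Units.mk0 κ hκ)).prodCongr
    (ContinuousLinearEquiv.smulLeft (Units.mk0 (κ ^ 2) (pow_ne_zero 2 hκ)))).prodCongr
    (ContinuousLinearEquiv.refl ℝ W)

lemma scaleEquiv_apply (W : Type*) [NormedAddCommGroup W] [NormedSpace ℝ W] (κ : ℝ) (hκ : κ ≠ 0)
    (x : (ℂ × ℝ) × W) : scaleEquiv W κ hκ x = ((κ • x.1.1, κ ^ 2 * x.1.2), x.2) := rfl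

lemma stdForm_scale (κ : ℝ) (p v : ℂ × ℝ) :
    stdForm (κ • p.1, κ ^ 2 * p.2) (κ • v.1, κ ^ 2 * v.2) = κ ^ 2 * stdForm p v := by
  rw [stdForm_apply, stdForm_apply]
  simp
  ring

/-! ### Tubes around a slice -/

section SliceChart

variable {n : ℕ} {M : Type*} [TopologicalSpace M] [ChartedSpace (Euc (2 * n + 1)) M]
  [IsManifold (𝓡 (2 * n + 1)) ∞ M]

lemma IsContactForm.exists_extD_ne {α : OneForm (2 * n + 1) M} (h : IsContactForm α) (hn : 1 ≤ n)
    (x : M) : ∃ a b, α x a = 0 ∧ α x b = 0 ∧ extD α x a b ≠ 0 := by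
  obtain ⟨a, ha, ha0⟩ : ∃ a : Euc (2 * n + 1), formLin α x a = 0 ∧ a ≠ 0 := by
    have h1 := LinearMap.finrank_range_add_finrank_ker (formLin α x)
    have h2 : Module.finrank ℝ (LinearMap.range (formLin α x)) ≤ 1 := by
      simpa using Submodule.finrank_le (LinearMap.range (formLin α x))
    rw [finrank_euclideanSpace_fin] at h1
    have h3 : LinearMap.ker (formLin α x) ≠ ⊥ := by
      intro h4
      rw [h4, finrank_bot] at h1
      omega
    obtain ⟨a, ha, ha0⟩ := (Submodule.ne_bot_iff _).1 h3
    exact ⟨a, ha, ha0⟩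
  by_contra! hcon
  exact ha0 (h.nondegenerate (x := x) ha fun w hw => hcon a w ha hw)

/-- A tube around a three-dimensional slice, on which a contact form is a multiple of the standard
contact form of `ℂ × ℝ`. -/
theorem IsContactForm.exists_slice_chart {α : OneForm (2 * n + 1) M} (h : IsContactForm α)
    (hn : 1 ≤ n) (x₀ : M) (R : ℝ) :
    ∃ (W : Submodule ℝ (Euc (2 * n + 1))) (Φ : OpenPartialHomeomorph ((ℂ × ℝ) × W) M),
      ContMDiffOn 𝓘(ℝ, (ℂ × ℝ) × W) (𝓡 (2 * n + 1)) ∞ Φ Φ.source ∧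
      ContMDiffOn (𝓡 (2 * n + 1)) 𝓘(ℝ, (ℂ × ℝ) × W) ∞ Φ.symm Φ.target ∧
      ∀ p ∈ Metric.ball (0 : ℂ × ℝ) R, (p, 0) ∈ Φ.source ∧ ∃ m > 0, ∀ v,
        pullForm α Φ (p, 0) (v, 0) = m * stdForm p v := by
  set c := extChartAt (𝓡 (2 * n + 1)) x₀ with hc
  have hy₀ : c x₀ ∈ c.target := mem_extChartAt_target x₀
  have hct : IsOpen c.target := isOpen_extChartAt_target x₀
  obtain ⟨a, b, ha, hb, hab⟩ := h.exists_extD_ne hn (c.symm (c x₀))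
  have hη : ∀ᶠ y in 𝓝 (c x₀), ContDiffAt ℝ ∞ (chartForm α x₀) y := by
    filter_upwards [hct.mem_nhds hy₀] with y hy
    exact (h.1.contDiffOn_chartForm x₀).contDiffAt (hct.mem_nhds hy)
  obtain ⟨ψ, hψ0, hψi, hψ⟩ := exists_contact_slice (η := chartForm α x₀) (y₀ := c x₀)
    (a := chartD x₀ (c.symm (c x₀)) a) (b := chartD x₀ (c.symm (c x₀)) b)
    (c := chartReeb α x₀ (c x₀)) hη
    ((chartForm_chartD hy₀ a).trans ha) ((chartForm_chartD hy₀ b).trans hb)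
    (h.chartForm_chartReeb hy₀) (ne_of_eq_of_ne (h.1.dform_chartD hy₀ a b) hab)
  obtain ⟨W, hW⟩ := Submodule.exists_isCompl (LinearMap.range (fderiv ℝ ψ 0).toLinearMap)
  obtain ⟨U, hU, hUo, hU0⟩ := eventually_nhds_iff.1 hψ
  let f : (ℂ × ℝ) × W → Euc (2 * n + 1) := fun x => ψ x.1 + x.2
  have hfd : ∀ x : (ℂ × ℝ) × W, x.1 ∈ U → HasFDerivAt f
      ((fderiv ℝ ψ x.1).comp (ContinuousLinearMap.fst ℝ (ℂ × ℝ) W) +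
        W.subtypeL.comp (ContinuousLinearMap.snd ℝ (ℂ × ℝ) W)) x := by
    intro x hx
    have h1 : HasFDerivAt ψ (fderiv ℝ ψ x.1) x.1 :=
      ((hU _ hx).1.differentiableAt (by simp)).hasFDerivAt
    exact (h1.comp x hasFDerivAt_fst).add (W.subtypeL.hasFDerivAt.comp x hasFDerivAt_snd)
  have hfs : ContDiffOn ℝ ∞ f (U ×ˢ univ) := by
    intro x hx
    have h1 : ContDiffAt ℝ ∞ ψ x.1 := (hU _ hx.1).1
    exact ((h1.comp x contDiffAt_fst).add
      (W.subtypeL.contDiff.contDiffAt.comp x contDiffAt_snd)).contDiffWithinAt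
  let D : (ℂ × ℝ) × W →L[ℝ] Euc (2 * n + 1) := (fderiv ℝ ψ 0).comp (ContinuousLinearMap.fst ℝ (ℂ × ℝ) W) +
        W.subtypeL.comp (ContinuousLinearMap.snd ℝ (ℂ × ℝ) W)
  have hDa : ∀ x, D x = fderiv ℝ ψ 0 x.1 + x.2 := fun x => rfl
  have hDb : Function.Bijective D.toLinearMap := by
    constructor
    · rw [injective_iff_map_eq_zero]
      intro x hx
      have hx' : fderiv ℝ ψ 0 x.1 + (x.2 : Euc (2 * n + 1)) = 0 := hx
      have h1 : fderiv ℝ ψ 0 x.1 = 0 := by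
        refine Submodule.disjoint_def.1 hW.disjoint _ ⟨x.1, rfl⟩ ?_
        rw [eq_neg_of_add_eq_zero_left hx']
        exact W.neg_mem x.2.2
      rw [h1, zero_add] at hx'
      exact Prod.ext (hψi (h1.trans (map_zero _).symm)) (Subtype.ext hx')
    · intro y
      obtain ⟨y1, ⟨u, rfl⟩, y2, hy2, rfl⟩ := Submodule.mem_sup.1
        (hW.codisjoint.eq_top ▸ Submodule.mem_top : y ∈ _ ⊔ W)
      exact ⟨(u, ⟨y2, hy2⟩), rfl⟩
  let e : ((ℂ × ℝ) × W) ≃L[ℝ] Euc (2 * n + 1) := (LinearEquiv.ofBijective _ hDb).toContinuousLinearEquiv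
  have he : HasFDerivAt f (e : (ℂ × ℝ) × W →L[ℝ] Euc (2 * n + 1)) 0 := by
    have : (e : (ℂ × ℝ) × W →L[ℝ] Euc (2 * n + 1)) = D := ContinuousLinearMap.ext fun u => rfl
    rw [this]
    exact hfd 0 hU0
  obtain ⟨Φ₁, hΦ₁0, hΦ₁U, hΦ₁, hΦ₁s, -⟩ := exists_openPartialHomeomorph_of_contDiffOn
    (hUo.prod isOpen_univ) hfs ⟨hU0, mem_univ _⟩ e he
  let ch : OpenPartialHomeomorph M (Euc (2 * n + 1)) := chartAt (Euc (2 * n + 1)) x₀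
  have hchs : ⇑ch.symm = c.symm := rfl
  have hch : ⇑ch = c := rfl
  have hcht : ch.symm.source = c.target := by
    simp [ch, c, extChartAt]
  have hchS : ch.source = c.source := (extChartAt_source (𝓡 (2 * n + 1)) x₀).symm
  let Φ₂ := Φ₁.trans ch.symm
  have hf0 : f 0 = c x₀ := by simp [f, hψ0]
  have hΦ₂0 : (0 : (ℂ × ℝ) × W) ∈ Φ₂.source := by
    rw [OpenPartialHomeomorph.trans_source]
    refine ⟨hΦ₁0, ?_⟩
    rw [mem_preimage, hΦ₁, hf0, hcht]
    exact hy₀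
  have hgood : ∀ᶠ p : ℂ × ℝ in 𝓝 0, (p, (0 : W)) ∈ Φ₂.source := by
    have h1 : Continuous fun p : ℂ × ℝ => (p, (0 : W)) := by fun_prop
    exact h1.continuousAt.eventually (Φ₂.open_source.mem_nhds hΦ₂0)
  obtain ⟨δ, hδ, hδg⟩ := Metric.eventually_nhds_iff_ball.1 hgood
  -- The scaling (κ ζ, κ² z) multiplies the standard form by κ². It shrinks a ball of any radius R
  -- into the chart at the cost of a positive factor.
  set κ : ℝ := min 1 (δ / (2 * (|R| + 1))) with hκ
  have hκ0 : 0 < κ := lt_min one_pos (by positivity)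
  have hκ1 : κ ≤ 1 := min_le_left _ _
  have hκR : κ * |R| < δ := by
    have h1 : κ ≤ δ / (2 * (|R| + 1)) := min_le_right _ _
    have h2 : κ * (2 * (|R| + 1)) ≤ δ := (le_div_iff₀ (by positivity)).1 h1
    nlinarith [abs_nonneg R, mul_nonneg hκ0.le (abs_nonneg R)]
  have hball : ∀ p ∈ Metric.ball (0 : ℂ × ℝ) R, (κ • p.1, κ ^ 2 * p.2) ∈ Metric.ball 0 δ := by
    intro p hp
    rw [mem_ball_zero_iff, Prod.norm_def, max_lt_iff] at hp ⊢
    have hR : R ≤ |R| := le_abs_self R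
    constructor
    · simp only [norm_smul, Real.norm_eq_abs, abs_of_pos hκ0]
      nlinarith [hp.1]
    · simp only [norm_mul, norm_pow, Real.norm_eq_abs, abs_of_pos hκ0]
      have h1 : |p.2| < R := hp.2
      have h2 : κ ^ 2 * |p.2| ≤ κ * |p.2| := by
        rw [sq, mul_assoc]
        exact mul_le_of_le_one_left (by positivity) hκ1
      nlinarith
  let S := scaleEquiv W κ hκ0.ne'
  let Φ := S.toHomeomorph.toOpenPartialHomeomorph.trans Φ₂
  have hΦsrc : ∀ x, x ∈ Φ.source ↔ S x ∈ Φ₁.source ∧ f (S x) ∈ c.target := by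
    intro x
    have : x ∈ Φ.source ↔ S x ∈ Φ₁.source ∧ Φ₁ (S x) ∈ ch.symm.source := by
      simp only [Φ, Φ₂, OpenPartialHomeomorph.trans_source]
      exact ⟨fun h => h.2, fun h => ⟨mem_univ _, h⟩⟩
    rw [this, hΦ₁, hcht]
  have hΦe : ∀ x, Φ x = c.symm (f (S x)) := by
    intro x
    have : Φ x = c.symm (Φ₁ (S x)) := rfl
    rw [this, hΦ₁]
  have hcs : ∀ y ∈ c.target, ContMDiffAt 𝓘(ℝ, Euc (2 * n + 1)) (𝓡 (2 * n + 1)) ∞ c.symm y := fun y hy =>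
    (contMDiffOn_extChartAt_symm x₀).contMDiffAt (hct.mem_nhds hy)
  have hfS : ∀ x, S x ∈ Φ₁.source → ContDiffAt ℝ ∞ (f ∘ S) x := fun x hx =>
    (hfs.contDiffAt ((hUo.prod isOpen_univ).mem_nhds (hΦ₁U hx))).comp x S.contDiff.contDiffAt
  have hΦf : ⇑Φ = c.symm ∘ (f ∘ S) := funext hΦe
  refine ⟨W, Φ, fun x hx => ?_, fun x hx => ?_, fun p hp => ?_⟩
  · rw [hΦsrc] at hx
    rw [hΦf]
    exact (ContMDiffAt.comp x (hcs _ hx.2) (hfS x hx.1).contMDiffAt).contMDiffWithinAt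
  · have h1 : x ∈ c.source ∧ c x ∈ Φ₁.target := by
      have : x ∈ ch.symm.target ∧ ch x ∈ Φ₁.target := by
        have h2 : x ∈ Φ₂.target := by
          simp only [Φ, OpenPartialHomeomorph.trans_target] at hx
          exact hx.1
        simp only [Φ₂, OpenPartialHomeomorph.trans_target] at h2
        exact h2
      exact ⟨hchS ▸ this.1, this.2⟩
    have h2 : ⇑Φ.symm = (S.symm ∘ Φ₁.symm) ∘ c := rfl
    rw [h2]
    have h3 : ContDiffAt ℝ ∞ (S.symm ∘ Φ₁.symm) (c x) :=
      S.symm.contDiff.contDiffAt.comp _ (hΦ₁s.contDiffAt (Φ₁.open_target.mem_nhds h1.2))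
    exact (ContMDiffAt.comp x h3.contMDiffAt (contMDiffAt_extChartAt' (hchS ▸ h1.1))).contMDiffWithinAt
  · have h1 : (p, (0 : W)) ∈ Φ.source := by
      have := hδg _ (hball p hp)
      simp only [Φ, OpenPartialHomeomorph.trans_source]
      exact ⟨mem_univ _, this⟩
    refine ⟨h1, ?_⟩
    have h2 := (hΦsrc _).1 h1
    have h3 : (κ • p.1, κ ^ 2 * p.2) ∈ U := (hΦ₁U h2.1).1
    obtain ⟨m, hm, hmv⟩ := (hU _ h3).2
    refine ⟨m * κ ^ 2, by positivity, fun v => ?_⟩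
    rw [hΦf, pullForm_comp α (g := f ∘ S) ((hcs _ h2.2).mdifferentiableAt (by simp))
      ((hfS _ h2.1).differentiableAt (by simp)), ← chartForm_eq_pullForm]
    have h4 : HasFDerivAt (f ∘ S) _ (p, (0 : W)) :=
      (hfd (S (p, 0)) h3).comp (p, (0 : W)) S.hasFDerivAt
    rw [h4.fderiv]
    have h5 := hmv (κ • v.1, κ ^ 2 * v.2)
    rw [stdForm_scale, ← mul_assoc] at h5
    have h6 : (f ∘ S) (p, 0) = ψ (κ • p.1, κ ^ 2 * p.2) := by
      simp [f, S, scaleEquiv_apply]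
    have h7 : ∀ y : Euc (2 * n + 1), y = ψ (κ • p.1, κ ^ 2 * p.2) →
        ∀ w : Euc (2 * n + 1), w = fderiv ℝ ψ (κ • p.1, κ ^ 2 * p.2) (κ • v.1, κ ^ 2 * v.2) →
        chartForm α x₀ y w = m * κ ^ 2 * stdForm p v := by
      rintro y rfl w rfl
      exact h5
    refine h7 _ h6 _ ?_
    simp [S, scaleEquiv_apply]

end SliceChart

/-! ### Extending functions from a tube to the manifold -/

section Extension

variable {d : ℕ} {M : Type*} [TopologicalSpace M] [T2Space M] [ChartedSpace (Euc d) M]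
  {E : Type*} [NormedAddCommGroup E] [NormedSpace ℝ E] [FiniteDimensional ℝ E]

/-- A smooth function on the domain of a local parametrization extends to the manifold from a
neighbourhood of a compact set. -/
lemma exists_contMDiff_extension {Φ : OpenPartialHomeomorph E M}
    (hs : ContMDiffOn (𝓡 d) 𝓘(ℝ, E) ∞ Φ.symm Φ.target) {U : Set E} (hU : IsOpen U)
    (hUs : U ⊆ Φ.source) {g : E → ℝ} (hg : ∀ x ∈ U, ContDiffAt ℝ ∞ g x) {K : Set E}
    (hK : IsCompact K) (hKU : K ⊆ U) :
    ∃ k : M → ℝ, ContMDiff (𝓡 d) 𝓘(ℝ, ℝ) ∞ k ∧ ∀ x ∈ K, ∀ᶠ y in 𝓝 x, k (Φ y) = g y := by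
  obtain ⟨t, ht, hKt, htU⟩ := exists_compact_between hK hU hKU
  obtain ⟨χ, h1, h0, -⟩ := exists_contMDiffMap_one_nhds_of_subset_interior (n := (⊤ : ℕ∞)) 𝓘(ℝ, E)
    hK.isClosed hKt
  have hχ : ContDiff ℝ ∞ χ := χ.contMDiff.contDiff
  classical
  let k : M → ℝ := fun x => if x ∈ Φ.target then χ (Φ.symm x) * g (Φ.symm x) else 0
  have hcl : IsClosed (Φ '' t) := (ht.image_of_continuousOn
    (Φ.continuousOn.mono (htU.trans hUs))).isClosed
  refine ⟨k, fun x => ?_, fun x hx => ?_⟩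
  · by_cases hx : x ∈ Φ '' t
    · obtain ⟨y, hy, rfl⟩ := hx
      have hyt : Φ y ∈ Φ.target := Φ.map_source (hUs (htU hy))
      have h2 : ContDiffAt ℝ ∞ (fun y => χ y * g y) (Φ.symm (Φ y)) := by
        rw [Φ.left_inv (hUs (htU hy))]
        exact hχ.contDiffAt.mul (hg y (htU hy))
      have h3 : ContMDiffAt (𝓡 d) 𝓘(ℝ, ℝ) ∞ ((fun y => χ y * g y) ∘ Φ.symm) (Φ y) :=
        ContMDiffAt.comp _ h2.contMDiffAt (hs.contMDiffAt (Φ.open_target.mem_nhds hyt))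
      refine h3.congr_of_eventuallyEq ?_
      filter_upwards [Φ.open_target.mem_nhds hyt] with z hz
      simp only [k, hz, if_true, Function.comp_apply]
    · refine (contMDiffAt_const (c := (0 : ℝ))).congr_of_eventuallyEq ?_
      filter_upwards [hcl.isOpen_compl.mem_nhds hx] with z hz
      by_cases hzt : z ∈ Φ.target
      · have h2 : Φ.symm z ∉ t := fun h => hz ⟨_, h, Φ.right_inv hzt⟩
        simp only [k, hzt, if_true, h0 _ h2, zero_mul]
      · simp only [k, hzt, if_false]
  · have h2 : ∀ᶠ y in 𝓝 x, χ y = 1 := (Filter.Eventually.filter_mono (nhds_le_nhdsSet hx) h1)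
    filter_upwards [h2, Φ.open_source.mem_nhds (hUs (hKU hx))] with y hy hys
    have h3 : k (Φ y) = χ (Φ.symm (Φ y)) * g (Φ.symm (Φ y)) := if_pos (Φ.map_source hys)
    rw [h3, Φ.left_inv hys, hy, one_mul]

omit [T2Space M] [FiniteDimensional ℝ E] in
lemma exists_mfderiv_eq [IsManifold (𝓡 d) ∞ M] {Φ : OpenPartialHomeomorph E M}
    (hΦ : ContMDiffOn 𝓘(ℝ, E) (𝓡 d) ∞ Φ Φ.source)
    (hs : ContMDiffOn (𝓡 d) 𝓘(ℝ, E) ∞ Φ.symm Φ.target) {y : E} (hy : y ∈ Φ.source)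
    (w : TangentSpace (𝓡 d) (Φ y)) : ∃ v : E, mfderiv 𝓘(ℝ, E) (𝓡 d) Φ y v = w := by
  have h1 : MDifferentiableAt 𝓘(ℝ, E) (𝓡 d) Φ (Φ.symm (Φ y)) := by
    rw [Φ.left_inv hy]
    exact (hΦ.contMDiffAt (Φ.open_source.mem_nhds hy)).mdifferentiableAt (by simp)
  have h2 := (hs.contMDiffAt (Φ.open_target.mem_nhds (Φ.map_source hy))).mdifferentiableAt
    (n := ∞) (by simp)
  have h3 := mfderiv_comp (Φ y) h1 h2
  have h4 : Φ ∘ Φ.symm =ᶠ[𝓝 (Φ y)] id := by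
    filter_upwards [Φ.open_target.mem_nhds (Φ.map_source hy)] with z hz using Φ.right_inv hz
  rw [h4.mfderiv_eq, mfderiv_id] at h3
  have h5 := congrArg (fun A : Euc d →L[ℝ] Euc d => A w) h3
  have h6 : ∀ z : E, z = y → ∀ u : Euc d,
      w = (mfderiv 𝓘(ℝ, E) (𝓡 d) Φ z : E →L[ℝ] Euc d)
        ((mfderiv (𝓡 d) 𝓘(ℝ, E) Φ.symm (Φ y) : Euc d →L[ℝ] E) u) → ∃ v : E, mfderiv 𝓘(ℝ, E) (𝓡 d) Φ y v = w := by
    rintro z rfl u hu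
    exact ⟨_, hu.symm⟩
  exact h6 _ (Φ.left_inv hy) w h5

end Extension

/-! ### Rescaling to the model form along the slice -/

section Slice

variable {n : ℕ} {M : Type*} [TopologicalSpace M] [T2Space M] [ChartedSpace (Euc (2 * n + 1)) M]
  [IsManifold (𝓡 (2 * n + 1)) ∞ M]
  {W : Type*} [NormedAddCommGroup W] [NormedSpace ℝ W] [FiniteDimensional ℝ W]

omit [T2Space M] [FiniteDimensional ℝ W] [IsManifold (𝓡 (2 * n + 1)) ∞ M] in
lemma pullForm_smul {E : Type*} [NormedAddCommGroup E] [NormedSpace ℝ E] (k : M → ℝ)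
    (α : OneForm (2 * n + 1) M) (Ψ : E → M) (y : E) :
    pullForm (fun x => k x • α x) Ψ y = k (Ψ y) • pullForm α Ψ y := rfl

/-- A contact form that is proportional to the standard one along a slice can be rescaled so that
it becomes a prescribed multiple, with the Reeb field tangent to the slice. -/
theorem IsContactForm.exists_rescaling {α : OneForm (2 * n + 1) M} (h : IsContactForm α)
    {Φ : OpenPartialHomeomorph ((ℂ × ℝ) × W) M}
    (hΦ : ContMDiffOn 𝓘(ℝ, (ℂ × ℝ) × W) (𝓡 (2 * n + 1)) ∞ Φ Φ.source)
    (hs : ContMDiffOn (𝓡 (2 * n + 1)) 𝓘(ℝ, (ℂ × ℝ) × W) ∞ Φ.symm Φ.target) {R R₁ : ℝ}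
    (hb : ∀ p ∈ Metric.ball (0 : ℂ × ℝ) R, (p, 0) ∈ Φ.source ∧ ∃ m > 0, ∀ v,
        pullForm α Φ (p, 0) (v, 0) = m * stdForm p v) (hR : R₁ < R)
    {F : ℂ × ℝ → ℝ} (hF : ContDiff ℝ ∞ F) {X : ℂ × ℝ → ℂ × ℝ} (hX : ContDiff ℝ ∞ X)
    (hX1 : ∀ p, Real.exp (F p) * stdForm p (X p) = 1)
    (hX2 : ∀ p v, dform (fun p => Real.exp (F p) • stdForm p) p (X p) v = 0) :
    ∃ k : M → ℝ, ContMDiff (𝓡 (2 * n + 1)) 𝓘(ℝ, ℝ) ∞ k ∧ (∀ x, 0 < k x) ∧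
      ∀ p ∈ Metric.closedBall (0 : ℂ × ℝ) R₁,
        (∀ v, pullForm (fun x => k x • α x) Φ (p, 0) (v, 0) = Real.exp (F p) * stdForm p v) ∧
        reeb (fun x => k x • α x) (Φ (p, 0)) =
          mfderiv 𝓘(ℝ, (ℂ × ℝ) × W) (𝓡 (2 * n + 1)) Φ (p, 0) (X p, 0) := by
  set η := pullForm α Φ with hηd
  have hη : ∀ y ∈ Φ.source, ContDiffAt ℝ ∞ η y := fun y hy =>
    h.1.contDiffAt_pullForm (hΦ.contMDiffAt (Φ.open_source.mem_nhds hy))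
  let j : ℂ × ℝ → (ℂ × ℝ) × W := fun p => (p, 0)
  have hj : ContDiff ℝ ∞ j := by fun_prop
  let m : ℂ × ℝ → ℝ := fun p => η (j p) ((0, 1), 0)
  have hm : ∀ p ∈ Metric.ball (0 : ℂ × ℝ) R, 0 < m p ∧ ∀ v, η (j p) (v, 0) = m p * stdForm p v := by
    intro p hp
    obtain ⟨-, m', hm', hv⟩ := hb p hp
    have : m p = m' := by
      have := hv (0, 1)
      rw [stdForm_apply] at this
      simpa using this
    rw [this]
    exact ⟨hm', hv⟩
  have hηj : ∀ p ∈ Metric.ball (0 : ℂ × ℝ) R, ContDiffAt ℝ ∞ (fun p => η (j p)) p := fun p hp =>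
    ContDiffAt.comp (g := η) p (hη _ (hb p hp).1) hj.contDiffAt
  have hms : ∀ p ∈ Metric.ball (0 : ℂ × ℝ) R, ContDiffAt ℝ ∞ m p := fun p hp =>
    (hηj p hp).clm_apply contDiffAt_const
  let f : ℂ × ℝ → ℝ := fun p => F p - Real.log (m p)
  have hf : ∀ p ∈ Metric.ball (0 : ℂ × ℝ) R, ContDiffAt ℝ ∞ f p := fun p hp =>
    hF.contDiffAt.sub ((hms p hp).log (hm p hp).1.ne')
  let inr : W →L[ℝ] (ℂ × ℝ) × W := ContinuousLinearMap.inr ℝ (ℂ × ℝ) W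
  -- The normal derivative of the exponent g. It is determined by requiring dη(X, w) + dg(X) η(w) -
  -- dg(w) η(X) = 0 for w transverse to the slice. Thus X, already the Reeb field within the slice,
  -- is the Reeb field of the ambient form.
  let ℓ : ℂ × ℝ → W →L[ℝ] ℝ := fun p => (η (j p) (X p, 0))⁻¹ •
    (fderiv ℝ f p (X p) • (η (j p)).comp inr + (dform η (j p) (X p, 0)).comp inr)
  have hXne : ∀ p ∈ Metric.ball (0 : ℂ × ℝ) R, η (j p) (X p, 0) ≠ 0 := by
    intro p hp
    rw [(hm p hp).2]
    refine mul_ne_zero (hm p hp).1.ne' fun h0 => ?_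
    have := hX1 p
    rw [h0, mul_zero] at this
    exact zero_ne_one this
  have hXj : ContDiff ℝ ∞ fun p => (X p, (0 : W)) := by fun_prop
  have hℓ : ∀ p ∈ Metric.ball (0 : ℂ × ℝ) R, ContDiffAt ℝ ∞ ℓ p := by
    intro p hp
    have h1 : ContDiffAt ℝ ∞ (fun p => η (j p) (X p, 0)) p := (hηj p hp).clm_apply hXj.contDiffAt
    have h2 : ContDiffAt ℝ ∞ (fun p => dform η (j p)) p :=
      ContDiffAt.comp (g := dform η) p (show ContDiffAt ℝ ∞ (dform η) (j p) from (hη _ (hb p hp).1).dform) hj.contDiffAt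
    have h3 : ContDiffAt ℝ ∞ (fun p => fderiv ℝ f p (X p)) p :=
      ((hf p hp).fderiv_right (m := ∞) (by simp)).clm_apply hX.contDiffAt
    exact (h1.inv (hXne p hp)).smul ((h3.smul ((hηj p hp).clm_comp contDiffAt_const)).add
      ((h2.clm_apply hXj.contDiffAt).clm_comp contDiffAt_const))
  let g : (ℂ × ℝ) × W → ℝ := fun x => f x.1 + ℓ x.1 x.2
  have hg : ∀ x : (ℂ × ℝ) × W, x.1 ∈ Metric.ball (0 : ℂ × ℝ) R → ContDiffAt ℝ ∞ g x := by
    intro x hx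
    exact (ContDiffAt.comp (g := f) x (hf _ hx) contDiffAt_fst).add
      ((ContDiffAt.comp (g := ℓ) x (hℓ _ hx) contDiffAt_fst).clm_apply contDiffAt_snd)
  have hgd : ∀ p ∈ Metric.ball (0 : ℂ × ℝ) R, ∀ v, fderiv ℝ g (j p) v = fderiv ℝ f p v.1 + ℓ p v.2 := by
    intro p hp v
    have h1 : HasFDerivAt f (fderiv ℝ f p) (j p).1 :=
      ((hf p hp).differentiableAt (by simp)).hasFDerivAt
    have h2 : HasFDerivAt ℓ (fderiv ℝ ℓ p) (j p).1 :=
      ((hℓ p hp).differentiableAt (by simp)).hasFDerivAt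
    have h3 := (h1.comp (j p) hasFDerivAt_fst).add
      ((h2.comp (j p) hasFDerivAt_fst).clm_apply hasFDerivAt_snd)
    have h4 : HasFDerivAt g _ (j p) := h3
    rw [h4.fderiv]
    simp [j]
  obtain ⟨k, hk, hke⟩ := exists_contMDiff_extension (K := j '' Metric.closedBall 0 R₁) hs
    (U := Φ.source ∩ Prod.fst ⁻¹' Metric.ball (0 : ℂ × ℝ) R)
    (Φ.open_source.inter (Metric.isOpen_ball.preimage continuous_fst)) inter_subset_left
    (g := g) (fun x hx => hg x hx.2) ((isCompact_closedBall 0 R₁).image hj.continuous) (by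
      rintro _ ⟨p, hp, rfl⟩
      have := Metric.closedBall_subset_ball hR hp
      exact ⟨(hb p this).1, this⟩)
  have hK : ContMDiff (𝓡 (2 * n + 1)) 𝓘(ℝ, ℝ) ∞ fun x => Real.exp (k x) :=
    Real.contDiff_exp.contMDiff.comp hk
  refine ⟨fun x => Real.exp (k x), hK, fun x => Real.exp_pos _, fun p hp => ?_⟩
  have hpb := Metric.closedBall_subset_ball hR hp
  have hlam : IsContactForm fun x => Real.exp (k x) • α x := h.smul hK fun x => (Real.exp_pos _).ne'
  have hps := (hb p hpb).1
  have hev : pullForm (fun x => Real.exp (k x) • α x) Φ =ᶠ[𝓝 (j p)] fun y => Real.exp (g y) • η y := by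
    filter_upwards [hke (j p) ⟨p, hp, rfl⟩] with y hy
    exact (pullForm_smul _ _ _ _).trans (by rw [hy])
  have hval : ∀ q ∈ Metric.ball (0 : ℂ × ℝ) R, ∀ v, (Real.exp (g (j q)) • η (j q)) (v, 0) = Real.exp (F q) * stdForm q v := by
    intro q hq v
    have h1 : g (j q) = F q - Real.log (m q) := by simp [g, j, f]
    rw [h1, smul_apply, (hm q hq).2, Real.exp_sub, Real.exp_log (hm q hq).1, smul_eq_mul]
    have := (hm q hq).1.ne'
    field_simp
  have hval' : ∀ v, pullForm (fun x => Real.exp (k x) • α x) Φ (j p) (v, 0) = Real.exp (F p) * stdForm p v := by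
    intro v
    rw [hev.self_of_nhds]
    exact hval p hpb v
  refine ⟨hval', ?_⟩
  have hΦp := hΦ.contMDiffAt (Φ.open_source.mem_nhds hps)
  have hgp := hg (j p) hpb
  have hηd' : DifferentiableAt ℝ η (j p) := (hη _ hps).differentiableAt (by simp)
  refine (hlam.eq_reeb ((hval' _).trans (hX1 p)) fun w => ?_).symm
  obtain ⟨v, rfl⟩ := exists_mfderiv_eq hΦ hs hps w
  refine (hlam.1.extD_mfderiv hΦp _ _).trans ?_
  rw [dform_congr hev]
  have hsplit : v = (v.1, 0) + (0, v.2) := by simp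
  rw [hsplit, map_add]
  have e1 : dform (fun y => Real.exp (g y) • η y) (j p) (X p, 0) (v.1, 0) = 0 := by
    have h1 := hX2 p v.1
    have hfd : fderiv ℝ j p = ContinuousLinearMap.inl ℝ (ℂ × ℝ) W :=
      (ContinuousLinearMap.inl ℝ (ℂ × ℝ) W).fderiv
    have hdiff : DifferentiableAt ℝ (fun y => Real.exp (g y) • η y) (j p) :=
      (hgp.exp.smul (hη _ hps)).differentiableAt (by simp)
    have h2 := dform_comp (η := fun y => Real.exp (g y) • η y) hj.contDiffAt hdiff (X p) v.1
    rw [hfd] at h2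
    refine (h2.symm.trans ?_).trans h1
    congr 2
    refine dform_congr ?_
    filter_upwards [Metric.isOpen_ball.mem_nhds hpb] with q hq
    refine ContinuousLinearMap.ext fun u => ?_
    have hfq : fderiv ℝ j q = ContinuousLinearMap.inl ℝ (ℂ × ℝ) W :=
      (ContinuousLinearMap.inl ℝ (ℂ × ℝ) W).fderiv
    rw [hfq]
    exact hval q hq u
  have e2 : dform (fun y => Real.exp (g y) • η y) (j p) (X p, 0) (0, v.2) = 0 := by
    rw [dform_smul (hgp.exp.differentiableAt (by simp)) hηd']
    have hge : fderiv ℝ (fun y => Real.exp (g y)) (j p) = Real.exp (g (j p)) • fderiv ℝ g (j p) :=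
      ((hgp.differentiableAt (by simp)).hasFDerivAt.exp).fderiv
    rw [hge, smul_apply, smul_apply, hgd p hpb, hgd p hpb]
    have hℓv : ℓ p v.2 = (η (j p) (X p, 0))⁻¹ *
        (fderiv ℝ f p (X p) * η (j p) (0, v.2) + dform η (j p) (X p, 0) (0, v.2)) := rfl
    have hne := hXne p hpb
    simp only [map_zero, add_zero, zero_add, smul_eq_mul, hℓv]
    field_simp
    ring
  rw [e1, e2, add_zero]

end Slice

/-- Near `p₀`, the pairs in `D` are rotations of each other with respect to a smooth frame of
`ker stdForm` that is oriented by the exterior derivative of `exp F • stdForm`. -/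
def HasModelFrame (F : ℂ × ℝ → ℝ) (D : ℂ × ℝ → Set ((ℂ × ℝ) × (ℂ × ℝ))) (p₀ : ℂ × ℝ) : Prop :=
  ∃ e₁ e₂ : ℂ × ℝ → ℂ × ℝ, 0 < dform (fun p => Real.exp (F p) • stdForm p) p₀ (e₁ p₀) (e₂ p₀) ∧
    ∀ᶠ p in 𝓝 p₀, ContDiffAt ℝ ∞ e₁ p ∧ ContDiffAt ℝ ∞ e₂ p ∧ ∀ x ∈ D p,
      ∃ c₁ c₂ : ℝ, x.1 = c₁ • e₁ p + c₂ • e₂ p ∧ x.2 = c₁ • e₂ p - c₂ • e₁ p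

/-! ### Realizing a compact model inside a contact manifold -/

section Slice

variable {n : ℕ} {M : Type*} [TopologicalSpace M] [T2Space M] [ChartedSpace (Euc (2 * n + 1)) M]
  [IsManifold (𝓡 (2 * n + 1)) ∞ M]

/-- The derivative of the parametrization of a slice. -/
def sliceD (ι : ℂ × ℝ → M) (p : ℂ × ℝ) : ℂ × ℝ →L[ℝ] Euc (2 * n + 1) :=
  mfderiv 𝓘(ℝ, ℂ × ℝ) (𝓡 (2 * n + 1)) ι p

/-- The vectors tangent to a slice that a compatible complex structure is required to rotate. -/
def slicePairs (ι : ℂ × ℝ → M) (D : ℂ × ℝ → Set ((ℂ × ℝ) × (ℂ × ℝ))) (x : M) :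
    Set (Euc (2 * n + 1) × Euc (2 * n + 1)) :=
  {q | ∃ p, ι p = x ∧ ∃ a ∈ D p, q = (sliceD ι p a.1,
    sliceD ι p a.2)}

/-- The prescribed pairs sit over the image of the compact set K, which is closed in M. Off this
image nothing is prescribed nearby, and at its points the model frame is carried over to M. -/
theorem exists_isCompatible_of_slice [SigmaCompactSpace M]
    {W : Type*} [NormedAddCommGroup W] [NormedSpace ℝ W]
    {lam : OneForm (2 * n + 1) M} (h : IsContactForm lam)
    {Φ : OpenPartialHomeomorph ((ℂ × ℝ) × W) M}
    (hΦ : ContMDiffOn 𝓘(ℝ, (ℂ × ℝ) × W) (𝓡 (2 * n + 1)) ∞ Φ Φ.source)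
    (hs : ContMDiffOn (𝓡 (2 * n + 1)) 𝓘(ℝ, (ℂ × ℝ) × W) ∞ Φ.symm Φ.target)
    {B K : Set (ℂ × ℝ)} (hB : IsOpen B) (hK : IsCompact K) (hKB : K ⊆ B)
    {F : ℂ × ℝ → ℝ} {ι : ℂ × ℝ → M} (hι : ι = fun p => Φ (p, 0))
    (hsrc : ∀ p ∈ B, (p, 0) ∈ Φ.source)
    (hlam : ∀ p ∈ B, pullForm lam ι p = Real.exp (F p) • stdForm p)
    {D : ℂ × ℝ → Set ((ℂ × ℝ) × (ℂ × ℝ))} (hDK : ∀ p ∉ K, D p = ∅)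
    (hD0 : ∀ p, ∀ a ∈ D p, stdForm p a.1 = 0 ∧ stdForm p a.2 = 0)
    (hD : ∀ p ∈ K, HasModelFrame F D p) :
    ∃ J : TangentEnd (2 * n + 1) M, IsCompatible lam J ∧ ∀ p, ∀ a ∈ D p,
      J (ι p) (sliceD ι p a.1) =
        sliceD ι p a.2 := by
  let j : ℂ × ℝ → (ℂ × ℝ) × W := fun p => (p, 0)
  have hj : ContDiff ℝ ∞ j := by fun_prop
  have hjd : ∀ p v, fderiv ℝ j p v = (v, 0) := fun p v => by
    have : fderiv ℝ j p = ContinuousLinearMap.inl ℝ (ℂ × ℝ) W :=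
      (ContinuousLinearMap.inl ℝ (ℂ × ℝ) W).fderiv
    rw [this]; rfl
  have hιj : ι = Φ ∘ j := hι
  have hΦa : ∀ p ∈ B, ContMDiffAt 𝓘(ℝ, (ℂ × ℝ) × W) (𝓡 (2 * n + 1)) ∞ Φ (j p) := fun p hp =>
    hΦ.contMDiffAt (Φ.open_source.mem_nhds (hsrc p hp))
  have hιs : ∀ p ∈ B, ContMDiffAt 𝓘(ℝ, ℂ × ℝ) (𝓡 (2 * n + 1)) ∞ ι p := fun p hp => by
    rw [hιj]
    exact ContMDiffAt.comp p (hΦa p hp) hj.contMDiff.contMDiffAt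
  have hιd : ∀ p ∈ B, ∀ v, sliceD ι p v =
      mfderiv 𝓘(ℝ, (ℂ × ℝ) × W) (𝓡 (2 * n + 1)) Φ (j p) (v, 0) := by
    intro p hp v
    have h1 := mfderiv_comp_vec (Ψ := Φ) (g := j) (y := p) ((hΦa p hp).mdifferentiableAt (by simp))
      (hj.differentiable (by simp) p) v
    have h0 : sliceD ι p v = mfderiv 𝓘(ℝ, ℂ × ℝ) (𝓡 (2 * n + 1)) (Φ ∘ j) p v := by
      rw [← hιj]
      rfl
    exact (h0.trans h1).trans (congrArg (mfderiv 𝓘(ℝ, (ℂ × ℝ) × W) (𝓡 (2 * n + 1)) Φ (j p)) (hjd p v))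
  have hDp : ∀ p, ∀ a ∈ D p, p ∈ K := fun p a ha => by
    by_contra hp
    rw [hDK p hp] at ha
    exact ha
  have hker : ∀ p ∈ B, ∀ v, stdForm p v = 0 →
      lam (ι p) (sliceD ι p v) = 0 := fun p hp v hv => by
    have h1 : pullForm lam ι p v = 0 := by
      rw [hlam p hp, smul_apply, hv, smul_zero]
    exact h1
  have hC0 : ∀ x, ∀ q ∈ slicePairs ι D x, lam x q.1 = 0 ∧ lam x q.2 = 0 := by
    rintro x q ⟨p, rfl, a, ha, rfl⟩
    have hp := hKB (hDp p a ha)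
    exact ⟨hker p hp _ (hD0 p a ha).1, hker p hp _ (hD0 p a ha).2⟩
  have hcl : IsClosed (ι '' K) := (hK.image_of_continuousOn fun p hp =>
    (hιs p (hKB hp)).continuousAt.continuousWithinAt).isClosed
  suffices hfr : ∀ x, HasAdaptedFrame lam (slicePairs ι D) x by
    obtain ⟨J, hJ, hJC⟩ := h.exists_isCompatible hfr hC0
    exact ⟨J, hJ, fun p a ha => hJC (ι p) _ ⟨p, rfl, a, ha, rfl⟩⟩
  intro x
  by_cases hx : x ∉ ι '' K
  · left
    filter_upwards [hcl.isOpen_compl.mem_nhds hx] with z hz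
    rw [eq_empty_iff_forall_notMem]
    rintro q ⟨p, rfl, a, ha, rfl⟩
    exact hz ⟨p, hDp p a ha, rfl⟩
  right
  rw [not_not] at hx
  obtain ⟨p₀, hp₀, rfl⟩ := hx
  have hp₀B := hKB hp₀
  obtain ⟨e₁, e₂, he, hev⟩ := hD p₀ hp₀
  set c := extChartAt (𝓡 (2 * n + 1)) (ι p₀) with hc
  have hy₀ : c (ι p₀) ∈ c.target := mem_extChartAt_target _
  let G : Euc (2 * n + 1) → (ℂ × ℝ) × W := fun y => Φ.symm (c.symm y)
  have hG0 : G (c (ι p₀)) = j p₀ := by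
    have h1 : c.symm (c (ι p₀)) = ι p₀ := c.left_inv (mem_extChartAt_source _)
    change Φ.symm (c.symm (c (ι p₀))) = j p₀
    rw [h1, hιj]
    exact Φ.left_inv (hsrc p₀ hp₀B)
  have hιt : ι p₀ ∈ Φ.target := by
    rw [hιj]
    exact Φ.map_source (hsrc p₀ hp₀B)
  have hGs : ∀ᶠ y in 𝓝 (c (ι p₀)), y ∈ c.target ∧ c.symm y ∈ Φ.target ∧ ContDiffAt ℝ ∞ G y := by
    have hct : IsOpen c.target := isOpen_extChartAt_target _
    have hcont : ContinuousAt c.symm (c (ι p₀)) := continuousAt_extChartAt_symm _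
    have h2 : ∀ᶠ y in 𝓝 (c (ι p₀)), c.symm y ∈ Φ.target := by
      refine hcont.eventually (Φ.open_target.mem_nhds ?_)
      rw [c.left_inv (mem_extChartAt_source _)]
      exact hιt
    filter_upwards [hct.mem_nhds hy₀, h2] with y hy h2
    refine ⟨hy, h2, ?_⟩
    rw [← contMDiffAt_iff_contDiffAt]
    exact ContMDiffAt.comp y (hs.contMDiffAt (Φ.open_target.mem_nhds h2))
      ((contMDiffOn_extChartAt_symm (ι p₀)).contMDiffAt (hct.mem_nhds hy))
  have hGc : ContinuousAt G (c (ι p₀)) := hGs.self_of_nhds.2.2.continuousAt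
  have hcΦ : ∀ᶠ q in 𝓝 (j p₀), ContDiffAt ℝ ∞ (c ∘ Φ) q := by
    have h1 : ∀ᶠ q in 𝓝 (j p₀), Φ q ∈ c.source := by
      refine (hΦa p₀ hp₀B).continuousAt.eventually ?_
      refine (isOpen_extChartAt_source (I := 𝓡 (2 * n + 1)) (ι p₀)).mem_nhds ?_
      rw [hιj]
      exact mem_extChartAt_source _
    filter_upwards [h1, Φ.open_source.mem_nhds (hsrc p₀ hp₀B)] with q h1 h2
    rw [← contMDiffAt_iff_contDiffAt]
    refine ContMDiffAt.comp q (contMDiffAt_extChartAt' ?_)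
      (hΦ.contMDiffAt (Φ.open_source.mem_nhds h2))
    rwa [← extChartAt_source (𝓡 (2 * n + 1))]
  -- The frame of the slice, spread over the tube independently of the W-coordinate and read in the
  -- chart.
  let T : (ℂ × ℝ → ℂ × ℝ) → Euc (2 * n + 1) → Euc (2 * n + 1) := fun e y =>
    fderiv ℝ (c ∘ Φ) (G y) (e (G y).1, 0)
  have hT : ∀ e : ℂ × ℝ → ℂ × ℝ, (∀ᶠ p in 𝓝 p₀, ContDiffAt ℝ ∞ e p) →
      ∀ᶠ y in 𝓝 (c (ι p₀)), ContDiffAt ℝ ∞ (T e) y := by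
    intro e hes
    have h1 : Tendsto (fun y => (G y).1) (𝓝 (c (ι p₀))) (𝓝 p₀) := by
      have : ContinuousAt (fun y => (G y).1) (c (ι p₀)) := continuousAt_fst.comp hGc
      have h2 := this.tendsto
      rwa [hG0] at h2
    have h3 : Tendsto G (𝓝 (c (ι p₀))) (𝓝 (j p₀)) := by
      have := hGc.tendsto
      rwa [hG0] at this
    filter_upwards [h1.eventually hes, h3.eventually hcΦ, hGs] with y h4 h5 h6
    have h7 : ContDiffAt ℝ ∞ (fun q => fderiv ℝ (c ∘ Φ) q (e q.1, 0)) (G y) :=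
      (h5.fderiv_right (m := ∞) (by simp)).clm_apply
        ((ContDiffAt.comp (g := e) (G y) h4 contDiffAt_fst).prodMk contDiffAt_const)
    exact ContDiffAt.comp (g := fun q => fderiv ℝ (c ∘ Φ) q (e q.1, 0)) y h7 h6.2.2
  have hchart : ∀ p ∈ B, ι p ∈ c.source → ∀ v, fderiv ℝ (c ∘ Φ) (j p) (v, 0) =
      chartD (ι p₀) (ι p) (sliceD ι p v) := by
    intro p hp hpc v
    rw [extChartAt_source] at hpc
    have h1 := fderiv_chart_comp (Ψ := Φ) (y := j p) ((hΦa p hp).mdifferentiableAt (by simp))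
      (x₁ := ι p₀) (by rw [hιj] at hpc ⊢; exact hpc) (v, 0)
    refine h1.trans ?_
    refine Eq.trans ?_ (congrArg (chartD (ι p₀) (ι p)) (hιd p hp v)).symm
    rw [hιj]
    rfl
  have hGι : ∀ p ∈ B, ι p ∈ c.source → G (c (ι p)) = j p := by
    intro p hp hpc
    have h1 : c.symm (c (ι p)) = ι p := c.left_inv hpc
    change Φ.symm (c.symm (c (ι p))) = j p
    rw [h1, hιj]
    exact Φ.left_inv (hsrc p hp)
  have hT0 : ∀ e : ℂ × ℝ → ℂ × ℝ, ∀ p ∈ B, ι p ∈ c.source → T e (c (ι p)) =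
      chartD (ι p₀) (ι p) (sliceD ι p (e p)) := by
    intro e p hp hpc
    rw [← hchart p hp hpc]
    simp only [T, hGι p hp hpc]
    rfl
  refine ⟨T e₁, T e₂, ?_, ?_⟩
  · rw [hT0 e₁ p₀ hp₀B (mem_extChartAt_source _), hT0 e₂ p₀ hp₀B (mem_extChartAt_source _)]
    have h1 : c.symm (c (ι p₀)) = ι p₀ := c.left_inv (mem_extChartAt_source _)
    have h2 : ∀ v w, dform (chartForm lam (ι p₀)) (c (ι p₀)) (chartD (ι p₀) (ι p₀) v)
        (chartD (ι p₀) (ι p₀) w) = extD lam (ι p₀) v w := by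
      intro v w
      have := h.1.dform_chartD (x₀ := ι p₀) hy₀ v w
      rwa [← hc, h1] at this
    rw [h2]
    have h3 := h.1.extD_mfderiv (hιs p₀ hp₀B) (e₁ p₀) (e₂ p₀)
    refine lt_of_lt_of_eq he (Eq.trans ?_ h3.symm)
    congr 2
    refine dform_congr ?_
    filter_upwards [hB.mem_nhds hp₀B] with p hp using (hlam p hp).symm
  · have h1 : Tendsto (fun y => (G y).1) (𝓝 (c (ι p₀))) (𝓝 p₀) := by
      have : ContinuousAt (fun y => (G y).1) (c (ι p₀)) := continuousAt_fst.comp hGc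
      have h2 := this.tendsto
      rwa [hG0] at h2
    filter_upwards [hT e₁ (hev.mono fun p hp => hp.1), hT e₂ (hev.mono fun p hp => hp.2.1),
      h1.eventually hev, hGs] with y h2 h3 h4 h5
    refine ⟨h2, h3, fun q hq => ⟨(hC0 _ q hq).1, (hC0 _ q hq).2, ?_⟩⟩
    obtain ⟨p, hpy, a, ha, rfl⟩ := hq
    have hp := hKB (hDp p a ha)
    have hpc : ι p ∈ c.source := by
      rw [hpy]
      exact c.map_target h5.1
    have hyp : y = c (ι p) := by rw [hpy, c.right_inv h5.1]
    subst hyp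
    have hG1 : (G (c (ι p))).1 = p := by rw [hGι p hp hpc]
    rw [hG1] at h4
    obtain ⟨c₁, c₂, hc₁, hc₂⟩ := h4.2.2 a ha
    refine ⟨c₁, c₂, ?_, ?_⟩
    · have h6 : chartI (ι p₀) (c (ι p)) (chartD (ι p₀) (ι p)
          (sliceD ι p (c₁ • e₁ p + c₂ • e₂ p))) = sliceD ι p a.1 := by
        rw [chartI_comp_chartD hpc, hc₁]
      rw [hT0 e₁ p hp hpc, hT0 e₂ p hp hpc, ← h6]
      simp only [map_add, map_smul]
    · have h6 : chartI (ι p₀) (c (ι p)) (chartD (ι p₀) (ι p)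
          (sliceD ι p (c₁ • e₂ p - c₂ • e₁ p))) = sliceD ι p a.2 := by
        rw [chartI_comp_chartD hpc, hc₂]
      rw [hT0 e₁ p hp hpc, hT0 e₂ p hp hpc, ← h6]
      simp only [map_sub, map_smul]

/-- A contact manifold of dimension at least `3` contains a given compact piece of `ℂ × ℝ`, with a
prescribed contact form, Reeb field and (partially) complex structure. -/
theorem IsContactForm.exists_model_slice [SigmaCompactSpace M] {α : OneForm (2 * n + 1) M}
    (h : IsContactForm α) (hn : 1 ≤ n) (x₀ : M) {R : ℝ} {F : ℂ × ℝ → ℝ} (hF : ContDiff ℝ ∞ F)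
    {X : ℂ × ℝ → ℂ × ℝ} (hX : ContDiff ℝ ∞ X) (hX1 : ∀ p, Real.exp (F p) * stdForm p (X p) = 1)
    (hX2 : ∀ p v, dform (fun p => Real.exp (F p) • stdForm p) p (X p) v = 0)
    {K : Set (ℂ × ℝ)} (hK : IsCompact K) (hKR : K ⊆ Metric.ball 0 R)
    {D : ℂ × ℝ → Set ((ℂ × ℝ) × (ℂ × ℝ))} (hDK : ∀ p ∉ K, D p = ∅)
    (hD0 : ∀ p, ∀ a ∈ D p, stdForm p a.1 = 0 ∧ stdForm p a.2 = 0)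
    (hD : ∀ p ∈ K, HasModelFrame F D p) :
    ∃ (k : M → ℝ) (J : TangentEnd (2 * n + 1) M) (ι : ℂ × ℝ → M), (∀ x, 0 < k x) ∧
      IsContactForm (fun x => k x • α x) ∧ IsCompatible (fun x => k x • α x) J ∧
      InjOn ι (Metric.ball 0 R) ∧ (∀ p ∈ Metric.ball 0 R,
        ContMDiffAt 𝓘(ℝ, ℂ × ℝ) (𝓡 (2 * n + 1)) ∞ ι p ∧ Function.Injective (sliceD (n := n) ι p) ∧
        pullForm (fun x => k x • α x) ι p = Real.exp (F p) • stdForm p ∧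
        reeb (fun x => k x • α x) (ι p) = sliceD ι p (X p)) ∧
      ∀ p, ∀ a ∈ D p, J (ι p) (sliceD ι p a.1) = sliceD ι p a.2 := by
  obtain ⟨W, Φ, hΦ, hs, hb⟩ := h.exists_slice_chart hn x₀ (R + 1)
  obtain ⟨k, hk, hk0, hkp⟩ := h.exists_rescaling hΦ hs hb (lt_add_one R) hF hX hX1 hX2
  have hlam : IsContactForm fun x => k x • α x := h.smul hk fun x => (hk0 x).ne'
  let j : ℂ × ℝ → (ℂ × ℝ) × W := fun p => (p, 0)
  have hj : ContDiff ℝ ∞ j := by fun_prop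
  have hjd : ∀ p v, fderiv ℝ j p v = (v, 0) := fun p v => by
    have : fderiv ℝ j p = ContinuousLinearMap.inl ℝ (ℂ × ℝ) W :=
      (ContinuousLinearMap.inl ℝ (ℂ × ℝ) W).fderiv
    rw [this]; rfl
  have hsrc : ∀ p ∈ Metric.ball (0 : ℂ × ℝ) R, (p, 0) ∈ Φ.source := fun p hp =>
    (hb p (Metric.ball_subset_ball (by linarith) hp)).1
  have hΦa : ∀ p ∈ Metric.ball (0 : ℂ × ℝ) R,
      ContMDiffAt 𝓘(ℝ, (ℂ × ℝ) × W) (𝓡 (2 * n + 1)) ∞ Φ (j p) := fun p hp =>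
    hΦ.contMDiffAt (Φ.open_source.mem_nhds (hsrc p hp))
  have hιd : ∀ p ∈ Metric.ball (0 : ℂ × ℝ) R, ∀ v, sliceD (n := n) (fun p => Φ (p, 0)) p v =
      mfderiv 𝓘(ℝ, (ℂ × ℝ) × W) (𝓡 (2 * n + 1)) Φ (j p) (v, 0) := fun p hp v =>
    (mfderiv_comp_vec (Ψ := Φ) (g := j) (y := p) ((hΦa p hp).mdifferentiableAt (by simp))
      (hj.differentiable (by simp) p) v).trans
      (congrArg (mfderiv 𝓘(ℝ, (ℂ × ℝ) × W) (𝓡 (2 * n + 1)) Φ (j p)) (hjd p v))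
  have hpf : ∀ p ∈ Metric.ball (0 : ℂ × ℝ) R, pullForm (fun x => k x • α x) (fun p => Φ (p, 0)) p =
      Real.exp (F p) • stdForm p := fun p hp => by
    refine ContinuousLinearMap.ext fun v => ?_
    refine Eq.trans ?_ ((hkp p (Metric.ball_subset_closedBall hp)).1 v)
    exact congrArg (k (Φ (p, 0)) • α (Φ (p, 0))) (hιd p hp v)
  obtain ⟨J, hJ, hJD⟩ := exists_isCompatible_of_slice hlam hΦ hs Metric.isOpen_ball hK hKR
    (F := F) rfl hsrc hpf hDK hD0 hD
  refine ⟨k, J, fun p => Φ (p, 0), hk0, hlam, hJ, fun p hp q hq hpq => ?_, fun p hp => ⟨?_, ?_,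
    hpf p hp, ?_⟩, hJD⟩
  · exact (Prod.mk.inj (Φ.injOn (hsrc p hp) (hsrc q hq) hpq)).1
  · exact ContMDiffAt.comp p (hΦa p hp) hj.contMDiff.contMDiffAt
  · have h1 := (hs.contMDiffAt (Φ.open_target.mem_nhds (Φ.map_source (hsrc p hp)))).mdifferentiableAt
      (n := ∞) (by simp)
    have h2 := mfderiv_comp (j p) h1 ((hΦa p hp).mdifferentiableAt (by simp))
    have h4 : Φ.symm ∘ Φ =ᶠ[𝓝 (j p)] id := by
      filter_upwards [Φ.open_source.mem_nhds (hsrc p hp)] with z hz using Φ.left_inv hz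
    rw [h4.mfderiv_eq, mfderiv_id] at h2
    intro v w hvw
    have h5 := fun u : (ℂ × ℝ) × W =>
      congrArg (fun A : (ℂ × ℝ) × W →L[ℝ] (ℂ × ℝ) × W => A u) h2
    have h6 := (hιd p hp v).symm.trans (hvw.trans (hιd p hp w))
    have h7 : ((v, 0) : (ℂ × ℝ) × W) = (w, 0) := (h5 (v, 0)).trans ((congrArg
      (mfderiv (𝓡 (2 * n + 1)) 𝓘(ℝ, (ℂ × ℝ) × W) Φ.symm (Φ (j p))) h6).trans (h5 (w, 0)).symm)
    exact (Prod.mk.inj h7).1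
  · exact (hkp p (Metric.ball_subset_closedBall hp)).2.trans (hιd p hp (X p)).symm

end Slice

/-! ### Functions that are flat at the zeros of the cosine -/

/-- The function `xᵏ exp (i c x - x²)` of `x = tan p`, extended by zero. -/
def flatTan (k : ℕ) (c : ℝ) (p : ℝ) : ℂ :=
  if Real.cos p = 0 then 0 else
    (Real.tan p : ℂ) ^ k * Complex.exp (Complex.I * c * Real.tan p - (Real.tan p : ℂ) ^ 2)

lemma flatTan_of_eq {k : ℕ} {c p : ℝ} (h : Real.cos p = 0) : flatTan k c p = 0 := if_pos h

lemma flatTan_of_ne {k : ℕ} {c p : ℝ} (h : Real.cos p ≠ 0) : flatTan k c p =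
    (Real.tan p : ℂ) ^ k * Complex.exp (Complex.I * c * Real.tan p - (Real.tan p : ℂ) ^ 2) :=
  if_neg h

lemma norm_flatTan_of_ne {k : ℕ} {c p : ℝ} (h : Real.cos p ≠ 0) :
    ‖flatTan k c p‖ = |Real.tan p| ^ k * Real.exp (-Real.tan p ^ 2) := by
  rw [flatTan_of_ne h, norm_mul, norm_pow, Complex.norm_real, Real.norm_eq_abs, Complex.norm_exp]
  congr 2
  generalize Real.tan p = x
  have : (Complex.I * c * x - (x : ℂ) ^ 2 : ℂ) =
      ((-x ^ 2 : ℝ) : ℂ) + ((c * x : ℝ) : ℂ) * Complex.I := by push_cast; ring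
  rw [this, Complex.add_re, Complex.ofReal_re, Complex.re_ofReal_mul, Complex.I_re, mul_zero,
    add_zero]

/-- The derivative of `flatTan k c`. -/
def flatTanDeriv (k : ℕ) (c : ℝ) (p : ℝ) : ℂ :=
  k * flatTan (k - 1) c p + k * flatTan (k + 1) c p + Complex.I * c * flatTan k c p +
    Complex.I * c * flatTan (k + 2) c p - 2 * flatTan (k + 1) c p - 2 * flatTan (k + 3) c p

lemma one_div_cos_sq {p : ℝ} (h : Real.cos p ≠ 0) : 1 / Real.cos p ^ 2 = 1 + Real.tan p ^ 2 := by
  rw [Real.tan_eq_sin_div_cos]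
  field_simp
  rw [add_comm]
  exact (Real.sin_sq_add_cos_sq p).symm

lemma hasDerivAt_tan' {p : ℝ} (h : Real.cos p ≠ 0) :
    HasDerivAt Real.tan (1 + Real.tan p ^ 2) p := by
  rw [← one_div_cos_sq h]
  exact Real.hasDerivAt_tan h

lemma eventually_cos_ne {p : ℝ} (h : Real.cos p ≠ 0) : ∀ᶠ q in 𝓝 p, Real.cos q ≠ 0 :=
  Real.continuous_cos.continuousAt.eventually (isOpen_ne.mem_nhds h)

lemma tendsto_flatTan_bound (k : ℕ) :
    Tendsto (fun x : ℝ => x ^ k * (1 + x ^ 2) * Real.exp (-x ^ 2)) atTop (𝓝 0) := by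
  have h := (Real.tendsto_pow_mul_exp_neg_atTop_nhds_zero k).add
    (Real.tendsto_pow_mul_exp_neg_atTop_nhds_zero (k + 2))
  rw [add_zero] at h
  refine tendsto_of_tendsto_of_tendsto_of_le_of_le' tendsto_const_nhds h ?_ ?_
  · filter_upwards [eventually_ge_atTop 0] with x hx
    positivity
  · filter_upwards [eventually_ge_atTop 1] with x hx
    have h1 : Real.exp (-x ^ 2) ≤ Real.exp (-x) := Real.exp_le_exp.2 (by nlinarith)
    have h2 : 0 ≤ x ^ k * (1 + x ^ 2) := by positivity
    calc x ^ k * (1 + x ^ 2) * Real.exp (-x ^ 2) ≤ x ^ k * (1 + x ^ 2) * Real.exp (-x) :=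
          mul_le_mul_of_nonneg_left h1 h2
      _ = _ := by ring

/-- Differentiation multiplies by 1 + tan² p and stays within the family. At a zero p of the cosine,
|cos q| ≤ |q - p| gives |q - p|⁻¹ ≤ 1 + tan² q, so the difference quotient is a polynomial in |tan
q| times a Gaussian at most, and it tends to 0. -/
lemma hasDerivAt_flatTan (k : ℕ) (c p : ℝ) :
    HasDerivAt (flatTan k c) (flatTanDeriv k c p) p := by
  by_cases h : Real.cos p = 0
  · have h0 : flatTanDeriv k c p = 0 := by simp [flatTanDeriv, flatTan_of_eq h]
    rw [h0, hasDerivAt_iff_tendsto_slope, tendsto_zero_iff_norm_tendsto_zero]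
    have hb : Tendsto (fun q => |Real.tan q| ^ k * (1 + |Real.tan q| ^ 2) *
        Real.exp (-|Real.tan q| ^ 2)) (𝓝[≠] p) (𝓝 0) :=
      (tendsto_flatTan_bound k).comp (Real.tendsto_abs_tan_of_cos_eq_zero h)
    refine tendsto_of_tendsto_of_tendsto_of_le_of_le' tendsto_const_nhds hb
      (Eventually.of_forall fun _ => norm_nonneg _) ?_
    have hne : ∀ᶠ q in 𝓝[≠] p, Real.tan q ≠ 0 := by
      have := (Real.tendsto_abs_tan_of_cos_eq_zero h).eventually (eventually_gt_atTop 0)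
      filter_upwards [this] with q hq
      exact abs_pos.1 hq
    filter_upwards [hne, self_mem_nhdsWithin] with q hq hqp
    have hcq : Real.cos q ≠ 0 := by
      intro h
      rw [Real.tan_eq_sin_div_cos, h, div_zero] at hq
      exact hq rfl
    rw [slope_def_module, flatTan_of_eq h, sub_zero, norm_smul, norm_flatTan_of_ne hcq, sq_abs,
      norm_inv, Real.norm_eq_abs]
    have h1 : |Real.cos q| ≤ |q - p| := by
      have h2 : |Real.cos q - Real.cos p| ≤ |q - p| := by
        simpa using Real.abs_cos_sub_cos_le q p
      rwa [h, sub_zero] at h2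
    have h3 : 0 < |Real.cos q| := abs_pos.2 hcq
    have h4 : |q - p|⁻¹ ≤ 1 + Real.tan q ^ 2 := by
      rw [← one_div_cos_sq hcq, ← sq_abs, one_div]
      refine inv_anti₀ (by positivity) (le_trans ?_ h1)
      rw [sq]
      exact mul_le_of_le_one_left h3.le (Real.abs_cos_le_one q)
    calc |q - p|⁻¹ * (|Real.tan q| ^ k * Real.exp (-Real.tan q ^ 2))
        ≤ (1 + Real.tan q ^ 2) * (|Real.tan q| ^ k * Real.exp (-Real.tan q ^ 2)) :=
          mul_le_mul_of_nonneg_right h4 (by positivity)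
      _ = _ := by ring
  · have h1 : HasDerivAt (fun q => (Real.tan q : ℂ)) ((1 + Real.tan p ^ 2 : ℝ) : ℂ) p :=
      (hasDerivAt_tan' h).ofReal_comp
    have h2 := (h1.pow k).mul (((h1.const_mul (Complex.I * c)).sub (h1.pow 2)).cexp)
    refine (h2.congr_of_eventuallyEq ?_).congr_deriv ?_
    · filter_upwards [eventually_cos_ne h] with q hq
      exact flatTan_of_ne hq
    · simp only [flatTanDeriv, flatTan_of_ne h, Pi.pow_apply, Pi.sub_apply]
      generalize Real.tan p = x
      push_cast
      -- For k = 0 the truncated index k - 1 is harmless, because its coefficient is zero.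
      rcases k with _ | k
      · simp
        ring
      · simp only [Nat.add_sub_cancel]
        push_cast
        ring

/-- The derivative is a linear combination of members of the same family, so the order of
differentiability goes up for all k simultaneously. -/
lemma contDiff_flatTan (k : ℕ) (c : ℝ) : ContDiff ℝ ∞ (flatTan k c) := by
  rw [contDiff_infty]
  intro n
  induction n generalizing k with
  | zero =>
    exact contDiff_zero.2 (continuous_iff_continuousAt.2 fun p =>
      (hasDerivAt_flatTan k c p).continuousAt)
  | succ n ih =>
    have hd : deriv (flatTan k c) = flatTanDeriv k c := funext fun p => (hasDerivAt_flatTan k c p).deriv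
    push_cast
    rw [contDiff_succ_iff_deriv]
    refine ⟨fun p => (hasDerivAt_flatTan k c p).differentiableAt, by simp, ?_⟩
    rw [hd]
    exact (((((contDiff_const.mul (ih _)).add (contDiff_const.mul (ih _))).add
      (contDiff_const.mul (ih _))).add (contDiff_const.mul (ih _))).sub
      (contDiff_const.mul (ih _))).sub (contDiff_const.mul (ih _))

/-- `exp (-tan² p)`. -/
def flatM (p : ℝ) : ℝ := (flatTan 0 0 p).re

/-- `(1 + tan² p) exp (-tan² p)`. -/
def flatS (p : ℝ) : ℝ := (flatTan 0 0 p).re + (flatTan 2 0 p).re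

/-- `cos (tan p) exp (-tan² p)`. -/
def flatC (p : ℝ) : ℝ := (flatTan 0 1 p).re

/-- `sin (tan p) exp (-tan² p)`. -/
def flatD (p : ℝ) : ℝ := (flatTan 0 1 p).im

lemma contDiff_flatS : ContDiff ℝ ∞ flatS :=
  (Complex.reCLM.contDiff.comp (contDiff_flatTan 0 0)).add
    (Complex.reCLM.contDiff.comp (contDiff_flatTan 2 0))
lemma contDiff_flatC : ContDiff ℝ ∞ flatC := Complex.reCLM.contDiff.comp (contDiff_flatTan 0 1)
lemma contDiff_flatD : ContDiff ℝ ∞ flatD := Complex.imCLM.contDiff.comp (contDiff_flatTan 0 1)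

section

variable {p : ℝ} (h : Real.cos p ≠ 0)
include h

lemma flatM_of_ne : flatM p = Real.exp (-Real.tan p ^ 2) := by
  rw [flatM, flatTan_of_ne h]
  have : (Real.tan p : ℂ) ^ 0 * Complex.exp (Complex.I * (0 : ℝ) * Real.tan p - (Real.tan p : ℂ) ^ 2)
      = ((Real.exp (-Real.tan p ^ 2) : ℝ) : ℂ) := by
    push_cast
    simp
  rw [this, Complex.ofReal_re]

lemma flatS_of_ne : flatS p = (1 + Real.tan p ^ 2) * flatM p := by
  rw [flatM_of_ne h]
  have h1 : flatTan 2 0 p = ((Real.tan p ^ 2 * Real.exp (-Real.tan p ^ 2) : ℝ) : ℂ) := by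
    rw [flatTan_of_ne h]
    push_cast
    simp
  have h2 := flatM_of_ne h
  rw [flatM] at h2
  rw [flatS, h2, h1, Complex.ofReal_re]
  ring

lemma flatTan_one_eq : flatTan 0 1 p =
    (flatM p : ℂ) * (Complex.cos (Real.tan p) + Complex.sin (Real.tan p) * Complex.I) := by
  rw [flatM_of_ne h, flatTan_of_ne h, ← Complex.exp_mul_I]
  push_cast
  rw [← Complex.exp_add]
  simp only [pow_zero, one_mul, mul_one]
  congr 1
  ring

lemma flatC_of_ne : flatC p = flatM p * Real.cos (Real.tan p) := by
  rw [flatC, flatTan_one_eq h, ← Complex.ofReal_cos, ← Complex.ofReal_sin]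
  generalize Real.tan p = x
  simp [-Complex.ofReal_cos, -Complex.ofReal_sin]

lemma flatD_of_ne : flatD p = flatM p * Real.sin (Real.tan p) := by
  rw [flatD, flatTan_one_eq h, ← Complex.ofReal_cos, ← Complex.ofReal_sin]
  generalize Real.tan p = x
  simp [-Complex.ofReal_cos, -Complex.ofReal_sin]

lemma flatM_pos : 0 < flatM p := by
  rw [flatM_of_ne h]
  exact Real.exp_pos _

lemma flatS_pos : 0 < flatS p := by
  rw [flatS_of_ne h]
  have := flatM_pos h
  positivity

lemma hasDerivAt_flatM : HasDerivAt flatM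
    (flatM p * (-2 * Real.tan p * (1 + Real.tan p ^ 2))) p := by
  have h1 := (((hasDerivAt_tan' h).pow 2).neg).exp
  refine (h1.congr_of_eventuallyEq ?_).congr_deriv ?_
  · filter_upwards [eventually_cos_ne h] with q hq
    exact flatM_of_ne hq
  · rw [flatM_of_ne h]
    simp

end

section

variable {p : ℝ} (h : Real.cos p = 0)
include h

lemma flatS_of_eq : flatS p = 0 := by simp [flatS, flatTan_of_eq h]
lemma flatC_of_eq : flatC p = 0 := by simp [flatC, flatTan_of_eq h]
lemma flatD_of_eq : flatD p = 0 := by simp [flatD, flatTan_of_eq h]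

lemma hasDerivAt_flatC_of_eq : HasDerivAt flatC 0 p := by
  have h1 := Complex.reCLM.hasFDerivAt.comp_hasDerivAt p (hasDerivAt_flatTan 0 1 p)
  have h0 : flatTanDeriv 0 1 p = 0 := by simp [flatTanDeriv, flatTan_of_eq h]
  rw [h0, map_zero] at h1
  exact h1

lemma hasDerivAt_flatD_of_eq : HasDerivAt flatD 0 p := by
  have h1 := Complex.imCLM.hasFDerivAt.comp_hasDerivAt p (hasDerivAt_flatTan 0 1 p)
  have h0 : flatTanDeriv 0 1 p = 0 := by simp [flatTanDeriv, flatTan_of_eq h]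
  rw [h0, map_zero] at h1
  exact h1

end

/-! ### Geometry of exp(F) (dz + x dy - y dx) -/

section StdForm

lemma contDiff_stdForm : ContDiff ℝ ∞ stdForm := by
  have h1 : ContDiff ℝ ∞ fun p : ℂ × ℝ => p.1.re := Complex.reCLM.contDiff.comp contDiff_fst
  have h2 : ContDiff ℝ ∞ fun p : ℂ × ℝ => p.1.im := Complex.imCLM.contDiff.comp contDiff_fst
  exact contDiff_const.add (((h1.smul contDiff_const).sub (h2.smul contDiff_const)).clm_comp
    contDiff_const)

lemma fderiv_stdForm (p v w : ℂ × ℝ) :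
    fderiv ℝ stdForm p v w = v.1.re * w.1.im - v.1.im * w.1.re := by
  have h0 : HasFDerivAt stdForm (fderiv ℝ stdForm p) p :=
    (contDiff_stdForm.differentiable (by simp) p).hasFDerivAt
  have h1 := h0.clm_apply (hasFDerivAt_const w p)
  have hre : HasFDerivAt (fun p : ℂ × ℝ => p.1.re) (Complex.reCLM.comp (ContinuousLinearMap.fst ℝ ℂ ℝ)) p :=
    (Complex.reCLM.comp (ContinuousLinearMap.fst ℝ ℂ ℝ)).hasFDerivAt
  have him : HasFDerivAt (fun p : ℂ × ℝ => p.1.im) (Complex.imCLM.comp (ContinuousLinearMap.fst ℝ ℂ ℝ)) p :=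
    (Complex.imCLM.comp (ContinuousLinearMap.fst ℝ ℂ ℝ)).hasFDerivAt
  have h2 := ((hre.mul_const w.1.im).sub (him.mul_const w.1.re)).const_add w.2
  have h3 := congrArg (fun A : ℂ × ℝ →L[ℝ] ℝ => A v) (h1.unique h2)
  simp at h3
  linarith

lemma dform_stdForm (p v w : ℂ × ℝ) :
    dform stdForm p v w = 2 * (v.1.re * w.1.im - v.1.im * w.1.re) := by
  rw [dform_apply, fderiv_stdForm, fderiv_stdForm]
  ring

lemma dform_exp_smul_stdForm {F : ℂ × ℝ → ℝ} {p : ℂ × ℝ} (hF : DifferentiableAt ℝ F p)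
    (v w : ℂ × ℝ) : dform (fun p => Real.exp (F p) • stdForm p) p v w =
      Real.exp (F p) * (2 * (v.1.re * w.1.im - v.1.im * w.1.re) +
        (fderiv ℝ F p v * stdForm p w - fderiv ℝ F p w * stdForm p v)) := by
  rw [dform_smul hF.exp (contDiff_stdForm.differentiable (by simp) p), dform_stdForm,
    hF.hasFDerivAt.exp.fderiv, smul_apply, smul_apply, smul_eq_mul, smul_eq_mul]
  ring

/-- The lift of a vector of `ℂ` to the kernel of the standard contact form. -/
def stdLift (q ζ : ℂ) : ℂ × ℝ := (ζ, q.im * ζ.re - q.re * ζ.im)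

lemma stdForm_stdLift (p : ℂ × ℝ) (ζ : ℂ) : stdForm p (stdLift p.1 ζ) = 0 := by
  rw [stdForm_apply]
  simp [stdLift]

/-- The horizontal part of the Reeb field of `exp F • stdForm`. -/
def reebSlope (F : ℂ × ℝ → ℝ) (p : ℂ × ℝ) : ℂ :=
  ⟨fderiv ℝ F p (stdLift p.1 Complex.I) / 2, -fderiv ℝ F p (stdLift p.1 1) / 2⟩

/-- The Reeb field of `exp F • stdForm`. -/
def modelReeb (F : ℂ × ℝ → ℝ) (p : ℂ × ℝ) : ℂ × ℝ :=
  Real.exp (-F p) • (stdLift p.1 (reebSlope F p) + (0, 1))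

lemma eq_stdLift_add (p v : ℂ × ℝ) : v = v.1.re • stdLift p.1 1 + v.1.im • stdLift p.1 Complex.I +
    stdForm p v • ((0 : ℂ), (1 : ℝ)) := by
  rw [stdForm_apply]
  refine Prod.ext (Complex.ext ?_ ?_) ?_
  · simp [stdLift]
  · simp [stdLift]
  · simp [stdLift]
    ring

lemma exp_mul_stdForm_modelReeb (F : ℂ × ℝ → ℝ) (p : ℂ × ℝ) :
    Real.exp (F p) * stdForm p (modelReeb F p) = 1 := by
  rw [modelReeb, map_smul, map_add, stdForm_stdLift, stdForm_apply]
  simp [← Real.exp_add]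

/-- Let σ be the standard form and v horizontal. The two-form on (X, v) is proportional to dσ(X, v)
- dF(v) σ(X), and the horizontal part of X, a symplectic gradient of F on the contact planes, is
chosen to cancel this. -/
lemma dform_modelReeb {F : ℂ × ℝ → ℝ} {p : ℂ × ℝ} (hF : DifferentiableAt ℝ F p) (v : ℂ × ℝ) :
    dform (fun p => Real.exp (F p) • stdForm p) p (modelReeb F p) v = 0 := by
  rw [dform_exp_smul_stdForm hF]
  have h1 := exp_mul_stdForm_modelReeb F p
  have h2 : ∀ v, fderiv ℝ F p v = v.1.re * fderiv ℝ F p (stdLift p.1 1) +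
      v.1.im * fderiv ℝ F p (stdLift p.1 Complex.I) + stdForm p v * fderiv ℝ F p (0, 1) := by
    intro v
    conv_lhs => rw [eq_stdLift_add p v]
    simp only [map_add, map_smul, smul_eq_mul]
  have h3 : (modelReeb F p).1.re = Real.exp (-F p) * (fderiv ℝ F p (stdLift p.1 Complex.I) / 2) := by
    simp [modelReeb, stdLift, reebSlope, -Complex.real_smul, Complex.smul_re]
  have h4 : (modelReeb F p).1.im = Real.exp (-F p) * (-fderiv ℝ F p (stdLift p.1 1) / 2) := by
    simp [modelReeb, stdLift, reebSlope, -Complex.real_smul, Complex.smul_im]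
  have h5 : stdForm p (modelReeb F p) = Real.exp (-F p) := by
    rw [Real.exp_neg]
    exact eq_inv_of_mul_eq_one_right h1
  rw [h2 (modelReeb F p), h2 v, h3, h4, h5]
  ring

lemma contDiff_modelReeb {F : ℂ × ℝ → ℝ} (hF : ContDiff ℝ ∞ F) : ContDiff ℝ ∞ (modelReeb F) := by
  have hd : ContDiff ℝ ∞ (fderiv ℝ F) := hF.fderiv_right (by simp)
  have hre : ContDiff ℝ ∞ fun p : ℂ × ℝ => p.1.re := Complex.reCLM.contDiff.comp contDiff_fst
  have him : ContDiff ℝ ∞ fun p : ℂ × ℝ => p.1.im := Complex.imCLM.contDiff.comp contDiff_fst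
  have hl : ∀ {g : ℂ × ℝ → ℂ}, ContDiff ℝ ∞ g → ContDiff ℝ ∞ fun p => stdLift p.1 (g p) := fun hg =>
    hg.prodMk ((him.mul (Complex.reCLM.contDiff.comp hg)).sub
      (hre.mul (Complex.imCLM.contDiff.comp hg)))
  have hs : ContDiff ℝ ∞ (reebSlope F) := by
    have h1 : ContDiff ℝ ∞ fun p => fderiv ℝ F p (stdLift p.1 Complex.I) / 2 :=
      (hd.clm_apply (hl contDiff_const)).div_const 2
    have h2 : ContDiff ℝ ∞ fun p => -fderiv ℝ F p (stdLift p.1 1) / 2 :=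
      (hd.clm_apply (hl contDiff_const)).neg.div_const 2
    exact Complex.equivRealProdCLM.symm.contDiff.comp (h1.prodMk h2)
  exact (Real.contDiff_exp.comp hF.neg).smul ((hl hs).add contDiff_const)

/-- The lift of the vector `u ∂r + v ∂z` to the kernel of the standard contact form, without
radial component in the angular direction. -/
def radLift (q : ℂ) (u v : ℝ) : ℂ × ℝ := (q * ⟨u / ‖q‖, -v / ‖q‖ ^ 2⟩, v)

lemma normSq_eq_re_im (q : ℂ) : ‖q‖ ^ 2 = q.re ^ 2 + q.im ^ 2 := by
  rw [← Complex.normSq_eq_norm_sq, Complex.normSq_apply]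
  ring

lemma stdForm_radLift {p : ℂ × ℝ} (hp : p.1 ≠ 0) (u v : ℝ) : stdForm p (radLift p.1 u v) = 0 := by
  have h : ‖p.1‖ ≠ 0 := norm_ne_zero_iff.2 hp
  have h2 := normSq_eq_re_im p.1
  rw [stdForm_apply]
  simp only [radLift, Complex.mul_re, Complex.mul_im]
  field_simp
  rw [h2]
  ring

lemma radLift_smul (q : ℂ) (c u v : ℝ) : c • radLift q u v = radLift q (c * u) (c * v) := by
  refine Prod.ext (Complex.ext ?_ ?_) ?_ <;> simp [radLift] <;> ring

/-- The contact planes are oriented by the exterior derivative. -/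
lemma dform_radLift {F : ℂ × ℝ → ℝ} {p : ℂ × ℝ} (hF : DifferentiableAt ℝ F p) (hp : p.1 ≠ 0)
    (u v u' v' : ℝ) : dform (fun p => Real.exp (F p) • stdForm p) p (radLift p.1 u v)
      (radLift p.1 u' v') = Real.exp (F p) * (2 / ‖p.1‖ * (v * u' - u * v')) := by
  have h : ‖p.1‖ ≠ 0 := norm_ne_zero_iff.2 hp
  have h2 := normSq_eq_re_im p.1
  rw [dform_exp_smul_stdForm hF, stdForm_radLift hp, stdForm_radLift hp]
  congr 1
  simp only [radLift, Complex.mul_re, Complex.mul_im, mul_zero, sub_zero, add_zero]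
  field_simp
  have h3 : ‖p.1‖ ^ 3 = ‖p.1‖ * (p.1.re ^ 2 + p.1.im ^ 2) := by rw [← h2]; ring
  rw [h3]
  ring

/-- The component in the contact planes of the rotation field. -/
def rotField (F : ℂ × ℝ → ℝ) (p : ℂ × ℝ) : ℂ × ℝ :=
  (Complex.I * p.1, 0) - (Real.exp (F p) * ‖p.1‖ ^ 2) • modelReeb F p

lemma stdForm_rot (p : ℂ × ℝ) : stdForm p (Complex.I * p.1, 0) = ‖p.1‖ ^ 2 := by
  rw [stdForm_apply, normSq_eq_re_im]
  simp
  ring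

lemma stdForm_rotField (F : ℂ × ℝ → ℝ) (p : ℂ × ℝ) : stdForm p (rotField F p) = 0 := by
  rw [rotField, map_sub, map_smul, stdForm_rot, smul_eq_mul, mul_right_comm,
    exp_mul_stdForm_modelReeb, one_mul, sub_self]

lemma contDiff_rotField {F : ℂ × ℝ → ℝ} (hF : ContDiff ℝ ∞ F) : ContDiff ℝ ∞ (rotField F) := by
  have h1 : ContDiff ℝ ∞ fun p : ℂ × ℝ => ‖p.1‖ ^ 2 := contDiff_fst.norm_sq ℝ
  have h2 : ContDiff ℝ ∞ fun p : ℂ × ℝ => (Complex.I * p.1, (0 : ℝ)) :=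
    (contDiff_const.mul contDiff_fst).prodMk contDiff_const
  exact h2.sub (((Real.contDiff_exp.comp hF).mul h1).smul (contDiff_modelReeb hF))

/-- The norm of a complex number has derivative `Re (conj q · ζ) / ‖q‖`. -/
lemma hasFDerivAt_norm_complex {q : ℂ} (hq : q ≠ 0) : HasFDerivAt (fun q : ℂ => ‖q‖)
    ((q.re / ‖q‖) • Complex.reCLM + (q.im / ‖q‖) • Complex.imCLM) q := by
  have h : ‖q‖ ≠ 0 := norm_ne_zero_iff.2 hq
  have h1 : HasFDerivAt (fun q : ℂ => q.re ^ 2 + q.im ^ 2) _ q :=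
    (Complex.reCLM.hasFDerivAt.pow 2).add (Complex.imCLM.hasFDerivAt.pow 2)
  have h2 := h1.sqrt (by
    rw [← normSq_eq_re_im]
    positivity)
  have h3 : (fun q : ℂ => ‖q‖) = fun q : ℂ => √(q.re ^ 2 + q.im ^ 2) := by
    funext q
    rw [← normSq_eq_re_im, Real.sqrt_sq (norm_nonneg _)]
  rw [h3]
  refine h2.congr_fderiv ?_
  refine ContinuousLinearMap.ext fun ζ => ?_
  rw [← normSq_eq_re_im, Real.sqrt_sq (norm_nonneg _)]
  simp
  field_simp

lemma hasFDerivAt_radial {f : ℝ × ℝ → ℝ} {p : ℂ × ℝ} (hp : p.1 ≠ 0) {gr gz : ℝ}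
    (hf : HasFDerivAt f (gr • ContinuousLinearMap.fst ℝ ℝ ℝ + gz • ContinuousLinearMap.snd ℝ ℝ ℝ)
      (‖p.1‖, p.2)) :
    HasFDerivAt (fun p : ℂ × ℝ => f (‖p.1‖, p.2))
      (gr • (((p.1.re / ‖p.1‖) • Complex.reCLM + (p.1.im / ‖p.1‖) • Complex.imCLM).comp
        (ContinuousLinearMap.fst ℝ ℂ ℝ)) + gz • ContinuousLinearMap.snd ℝ ℂ ℝ) p := by
  have h1 := ((hasFDerivAt_norm_complex hp).comp p hasFDerivAt_fst).prodMk
    (hasFDerivAt_snd (𝕜 := ℝ) (E := ℂ) (F := ℝ) (p := p))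
  have h2 := HasFDerivAt.comp (g := f) p hf h1
  refine h2.congr_fderiv ?_
  refine ContinuousLinearMap.ext fun v => ?_
  simp

/-- The rotation field of a rotationally invariant contact form. -/
lemma rotField_eq {f : ℝ × ℝ → ℝ} {p : ℂ × ℝ} (hp : p.1 ≠ 0) {gr gz : ℝ}
    (hf : HasFDerivAt f (gr • ContinuousLinearMap.fst ℝ ℝ ℝ + gz • ContinuousLinearMap.snd ℝ ℝ ℝ)
      (‖p.1‖, p.2)) :
    rotField (fun p => f (‖p.1‖, p.2)) p =
      (‖p.1‖ ^ 3 / 2) • radLift p.1 gz (-(gr + 2 / ‖p.1‖)) := by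
  have h : ‖p.1‖ ≠ 0 := norm_ne_zero_iff.2 hp
  have h2 := normSq_eq_re_im p.1
  have hd := (hasFDerivAt_radial hp hf).fderiv
  -- By rotational invariance the slope is p.1 times a quantity depending on r and z only. In the
  -- end gz and gr + 2 / r appear: the rotation field is a rotated gradient of f + 2 log r, the
  -- logarithm of the action, and vanishes at its critical points.
  have e1 : reebSlope (fun p => f (‖p.1‖, p.2)) p =
      p.1 * ⟨-gz / 2, -gr / (2 * ‖p.1‖)⟩ := by
    rw [reebSlope, hd]
    refine Complex.ext ?_ ?_
    · simp [stdLift]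
      field_simp
      ring
    · simp [stdLift]
      field_simp
      ring
  have h6 : Real.exp (f (‖p.1‖, p.2)) * Real.exp (-f (‖p.1‖, p.2)) = 1 := by
    rw [← Real.exp_add, add_neg_cancel, Real.exp_zero]
  have e2 : (Real.exp (f (‖p.1‖, p.2)) * ‖p.1‖ ^ 2) • modelReeb (fun p => f (‖p.1‖, p.2)) p =
      ‖p.1‖ ^ 2 • (stdLift p.1 (p.1 * ⟨-gz / 2, -gr / (2 * ‖p.1‖)⟩) + (0, 1)) := by
    rw [modelReeb, e1, smul_smul, mul_right_comm, h6, one_mul]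
  rw [rotField, e2, radLift_smul]
  refine Prod.ext (Complex.ext ?_ ?_) ?_
  · simp [radLift, stdLift, -Complex.real_smul, Complex.smul_re]
    field_simp
    ring
  · simp [radLift, stdLift, -Complex.real_smul, Complex.smul_im]
    field_simp
    ring
  · simp [radLift, stdLift, -Complex.real_smul]
    field_simp
    linear_combination gr * h2

end StdForm

/-! ### Functions in polar coordinates around (7, 0) -/

section Radial

/-- The distance to the point `(7, 0)` of the half-plane. -/
def torusDist (x : ℝ × ℝ) : ℝ := √((7 - x.1) ^ 2 + x.2 ^ 2)

lemma torusDist_nonneg (x : ℝ × ℝ) : 0 ≤ torusDist x := Real.sqrt_nonneg _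

lemma torusDist_sq (x : ℝ × ℝ) : torusDist x ^ 2 = (7 - x.1) ^ 2 + x.2 ^ 2 :=
  Real.sq_sqrt (by positivity)

lemma continuous_torusDist : Continuous torusDist := by
  unfold torusDist
  fun_prop

lemma contDiffAt_torusDist {x : ℝ × ℝ} (h : 0 < torusDist x) : ContDiffAt ℝ ∞ torusDist x := by
  refine ContDiffAt.sqrt ?_ ?_
  · fun_prop
  · rw [← torusDist_sq]
    positivity

lemma hasFDerivAt_torusDist {x : ℝ × ℝ} (h : 0 < torusDist x) : HasFDerivAt torusDist
    (((x.1 - 7) / torusDist x) • ContinuousLinearMap.fst ℝ ℝ ℝ +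
      (x.2 / torusDist x) • ContinuousLinearMap.snd ℝ ℝ ℝ) x := by
  have hr : HasFDerivAt (fun x : ℝ × ℝ => x.1) (ContinuousLinearMap.fst ℝ ℝ ℝ) x := hasFDerivAt_fst
  have hz : HasFDerivAt (fun x : ℝ × ℝ => x.2) (ContinuousLinearMap.snd ℝ ℝ ℝ) x := hasFDerivAt_snd
  have h1 : HasFDerivAt (fun x : ℝ × ℝ => (7 - x.1) ^ 2 + x.2 ^ 2) _ x :=
    ((hr.const_sub 7).pow 2).add (hz.pow 2)
  have h2 := h1.sqrt (by
    rw [← torusDist_sq]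
    positivity)
  refine h2.congr_fderiv ?_
  refine ContinuousLinearMap.ext fun v => ?_
  rw [← torusDist_sq, Real.sqrt_sq h.le]
  simp
  field_simp
  ring

/-- Functions of the half-plane that are affine along the circles around `(7, 0)`, up to a
logarithm. -/
def circFun (a b c k : ℝ → ℝ) (x : ℝ × ℝ) : ℝ :=
  a (torusDist x) + b (torusDist x) * x.2 + c (torusDist x) * (7 - x.1) -
    2 * k (torusDist x) * Real.log x.1

variable {a b c k : ℝ → ℝ}

/-- G collects the derivatives of the coefficients and multiplies the gradient of `torusDist`. It is
isolated because it vanishes along the spirals and on the limit circles, where the gradient then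
involves only b, c and k. -/
lemma hasFDerivAt_circFun {x : ℝ × ℝ} (hx : 0 < x.1) (h : 0 < torusDist x) {a' b' c' k' : ℝ}
    (ha : HasDerivAt a a' (torusDist x)) (hb : HasDerivAt b b' (torusDist x))
    (hc : HasDerivAt c c' (torusDist x)) (hk : HasDerivAt k k' (torusDist x)) {G : ℝ}
    (hG : G = a' + b' * x.2 + c' * (7 - x.1) - 2 * k' * Real.log x.1) :
    HasFDerivAt (circFun a b c k)
      (((x.1 - 7) / torusDist x * G - c (torusDist x) - 2 * k (torusDist x) / x.1) •
        ContinuousLinearMap.fst ℝ ℝ ℝ +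
      (x.2 / torusDist x * G + b (torusDist x)) • ContinuousLinearMap.snd ℝ ℝ ℝ) x := by
  have hρ := hasFDerivAt_torusDist h
  have h1 := ha.comp_hasFDerivAt x hρ
  have h2 := (hb.comp_hasFDerivAt x hρ).mul (hasFDerivAt_snd (𝕜 := ℝ) (E := ℝ) (F := ℝ) (p := x))
  have h3 := (hc.comp_hasFDerivAt x hρ).mul
    ((hasFDerivAt_fst (𝕜 := ℝ) (E := ℝ) (F := ℝ) (p := x)).const_sub 7)
  have h4 := ((hk.comp_hasFDerivAt x hρ).const_mul 2).mul
    ((hasFDerivAt_fst (𝕜 := ℝ) (E := ℝ) (F := ℝ) (p := x)).log hx.ne')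
  refine (((h1.add h2).add h3).sub h4).congr_fderiv ?_
  refine ContinuousLinearMap.ext fun v => ?_
  subst hG
  simp
  field_simp
  ring

/-- The function on `ℂ × ℝ` given by `circFun`. -/
def circFunC (a b c k : ℝ → ℝ) (p : ℂ × ℝ) : ℝ := circFun a b c k (‖p.1‖, p.2)

lemma circFun_eq_zero {x : ℝ × ℝ} (h : a (torusDist x) = 0 ∧ b (torusDist x) = 0 ∧
    c (torusDist x) = 0 ∧ k (torusDist x) = 0) : circFun a b c k x = 0 := by
  simp [circFun, h.1, h.2.1, h.2.2.1, h.2.2.2]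

lemma seven_le_torusDist (z : ℝ) : 7 ≤ torusDist (0, z) := by
  refine Real.le_sqrt_of_sq_le ?_
  simp
  positivity

/-- The distance is singular at (7, 0), and ‖p.1‖ and the logarithm are singular on the axis. All
coefficients vanish near both, as the axis has distance at least 7. -/
lemma contDiff_circFunC (ha : ContDiff ℝ ∞ a) (hb : ContDiff ℝ ∞ b) (hc : ContDiff ℝ ∞ c)
    (hk : ContDiff ℝ ∞ k)
    (h0 : ∀ p, p ≤ 1 ∨ 13 / 2 ≤ p → a p = 0 ∧ b p = 0 ∧ c p = 0 ∧ k p = 0) :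
    ContDiff ℝ ∞ (circFunC a b c k) := by
  rw [contDiff_iff_contDiffAt]
  intro p
  have hcont : Continuous fun p : ℂ × ℝ => torusDist (‖p.1‖, p.2) :=
    continuous_torusDist.comp (by fun_prop)
  by_cases h1 : torusDist (‖p.1‖, p.2) < 1 ∨ 13 / 2 < torusDist (‖p.1‖, p.2)
  · have h2 : circFunC a b c k =ᶠ[𝓝 p] fun _ => 0 := by
      rcases h1 with h1 | h1
      · filter_upwards [hcont.continuousAt.eventually (gt_mem_nhds h1)] with q hq
        exact circFun_eq_zero (h0 _ (Or.inl (le_of_lt hq)))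
      · filter_upwards [hcont.continuousAt.eventually (lt_mem_nhds h1)] with q hq
        exact circFun_eq_zero (h0 _ (Or.inr (le_of_lt hq)))
    exact contDiffAt_const.congr_of_eventuallyEq h2
  · push Not at h1
    have hρ : 0 < torusDist (‖p.1‖, p.2) := by linarith [h1.1]
    have hp : p.1 ≠ 0 := by
      intro h
      rw [h, norm_zero] at h1
      linarith [seven_le_torusDist p.2, h1.2]
    have h2 : ContDiffAt ℝ ∞ (fun p : ℂ × ℝ => ‖p.1‖) p := contDiffAt_fst.norm ℝ hp
    have h3 : ContDiffAt ℝ ∞ (fun p : ℂ × ℝ => torusDist (‖p.1‖, p.2)) p :=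
      ContDiffAt.comp (g := torusDist) p (contDiffAt_torusDist hρ) (h2.prodMk contDiffAt_snd)
    exact (((ha.contDiffAt.comp p h3).add ((hb.contDiffAt.comp p h3).mul contDiffAt_snd)).add
      ((hc.contDiffAt.comp p h3).mul (contDiffAt_const.sub h2))).sub
      ((contDiffAt_const.mul (hk.contDiffAt.comp p h3)).mul (h2.log (norm_ne_zero_iff.2 hp)))

end Radial

/-! ### Cutoff functions and the integral of `flatS` -/

section Cutoff

/-- A smooth cutoff function: `1` up to `a`, and `0` from `a + 1 / 2` on. -/
def cutoff (a p : ℝ) : ℝ := 1 - Real.smoothTransition (2 * (p - a))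

lemma contDiff_cutoff (a : ℝ) : ContDiff ℝ ∞ (cutoff a) :=
  contDiff_const.sub (Real.smoothTransition.contDiff.comp (by fun_prop))

lemma cutoff_eq_one {a p : ℝ} (h : p ≤ a) : cutoff a p = 1 := by
  rw [cutoff, Real.smoothTransition.zero_of_nonpos (by linarith), sub_zero]

lemma cutoff_eq_zero {a p : ℝ} (h : a + 1 / 2 ≤ p) : cutoff a p = 0 := by
  rw [cutoff, Real.smoothTransition.one_of_one_le (by linarith), sub_self]

lemma cutoff_nonneg (a p : ℝ) : 0 ≤ cutoff a p := sub_nonneg.2 (Real.smoothTransition.le_one _)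

lemma cutoff_le_one (a p : ℝ) : cutoff a p ≤ 1 :=
  sub_le_self _ (Real.smoothTransition.nonneg _)

lemma hasDerivAt_cutoff (a p : ℝ) : HasDerivAt (cutoff a) (deriv (cutoff a) p) p :=
  ((contDiff_cutoff a).differentiable (by simp) p).hasDerivAt

lemma antitone_cutoff (a : ℝ) : Antitone (cutoff a) := fun _ _ h =>
  sub_le_sub_left (Real.smoothTransition.monotone (by linarith)) 1

lemma deriv_cutoff_nonpos (a p : ℝ) : deriv (cutoff a) p ≤ 0 := (antitone_cutoff a).deriv_nonpos

lemma deriv_cutoff_of_lt {a p : ℝ} (h : p < a) : deriv (cutoff a) p = 0 := by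
  have : cutoff a =ᶠ[𝓝 p] fun _ => 1 := by
    filter_upwards [gt_mem_nhds h] with q hq using cutoff_eq_one (le_of_lt hq)
  rw [this.deriv_eq, deriv_const]

lemma deriv_cutoff_of_gt {a p : ℝ} (h : a + 1 / 2 < p) : deriv (cutoff a) p = 0 := by
  have : cutoff a =ᶠ[𝓝 p] fun _ => 0 := by
    filter_upwards [lt_mem_nhds h] with q hq using cutoff_eq_zero (le_of_lt hq)
  rw [this.deriv_eq, deriv_const]

/-- A smooth cutoff function: `0` up to `1`, and `1` from `3 / 2` on. -/
def cutin (p : ℝ) : ℝ := 1 - cutoff 1 p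

lemma contDiff_cutin : ContDiff ℝ ∞ cutin := contDiff_const.sub (contDiff_cutoff 1)

lemma cutin_eq_zero {p : ℝ} (h : p ≤ 1) : cutin p = 0 := by rw [cutin, cutoff_eq_one h, sub_self]

lemma cutin_eq_one {p : ℝ} (h : 3 / 2 ≤ p) : cutin p = 1 := by
  rw [cutin, cutoff_eq_zero (by linarith), sub_zero]

/-- The integral of `flatS` from `p` to `13 / 2`. -/
def tailS (p : ℝ) : ℝ := ∫ x in p..(13 / 2), flatS x

lemma hasDerivAt_tailS (p : ℝ) : HasDerivAt tailS (-flatS p) p :=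
  intervalIntegral.integral_hasDerivAt_left
    (contDiff_flatS.continuous.intervalIntegrable _ _)
    (contDiff_flatS.continuous.stronglyMeasurableAtFilter _ _)
    contDiff_flatS.continuous.continuousAt

lemma contDiff_tailS : ContDiff ℝ ∞ tailS := by
  rw [contDiff_infty_iff_deriv]
  refine ⟨fun p => (hasDerivAt_tailS p).differentiableAt, ?_⟩
  rw [funext fun p => (hasDerivAt_tailS p).deriv]
  exact contDiff_flatS.neg

lemma flatS_nonneg (p : ℝ) : 0 ≤ flatS p := by
  by_cases h : Real.cos p = 0
  · rw [flatS_of_eq h]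
  · exact (flatS_pos h).le

lemma tailS_nonneg {p : ℝ} (h : p ≤ 13 / 2) : 0 ≤ tailS p :=
  intervalIntegral.integral_nonneg h fun _ _ => flatS_nonneg _

lemma antitone_tailS : Antitone tailS :=
  antitone_of_deriv_nonpos (contDiff_tailS.differentiable (by simp)) fun p => by
    rw [(hasDerivAt_tailS p).deriv]
    exact neg_nonpos.2 (flatS_nonneg p)

end Cutoff

/-! ### The model contact form -/

section Model

/-- The coefficients of the logarithm of the model contact form. -/
def coefK (p : ℝ) : ℝ := cutin p * cutoff 6 p
-- The cutoffs are staggered. `cutin` is complete at 3/2 < π/2. The oscillating terms B and C are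
-- switched off between 5 and 11/2, where the curve still follows φ = tan ρ and they cancel on it.
-- The curve is straightened between 11/2 and 6. Then A and K are switched off between 6 and 13/2,
-- on the straight part.
def coefA (p : ℝ) : ℝ := coefK p * tailS p
-- With (7 - r, -z) = ρ (cos φ, sin φ), the terms of B and C together give M(ρ) sin(tan ρ - φ), M =
-- `flatM`, for 3/2 ≤ ρ ≤ 5 with cos ρ ≠ 0. The logarithmic term cancels 2 log r in the logarithm of
-- the action, which becomes `tailS` ρ + M(ρ) sin(tan ρ - φ).
def coefB (p : ℝ) : ℝ := cutin p / p * (cutoff 5 p * flatC p)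
def coefC (p : ℝ) : ℝ := cutin p / p * (cutoff 5 p * flatD p)

lemma contDiff_cutin_div : ContDiff ℝ ∞ fun p => cutin p / p := by
  rw [contDiff_iff_contDiffAt]
  intro p
  by_cases h : p = 0
  · refine (contDiffAt_const (c := (0 : ℝ))).congr_of_eventuallyEq ?_
    subst h
    filter_upwards [gt_mem_nhds (zero_lt_one (α := ℝ))] with q hq
    rw [cutin_eq_zero (le_of_lt hq), zero_div]
  · exact contDiff_cutin.contDiffAt.div contDiffAt_id h

lemma contDiff_coefK : ContDiff ℝ ∞ coefK := contDiff_cutin.mul (contDiff_cutoff 6)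
lemma contDiff_coefA : ContDiff ℝ ∞ coefA := contDiff_coefK.mul contDiff_tailS
lemma contDiff_coefB : ContDiff ℝ ∞ coefB :=
  contDiff_cutin_div.mul ((contDiff_cutoff 5).mul contDiff_flatC)
lemma contDiff_coefC : ContDiff ℝ ∞ coefC :=
  contDiff_cutin_div.mul ((contDiff_cutoff 5).mul contDiff_flatD)

lemma coef_eq_zero (p : ℝ) (h : p ≤ 1 ∨ 13 / 2 ≤ p) :
    coefA p = 0 ∧ coefB p = 0 ∧ coefC p = 0 ∧ coefK p = 0 := by
  have hK : coefK p = 0 := by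
    rcases h with h | h
    · rw [coefK, cutin_eq_zero h, zero_mul]
    · rw [coefK, cutoff_eq_zero (by linarith), mul_zero]
  refine ⟨by rw [coefA, hK, zero_mul], ?_, ?_, hK⟩
  · rcases h with h | h
    · rw [coefB, cutin_eq_zero h, zero_div, zero_mul]
    · rw [coefB, cutoff_eq_zero (by linarith), zero_mul, mul_zero]
  · rcases h with h | h
    · rw [coefC, cutin_eq_zero h, zero_div, zero_mul]
    · rw [coefC, cutoff_eq_zero (by linarith), zero_mul, mul_zero]

/-- The logarithm of the model contact form, in the half-plane. -/
def modelF₂ : ℝ × ℝ → ℝ := circFun coefA coefB coefC coefK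

/-- The logarithm of the ratio of the model contact form and the standard contact form. -/
def modelF (p : ℂ × ℝ) : ℝ := modelF₂ (‖p.1‖, p.2)

lemma contDiff_modelF : ContDiff ℝ ∞ modelF :=
  contDiff_circFunC contDiff_coefA contDiff_coefB contDiff_coefC contDiff_coefK coef_eq_zero

lemma coefK_of_mem {p : ℝ} (h : 3 / 2 ≤ p) : coefK p = cutoff 6 p := by
  rw [coefK, cutin_eq_one h, one_mul]

lemma coefB_of_mem {p : ℝ} (h : 3 / 2 ≤ p) : coefB p = cutoff 5 p * flatC p / p := by
  rw [coefB, cutin_eq_one h]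
  ring

lemma coefC_of_mem {p : ℝ} (h : 3 / 2 ≤ p) : coefC p = cutoff 5 p * flatD p / p := by
  rw [coefC, cutin_eq_one h]
  ring

end Model

/-! ### The profile curve, its time and its action -/

section Curve

/-- The primitive of `exp (u²)`. -/
def expSqInt (u : ℝ) : ℝ := ∫ v in (0 : ℝ)..u, Real.exp (v ^ 2)

lemma hasDerivAt_expSqInt (u : ℝ) : HasDerivAt expSqInt (Real.exp (u ^ 2)) u := by
  have hc : Continuous fun v : ℝ => Real.exp (v ^ 2) := by fun_prop
  exact intervalIntegral.integral_hasDerivAt_right (hc.intervalIntegrable _ _)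
    (hc.stronglyMeasurableAtFilter _ _) hc.continuousAt

lemma contDiff_expSqInt : ContDiff ℝ ∞ expSqInt := by
  rw [contDiff_infty_iff_deriv]
  refine ⟨fun p => (hasDerivAt_expSqInt p).differentiableAt, ?_⟩
  rw [funext fun p => (hasDerivAt_expSqInt p).deriv]
  exact Real.contDiff_exp.comp (contDiff_id.pow 2)

lemma monotone_expSqInt_sub : Monotone fun u => expSqInt u - u := by
  have h : ∀ u, HasDerivAt (fun u => expSqInt u - u) (Real.exp (u ^ 2) - 1) u := fun u =>
    (hasDerivAt_expSqInt u).sub (hasDerivAt_id u)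
  refine monotone_of_deriv_nonneg (fun u => (h u).differentiableAt) fun u => ?_
  rw [(h u).deriv]
  linarith [Real.add_one_le_exp (u ^ 2), sq_nonneg u]

lemma expSqInt_zero : expSqInt 0 = 0 := intervalIntegral.integral_same

lemma le_expSqInt {u : ℝ} (h : 0 ≤ u) : u ≤ expSqInt u := by
  have := monotone_expSqInt_sub h
  simp only [expSqInt_zero] at this
  linarith

lemma expSqInt_le {u : ℝ} (h : u ≤ 0) : expSqInt u ≤ u := by
  have := monotone_expSqInt_sub h
  simp only [expSqInt_zero] at this
  linarith

lemma tendsto_expSqInt_atTop : Tendsto expSqInt atTop atTop :=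
  tendsto_atTop_mono' _ ((eventually_ge_atTop 0).mono fun _ => le_expSqInt) tendsto_id

lemma tendsto_expSqInt_atBot : Tendsto expSqInt atBot atBot :=
  tendsto_atBot_mono' _ ((eventually_le_atBot 0).mono fun _ => expSqInt_le) tendsto_id

/-- The angle along the profile curve. -/
def profAngle (p : ℝ) : ℝ := cutoff (11 / 2) p * Real.tan p

/-- The profile curve, parametrized by the distance to `(7, 0)`. -/
def profCurve (p : ℝ) : ℝ × ℝ := (7 - p * Real.cos (profAngle p), -(p * Real.sin (profAngle p)))

/-- The time along the profile curve. -/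
def profTime (p : ℝ) : ℝ :=
  cutoff 5 p * (1 - expSqInt (Real.tan p)) + (1 - cutoff 5 p) * Real.log (7 - p)

lemma torusDist_profCurve {p : ℝ} (h : 0 ≤ p) : torusDist (profCurve p) = p := by
  rw [torusDist, profCurve]
  have : (7 - (7 - p * Real.cos (profAngle p))) ^ 2 + (-(p * Real.sin (profAngle p))) ^ 2 = p ^ 2 := by
    have := Real.sin_sq_add_cos_sq (profAngle p)
    linear_combination p ^ 2 * this
  rw [this, Real.sqrt_sq h]

lemma profCurve_fst_pos {p : ℝ} (h : 0 ≤ p) (h7 : p < 7) : 0 < (profCurve p).1 := by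
  have := Real.cos_le_one (profAngle p)
  simp only [profCurve]
  nlinarith

lemma contDiffAt_tan' {p : ℝ} (h : Real.cos p ≠ 0) : ContDiffAt ℝ ∞ Real.tan p :=
  Real.contDiffAt_tan.2 h

lemma contDiffAt_profAngle {p : ℝ} (h : Real.cos p ≠ 0) : ContDiffAt ℝ ∞ profAngle p :=
  (contDiff_cutoff _).contDiffAt.mul (contDiffAt_tan' h)

lemma contDiffAt_profCurve {p : ℝ} (h : Real.cos p ≠ 0) : ContDiffAt ℝ ∞ profCurve p :=
  (contDiffAt_const.sub (contDiffAt_id.mul (contDiffAt_profAngle h).cos)).prodMk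
    (contDiffAt_id.mul (contDiffAt_profAngle h).sin).neg

lemma contDiffAt_profTime {p : ℝ} (h : Real.cos p ≠ 0) (h7 : p < 7) : ContDiffAt ℝ ∞ profTime p :=
  ((contDiff_cutoff 5).contDiffAt.mul (contDiffAt_const.sub
    (contDiff_expSqInt.contDiffAt.comp p (contDiffAt_tan' h)))).add
    ((contDiffAt_const.sub (contDiff_cutoff 5).contDiffAt).mul
      ((contDiffAt_const.sub contDiffAt_id).log (by simp; linarith)))

/-- The parameters of the two profile curves. -/
def profDom : Set ℝ := {p | Real.pi / 2 < p ∧ p < 7 ∧ p ≠ 3 * Real.pi / 2}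

lemma cos_pos_of_profDom {p : ℝ} (h1 : 3 * Real.pi / 2 < p) (h2 : p < 15 / 2) : 0 < Real.cos p := by
  rw [← Real.cos_sub_two_pi]
  exact Real.cos_pos_of_mem_Ioo ⟨by linarith, by linarith [Real.pi_gt_d2]⟩

lemma cos_ne_zero_of_profDom {p : ℝ} (h : p ∈ profDom) : Real.cos p ≠ 0 := by
  rcases lt_or_gt_of_ne h.2.2 with h1 | h1
  · exact (Real.cos_neg_of_pi_div_two_lt_of_lt h.1 (by linarith)).ne
  · exact (cos_pos_of_profDom h1 (by linarith [h.2.1])).ne'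

lemma three_halves_lt_of_profDom {p : ℝ} (h : Real.pi / 2 ≤ p) : 3 / 2 < p := by
  linarith [Real.pi_gt_three]

lemma three_pi_div_two_lt : 3 * Real.pi / 2 < 19 / 4 := by linarith [Real.pi_lt_d2]

lemma tan_nonpos_of_mem {p : ℝ} (h1 : 3 * Real.pi / 2 < p) (h2 : p ≤ 6) : Real.tan p ≤ 0 := by
  have h3 : Real.tan p = Real.tan (p - 2 * Real.pi) := by
    rw [Real.tan_eq_sin_div_cos, Real.tan_eq_sin_div_cos, Real.sin_sub_two_pi, Real.cos_sub_two_pi]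
  rw [h3]
  exact Real.tan_nonpos_of_nonpos_of_neg_pi_div_two_le (by linarith [Real.pi_gt_three]) (by linarith)

/-- The speed of the time function. -/
lemma hasDerivAt_profTime {p : ℝ} (h : Real.cos p ≠ 0) (h7 : p < 7) : HasDerivAt profTime
    (deriv (cutoff 5) p * (1 - expSqInt (Real.tan p) - Real.log (7 - p)) -
      cutoff 5 p * (Real.exp (Real.tan p ^ 2) * (1 + Real.tan p ^ 2)) -
      (1 - cutoff 5 p) / (7 - p)) p := by
  have h1 := (hasDerivAt_expSqInt (Real.tan p)).comp p (hasDerivAt_tan' h)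
  have h2 : HasDerivAt (fun p => Real.log (7 - p)) (-1 / (7 - p)) p :=
    ((hasDerivAt_id p).const_sub 7).log (by simp; linarith)
  refine (((hasDerivAt_cutoff 5 p).mul (h1.const_sub 1)).add
    (((hasDerivAt_cutoff 5 p).const_sub 1).mul h2)).congr_deriv ?_
  simp only [Function.comp_apply]
  ring

/-- Outside [5, 11/2] only terms of negative sign survive. On this interval tan p ≤ 0, so 1 -
`expSqInt (tan p)` ≥ 1 > log 2 ≥ log (7 - p). The constant 1 in `profTime` serves to order the two
interpolated functions in this way. -/
lemma deriv_profTime_neg {p : ℝ} (h : p ∈ profDom) : deriv profTime p < 0 := by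
  rw [(hasDerivAt_profTime (cos_ne_zero_of_profDom h) h.2.1).deriv]
  have h7 : 0 < 7 - p := by linarith [h.2.1]
  have h1 : deriv (cutoff 5) p * (1 - expSqInt (Real.tan p) - Real.log (7 - p)) ≤ 0 := by
    by_cases h5 : 5 ≤ p ∧ p ≤ 11 / 2
    · refine mul_nonpos_of_nonpos_of_nonneg (deriv_cutoff_nonpos _ _) ?_
      have h2 := tan_nonpos_of_mem (p := p) (by linarith [three_pi_div_two_lt, h5.1])
        (by linarith [h5.2])
      have h3 := expSqInt_le h2
      have h4 := Real.log_le_sub_one_of_pos (show 0 < (7 - p) / 2 by linarith)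
      have h6 : Real.log ((7 - p) / 2) = Real.log (7 - p) - Real.log 2 := Real.log_div h7.ne' two_ne_zero
      have := Real.log_two_lt_d9
      linarith [h5.1]
    · have h2 : deriv (cutoff 5) p = 0 := by
        rcases lt_or_ge p 5 with h3 | h3
        · exact deriv_cutoff_of_lt h3
        · have : ¬ p ≤ 11 / 2 := fun h4 => h5 ⟨h3, h4⟩
          exact deriv_cutoff_of_gt (by linarith)
      rw [h2, zero_mul]
  have h2 : 0 ≤ cutoff 5 p := cutoff_nonneg _ _
  have h3 : 0 ≤ 1 - cutoff 5 p := sub_nonneg.2 (cutoff_le_one _ _)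
  have h4 : 0 < Real.exp (Real.tan p ^ 2) * (1 + Real.tan p ^ 2) := by positivity
  have h5 : 0 < 1 / (7 - p) := by positivity
  have h6 : (1 - cutoff 5 p) / (7 - p) = (1 - cutoff 5 p) * (1 / (7 - p)) := by ring
  rw [h6]
  rcases h2.eq_or_lt with h0 | h0
  · rw [← h0]
    linarith
  · nlinarith [mul_pos h0 h4, mul_nonneg h3 h5.le]

/-- In other words dp/ds = -M cos² p with M = `flatM`. The factor M is the one that also occurs in
the rotation field, and cos² p compensates the angular speed 1 + tan² p of the spiral. -/
lemma deriv_profTime_of_lt {p : ℝ} (h : p ∈ profDom) (h5 : p < 5) :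
    flatM p * deriv profTime p = -(1 + Real.tan p ^ 2) := by
  have hc := cos_ne_zero_of_profDom h
  rw [(hasDerivAt_profTime hc h.2.1).deriv, deriv_cutoff_of_lt h5, cutoff_eq_one h5.le,
    flatM_of_ne hc]
  have : Real.exp (-Real.tan p ^ 2) * Real.exp (Real.tan p ^ 2) = 1 := by
    rw [← Real.exp_add, neg_add_cancel, Real.exp_zero]
  linear_combination (-(1 + Real.tan p ^ 2)) * this

lemma deriv_profTime_of_gt {p : ℝ} (h : p ∈ profDom) (h5 : 11 / 2 < p) :
    deriv profTime p = -1 / (7 - p) := by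
  rw [(hasDerivAt_profTime (cos_ne_zero_of_profDom h) h.2.1).deriv,
    deriv_cutoff_of_gt (by linarith), cutoff_eq_zero (by linarith)]
  ring

lemma profAngle_of_le {p : ℝ} (h : p ≤ 11 / 2) : profAngle p = Real.tan p := by
  rw [profAngle, cutoff_eq_one h, one_mul]

lemma profAngle_of_ge {p : ℝ} (h : 6 ≤ p) : profAngle p = 0 := by
  rw [profAngle, cutoff_eq_zero (by linarith), zero_mul]

lemma profCurve_of_ge {p : ℝ} (h : 6 ≤ p) : profCurve p = (7 - p, 0) := by
  simp [profCurve, profAngle_of_ge h]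

lemma hasDerivAt_profCurve_of_lt {p : ℝ} (hc : Real.cos p ≠ 0) (h : p < 11 / 2) :
    HasDerivAt profCurve (-Real.cos (Real.tan p) + p * Real.sin (Real.tan p) * (1 + Real.tan p ^ 2),
      -Real.sin (Real.tan p) - p * Real.cos (Real.tan p) * (1 + Real.tan p ^ 2)) p := by
  have h1 := hasDerivAt_tan' hc
  have h2 := (((hasDerivAt_id p).mul h1.cos).const_sub 7).prodMk ((hasDerivAt_id p).mul h1.sin).neg
  refine (h2.congr_of_eventuallyEq ?_).congr_deriv ?_
  · filter_upwards [gt_mem_nhds h] with q hq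
    simp only [profCurve, profAngle_of_le (le_of_lt hq)]
    rfl
  · refine Prod.ext ?_ ?_ <;> simp <;> ring

lemma hasDerivAt_profCurve_of_gt {p : ℝ} (h : 6 < p) : HasDerivAt profCurve (-1, 0) p := by
  have h2 := ((hasDerivAt_id p).const_sub 7).prodMk (hasDerivAt_const p (0 : ℝ))
  refine h2.congr_of_eventuallyEq ?_
  filter_upwards [lt_mem_nhds h] with q hq
  exact profCurve_of_ge (le_of_lt hq)

lemma hasDerivAt_profCurve {p : ℝ} (h : Real.cos p ≠ 0) :
    HasDerivAt profCurve (deriv profCurve p) p :=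
  ((contDiffAt_profCurve h).differentiableAt (by simp)).hasDerivAt

/-- The logarithm of the action of the circles along the profile curve. -/
def profAction (p : ℝ) : ℝ := cutoff 6 p * tailS p + (1 - cutoff 6 p) * (2 * Real.log (7 - p))

/-- The terms of B and C cancel on the curve, since φ = tan p as long as they are present. The
logarithm enters with the factor 1 - `cutoff 6 p`, which is nonzero only where r = 7 - p. -/
lemma modelF₂_profCurve {p : ℝ} (h : p ∈ profDom) :
    modelF₂ (profCurve p) + 2 * Real.log (profCurve p).1 = profAction p := by
  have hp := three_halves_lt_of_profDom h.1.le
  have hc := cos_ne_zero_of_profDom h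
  rw [modelF₂, circFun, torusDist_profCurve (by linarith), coefA, coefK_of_mem hp.le,
    coefB_of_mem hp.le, coefC_of_mem hp.le, flatC_of_ne hc, flatD_of_ne hc]
  have h1 : cutoff 5 p * (flatM p * Real.cos (Real.tan p)) / p * (profCurve p).2 +
      cutoff 5 p * (flatM p * Real.sin (Real.tan p)) / p * (7 - (profCurve p).1) = 0 := by
    by_cases h5 : p ≤ 11 / 2
    · simp only [profCurve, profAngle_of_le h5]
      field_simp
      ring
    · rw [cutoff_eq_zero (by linarith)]
      ring
  have h2 : (1 - cutoff 6 p) * Real.log (profCurve p).1 = (1 - cutoff 6 p) * Real.log (7 - p) := by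
    by_cases h5 : p ≤ 6
    · rw [cutoff_eq_one h5]
      ring
    · rw [profCurve_of_ge (by linarith)]
  rw [profAction]
  linear_combination h1 + 2 * h2

lemma hasDerivAt_profAction {p : ℝ} (h7 : p < 7) : HasDerivAt profAction
    (deriv (cutoff 6) p * (tailS p - 2 * Real.log (7 - p)) - cutoff 6 p * flatS p -
      (1 - cutoff 6 p) * (2 / (7 - p))) p := by
  have h2 : HasDerivAt (fun p => Real.log (7 - p)) (-1 / (7 - p)) p :=
    ((hasDerivAt_id p).const_sub 7).log (by simp; linarith)
  refine (((hasDerivAt_cutoff 6 p).mul (hasDerivAt_tailS p)).add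
    (((hasDerivAt_cutoff 6 p).const_sub 1).mul (h2.const_mul 2))).congr_deriv ?_
  ring

/-- Where the cutoff varies, `tailS` is nonnegative and log (7 - p) is nonpositive, so the
interpolation decreases too. Time also decreases in p; hence the action increases in time, which is
the positivity needed for J. -/
lemma deriv_profAction_neg {p : ℝ} (h : p ∈ profDom) : deriv profAction p < 0 := by
  rw [(hasDerivAt_profAction h.2.1).deriv]
  have h7 : 0 < 7 - p := by linarith [h.2.1]
  have h1 : deriv (cutoff 6) p * (tailS p - 2 * Real.log (7 - p)) ≤ 0 := by
    by_cases h5 : 6 ≤ p ∧ p ≤ 13 / 2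
    · refine mul_nonpos_of_nonpos_of_nonneg (deriv_cutoff_nonpos _ _) ?_
      have h3 := tailS_nonneg h5.2
      have h4 := Real.log_nonpos h7.le (by linarith [h5.1])
      linarith
    · have h2 : deriv (cutoff 6) p = 0 := by
        rcases lt_or_ge p 6 with h3 | h3
        · exact deriv_cutoff_of_lt h3
        · have : ¬ p ≤ 13 / 2 := fun h4 => h5 ⟨h3, h4⟩
          exact deriv_cutoff_of_gt (by linarith)
      rw [h2, zero_mul]
  have h2 : 0 ≤ cutoff 6 p := cutoff_nonneg _ _
  have h3 : 0 ≤ 1 - cutoff 6 p := sub_nonneg.2 (cutoff_le_one _ _)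
  have h4 := flatS_pos (cos_ne_zero_of_profDom h)
  have h5 : 0 < 2 / (7 - p) := by positivity
  rcases h2.eq_or_lt with h0 | h0
  · rw [← h0]
    linarith
  · nlinarith [mul_pos h0 h4, mul_nonneg h3 h5.le]

lemma profAction_le {p : ℝ} (h : p ∈ profDom) : profAction p ≤ tailS 0 := by
  have hp := three_halves_lt_of_profDom h.1.le
  have h1 : tailS p ≤ tailS 0 := antitone_tailS (by linarith)
  have h0 : 0 ≤ tailS 0 := tailS_nonneg (by norm_num)
  have h2 : 0 ≤ cutoff 6 p := cutoff_nonneg _ _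
  have h3 : 0 ≤ 1 - cutoff 6 p := sub_nonneg.2 (cutoff_le_one _ _)
  have h4 : (1 - cutoff 6 p) * (2 * Real.log (7 - p)) ≤ 0 := by
    by_cases h5 : p ≤ 6
    · rw [cutoff_eq_one h5]
      simp
    · have := Real.log_nonpos (show (0 : ℝ) ≤ 7 - p by linarith [h.2.1]) (by linarith)
      nlinarith
  have h5 : cutoff 6 p * tailS p ≤ cutoff 6 p * tailS 0 := mul_le_mul_of_nonneg_left h1 h2
  rw [profAction]
  nlinarith [cutoff_le_one 6 p]

lemma isOpen_profDom : IsOpen profDom :=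
  (isOpen_lt continuous_const continuous_id).inter
    ((isOpen_lt continuous_id continuous_const).inter isOpen_ne)

lemma differentiableAt_modelF₂ {x : ℝ × ℝ} (hx : 0 < x.1) (h : 0 < torusDist x) :
    ∃ gr gz : ℝ, HasFDerivAt modelF₂
      (gr • ContinuousLinearMap.fst ℝ ℝ ℝ + gz • ContinuousLinearMap.snd ℝ ℝ ℝ) x := by
  have hd : ∀ {f : ℝ → ℝ}, ContDiff ℝ ∞ f → ∀ p, HasDerivAt f (deriv f p) p := fun hf p =>
    (hf.differentiable (by simp) p).hasDerivAt
  exact ⟨_, _, hasFDerivAt_circFun hx h (hd contDiff_coefA _) (hd contDiff_coefB _)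
    (hd contDiff_coefC _) (hd contDiff_coefK _) rfl⟩

/-- The derivative of the action along the profile curve. -/
lemma deriv_profAction_eq {p : ℝ} (h : p ∈ profDom) {gr gz : ℝ} (hg : HasFDerivAt modelF₂
    (gr • ContinuousLinearMap.fst ℝ ℝ ℝ + gz • ContinuousLinearMap.snd ℝ ℝ ℝ) (profCurve p)) :
    deriv profAction p = (gr + 2 / (profCurve p).1) * (deriv profCurve p).1 +
      gz * (deriv profCurve p).2 := by
  have hp := three_halves_lt_of_profDom h.1.le
  have h1 := hasDerivAt_profCurve (cos_ne_zero_of_profDom h)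
  have h2 := hg.comp_hasDerivAt p h1
  have h3 : HasDerivAt (fun p => (profCurve p).1) (deriv profCurve p).1 p :=
    (ContinuousLinearMap.fst ℝ ℝ ℝ).hasFDerivAt.comp_hasDerivAt p h1
  have h4 := (h3.log (profCurve_fst_pos (by linarith) h.2.1).ne').const_mul 2
  have h5 : profAction =ᶠ[𝓝 p] fun p => modelF₂ (profCurve p) + 2 * Real.log (profCurve p).1 := by
    filter_upwards [isOpen_profDom.mem_nhds h] with q hq using (modelF₂_profCurve hq).symm
  rw [h5.deriv_eq]
  refine (h2.add h4).deriv.trans ?_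
  simp
  ring

/-- The gradient of the model function along the profile curve, before the cutoffs set in, and along
the limit circles. -/
lemma hasFDerivAt_modelF₂ {x : ℝ × ℝ} (hx : 0 < x.1) (h1 : 3 / 2 < torusDist x)
    (h5 : torusDist x < 5)
    (h : Real.cos (torusDist x) = 0 ∨ Real.cos (torusDist x) ≠ 0 ∧ x = profCurve (torusDist x)) :
    HasFDerivAt modelF₂
      ((-coefC (torusDist x) - 2 / x.1) • ContinuousLinearMap.fst ℝ ℝ ℝ +
        coefB (torusDist x) • ContinuousLinearMap.snd ℝ ℝ ℝ) x := by
  set p := torusDist x with hp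
  have hnear : ∀ᶠ q in 𝓝 p, 3 / 2 < q ∧ q < 5 := (lt_mem_nhds h1).and (gt_mem_nhds h5)
  have hk : HasDerivAt coefK 0 p := by
    refine (hasDerivAt_const p (1 : ℝ)).congr_of_eventuallyEq ?_
    filter_upwards [hnear] with q hq
    rw [coefK_of_mem hq.1.le, cutoff_eq_one (by linarith [hq.2])]
  have ha : HasDerivAt coefA (-flatS p) p := by
    refine (hasDerivAt_tailS p).congr_of_eventuallyEq ?_
    filter_upwards [hnear] with q hq
    rw [coefA, coefK_of_mem hq.1.le, cutoff_eq_one (by linarith [hq.2]), one_mul]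
  have hb : ∀ {m' : ℝ}, HasDerivAt flatC m' p → HasDerivAt coefB ((m' * p - flatC p) / p ^ 2) p := by
    intro m' hm
    have := hm.div (hasDerivAt_id p) (by simp; linarith)
    refine (this.congr_of_eventuallyEq ?_).congr_deriv (by simp)
    filter_upwards [hnear] with q hq
    rw [coefB_of_mem hq.1.le, cutoff_eq_one (by linarith [hq.2]), one_mul]
    rfl
  have hc : ∀ {m' : ℝ}, HasDerivAt flatD m' p → HasDerivAt coefC ((m' * p - flatD p) / p ^ 2) p := by
    intro m' hm
    have := hm.div (hasDerivAt_id p) (by simp; linarith)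
    refine (this.congr_of_eventuallyEq ?_).congr_deriv (by simp)
    filter_upwards [hnear] with q hq
    rw [coefC_of_mem hq.1.le, cutoff_eq_one (by linarith [hq.2]), one_mul]
    rfl
  have hK : coefK p = 1 := by rw [coefK_of_mem h1.le, cutoff_eq_one (by linarith)]
  -- It remains to show that the term G of `hasFDerivAt_circFun` vanishes. On the limit circles
  -- every part of it is flat. On the spiral the B- and C-terms add up to M times the derivative of
  -- tan, which cancels `flatS`.
  have key : ∀ {b' c' : ℝ}, HasDerivAt coefB b' p → HasDerivAt coefC c' p →
      0 = -flatS p + b' * x.2 + c' * (7 - x.1) - 2 * 0 * Real.log x.1 →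
      HasFDerivAt modelF₂ ((-coefC p - 2 / x.1) • ContinuousLinearMap.fst ℝ ℝ ℝ +
        coefB p • ContinuousLinearMap.snd ℝ ℝ ℝ) x := by
    intro b' c' hb' hc' h0
    refine (hasFDerivAt_circFun hx (by linarith) ha hb' hc' hk h0).congr_fderiv ?_
    rw [hp] at hK ⊢
    rw [hK]
    simp
  rcases h with h | ⟨h, hxp⟩
  · refine key (hb (hasDerivAt_flatC_of_eq h)) (hc (hasDerivAt_flatD_of_eq h)) ?_
    rw [flatS_of_eq h, flatC_of_eq h, flatD_of_eq h]
    simp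
  · have hM := hasDerivAt_flatM h
    have hT := hasDerivAt_tan' h
    have hC : HasDerivAt flatC _ p := (hM.mul hT.cos).congr_of_eventuallyEq (by
      filter_upwards [eventually_cos_ne h] with q hq using flatC_of_ne hq)
    have hD : HasDerivAt flatD _ p := (hM.mul hT.sin).congr_of_eventuallyEq (by
      filter_upwards [eventually_cos_ne h] with q hq using flatD_of_ne hq)
    refine key (hb hC) (hc hD) ?_
    have h7 : 7 - x.1 = p * Real.cos (Real.tan p) := by
      rw [hxp, profCurve, profAngle_of_le (by linarith)]
      ring
    have hz : x.2 = -(p * Real.sin (Real.tan p)) := by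
      rw [hxp, profCurve, profAngle_of_le (by linarith)]
    have hp0 : p ≠ 0 := by linarith
    rw [h7, hz, flatS_of_ne h, flatC_of_ne h, flatD_of_ne h]
    have hsc := Real.sin_sq_add_cos_sq (Real.tan p)
    field_simp
    linear_combination (-(flatM p) * p * (1 + Real.tan p ^ 2)) * hsc

end Curve

/-! ### Smooth frames containing the prescribed values of J -/

section Frames

/-- The pairs of vectors along the model curves that the complex structure has to rotate. -/
def modelPairs (x : ℂ × ℝ) : Set ((ℂ × ℝ) × (ℂ × ℝ)) :=
  {y | ∃ p ∈ profDom, profCurve p = (‖x.1‖, x.2) ∧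
    y = (radLift x.1 ((deriv profTime p)⁻¹ * (deriv profCurve p).1)
      ((deriv profTime p)⁻¹ * (deriv profCurve p).2), rotField modelF x)} ∪
  {y | x = 0 ∧ ∃ v : ℂ, y = ((v, 0), (Complex.I * v, 0))}

/-- A compact set that contains the model curves. -/
def modelCore : Set (ℂ × ℝ) :=
  {x | torusDist (‖x.1‖, x.2) ∈ Icc (Real.pi / 2) (19 / 4)} ∪
    {x | (‖x.1‖, x.2) ∈ profCurve '' Icc (19 / 4) 7}

lemma continuous_normPair : Continuous fun x : ℂ × ℝ => (‖x.1‖, x.2) := by fun_prop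

lemma norm_sub_le_torusDist (x : ℂ × ℝ) :
    ‖x.1‖ ≤ 7 + torusDist (‖x.1‖, x.2) ∧ |x.2| ≤ torusDist (‖x.1‖, x.2) := by
  have h := torusDist_sq (‖x.1‖, x.2)
  have h0 := torusDist_nonneg (‖x.1‖, x.2)
  constructor
  · by_contra! h1
    nlinarith [sq_nonneg x.2]
  · refine abs_le_of_sq_le_sq ?_ h0
    nlinarith [sq_nonneg (7 - ‖x.1‖)]

lemma torusDist_le_of_mem_modelCore {x : ℂ × ℝ} (h : x ∈ modelCore) :
    torusDist (‖x.1‖, x.2) ≤ 7 := by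
  rcases h with h | ⟨p, hp, h⟩
  · linarith [h.2]
  · rw [← h, torusDist_profCurve (by linarith [hp.1])]
    exact hp.2

lemma modelCore_subset : modelCore ⊆ Metric.ball 0 20 := by
  intro x hx
  have h1 := torusDist_le_of_mem_modelCore hx
  have h2 := norm_sub_le_torusDist x
  rw [mem_ball_zero_iff, Prod.norm_def, max_lt_iff, Real.norm_eq_abs]
  constructor <;> linarith [h2.1, h2.2]

lemma isCompact_modelCore : IsCompact modelCore := by
  have hcl : IsClosed modelCore := by
    refine IsClosed.union ?_ ?_
    · exact isClosed_Icc.preimage (continuous_torusDist.comp continuous_normPair)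
    · refine IsClosed.preimage continuous_normPair (IsCompact.isClosed ?_)
      refine isCompact_Icc.image_of_continuousOn fun p hp => ?_
      have hc := (cos_pos_of_profDom (p := p) (by linarith [three_pi_div_two_lt, hp.1])
        (by linarith [hp.2])).ne'
      exact (contDiffAt_profCurve hc).continuousAt.continuousWithinAt
  exact (isCompact_closedBall (0 : ℂ × ℝ) 20).of_isClosed_subset hcl
    (modelCore_subset.trans Metric.ball_subset_closedBall)

lemma profCurve_seven : profCurve 7 = (0, 0) := by
  rw [profCurve_of_ge (by norm_num), sub_self]

lemma modelPairs_eq_empty {x : ℂ × ℝ} (hx : x ∉ modelCore) : modelPairs x = ∅ := by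
  rw [eq_empty_iff_forall_notMem]
  rintro y (⟨p, hp, hpx, -⟩ | ⟨rfl, -⟩)
  · refine hx ?_
    -- The threshold 19/4 lies between 3π/2 and 5. The first piece of the core contains both limit
    -- tori and stays where no cutoff acts; the second is the remaining arc to the axis.
    rcases le_or_gt p (19 / 4) with h | h
    · left
      have hp0 : 0 ≤ p := by linarith [three_halves_lt_of_profDom hp.1.le]
      show torusDist (‖x.1‖, x.2) ∈ Icc (Real.pi / 2) (19 / 4)
      rw [← hpx, torusDist_profCurve hp0]
      exact ⟨hp.1.le, h⟩
    · right
      exact ⟨p, ⟨h.le, hp.2.1.le⟩, hpx⟩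
  · refine hx (Or.inr ⟨7, by norm_num, ?_⟩)
    rw [profCurve_seven]
    simp

lemma fst_ne_zero_of_profCurve {x : ℂ × ℝ} {p : ℝ} (hp : p ∈ profDom)
    (h : profCurve p = (‖x.1‖, x.2)) : x.1 ≠ 0 := by
  have h1 := profCurve_fst_pos (p := p) (by linarith [three_halves_lt_of_profDom hp.1.le]) hp.2.1
  rw [h] at h1
  exact norm_pos_iff.1 h1

lemma stdForm_modelPairs (x : ℂ × ℝ) (y : (ℂ × ℝ) × (ℂ × ℝ)) (hy : y ∈ modelPairs x) :
    stdForm x y.1 = 0 ∧ stdForm x y.2 = 0 := by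
  rcases hy with ⟨p, hp, hpx, rfl⟩ | ⟨rfl, v, rfl⟩
  · exact ⟨stdForm_radLift (fst_ne_zero_of_profCurve hp hpx) _ _, stdForm_rotField _ _⟩
  · simp [stdForm_apply]

lemma contDiffAt_radLift {u v : ℂ × ℝ → ℝ} {x : ℂ × ℝ} (hu : ContDiffAt ℝ ∞ u x)
    (hv : ContDiffAt ℝ ∞ v x) (hx : x.1 ≠ 0) :
    ContDiffAt ℝ ∞ (fun x => radLift x.1 (u x) (v x)) x := by
  have hn : ContDiffAt ℝ ∞ (fun x : ℂ × ℝ => ‖x.1‖) x := contDiffAt_fst.norm ℝ hx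
  have h0 : ‖x.1‖ ≠ 0 := norm_ne_zero_iff.2 hx
  have h1 : ContDiffAt ℝ ∞ (fun x : ℂ × ℝ => (⟨u x / ‖x.1‖, -v x / ‖x.1‖ ^ 2⟩ : ℂ)) x :=
    Complex.equivRealProdCLM.symm.contDiff.contDiffAt.comp x
      ((hu.div hn h0).prodMk (hv.neg.div (hn.pow 2) (pow_ne_zero 2 h0)))
  exact (contDiffAt_fst.mul h1).prodMk hv

lemma contDiffAt_torusDistC {x : ℂ × ℝ} (hx : x.1 ≠ 0) (h : 0 < torusDist (‖x.1‖, x.2)) :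
    ContDiffAt ℝ ∞ (fun x : ℂ × ℝ => torusDist (‖x.1‖, x.2)) x :=
  ContDiffAt.comp (g := torusDist) x (contDiffAt_torusDist h)
    ((contDiffAt_fst.norm ℝ hx).prodMk contDiffAt_snd)

lemma contDiffAt_deriv {E : Type*} [NormedAddCommGroup E] [NormedSpace ℝ E] {f : ℝ → E} {x : ℝ}
    (h : ContDiffAt ℝ ∞ f x) : ContDiffAt ℝ ∞ (deriv f) x :=
  (h.fderiv_right (m := ∞) (by simp)).clm_apply contDiffAt_const

lemma tendsto_torusDistC (x : ℂ × ℝ) :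
    ContinuousAt (fun x : ℂ × ℝ => torusDist (‖x.1‖, x.2)) x :=
  (continuous_torusDist.comp continuous_normPair).continuousAt

lemma fst_ne_zero_of_torusDist_lt {x : ℂ × ℝ} (h : torusDist (‖x.1‖, x.2) < 7) : x.1 ≠ 0 := by
  intro h0
  rw [h0, norm_zero] at h
  linarith [seven_le_torusDist x.2]

/-- The rotation field before the cutoffs set in. -/
lemma rotField_modelF {x : ℂ × ℝ} (h1 : 3 / 2 < torusDist (‖x.1‖, x.2))
    (h5 : torusDist (‖x.1‖, x.2) < 5)
    (h : Real.cos (torusDist (‖x.1‖, x.2)) = 0 ∨ Real.cos (torusDist (‖x.1‖, x.2)) ≠ 0 ∧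
      (‖x.1‖, x.2) = profCurve (torusDist (‖x.1‖, x.2))) :
    rotField modelF x = (‖x.1‖ ^ 3 / 2) • radLift x.1 (coefB (torusDist (‖x.1‖, x.2)))
      (coefC (torusDist (‖x.1‖, x.2))) := by
  have hx := fst_ne_zero_of_torusDist_lt (x := x) (by linarith)
  have h2 := rotField_eq hx (hasFDerivAt_modelF₂ (norm_pos_iff.2 hx) h1 h5 h)
  refine h2.trans ?_
  congr 2
  ring

/-- This is the smoothness of J across the limit tori. Along the spiral both vectors of a pair are
`flatM` times fields that are smooth there: the velocity gives the angular field plus cos² ρ / ρ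
times the inward radial field, and the rotation field gives a multiple of the inward radial field.
These two fields are the frame, so that the pair has coordinates c₁ = `flatM p`, c₂ = 0. -/
lemma hasModelFrame_of_lt {x₀ : ℂ × ℝ} (h1 : 3 / 2 < torusDist (‖x₀.1‖, x₀.2))
    (h5 : torusDist (‖x₀.1‖, x₀.2) < 5) : HasModelFrame modelF modelPairs x₀ := by
  let ρ : ℂ × ℝ → ℝ := fun x => torusDist (‖x.1‖, x.2)
  refine ⟨fun x => radLift x.1 (x.2 - Real.cos (ρ x) ^ 2 / ρ x * (‖x.1‖ - 7))
    (7 - ‖x.1‖ - Real.cos (ρ x) ^ 2 / ρ x * x.2),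
    fun x => radLift x.1 (‖x.1‖ ^ 3 / (2 * ρ x ^ 2) * (7 - ‖x.1‖))
      (-(‖x.1‖ ^ 3 / (2 * ρ x ^ 2) * x.2)), ?_, ?_⟩
  · have hx := fst_ne_zero_of_torusDist_lt (x := x₀) (by linarith)
    have hn : 0 < ‖x₀.1‖ := norm_pos_iff.2 hx
    rw [dform_radLift (contDiff_modelF.differentiable (by simp) x₀) hx]
    have hρ : 0 < ρ x₀ := by
      show 0 < torusDist _
      linarith
    have h2 : ρ x₀ ^ 2 = (7 - ‖x₀.1‖) ^ 2 + x₀.2 ^ 2 := torusDist_sq _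
    refine mul_pos (Real.exp_pos _) (mul_pos (by positivity) ?_)
    have h3 : (7 - ‖x₀.1‖ - Real.cos (ρ x₀) ^ 2 / ρ x₀ * x₀.2) *
        (‖x₀.1‖ ^ 3 / (2 * ρ x₀ ^ 2) * (7 - ‖x₀.1‖)) -
        (x₀.2 - Real.cos (ρ x₀) ^ 2 / ρ x₀ * (‖x₀.1‖ - 7)) *
        -(‖x₀.1‖ ^ 3 / (2 * ρ x₀ ^ 2) * x₀.2) =
        ‖x₀.1‖ ^ 3 / (2 * ρ x₀ ^ 2) * ((7 - ‖x₀.1‖) ^ 2 + x₀.2 ^ 2) := by ring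
    rw [h3, ← h2]
    positivity
  · filter_upwards [(tendsto_torusDistC x₀).eventually (lt_mem_nhds h1),
      (tendsto_torusDistC x₀).eventually (gt_mem_nhds h5)] with x h1 h5
    have hx := fst_ne_zero_of_torusDist_lt (x := x) (by linarith)
    have hρ : 0 < ρ x := by
      show 0 < torusDist _
      linarith
    have hρs : ContDiffAt ℝ ∞ ρ x := contDiffAt_torusDistC hx hρ
    have hn : ContDiffAt ℝ ∞ (fun x : ℂ × ℝ => ‖x.1‖) x := contDiffAt_fst.norm ℝ hx
    have hc : ContDiffAt ℝ ∞ (fun x => Real.cos (ρ x) ^ 2 / ρ x) x :=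
      (hρs.cos.pow 2).div hρs hρ.ne'
    have hk : ContDiffAt ℝ ∞ (fun x : ℂ × ℝ => ‖x.1‖ ^ 3 / (2 * ρ x ^ 2)) x :=
      (hn.pow 3).div (contDiffAt_const.mul (hρs.pow 2)) (by positivity)
    refine ⟨contDiffAt_radLift (contDiffAt_snd.sub (hc.mul (hn.sub contDiffAt_const)))
      ((contDiffAt_const.sub hn).sub (hc.mul contDiffAt_snd)) hx,
      contDiffAt_radLift (hk.mul (contDiffAt_const.sub hn)) (hk.mul contDiffAt_snd).neg hx, ?_⟩
    rintro y (⟨p, hp, hpx, rfl⟩ | ⟨rfl, -⟩)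
    · have hpρ : ρ x = p := by
        show torusDist (‖x.1‖, x.2) = p
        rw [← hpx, torusDist_profCurve (by linarith [three_halves_lt_of_profDom hp.1.le])]
      have hpρ' : torusDist (‖x.1‖, x.2) = p := hpρ
      rw [hpρ'] at h1 h5
      have hcos := cos_ne_zero_of_profDom hp
      have hr : 7 - ‖x.1‖ = p * Real.cos (Real.tan p) := by
        have := congrArg Prod.fst hpx
        simp only [profCurve, profAngle_of_le (show p ≤ 11 / 2 by linarith)] at this
        linarith
      have hz : x.2 = -(p * Real.sin (Real.tan p)) := by
        have := congrArg Prod.snd hpx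
        simp only [profCurve, profAngle_of_le (show p ≤ 11 / 2 by linarith)] at this
        exact this.symm
      have hS := deriv_profTime_of_lt hp h5
      have hm := flatM_pos hcos
      have hS' : (deriv profTime p)⁻¹ = -(flatM p * Real.cos p ^ 2) := by
        have h2 := one_div_cos_sq hcos
        rw [← h2] at hS
        rw [inv_eq_iff_eq_inv]
        have hd : deriv profTime p = -(1 / Real.cos p ^ 2) / flatM p := by
          rw [← hS]
          field_simp
        rw [hd]
        field_simp
      have hcos2 : Real.cos p ^ 2 * (1 + Real.tan p ^ 2) = 1 := by
        rw [← one_div_cos_sq hcos]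
        field_simp
      refine ⟨flatM p, 0, ?_, ?_⟩
      · rw [zero_smul, add_zero, radLift_smul, (hasDerivAt_profCurve_of_lt hcos (by linarith)).deriv,
          hpρ, hS', show ‖x.1‖ - 7 = -(p * Real.cos (Real.tan p)) by linarith, hr, hz]
        have hp0 : p ≠ 0 := by linarith
        refine congrArg₂ (radLift x.1) ?_ ?_
        · field_simp
          linear_combination (-(p * Real.sin (Real.tan p))) * hcos2
        · field_simp
          linear_combination (p * Real.cos (Real.tan p)) * hcos2
      · rw [zero_smul, sub_zero, rotField_modelF (by rw [hpρ']; exact h1) (by rw [hpρ']; exact h5)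
          (by rw [hpρ']; exact Or.inr ⟨hcos, hpx.symm⟩), hpρ', radLift_smul, radLift_smul, hr, hz, hpρ,
          coefB_of_mem h1.le, coefC_of_mem h1.le, cutoff_eq_one h5.le, flatC_of_ne hcos,
          flatD_of_ne hcos]
        have hp0 : p ≠ 0 := by linarith
        refine congrArg₂ (radLift x.1) ?_ ?_
        · field_simp
        · field_simp
    · exact absurd rfl hx

/-- Away from the limit tori the curve itself supplies the frame, extended as a function of the
distance ρ. Its orientation is governed by the product of the derivatives of time and action in p,
both negative. -/
lemma hasModelFrame_of_gt {x₀ : ℂ × ℝ} {p₀ : ℝ} (hp : p₀ ∈ profDom)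
    (h : profCurve p₀ = (‖x₀.1‖, x₀.2)) : HasModelFrame modelF modelPairs x₀ := by
  let ρ : ℂ × ℝ → ℝ := fun x => torusDist (‖x.1‖, x.2)
  have hp0 : 0 < p₀ := by linarith [three_halves_lt_of_profDom hp.1.le]
  have hρ₀ : ρ x₀ = p₀ := by
    show torusDist (‖x₀.1‖, x₀.2) = p₀
    rw [← h, torusDist_profCurve hp0.le]
  refine ⟨fun x => radLift x.1 (-(deriv profCurve (ρ x)).1) (-(deriv profCurve (ρ x)).2),
    fun x => (-deriv profTime (ρ x)) • rotField modelF x, ?_, ?_⟩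
  · have hx := fst_ne_zero_of_profCurve hp h
    have hn : 0 < ‖x₀.1‖ := norm_pos_iff.2 hx
    obtain ⟨gr, gz, hg⟩ := differentiableAt_modelF₂ (x := (‖x₀.1‖, x₀.2)) hn (by
      rw [← h, torusDist_profCurve hp0.le]
      exact hp0)
    have hrot : rotField modelF x₀ = _ := rotField_eq hx hg
    show 0 < dform (fun p => Real.exp (modelF p) • stdForm p) x₀
      (radLift x₀.1 (-(deriv profCurve (ρ x₀)).1) (-(deriv profCurve (ρ x₀)).2))
      (-deriv profTime (ρ x₀) • rotField modelF x₀)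
    rw [hrot, hρ₀, radLift_smul, radLift_smul,
      dform_radLift (contDiff_modelF.differentiable (by simp) x₀) hx]
    have hA := deriv_profAction_eq hp (h ▸ hg)
    have hA' := deriv_profAction_neg hp
    have hT := deriv_profTime_neg hp
    rw [h] at hA
    refine mul_pos (Real.exp_pos _) (mul_pos (by positivity) ?_)
    have h3 : ∀ a b S g g' c : ℝ, -b * (-S * (c * g)) - -a * (-S * (c * -g')) = c * (S * (g' * a + g * b)) := by
      intros
      ring
    rw [h3, ← hA]
    exact mul_pos (by positivity) (mul_pos_of_neg_of_neg hT hA')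
  · have hd : ∀ᶠ x in 𝓝 x₀, ρ x ∈ profDom := by
      have : ContinuousAt ρ x₀ := tendsto_torusDistC x₀
      refine this.eventually (isOpen_profDom.mem_nhds ?_)
      rw [hρ₀]
      exact hp
    filter_upwards [hd] with x hxd
    have hx := fst_ne_zero_of_torusDist_lt (x := x) hxd.2.1
    have hρ : 0 < ρ x := by linarith [three_halves_lt_of_profDom hxd.1.le]
    have hρs : ContDiffAt ℝ ∞ ρ x := contDiffAt_torusDistC hx hρ
    have hc := cos_ne_zero_of_profDom hxd
    have hγ : ContDiffAt ℝ ∞ (fun x => deriv profCurve (ρ x)) x :=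
      ContDiffAt.comp (g := deriv profCurve) x (contDiffAt_deriv (contDiffAt_profCurve hc)) hρs
    have hS : ContDiffAt ℝ ∞ (fun x => deriv profTime (ρ x)) x :=
      ContDiffAt.comp (g := deriv profTime) x (contDiffAt_deriv (contDiffAt_profTime hc hxd.2.1)) hρs
    refine ⟨contDiffAt_radLift (contDiffAt_fst.comp x hγ).neg (contDiffAt_snd.comp x hγ).neg hx,
      hS.neg.smul (contDiff_rotField contDiff_modelF).contDiffAt, ?_⟩
    rintro y (⟨p, hp, hpx, rfl⟩ | ⟨rfl, -⟩)
    · have hpρ : ρ x = p := by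
        show torusDist (‖x.1‖, x.2) = p
        rw [← hpx, torusDist_profCurve (by linarith [three_halves_lt_of_profDom hp.1.le])]
      have hT := (deriv_profTime_neg hp).ne
      refine ⟨-(deriv profTime p)⁻¹, 0, ?_, ?_⟩
      · rw [zero_smul, add_zero, radLift_smul, hpρ, neg_mul_neg, neg_mul_neg]
      · rw [zero_smul, sub_zero, hpρ, smul_smul, neg_mul_neg, inv_mul_cancel₀ hT, one_smul]
    · exact absurd rfl hx

lemma modelF_eq_zero {x : ℂ × ℝ} (h : 13 / 2 ≤ torusDist (‖x.1‖, x.2)) : modelF x = 0 :=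
  circFun_eq_zero (coef_eq_zero _ (Or.inr h))

lemma modelReeb_modelF_of_gt {x : ℂ × ℝ} (h : 13 / 2 < torusDist (‖x.1‖, x.2)) :
    modelReeb modelF x = (0, 1) := by
  have h0 : modelF =ᶠ[𝓝 x] fun _ => 0 := by
    filter_upwards [(tendsto_torusDistC x).eventually (lt_mem_nhds h)] with y hy
      using modelF_eq_zero (le_of_lt hy)
  have hd : fderiv ℝ modelF x = 0 := by
    rw [h0.fderiv_eq]
    simp
  have hs : reebSlope modelF x = 0 := by
    rw [reebSlope, hd]
    refine Complex.ext ?_ ?_ <;> simp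
  rw [modelReeb, hs, h0.self_of_nhds]
  simp [stdLift]

lemma rotField_modelF_of_gt {x : ℂ × ℝ} (h : 13 / 2 < torusDist (‖x.1‖, x.2)) :
    rotField modelF x = (Complex.I * x.1, -‖x.1‖ ^ 2) := by
  rw [rotField, modelReeb_modelF_of_gt h, modelF_eq_zero h.le]
  simp

/-- Polar frames are singular on the axis, but near the origin F vanishes and the curve is the
segment r = 7 - p = exp s. The surface is the flat disc there, and J is multiplication by i lifted
from ℂ. -/
lemma hasModelFrame_zero : HasModelFrame modelF modelPairs 0 := by
  refine ⟨fun x => stdLift x.1 1, fun x => stdLift x.1 Complex.I, ?_, ?_⟩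
  · have h1 := stdForm_stdLift 0 1
    have h2 := stdForm_stdLift 0 Complex.I
    rw [dform_exp_smul_stdForm (contDiff_modelF.differentiable (by simp) 0), h1, h2]
    refine mul_pos (Real.exp_pos _) ?_
    simp [stdLift]
  · have hre : ContDiff ℝ ∞ fun p : ℂ × ℝ => p.1.re := Complex.reCLM.contDiff.comp contDiff_fst
    have him : ContDiff ℝ ∞ fun p : ℂ × ℝ => p.1.im := Complex.imCLM.contDiff.comp contDiff_fst
    have h0 : 13 / 2 < torusDist (‖(0 : ℂ × ℝ).1‖, (0 : ℂ × ℝ).2) := by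
      have := seven_le_torusDist 0
      simp only [Prod.fst_zero, Prod.snd_zero, norm_zero]
      linarith
    filter_upwards [(tendsto_torusDistC 0).eventually (lt_mem_nhds h0)] with x h13
    refine ⟨?_, ?_, ?_⟩
    · exact (contDiff_const.prodMk ((him.mul contDiff_const).sub (hre.mul contDiff_const))).contDiffAt
    · exact (contDiff_const.prodMk ((him.mul contDiff_const).sub (hre.mul contDiff_const))).contDiffAt
    rintro y (⟨p, hp, hpx, rfl⟩ | ⟨rfl, v, rfl⟩)
    · have hpρ : torusDist (‖x.1‖, x.2) = p := by
        rw [← hpx, torusDist_profCurve (by linarith [three_halves_lt_of_profDom hp.1.le])]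
      have h13p := h13
      rw [hpρ] at h13p
      rw [profCurve_of_ge (by linarith)] at hpx
      have hr : 7 - p = ‖x.1‖ := congrArg Prod.fst hpx
      have hz : 0 = x.2 := congrArg Prod.snd hpx
      have hn : ‖x.1‖ ≠ 0 := by
        rw [← hr]
        linarith [hp.2.1]
      refine ⟨x.1.re, x.1.im, ?_, ?_⟩
      · rw [deriv_profTime_of_gt hp (by linarith), (hasDerivAt_profCurve_of_gt (by linarith)).deriv, hr]
        refine Prod.ext (Complex.ext ?_ ?_) ?_
        · simp [radLift, stdLift]
          field_simp
        · simp [radLift, stdLift]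
          field_simp
        · simp [radLift, stdLift]
          ring
      · rw [rotField_modelF_of_gt h13]
        have hsq := normSq_eq_re_im x.1
        refine Prod.ext (Complex.ext ?_ ?_) ?_
        · simp [stdLift]
        · simp [stdLift]
        · simp [stdLift, hsq]
          ring
    · refine ⟨v.re, v.im, ?_, ?_⟩
      · refine Prod.ext (Complex.ext ?_ ?_) ?_ <;> simp [stdLift]
      · refine Prod.ext (Complex.ext ?_ ?_) ?_ <;> simp [stdLift]

lemma hasModelFrame {x : ℂ × ℝ} (hx : x ∈ modelCore) : HasModelFrame modelF modelPairs x := by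
  rcases hx with h | ⟨p, hp, h⟩
  · exact hasModelFrame_of_lt (three_halves_lt_of_profDom h.1) (by linarith [h.2])
  · rcases hp.2.eq_or_lt with rfl | h7
    · rw [profCurve_seven] at h
      have h1 : x = 0 := Prod.ext (norm_eq_zero.1 (congrArg Prod.fst h).symm)
        (congrArg Prod.snd h).symm
      rw [h1]
      exact hasModelFrame_zero
    · refine hasModelFrame_of_gt ⟨?_, h7, ?_⟩ h
      · linarith [hp.1, Real.pi_lt_d2]
      · linarith [hp.1, three_pi_div_two_lt]

end Frames

/-! ### Parametrization by time and spiral ends -/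

section Profile

/-- The inverse of a decreasing function on an interval that runs from `+∞` to `-∞`. -/
lemma exists_contDiff_inverse {S : ℝ → ℝ} {a b : ℝ} (hab : a < b)
    (hS : ∀ p ∈ Ioo a b, ContDiffAt ℝ ∞ S p) (hd : ∀ p ∈ Ioo a b, deriv S p < 0)
    (ha : Tendsto S (𝓝[>] a) atTop) (hb : Tendsto S (𝓝[<] b) atBot) :
    ∃ P : ℝ → ℝ, ContDiff ℝ ∞ P ∧ (∀ s, P s ∈ Ioo a b) ∧ (∀ p ∈ Ioo a b, P (S p) = p) ∧
      (∀ s, HasDerivAt P (deriv S (P s))⁻¹ s) ∧ Tendsto P atTop (𝓝 a) ∧ Tendsto P atBot (𝓝 b) := by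
  have hcont : ContinuousOn S (Ioo a b) := fun p hp => (hS p hp).continuousAt.continuousWithinAt
  have hanti : StrictAntiOn S (Ioo a b) :=
    strictAntiOn_of_deriv_neg (convex_Ioo a b) hcont (by rwa [interior_Ioo])
  have hsurj : SurjOn S (Ioo a b) univ := by
    refine ContinuousOn.surjOn_of_tendsto' (nonempty_Ioo.2 hab) hcont ?_ ?_
    · exact (tendsto_comp_coe_Ioo_atBot hab).2 ha
    · exact (tendsto_comp_coe_Ioo_atTop hab).2 hb
  choose P hP hSP using fun s => hsurj (mem_univ s)
  have hlt : ∀ {c s}, c ∈ Ioo a b → (c < P s ↔ s < S c) := fun {c s} hc => by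
    rw [← hanti.lt_iff_gt (hP s) hc, hSP]
  have hgt : ∀ {c s}, c ∈ Ioo a b → (P s < c ↔ S c < s) := fun {c s} hc => by
    rw [← hanti.lt_iff_gt hc (hP s), hSP]
  have hPc : Continuous P := by
    refine continuous_iff_continuousAt.2 fun s => tendsto_order.2 ⟨fun c hc => ?_, fun c hc => ?_⟩
    · rcases le_or_gt c a with h | h
      · exact Eventually.of_forall fun t => h.trans_lt (hP t).1
      · have hm : c ∈ Ioo a b := ⟨h, hc.trans (hP s).2⟩
        exact (gt_mem_nhds ((hlt hm).1 hc)).mono fun t ht => (hlt hm).2 ht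
    · rcases le_or_gt b c with h | h
      · exact Eventually.of_forall fun t => (hP t).2.trans_le h
      · have hm : c ∈ Ioo a b := ⟨(hP s).1.trans hc, h⟩
        exact (lt_mem_nhds ((hgt hm).1 hc)).mono fun t ht => (hgt hm).2 ht
  have hder : ∀ s, HasDerivAt P (deriv S (P s))⁻¹ s := fun s =>
    HasDerivAt.of_local_left_inverse hPc.continuousAt
      ((hS _ (hP s)).differentiableAt (by simp)).hasDerivAt (hd _ (hP s)).ne
      (Eventually.of_forall hSP)
  have hmid : (a + b) / 2 ∈ Ioo a b := ⟨by linarith, by linarith⟩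
  refine ⟨P, contDiff_infty.2 fun m => ?_, hP, fun p hp => hanti.injOn (hP _) hp (hSP _), hder,
    tendsto_order.2 ⟨fun c hc => Eventually.of_forall fun t => hc.trans (hP t).1, fun c hc => ?_⟩,
    tendsto_order.2 ⟨fun c hc => ?_, fun c hc => Eventually.of_forall fun t => (hP t).2.trans hc⟩⟩
  · induction m with
    | zero => exact contDiff_zero.2 hPc
    | succ m ih =>
      refine (contDiff_succ_iff_deriv (n := (m : WithTop ℕ∞))).2 ⟨fun s => (hder s).differentiableAt, by simp, ?_⟩
      rw [funext fun s => (hder s).deriv]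
      refine contDiff_iff_contDiffAt.2 fun s => ContDiffAt.inv ?_ (hd _ (hP s)).ne
      have h1 : ContDiffAt ℝ m (deriv S) (P s) :=
        (contDiffAt_deriv (hS _ (hP s))).of_le (mod_cast le_top)
      exact h1.comp s ih.contDiffAt
  · have hm : min c ((a + b) / 2) ∈ Ioo a b := ⟨lt_min hc hmid.1, (min_le_right _ _).trans_lt hmid.2⟩
    exact (eventually_gt_atTop (S (min c ((a + b) / 2)))).mono fun t ht =>
      ((hgt hm).2 ht).trans_le (min_le_left _ _)
  · have hm : max c ((a + b) / 2) ∈ Ioo a b := ⟨hmid.1.trans_le (le_max_right _ _), max_lt hc hmid.2⟩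
    exact (eventually_lt_atBot (S (max c ((a + b) / 2)))).mono fun t ht =>
      (le_max_left _ _).trans_lt ((hlt hm).2 ht)

/-- A reparametrization of a branch of the profile curve by its time. -/
structure IsProfile (P : ℝ → ℝ) : Prop where
  contDiff : ContDiff ℝ ∞ P
  mem : ∀ s, P s ∈ profDom
  hasDerivAt : ∀ s, HasDerivAt P (deriv profTime (P s))⁻¹ s

/-- Along the end `l`, the profile curve spirals towards the circle of radius `c`. -/
structure IsSpiralEnd (P : ℝ → ℝ) (l : Filter ℝ) (c : ℝ) : Prop where
  cos_eq : Real.cos c = 0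
  le : Real.pi / 2 ≤ c
  ge : c ≤ 3 * Real.pi / 2
  tendsto : Tendsto P l (𝓝 c)
  exists_seq : ∀ φ : ℝ, ∃ s : ℕ → ℝ, Tendsto s atTop l ∧
    ∀ k, profCurve (P (s k)) = (7 - P (s k) * Real.cos φ, -(P (s k) * Real.sin φ))

lemma tan_sub_pi (p : ℝ) : Real.tan (p - Real.pi) = Real.tan p := Real.tan_periodic.sub_eq p

lemma tan_sub_two_pi (p : ℝ) : Real.tan (p - 2 * Real.pi) = Real.tan p := by
  rw [← tan_sub_pi p, ← tan_sub_pi (p - Real.pi)]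
  ring_nf

lemma tendsto_tan_left : Tendsto Real.tan (𝓝[<] (3 * Real.pi / 2)) atTop := by
  have h : Tendsto (fun p => p - Real.pi) (𝓝[<] (3 * Real.pi / 2)) (𝓝[<] (Real.pi / 2)) := by
    refine tendsto_nhdsWithin_of_tendsto_nhds_of_eventually_within _ ?_ ?_
    · refine ((continuous_id.sub continuous_const).tendsto' _ _ ?_).mono_left nhdsWithin_le_nhds
      simp only [Pi.sub_apply, id]
      ring
    · filter_upwards [self_mem_nhdsWithin] with p (hp : p < _)
      show p - Real.pi < _
      linarith
  refine (Real.tendsto_tan_pi_div_two.comp h).congr fun p => tan_sub_pi p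

lemma tendsto_tan_right_pi_div_two : Tendsto Real.tan (𝓝[>] (Real.pi / 2)) atBot := by
  have h : Tendsto (fun p => p - Real.pi) (𝓝[>] (Real.pi / 2)) (𝓝[>] (-(Real.pi / 2))) := by
    refine tendsto_nhdsWithin_of_tendsto_nhds_of_eventually_within _ ?_ ?_
    · refine ((continuous_id.sub continuous_const).tendsto' _ _ ?_).mono_left nhdsWithin_le_nhds
      simp only [Pi.sub_apply, id]
      ring
    · filter_upwards [self_mem_nhdsWithin] with p (hp : _ < p)
      show _ < p - Real.pi
      linarith
  refine (Real.tendsto_tan_neg_pi_div_two.comp h).congr fun p => tan_sub_pi p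

lemma tendsto_tan_right_three_pi : Tendsto Real.tan (𝓝[>] (3 * Real.pi / 2)) atBot := by
  have h : Tendsto (fun p => p - 2 * Real.pi) (𝓝[>] (3 * Real.pi / 2)) (𝓝[>] (-(Real.pi / 2))) := by
    refine tendsto_nhdsWithin_of_tendsto_nhds_of_eventually_within _ ?_ ?_
    · refine ((continuous_id.sub continuous_const).tendsto' _ _ ?_).mono_left nhdsWithin_le_nhds
      simp only [Pi.sub_apply, id]
      ring
    · filter_upwards [self_mem_nhdsWithin] with p (hp : _ < p)
      show _ < p - _
      linarith
  refine (Real.tendsto_tan_neg_pi_div_two.comp h).congr fun p => tan_sub_two_pi p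

lemma profTime_of_le {p : ℝ} (h : p ≤ 5) : profTime p = 1 - expSqInt (Real.tan p) := by
  rw [profTime, cutoff_eq_one h]
  ring

lemma profTime_of_ge {p : ℝ} (h : 11 / 2 ≤ p) : profTime p = Real.log (7 - p) := by
  rw [profTime, cutoff_eq_zero (by linarith)]
  ring

lemma tendsto_profTime_right {c : ℝ} (hc : c < 5) (h : Tendsto Real.tan (𝓝[>] c) atBot) :
    Tendsto profTime (𝓝[>] c) atTop := by
  have h1 : Tendsto (fun p => 1 - expSqInt (Real.tan p)) (𝓝[>] c) atTop :=
    tendsto_atTop_add_const_left _ 1 (tendsto_neg_atBot_atTop.comp (tendsto_expSqInt_atBot.comp h))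
  refine h1.congr' ?_
  filter_upwards [nhdsWithin_le_nhds (gt_mem_nhds hc)] with p hp
  exact (profTime_of_le (le_of_lt hp)).symm

lemma tendsto_profTime_left {c : ℝ} (hc : c < 5) (h : Tendsto Real.tan (𝓝[<] c) atTop) :
    Tendsto profTime (𝓝[<] c) atBot := by
  have h1 : Tendsto (fun p => 1 - expSqInt (Real.tan p)) (𝓝[<] c) atBot :=
    tendsto_atBot_add_const_left _ 1 (tendsto_neg_atTop_atBot.comp (tendsto_expSqInt_atTop.comp h))
  refine h1.congr' ?_
  filter_upwards [nhdsWithin_le_nhds (gt_mem_nhds hc)] with p hp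
  exact (profTime_of_le (le_of_lt hp)).symm

lemma tendsto_profTime_seven : Tendsto profTime (𝓝[<] 7) atBot := by
  have h1 : Tendsto (fun p : ℝ => 7 - p) (𝓝[<] 7) (𝓝[>] 0) := by
    refine tendsto_nhdsWithin_of_tendsto_nhds_of_eventually_within _ ?_ ?_
    · exact ((continuous_const.sub continuous_id).tendsto' _ _ (by simp)).mono_left nhdsWithin_le_nhds
    · filter_upwards [self_mem_nhdsWithin] with p (hp : p < _)
      show 0 < 7 - p
      linarith
  refine (Real.tendsto_log_nhdsGT_zero.comp h1).congr' ?_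
  filter_upwards [nhdsWithin_le_nhds (lt_mem_nhds (show (11 : ℝ) / 2 < 7 by norm_num))] with p hp
  exact (profTime_of_ge (le_of_lt hp)).symm

lemma profCurve_eq_of_tan {p φ : ℝ} {k : ℤ} (hp : p ≤ 11 / 2)
    (h : Real.tan p = φ + k * (2 * Real.pi)) :
    profCurve p = (7 - p * Real.cos φ, -(p * Real.sin φ)) := by
  rw [profCurve, profAngle_of_le hp, h, Real.cos_add_int_mul_two_pi, Real.sin_add_int_mul_two_pi]

/-- The shifted inverse tangents of `φ + 2 π ε k`. -/
lemma exists_seq_tan {c : ℝ} (φ ε d : ℝ) (m : ℤ) (e : ℤ) (he : (e : ℝ) = ε)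
    (l : Filter ℝ) (hl : Tendsto (fun k : ℕ => φ + (k : ℝ) * (ε * (2 * Real.pi))) atTop l)
    (hat : Tendsto Real.arctan l (𝓝 d)) (hc : d + m * Real.pi = c) (hc5 : c < 11 / 2) :
    ∃ p : ℕ → ℝ, (∀ k : ℕ, Real.arctan (φ + (k : ℝ) * (ε * (2 * Real.pi))) + m * Real.pi = p k) ∧
      Tendsto p atTop (𝓝 c) ∧
      ∀ᶠ k in atTop, profCurve (p k) = (7 - p k * Real.cos φ, -(p k * Real.sin φ)) := by
  have ht : Tendsto (fun k : ℕ => Real.arctan (φ + (k : ℝ) * (ε * (2 * Real.pi))) + m * Real.pi)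
      atTop (𝓝 c) := hc ▸ (hat.comp hl).add_const _
  refine ⟨_, fun k => rfl, ht, ?_⟩
  filter_upwards [ht.eventually (gt_mem_nhds hc5)] with k hk
  refine profCurve_eq_of_tan (k := k * e) (le_of_lt hk) ?_
  rw [Real.tan_add_int_mul_pi, Real.tan_arctan, ← he]
  push_cast
  ring

/-- The curve has angle φ whenever tan p = φ modulo 2π. The solutions arctan(φ - 2πk) + mπ decrease
to the pole of the tangent, and `profTime` carries them to times tending to +∞. -/
lemma exists_seq_right (φ : ℝ) (m : ℤ) {P : ℝ → ℝ} {b : ℝ}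
    (hc5 : -(Real.pi / 2) + m * Real.pi < 5) (hb : -(Real.pi / 2) + m * Real.pi < b)
    (hS : Tendsto profTime (𝓝[>] (-(Real.pi / 2) + m * Real.pi)) atTop)
    (hP : ∀ p ∈ Ioo (-(Real.pi / 2) + m * Real.pi) b, P (profTime p) = p) :
    ∃ s : ℕ → ℝ, Tendsto s atTop atTop ∧
      ∀ k, profCurve (P (s k)) = (7 - P (s k) * Real.cos φ, -(P (s k) * Real.sin φ)) := by
  have hl : Tendsto (fun k : ℕ => φ + (k : ℝ) * ((-1) * (2 * Real.pi))) atTop atBot :=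
    tendsto_atBot_add_const_left _ _ (tendsto_natCast_atTop_atTop.atTop_mul_const_of_neg
      (by linarith [Real.pi_pos]))
  obtain ⟨p, hpk, hp, hcurve⟩ := exists_seq_tan φ (-1) _ m (-1) (by simp) atBot hl
    (Real.tendsto_arctan_atBot.mono_right nhdsWithin_le_nhds) rfl (by linarith)
  have hp' : Tendsto p atTop (𝓝[>] (-(Real.pi / 2) + m * Real.pi)) := by
    refine tendsto_nhdsWithin_of_tendsto_nhds_of_eventually_within _ hp
      (Eventually.of_forall fun k => ?_)
    rw [← hpk]
    rw [mem_Ioi]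
    linarith [Real.neg_pi_div_two_lt_arctan (φ + (k : ℝ) * ((-1) * (2 * Real.pi)))]
  obtain ⟨N, hN⟩ := eventually_atTop.1 (hcurve.and ((hp.eventually (gt_mem_nhds hb)).and
    (hp'.eventually self_mem_nhdsWithin)))
  refine ⟨fun k => profTime (p (k + N)), (hS.comp hp').comp (tendsto_add_atTop_nat N), fun k => ?_⟩
  obtain ⟨h1, h2, h3⟩ := hN (k + N) (by omega)
  rw [hP _ ⟨h3, h2⟩, h1]

lemma exists_seq_left (φ : ℝ) (m : ℤ) {P : ℝ → ℝ} {b : ℝ}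
    (hc5 : Real.pi / 2 + m * Real.pi < 5) (hb : b < Real.pi / 2 + m * Real.pi)
    (hS : Tendsto profTime (𝓝[<] (Real.pi / 2 + m * Real.pi)) atBot)
    (hP : ∀ p ∈ Ioo b (Real.pi / 2 + m * Real.pi), P (profTime p) = p) :
    ∃ s : ℕ → ℝ, Tendsto s atTop atBot ∧
      ∀ k, profCurve (P (s k)) = (7 - P (s k) * Real.cos φ, -(P (s k) * Real.sin φ)) := by
  have hl : Tendsto (fun k : ℕ => φ + (k : ℝ) * (1 * (2 * Real.pi))) atTop atTop :=
    tendsto_atTop_add_const_left _ _ (tendsto_natCast_atTop_atTop.atTop_mul_const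
      (by linarith [Real.pi_pos]))
  obtain ⟨p, hpk, hp, hcurve⟩ := exists_seq_tan φ 1 _ m 1 (by simp) atTop hl
    (Real.tendsto_arctan_atTop.mono_right nhdsWithin_le_nhds) rfl (by linarith)
  have hp' : Tendsto p atTop (𝓝[<] (Real.pi / 2 + m * Real.pi)) := by
    refine tendsto_nhdsWithin_of_tendsto_nhds_of_eventually_within _ hp
      (Eventually.of_forall fun k => ?_)
    rw [← hpk]
    rw [mem_Iio]
    linarith [Real.arctan_lt_pi_div_two (φ + (k : ℝ) * (1 * (2 * Real.pi)))]
  obtain ⟨N, hN⟩ := eventually_atTop.1 (hcurve.and ((hp.eventually (lt_mem_nhds hb)).and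
    (hp'.eventually self_mem_nhdsWithin)))
  refine ⟨fun k => profTime (p (k + N)), (hS.comp hp').comp (tendsto_add_atTop_nat N), fun k => ?_⟩
  obtain ⟨h1, h2, h3⟩ := hN (k + N) (by omega)
  rw [hP _ ⟨h2, h3⟩, h1]

lemma cos_three_pi_div_two : Real.cos (3 * Real.pi / 2) = 0 := by
  rw [show 3 * Real.pi / 2 = Real.pi / 2 + Real.pi by ring, Real.cos_add_pi, Real.cos_pi_div_two,
    neg_zero]

/-- The branch between the pole 3π/2 and the axis at p = 7. For p ≥ 6 its time is log (7 - p), so s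
≤ 0 corresponds to the straight part. -/
theorem exists_plane_profile : ∃ P, IsProfile P ∧ IsSpiralEnd P atTop (3 * Real.pi / 2) ∧
    ∀ s ≤ 0, P s = 7 - Real.exp s := by
  have h0 := three_pi_div_two_lt
  have hπ := Real.pi_gt_three
  have hmem : ∀ p ∈ Ioo (3 * Real.pi / 2) 7, p ∈ profDom := fun p hp =>
    ⟨by linarith [hp.1], hp.2, hp.1.ne'⟩
  obtain ⟨P, h1, h2, h3, h4, h5, h6⟩ := exists_contDiff_inverse (S := profTime)
    (show 3 * Real.pi / 2 < 7 by linarith)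
    (fun p hp => contDiffAt_profTime (cos_ne_zero_of_profDom (hmem p hp)) hp.2)
    (fun p hp => deriv_profTime_neg (hmem p hp))
    (tendsto_profTime_right (by linarith) tendsto_tan_right_three_pi) tendsto_profTime_seven
  have hc : -(Real.pi / 2) + (2 : ℤ) * Real.pi = 3 * Real.pi / 2 := by
    push_cast
    ring
  refine ⟨P, ⟨h1, fun s => hmem _ (h2 s), h4⟩, ⟨cos_three_pi_div_two, by linarith, le_rfl, h5,
    fun φ => exists_seq_right φ 2 (b := 7) ?_ ?_ ?_ ?_⟩, fun s hs => ?_⟩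
  · rw [hc]
    linarith
  · rw [hc]
    linarith
  · rw [hc]
    exact tendsto_profTime_right (by linarith) tendsto_tan_right_three_pi
  · rwa [hc]
  · have he : Real.exp s ≤ 1 := Real.exp_le_one_iff.2 hs
    have hpos := Real.exp_pos s
    have := h3 (7 - Real.exp s) ⟨by linarith, by linarith⟩
    rwa [profTime_of_ge (by linarith), sub_sub_cancel, Real.log_exp] at this

/-- The branch between two consecutive poles of the tangent. Time decreases in p, so the future end
is at π/2 and the past end at 3π/2. -/
theorem exists_cylinder_profile : ∃ P, IsProfile P ∧ IsSpiralEnd P atTop (Real.pi / 2) ∧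
    IsSpiralEnd P atBot (3 * Real.pi / 2) := by
  have h0 := three_pi_div_two_lt
  have hπ := Real.pi_gt_three
  have hmem : ∀ p ∈ Ioo (Real.pi / 2) (3 * Real.pi / 2), p ∈ profDom := fun p hp =>
    ⟨hp.1, by linarith [hp.2], hp.2.ne⟩
  obtain ⟨P, h1, h2, h3, h4, h5, h6⟩ := exists_contDiff_inverse (S := profTime)
    (show Real.pi / 2 < 3 * Real.pi / 2 by linarith)
    (fun p hp => contDiffAt_profTime (cos_ne_zero_of_profDom (hmem p hp)) (hmem p hp).2.1)
    (fun p hp => deriv_profTime_neg (hmem p hp))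
    (tendsto_profTime_right (by linarith) tendsto_tan_right_pi_div_two)
    (tendsto_profTime_left (by linarith) tendsto_tan_left)
  have hc : -(Real.pi / 2) + (1 : ℤ) * Real.pi = Real.pi / 2 := by
    push_cast
    ring
  have hc' : Real.pi / 2 + (1 : ℤ) * Real.pi = 3 * Real.pi / 2 := by
    push_cast
    ring
  refine ⟨P, ⟨h1, fun s => hmem _ (h2 s), h4⟩, ⟨Real.cos_pi_div_two, le_rfl, by linarith, h5,
    fun φ => exists_seq_right φ 1 (b := 3 * Real.pi / 2) ?_ ?_ ?_ ?_⟩,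
    ⟨cos_three_pi_div_two, by linarith, le_rfl, h6,
    fun φ => exists_seq_left φ 1 (b := Real.pi / 2) ?_ ?_ ?_ ?_⟩⟩
  · rw [hc]
    linarith
  · rw [hc]
    linarith
  · rw [hc]
    exact tendsto_profTime_right (by linarith) tendsto_tan_right_pi_div_two
  · rwa [hc]
  · rw [hc']
    linarith
  · rw [hc']
    linarith
  · rw [hc']
    exact tendsto_profTime_left (by linarith) tendsto_tan_left
  · rwa [hc']

end Profile

/-! ### Surfaces obtained by rotating a curve with the argument -/

section Polar

lemma hasFDerivAt_log_norm {ζ : ℂ} (hζ : ζ ≠ 0) : HasFDerivAt (fun ζ : ℂ => Real.log ‖ζ‖)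
    (Complex.reCLM.comp (ContinuousLinearMap.mul ℝ ℂ ζ⁻¹)) ζ := by
  have h : ‖ζ‖ ≠ 0 := norm_ne_zero_iff.2 hζ
  refine ((hasFDerivAt_norm_complex hζ).log h).congr_fderiv ?_
  ext v
  have h2 := normSq_eq_re_im ζ
  simp [Complex.mul_re, Complex.inv_re, Complex.inv_im, Complex.normSq_eq_norm_sq]
  field_simp
  ring

/-- The surface swept out by rotating a curve with the argument. -/
def polarMap (c : ℝ → ℂ) (z : ℝ → ℝ) (ζ : ℂ) : ℂ × ℝ :=
  (c (Real.log ‖ζ‖) * (ζ / ‖ζ‖), z (Real.log ‖ζ‖))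

lemma contDiffAt_polarMap {c : ℝ → ℂ} {z : ℝ → ℝ} (hc : ContDiff ℝ ∞ c) (hz : ContDiff ℝ ∞ z)
    {ζ : ℂ} (hζ : ζ ≠ 0) : ContDiffAt ℝ ∞ (polarMap c z) ζ := by
  have hn : ContDiffAt ℝ ∞ (fun ζ : ℂ => ‖ζ‖) ζ := contDiffAt_norm ℝ hζ
  have hl := hn.log (norm_ne_zero_iff.2 hζ)
  have h1 : ContDiffAt ℝ ∞ (fun ζ : ℂ => ((‖ζ‖ : ℝ) : ℂ)) ζ :=
    Complex.ofRealCLM.contDiff.contDiffAt.comp ζ hn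
  refine ContDiffAt.prodMk ?_ (hz.contDiffAt.comp ζ hl)
  have h2 : ContDiffAt ℝ ∞ (fun ζ : ℂ => ζ / (‖ζ‖ : ℂ)) ζ :=
    (contDiffAt_id.mul (h1.inv (by simpa using hζ))).congr_of_eventuallyEq
      (Eventually.of_forall fun _ => div_eq_mul_inv _ _)
  exact (hc.contDiffAt.comp ζ hl).mul h2

/-- In the coordinate log ζ = s + i t the direction ζ η becomes η. Its real part moves along the
curve, its imaginary part rotates. -/
lemma fderiv_polarMap {c : ℝ → ℂ} {z : ℝ → ℝ} {ζ : ℂ} (hζ : ζ ≠ 0) {c' : ℂ} {z' : ℝ}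
    (hc : HasDerivAt c c' (Real.log ‖ζ‖)) (hz : HasDerivAt z z' (Real.log ‖ζ‖)) (η : ℂ) :
    fderiv ℝ (polarMap c z) ζ (ζ * η) = η.re • (c' * (ζ / ‖ζ‖), z') +
      η.im • (Complex.I * (c (Real.log ‖ζ‖) * (ζ / ‖ζ‖)), 0) := by
  have h : ‖ζ‖ ≠ 0 := norm_ne_zero_iff.2 hζ
  have hl := hasFDerivAt_log_norm hζ
  have hL : (Complex.reCLM.comp (ContinuousLinearMap.mul ℝ ℂ ζ⁻¹)) (ζ * η) = η.re := by
    simp [hζ]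
  have hexp : ∀ {ξ : ℂ}, ξ ≠ 0 → Complex.exp (Real.log ‖ξ‖) = ‖ξ‖ := fun {ξ} hξ => by
    rw [← Complex.ofReal_exp, Real.exp_log (norm_pos_iff.2 hξ)]
  have h1 := hc.hasFDerivAt.comp ζ hl
  have h2 := hz.hasFDerivAt.comp ζ hl
  -- Writing 1 / ‖ζ‖ as exp(-log ‖ζ‖) reduces every derivative to that of log ‖ζ‖.
  have he : HasFDerivAt (fun ζ : ℂ => ((Real.exp (-Real.log ‖ζ‖) : ℝ) : ℂ)) _ ζ :=
    Complex.ofRealCLM.hasFDerivAt.comp ζ hl.neg.exp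
  have h3 := h1.mul ((hasFDerivAt_id ζ).mul he)
  have h4 := (h3.prodMk h2).congr_of_eventuallyEq (f₁ := polarMap c z) (by
    filter_upwards [isOpen_ne.mem_nhds hζ] with ξ hξ
    refine Prod.ext ?_ rfl
    simp [polarMap, Real.exp_neg, hexp hξ, div_eq_mul_inv])
  rw [h4.fderiv]
  have h6 : (ζ⁻¹ * (ζ * η)).re = η.re := hL
  refine Prod.ext ?_ ?_
  · simp [h6, div_eq_mul_inv, Complex.exp_neg, hexp hζ]
    have h7 : (η : ℂ) = η.re + η.im * Complex.I := (Complex.re_add_im η).symm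
    generalize η.re = x at *
    generalize η.im = y at *
    rw [h7]
    ring
  · simp [h6]

end Polar

/-! ### The surface over the profile curve -/

section Profile

variable {P : ℝ → ℝ}

/-- The velocity of the profile curve. -/
def profVel (P : ℝ → ℝ) (s : ℝ) : ℝ × ℝ := (deriv profTime (P s))⁻¹ • deriv profCurve (P s)

/-- The phase that makes the rotated profile curve tangent to the contact structure. -/
def profPhase (P : ℝ → ℝ) (s : ℝ) : ℝ :=
  ∫ σ in (0 : ℝ)..s, -((profVel P σ).2 / (profCurve (P σ)).1 ^ 2)

/-- The rotated profile curve, projected to the plane. -/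
def profAmp (P : ℝ → ℝ) (s : ℝ) : ℂ :=
  (profCurve (P s)).1 * Complex.exp (profPhase P s * Complex.I)

/-- The height of the profile curve. -/
def profHeight (P : ℝ → ℝ) (s : ℝ) : ℝ := (profCurve (P s)).2

/-- The `ℝ`-coordinate over the profile curve. -/
def profLift (P : ℝ → ℝ) (s : ℝ) : ℝ := ∫ σ in (0 : ℝ)..s, Real.exp (profAction (P σ))

/-- The derivative of the action along the profile curve with respect to the time. -/
def profGrowth (P : ℝ → ℝ) (s : ℝ) : ℝ :=
  Real.exp (profAction (P s)) * (deriv profAction (P s) * (deriv profTime (P s))⁻¹)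

lemma IsProfile.fst_pos (hP : IsProfile P) (s : ℝ) : 0 < (profCurve (P s)).1 :=
  profCurve_fst_pos (by linarith [three_halves_lt_of_profDom (hP.mem s).1.le]) (hP.mem s).2.1

lemma IsProfile.hasDerivAt_curve (hP : IsProfile P) (s : ℝ) :
    HasDerivAt (fun s => profCurve (P s)) (profVel P s) s :=
  (hasDerivAt_profCurve (cos_ne_zero_of_profDom (hP.mem s))).scomp s (hP.hasDerivAt s)

lemma IsProfile.hasDerivAt_radius (hP : IsProfile P) (s : ℝ) :
    HasDerivAt (fun s => (profCurve (P s)).1) (profVel P s).1 s := by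
  have h : HasFDerivAt Prod.fst (ContinuousLinearMap.fst ℝ ℝ ℝ) (profCurve (P s)) := hasFDerivAt_fst
  exact h.comp_hasDerivAt s (hP.hasDerivAt_curve s)

lemma IsProfile.contDiff_curve (hP : IsProfile P) : ContDiff ℝ ∞ fun s => profCurve (P s) :=
  contDiff_iff_contDiffAt.2 fun s =>
    (contDiffAt_profCurve (cos_ne_zero_of_profDom (hP.mem s))).comp s hP.contDiff.contDiffAt

lemma IsProfile.contDiff_vel (hP : IsProfile P) : ContDiff ℝ ∞ (profVel P) := by
  have h := (contDiff_infty_iff_deriv.1 hP.contDiff_curve).2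
  rwa [funext fun s => (hP.hasDerivAt_curve s).deriv] at h

lemma contDiff_integral {f : ℝ → ℝ} (hf : ContDiff ℝ ∞ f) :
    ContDiff ℝ ∞ (fun s => ∫ σ in (0 : ℝ)..s, f σ) ∧
      ∀ s, HasDerivAt (fun s => ∫ σ in (0 : ℝ)..s, f σ) (f s) s := by
  have h : ∀ s, HasDerivAt (fun s => ∫ σ in (0 : ℝ)..s, f σ) (f s) s := fun s =>
    intervalIntegral.integral_hasDerivAt_right (hf.continuous.intervalIntegrable _ _)
      (hf.continuous.stronglyMeasurableAtFilter _ _) hf.continuous.continuousAt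
  refine ⟨contDiff_infty_iff_deriv.2 ⟨fun s => (h s).differentiableAt, ?_⟩, h⟩
  rwa [funext fun s => (h s).deriv]

lemma IsProfile.phase (hP : IsProfile P) : ContDiff ℝ ∞ (profPhase P) ∧
    ∀ s, HasDerivAt (profPhase P) (-((profVel P s).2 / (profCurve (P s)).1 ^ 2)) s :=
  contDiff_integral (hP.contDiff_vel.snd.div (hP.contDiff_curve.fst.pow 2)
    fun s => pow_ne_zero 2 (hP.fst_pos s).ne').neg

lemma IsProfile.contDiff_action (hP : IsProfile P) :
    ContDiff ℝ ∞ fun s => Real.exp (profAction (P s)) := by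
  have h : (fun s => Real.exp (profAction (P s))) = fun s =>
      Real.exp (modelF₂ (profCurve (P s)) + 2 * Real.log (profCurve (P s)).1) := by
    funext s
    rw [modelF₂_profCurve (hP.mem s)]
  have h2 : ∀ s, Real.exp (modelF₂ (profCurve (P s)) + 2 * Real.log (profCurve (P s)).1) =
      Real.exp (modelF (((profCurve (P s)).1 : ℂ), (profCurve (P s)).2)) *
        (profCurve (P s)).1 ^ 2 := by
    intro s
    rw [Real.exp_add, modelF, two_mul (Real.log _), Real.exp_add, Real.exp_log (hP.fst_pos s)]
    simp only [Complex.norm_real, Real.norm_of_nonneg (hP.fst_pos s).le]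
    rw [sq]
  rw [h, funext h2]
  exact (Real.contDiff_exp.comp (contDiff_modelF.comp
    ((Complex.ofRealCLM.contDiff.comp hP.contDiff_curve.fst).prodMk hP.contDiff_curve.snd))).mul
    (hP.contDiff_curve.fst.pow 2)

lemma IsProfile.lift (hP : IsProfile P) : ContDiff ℝ ∞ (profLift P) ∧
    ∀ s, HasDerivAt (profLift P) (Real.exp (profAction (P s))) s :=
  contDiff_integral hP.contDiff_action

lemma IsProfile.hasDerivAt_action (hP : IsProfile P) (s : ℝ) :
    HasDerivAt (fun s => Real.exp (profAction (P s))) (profGrowth P s) s := by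
  have h := (hasDerivAt_profAction (hP.mem s).2.1).differentiableAt.hasDerivAt
  exact (h.comp s (hP.hasDerivAt s)).exp

lemma IsProfile.growth_nonneg (hP : IsProfile P) (s : ℝ) : 0 ≤ profGrowth P s :=
  mul_nonneg (Real.exp_pos _).le (mul_nonneg_of_nonpos_of_nonpos
    (deriv_profAction_neg (hP.mem s)).le (inv_nonpos.2 (deriv_profTime_neg (hP.mem s)).le))

lemma IsProfile.action_le (hP : IsProfile P) (s : ℝ) :
    Real.exp (profAction (P s)) ≤ Real.exp (tailS 0) :=
  Real.exp_le_exp.2 (profAction_le (hP.mem s))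

lemma IsProfile.norm_amp (hP : IsProfile P) (s : ℝ) : ‖profAmp P s‖ = (profCurve (P s)).1 := by
  rw [profAmp, norm_mul, Complex.norm_exp_ofReal_mul_I, mul_one, Complex.norm_real,
    Real.norm_of_nonneg (hP.fst_pos s).le]

lemma IsProfile.contDiff_amp (hP : IsProfile P) : ContDiff ℝ ∞ (profAmp P) :=
  (Complex.ofRealCLM.contDiff.comp hP.contDiff_curve.fst).mul
    (((Complex.ofRealCLM.contDiff.comp hP.phase.1).mul contDiff_const).cexp)

/-- The phase has derivative -z' / r², the solution of z' + r² θ' = 0, which puts the lifted curve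
into the contact planes. -/
lemma IsProfile.hasDerivAt_amp (hP : IsProfile P) (s : ℝ) : HasDerivAt (profAmp P)
    (profAmp P s * ⟨(profVel P s).1 / (profCurve (P s)).1,
      -(profVel P s).2 / (profCurve (P s)).1 ^ 2⟩) s := by
  have h1 : HasDerivAt (fun s => (((profCurve (P s)).1 : ℝ) : ℂ)) ((profVel P s).1 : ℂ) s :=
    (hP.hasDerivAt_radius s).ofReal_comp
  have h2 := ((hP.phase.2 s).ofReal_comp.mul_const Complex.I).cexp
  refine (h1.mul h2).congr_deriv ?_
  have hr : ((profCurve (P s)).1 : ℂ) ≠ 0 := by exact_mod_cast (hP.fst_pos s).ne'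
  have h3 : (⟨(profVel P s).1 / (profCurve (P s)).1,
      -(profVel P s).2 / (profCurve (P s)).1 ^ 2⟩ : ℂ) =
      ((profVel P s).1 : ℂ) / (profCurve (P s)).1 +
        (-((profVel P s).2 : ℂ) / (profCurve (P s)).1 ^ 2) * Complex.I := by
    rw [Complex.mk_eq_add_mul_I]
    push_cast
    rfl
  rw [h3, profAmp]
  push_cast
  field_simp

/-- The surface in `ℂ × ℝ` swept out by the profile curve. -/
def profSurface (P : ℝ → ℝ) : ℂ → ℂ × ℝ := polarMap (profAmp P) (profHeight P)

lemma IsProfile.norm_surface_fst (hP : IsProfile P) {ζ : ℂ} (hζ : ζ ≠ 0) :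
    ‖(profSurface P ζ).1‖ = (profCurve (P (Real.log ‖ζ‖))).1 := by
  have h : ‖ζ‖ ≠ 0 := norm_ne_zero_iff.2 hζ
  rw [profSurface, polarMap, norm_mul, hP.norm_amp, norm_div, Complex.norm_real, norm_norm,
    div_self h, mul_one]

lemma IsProfile.surface_eq (hP : IsProfile P) {ζ : ℂ} (hζ : ζ ≠ 0) :
    profCurve (P (Real.log ‖ζ‖)) = (‖(profSurface P ζ).1‖, (profSurface P ζ).2) := by
  rw [hP.norm_surface_fst hζ]
  rfl

lemma IsProfile.surface_fst_ne_zero (hP : IsProfile P) {ζ : ℂ} (hζ : ζ ≠ 0) :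
    (profSurface P ζ).1 ≠ 0 := by
  rw [← norm_ne_zero_iff, hP.norm_surface_fst hζ]
  exact (hP.fst_pos _).ne'

lemma IsProfile.contDiffAt_surface (hP : IsProfile P) {ζ : ℂ} (hζ : ζ ≠ 0) :
    ContDiffAt ℝ ∞ (profSurface P) ζ :=
  contDiffAt_polarMap hP.contDiff_amp hP.contDiff_curve.snd hζ

/-- The radial derivative of the surface. -/
def profTangent (P : ℝ → ℝ) (ζ : ℂ) : ℂ × ℝ :=
  radLift (profSurface P ζ).1 (profVel P (Real.log ‖ζ‖)).1 (profVel P (Real.log ‖ζ‖)).2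

lemma IsProfile.tangent_eq (hP : IsProfile P) {ζ : ℂ} (hζ : ζ ≠ 0) : profTangent P ζ =
    (profAmp P (Real.log ‖ζ‖) * ⟨(profVel P (Real.log ‖ζ‖)).1 / (profCurve (P (Real.log ‖ζ‖))).1,
      -(profVel P (Real.log ‖ζ‖)).2 / (profCurve (P (Real.log ‖ζ‖))).1 ^ 2⟩ * (ζ / ‖ζ‖),
      (profVel P (Real.log ‖ζ‖)).2) := by
  rw [profTangent, radLift, hP.norm_surface_fst hζ, profSurface, polarMap]
  refine Prod.ext ?_ rfl
  ring

lemma IsProfile.hasDerivAt_height (hP : IsProfile P) (s : ℝ) :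
    HasDerivAt (profHeight P) (profVel P s).2 s := by
  have h : HasFDerivAt Prod.snd (ContinuousLinearMap.snd ℝ ℝ ℝ) (profCurve (P s)) := hasFDerivAt_snd
  exact h.comp_hasDerivAt s (hP.hasDerivAt_curve s)

lemma IsProfile.fderiv_surface (hP : IsProfile P) {ζ : ℂ} (hζ : ζ ≠ 0) (η : ℂ) :
    fderiv ℝ (profSurface P) ζ (ζ * η) = η.re • profTangent P ζ +
      η.im • (Complex.I * (profSurface P ζ).1, 0) := by
  rw [profSurface, fderiv_polarMap hζ (hP.hasDerivAt_amp _) (hP.hasDerivAt_height _),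
    hP.tangent_eq hζ]
  rfl

lemma IsProfile.mem_modelPairs (hP : IsProfile P) {ζ : ℂ} (hζ : ζ ≠ 0) :
    (profTangent P ζ, rotField modelF (profSurface P ζ)) ∈ modelPairs (profSurface P ζ) :=
  Or.inl ⟨P (Real.log ‖ζ‖), hP.mem _, hP.surface_eq hζ, rfl⟩

lemma IsProfile.surface_mem (hP : IsProfile P) {ζ : ℂ} (hζ : ζ ≠ 0) :
    profSurface P ζ ∈ modelCore := by
  by_contra h
  have := hP.mem_modelPairs hζ
  rw [modelPairs_eq_empty h] at this
  exact this

lemma IsProfile.exp_modelF (hP : IsProfile P) {x : ℂ × ℝ} {s : ℝ}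
    (hx : profCurve (P s) = (‖x.1‖, x.2)) :
    Real.exp (modelF x) * ‖x.1‖ ^ 2 = Real.exp (profAction (P s)) := by
  have hr : 0 < ‖x.1‖ := by
    have := hP.fst_pos s
    rwa [hx] at this
  rw [← modelF₂_profCurve (hP.mem s), hx, Real.exp_add, two_mul, Real.exp_add, Real.exp_log hr,
    modelF, sq]

/-- By rotational invariance dλ(·, ∂_θ) is the differential of λ(∂_θ) = exp(F) r². Along the curve
it is therefore the time derivative of the action. -/
lemma IsProfile.dform_surface (hP : IsProfile P) {ζ : ℂ} (hζ : ζ ≠ 0) :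
    dform (fun p => Real.exp (modelF p) • stdForm p) (profSurface P ζ) (profTangent P ζ)
      (Complex.I * (profSurface P ζ).1, 0) = profGrowth P (Real.log ‖ζ‖) := by
  set s := Real.log ‖ζ‖ with hs
  set x := profSurface P ζ with hx
  have h0 : ‖ζ‖ ≠ 0 := norm_ne_zero_iff.2 hζ
  have hx0 := hP.surface_fst_ne_zero hζ
  have hn0 : ‖x.1‖ ≠ 0 := norm_ne_zero_iff.2 hx0
  have hy : HasDerivAt (fun σ => (profAmp P σ * (ζ / ‖ζ‖), profHeight P σ)) (profTangent P ζ) s := by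
    rw [hP.tangent_eq hζ]
    exact ((hP.hasDerivAt_amp s).mul_const _).prodMk (hP.hasDerivAt_height s)
  have hF := (contDiff_modelF.differentiable (by simp) x)
  have hF' : HasFDerivAt modelF (fderiv ℝ modelF x) (profAmp P s * (ζ / ‖ζ‖), profHeight P s) :=
    hF.hasFDerivAt
  have h1 : HasDerivAt (fun σ => modelF (profAmp P σ * (ζ / ‖ζ‖), profHeight P σ))
      (fderiv ℝ modelF x (profTangent P ζ)) s :=
    HasFDerivAt.comp_hasDerivAt (f := fun σ => (profAmp P σ * (ζ / (‖ζ‖ : ℂ)), profHeight P σ)) s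
      hF' hy
  have h2 := h1.exp.mul ((hP.hasDerivAt_radius s).pow 2)
  have h3 : (fun σ => Real.exp (profAction (P σ))) = fun σ =>
      Real.exp (modelF (profAmp P σ * (ζ / ‖ζ‖), profHeight P σ)) * (profCurve (P σ)).1 ^ 2 := by
    funext σ
    have h4 : ‖profAmp P σ * (ζ / ‖ζ‖)‖ = (profCurve (P σ)).1 := by
      rw [norm_mul, hP.norm_amp, norm_div, Complex.norm_real, norm_norm, div_self h0, mul_one]
    rw [← hP.exp_modelF (x := (profAmp P σ * (ζ / ‖ζ‖), profHeight P σ)) (s := σ)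
      (by rw [h4]; rfl), h4]
  have h5 := hP.hasDerivAt_action s
  rw [h3] at h5
  rw [h5.unique h2, dform_exp_smul_stdForm hF, stdForm_rot, profTangent, stdForm_radLift hx0]
  have h6 : ‖x.1‖ = (profCurve (P s)).1 := hP.norm_surface_fst hζ
  have h7 : modelF (profAmp P s * (ζ / ‖ζ‖), profHeight P s) = modelF x := rfl
  have h8 := normSq_eq_re_im x.1
  simp only [h7, ← h6]
  rw [← hx, ← hs]
  have h9 : 2 * ((radLift x.1 (profVel P s).1 (profVel P s).2).1.re * (Complex.I * x.1).im -
      (radLift x.1 (profVel P s).1 (profVel P s).2).1.im * (Complex.I * x.1).re) =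
      2 * ‖x.1‖ * (profVel P s).1 := by
    simp only [radLift, Complex.mul_re, Complex.mul_im, Complex.I_re, Complex.I_im]
    field_simp
    linear_combination (-(profVel P s).1 * ‖x.1‖) * h8
  rw [h9]
  simp [← h6]
  ring

end Profile

/-! ### The Hofer energy of rotationally symmetric maps -/

section Energy

lemma lintegral_polar_le {g : ℝ → ℝ} (hg : Measurable g) {C : ℝ≥0∞}
    (hC : ∫⁻ r in Ioi (0 : ℝ), ENNReal.ofReal (r * g r) ≤ C) :
    ∫⁻ z : ℂ, ENNReal.ofReal (g ‖z‖) ≤ C * ENNReal.ofReal (2 * Real.pi) := by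
  rw [← Complex.lintegral_comp_polarCoord_symm]
  have h1 : ∫⁻ p in polarCoord.target, ENNReal.ofReal p.1 • ENNReal.ofReal (g ‖Complex.polarCoord.symm p‖)
      = ∫⁻ p in Ioi (0 : ℝ) ×ˢ Ioo (-Real.pi) Real.pi,
        ENNReal.ofReal (p.1 * g p.1) * (fun _ => (1 : ℝ≥0∞)) p.2 := by
    refine setLIntegral_congr_fun polarCoord.open_target.measurableSet fun p hp => ?_
    have hp1 : 0 < p.1 := hp.1
    simp only [Complex.norm_polarCoord_symm, abs_of_pos hp1, smul_eq_mul, mul_one]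
    rw [ENNReal.ofReal_mul hp1.le]
  rw [h1, Measure.volume_eq_prod, ← Measure.prod_restrict,
    lintegral_prod_mul (f := fun r => ENNReal.ofReal (r * g r)) (g := fun _ => (1 : ℝ≥0∞))
      (measurable_id.mul hg).ennreal_ofReal.aemeasurable aemeasurable_const, setLIntegral_one, Real.volume_Ioo, sub_neg_eq_add, ← two_mul]
  gcongr

/-- The half-line is exhausted by compact intervals, on which the fundamental theorem applies. As H
is bounded, no limits at the ends are needed. -/
lemma lintegral_Ioi_deriv_le {H H' : ℝ → ℝ} {C : ℝ} (hH : ∀ x, 0 < x → HasDerivAt H (H' x) x)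
    (h0 : ∀ x, 0 < x → 0 ≤ H' x) (hC : ∀ x, 0 < x → H x ∈ Icc 0 C) :
    ∫⁻ x in Ioi (0 : ℝ), ENNReal.ofReal (H' x) ≤ ENNReal.ofReal C := by
  have hU : Ioi (0 : ℝ) = ⋃ n : ℕ, Ioc (1 / ((n : ℝ) + 1)) (n + 1) := by
    ext x
    simp only [mem_Ioi, mem_iUnion, mem_Ioc]
    constructor
    · intro hx
      obtain ⟨n, hn⟩ := exists_nat_one_div_lt hx
      obtain ⟨m, hm⟩ := exists_nat_ge x
      refine ⟨max n m, lt_of_le_of_lt ?_ hn, hm.trans ?_⟩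
      · exact one_div_le_one_div_of_le (by positivity) (by push_cast; gcongr; exact le_max_left _ _)
      · push_cast
        linarith [le_max_right (n : ℝ) m]
    · rintro ⟨n, hn, -⟩
      exact lt_trans (by positivity) hn
  have hmono : Monotone fun n : ℕ => Ioc (1 / ((n : ℝ) + 1)) (n + 1) := fun m n hmn => by
    have : (m : ℝ) ≤ n := by exact_mod_cast hmn
    exact Ioc_subset_Ioc (one_div_le_one_div_of_le (by positivity) (by linarith)) (by linarith)
  rw [hU, setLIntegral_iUnion_of_directed _ hmono.directed_le]
  refine iSup_le fun n => ?_
  have hpos : (0 : ℝ) < 1 / ((n : ℝ) + 1) := by positivity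
  have hle : 1 / ((n : ℝ) + 1) ≤ n + 1 := by
    rw [div_le_iff₀ (by positivity)]
    nlinarith [(n.cast_nonneg : (0 : ℝ) ≤ n)]
  have hder : ∀ x ∈ Icc (1 / ((n : ℝ) + 1)) (n + 1), HasDerivAt H (H' x) x := fun x hx =>
    hH x (hpos.trans_le hx.1)
  have hcont : ContinuousOn H (Icc (1 / ((n : ℝ) + 1)) (n + 1)) := fun x hx =>
    (hder x hx).continuousAt.continuousWithinAt
  have hint := intervalIntegral.integrableOn_deriv_of_nonneg hcont
    (fun x hx => hder x (Ioo_subset_Icc_self hx)) fun x hx => h0 x (hpos.trans hx.1)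
  rw [← ofReal_integral_eq_lintegral_ofReal hint
    ((ae_restrict_iff' measurableSet_Ioc).2 (Eventually.of_forall fun x hx => h0 x (hpos.trans hx.1))),
    ← intervalIntegral.integral_of_le hle, intervalIntegral.integral_eq_sub_of_hasDerivAt
      (fun x hx => hder x (by rwa [uIcc_of_le hle] at hx))
      ((intervalIntegrable_iff_integrableOn_Ioc_of_le hle).2 hint)]
  refine ENNReal.ofReal_le_ofReal ?_
  linarith [(hC _ hpos).1, (hC _ (hpos.trans_le hle)).2]

variable {d : ℕ} {M : Type*} [TopologicalSpace M] [ChartedSpace (Euc d) M]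

/-- The Hofer energy of a map whose density is radially symmetric. -/
lemma hoferEnergy_lt_top {lam : OneForm d M} {Ω : Set ℂ} {a : ℂ → ℝ} {u : ℂ → M}
    {A f f' : ℝ → ℝ} {C : ℝ} (hA : ∀ s, HasDerivAt A (f s) s) (hf : ∀ s, HasDerivAt f (f' s) s)
    (hf0 : ∀ s, 0 ≤ f s) (hf' : ∀ s, 0 ≤ f' s) (hC : ∀ s, f s ≤ C)
    (hE : ∀ φ : ℝ → ℝ, ∀ ζ ∈ Ω, ζ ≠ 0 → energyDensity lam a u φ ζ =
      (‖ζ‖ ^ 2)⁻¹ * (deriv φ (A (Real.log ‖ζ‖)) * f (Real.log ‖ζ‖) ^ 2 +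
        φ (A (Real.log ‖ζ‖)) * f' (Real.log ‖ζ‖))) (hΩ : MeasurableSet Ω) :
    hoferEnergy lam Ω a u < ⊤ := by
  refine lt_of_le_of_lt (b := ENNReal.ofReal C * ENNReal.ofReal (2 * Real.pi))
    (iSup₂_le fun φ hφ => ?_) (ENNReal.mul_lt_top ENNReal.ofReal_lt_top ENNReal.ofReal_lt_top)
  obtain ⟨hφs, hφ01, hφ', -, -⟩ := hφ
  have hfd : f' = deriv f := funext fun s => (hf s).deriv.symm
  have hAc : Continuous A := continuous_iff_continuousAt.2 fun s => (hA s).continuousAt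
  have hfc : Continuous f := continuous_iff_continuousAt.2 fun s => (hf s).continuousAt
  have hf'm : Measurable f' := hfd ▸ measurable_deriv f
  set G : ℝ → ℝ := fun r => (r ^ 2)⁻¹ * (deriv φ (A (Real.log r)) * f (Real.log r) ^ 2 +
    φ (A (Real.log r)) * f' (Real.log r)) with hG
  have hGm : Measurable G :=
    (measurable_id.pow_const 2).inv.mul ((((measurable_deriv φ).comp (hAc.measurable.comp
      Real.measurable_log)).mul ((hfc.measurable.comp Real.measurable_log).pow_const 2)).add
      ((hφs.continuous.measurable.comp (hAc.measurable.comp Real.measurable_log)).mul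
        (hf'm.comp Real.measurable_log)))
  have hnn : ∀ s, 0 ≤ deriv φ (A s) * f s ^ 2 + φ (A s) * f' s := fun s =>
    add_nonneg (mul_nonneg (hφ' _) (sq_nonneg _)) (mul_nonneg (hφ01 _).1 (hf' s))
  have h1 : ∫⁻ z in Ω, ENNReal.ofReal (energyDensity lam a u φ z) ≤
      ∫⁻ z : ℂ, ENNReal.ofReal (G ‖z‖) := by
    calc _ = ∫⁻ z in Ω, ENNReal.ofReal (G ‖z‖) := by
          refine lintegral_congr_ae ((ae_restrict_iff' hΩ).2 ?_)
          have : ∀ᵐ z : ℂ, z ≠ 0 := by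
            rw [ae_iff]
            simp
          filter_upwards [this] with z hz hzΩ
          rw [hE φ z hzΩ hz]
      _ ≤ _ := setLIntegral_le_lintegral _ _
  refine h1.trans (lintegral_polar_le hGm ?_)
  have h2 : ∫⁻ r in Ioi (0 : ℝ), ENNReal.ofReal (r * G r) = ∫⁻ r in Ioi (0 : ℝ), ENNReal.ofReal
      (r⁻¹ * (deriv φ (A (Real.log r)) * f (Real.log r) ^ 2 +
        φ (A (Real.log r)) * f' (Real.log r))) := by
    refine setLIntegral_congr_fun measurableSet_Ioi fun r (hr : 0 < r) => ?_
    simp only [hG]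
    congr 1
    field_simp
  rw [h2]
  -- Since A' = f, the integrand is the derivative in r of φ(A) f evaluated at log r, a function
  -- with values between 0 and C.
  refine lintegral_Ioi_deriv_le (H := fun r => φ (A (Real.log r)) * f (Real.log r)) (fun r hr => ?_)
    (fun r hr => mul_nonneg (inv_pos.2 hr).le (hnn _)) fun r hr =>
      ⟨mul_nonneg (hφ01 _).1 (hf0 _), ?_⟩
  · have hl := Real.hasDerivAt_log hr.ne'
    have hφd : HasDerivAt φ (deriv φ (A (Real.log r))) (A (Real.log r)) :=
      (hφs.differentiable (by simp) _).hasDerivAt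
    have h3 := hφd.comp r ((hA _).comp r hl)
    refine (h3.mul ((hf _).comp r hl)).congr_deriv ?_
    simp only [Function.comp_apply]
    ring
  · exact (mul_le_of_le_one_left (hf0 _) (hφ01 _).2).trans (hC _)

end Energy

/-! ### Pseudoholomorphic surfaces in a model slice -/

section Slice

variable {n : ℕ} {M : Type*} [TopologicalSpace M] [ChartedSpace (Euc (2 * n + 1)) M]
  [IsManifold (𝓡 (2 * n + 1)) ∞ M]

/-- A slice of `M` on which the contact form and the complex structure are those of the model. -/
structure IsModelSlice (lam : OneForm (2 * n + 1) M) (J : TangentEnd (2 * n + 1) M)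
    (ι : ℂ × ℝ → M) : Prop where
  contact : IsContactForm lam
  compatible : IsCompatible lam J
  injOn : InjOn ι (Metric.ball 0 20)
  smooth : ∀ p ∈ Metric.ball (0 : ℂ × ℝ) 20, ContMDiffAt 𝓘(ℝ, ℂ × ℝ) (𝓡 (2 * n + 1)) ∞ ι p
  injective : ∀ p ∈ Metric.ball (0 : ℂ × ℝ) 20, Function.Injective (sliceD (n := n) ι p)
  pull : ∀ p ∈ Metric.ball (0 : ℂ × ℝ) 20, pullForm lam ι p = Real.exp (modelF p) • stdForm p
  reeb_eq : ∀ p ∈ Metric.ball (0 : ℂ × ℝ) 20, reeb lam (ι p) = sliceD ι p (modelReeb modelF p)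
  pairs : ∀ p, ∀ a ∈ modelPairs p, J (ι p) (sliceD ι p a.1) = sliceD ι p a.2

variable {lam : OneForm (2 * n + 1) M} {J : TangentEnd (2 * n + 1) M} {ι : ℂ × ℝ → M}

lemma IsModelSlice.lam_sliceD (h : IsModelSlice lam J ι) {p : ℂ × ℝ} (hp : p ∈ Metric.ball 0 20)
    (v : ℂ × ℝ) : lam (ι p) (sliceD ι p v) = Real.exp (modelF p) * stdForm p v :=
  congrArg (fun L => L v) (h.pull p hp)

lemma IsModelSlice.du_comp (h : IsModelSlice lam J ι) {w : ℂ → ℂ × ℝ} {ζ : ℂ}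
    (hp : w ζ ∈ Metric.ball 0 20) (hw : DifferentiableAt ℝ w ζ) (η : ℂ) :
    du (d := 2 * n + 1) (ι ∘ w) ζ η = sliceD ι (w ζ) (fderiv ℝ w ζ η) :=
  mfderiv_comp_vec ((h.smooth _ hp).mdifferentiableAt (by simp)) hw η

lemma IsModelSlice.extD_sliceD (h : IsModelSlice lam J ι) {p : ℂ × ℝ} (hp : p ∈ Metric.ball 0 20)
    (v w : ℂ × ℝ) : extD lam (ι p) (sliceD ι p v) (sliceD ι p w) =
      dform (fun p => Real.exp (modelF p) • stdForm p) p v w := by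
  refine (h.contact.1.extD_mfderiv (h.smooth p hp) v w).trans ?_
  rw [dform_congr ((Metric.isOpen_ball.eventually_mem hp).mono h.pull)]

variable {a : ℂ → ℝ} {w : ℂ → ℂ × ℝ} {ζ m : ℂ} {f : ℝ} {ws wt : ℂ × ℝ}

lemma IsModelSlice.lam_tangent (h : IsModelSlice lam J ι) (hp : w ζ ∈ Metric.ball 0 20)
    (hpair : (ws, wt - f • modelReeb modelF (w ζ)) ∈ modelPairs (w ζ)) :
    lam (ι (w ζ)) (sliceD ι (w ζ) ws) = 0 ∧ lam (ι (w ζ)) (sliceD ι (w ζ) wt) = f := by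
  obtain ⟨h1, h2⟩ := stdForm_modelPairs _ _ hpair
  rw [h.lam_sliceD hp, h.lam_sliceD hp]
  refine ⟨by rw [h1, mul_zero], ?_⟩
  rw [map_sub, map_smul, smul_eq_mul] at h2
  have h3 := exp_mul_stdForm_modelReeb modelF (w ζ)
  linear_combination Real.exp (modelF (w ζ)) * h2 + f * h3

/-- The Cauchy–Riemann equation at one point. The vector A is horizontal and B = Q A + f R, so Q A =
B - f R together with Q² A = -A matches multiplication of x + i y by i. -/
lemma symplJ_linear {V : Type*} [NormedAddCommGroup V] [NormedSpace ℝ V] (l : V →L[ℝ] ℝ)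
    (Q : V →L[ℝ] V) {R A B : V} (h1 : l A = 0) (h2 : l B = f) (hQ : Q A = B - f • R)
    (hQ2 : Q (Q A) = -A) (x y : ℝ) : (f * -y, -y • A + x • B) =
      (-l (x • A + y • B), (f * x) • R + Q (x • A + y • B - l (x • A + y • B) • R)) := by
  have hl : l (x • A + y • B) = y * f := by
    rw [map_add, map_smul, map_smul, h1, h2, smul_eq_mul, smul_eq_mul, mul_zero, zero_add]
  have h3 : x • A + y • B - (y * f) • R = x • A + y • Q A := by
    rw [hQ]
    module
  rw [hl, h3, map_add, map_smul, map_smul, hQ2, hQ]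
  refine Prod.ext ?_ ?_
  · ring
  · module

/-- A surface in the slice whose tangent vectors are rotated by `J` is pseudoholomorphic. -/
lemma IsModelSlice.symplJ_eq (h : IsModelSlice lam J ι) (hp : w ζ ∈ Metric.ball 0 20)
    (hw : DifferentiableAt ℝ w ζ) (hm : m ≠ 0) (ha' : ∀ η, fderiv ℝ a ζ (m * η) = f * η.re)
    (hw' : ∀ η : ℂ, fderiv ℝ w ζ (m * η) = η.re • ws + η.im • wt)
    (hpair : (ws, wt - f • modelReeb modelF (w ζ)) ∈ modelPairs (w ζ)) (η : ℂ) :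
    (fderiv ℝ a ζ (Complex.I * η), du (d := 2 * n + 1) (ι ∘ w) ζ (Complex.I * η)) =
      symplJ lam J ((ι ∘ w) ζ) (fderiv ℝ a ζ η, du (d := 2 * n + 1) (ι ∘ w) ζ η) := by
  obtain ⟨h1, h2⟩ := h.lam_tangent hp hpair
  have hη : η = m * (m⁻¹ * η) := by rw [mul_inv_cancel_left₀ hm]
  have hIη : Complex.I * η = m * (Complex.I * (m⁻¹ * η)) := by
    rw [mul_left_comm, mul_inv_cancel_left₀ hm]
  generalize m⁻¹ * η = ξ at hη hIη
  have hre : (Complex.I * ξ).re = -ξ.im := by simp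
  have him : (Complex.I * ξ).im = ξ.re := by simp
  have hdu : ∀ ξ : ℂ, (du (d := 2 * n + 1) (ι ∘ w) ζ (m * ξ) : Euc (2 * n + 1)) =
      ξ.re • sliceD (n := n) ι (w ζ) ws + ξ.im • sliceD (n := n) ι (w ζ) wt := fun ξ =>
    (h.du_comp hp hw _).trans (by rw [hw', map_add, map_smul, map_smul])
  obtain ⟨R, hR⟩ : ∃ R : Euc (2 * n + 1), R = reeb lam (ι (w ζ)) := ⟨_, rfl⟩
  have hJ1 : (J (ι (w ζ)) (sliceD (n := n) ι (w ζ) ws) : Euc (2 * n + 1)) =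
      sliceD (n := n) ι (w ζ) wt - f • R :=
    (h.pairs _ _ hpair).trans ((by rw [map_sub, map_smul] : sliceD (n := n) ι (w ζ) (wt - f • modelReeb modelF
      (w ζ)) = sliceD (n := n) ι (w ζ) wt - f • sliceD (n := n) ι (w ζ) (modelReeb modelF (w ζ))).trans
        (congrArg (fun r : Euc (2 * n + 1) => sliceD (n := n) ι (w ζ) wt - f • r) (hR.trans (h.reeb_eq _ hp)).symm))
  subst hR
  rw [hIη, hη, ha', ha', hre]
  refine (congrArg (fun v : Euc (2 * n + 1) => ((f * -ξ.im, v) : ℝ × Euc (2 * n + 1)))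
    (hdu (Complex.I * ξ))).trans ?_
  refine Eq.trans ?_ (congrArg (fun v : Euc (2 * n + 1) =>
    (symplJ lam J (ι (w ζ)) (f * ξ.re, v) : ℝ × Euc (2 * n + 1))) (hdu ξ)).symm
  rw [hre, him]
  exact symplJ_linear (V := Euc (2 * n + 1)) (lam (ι (w ζ))) (J (ι (w ζ)))
    (R := reeb lam (ι (w ζ))) (A := sliceD (n := n) ι (w ζ) ws) (B := sliceD (n := n) ι (w ζ) wt) h1 h2 hJ1 (h.compatible.sq _ _ h1) ξ.re ξ.im

/-- On the directions m and m i, the two-form da ∧ λ takes the value f² and dλ the value on (ws,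
wt). Passing to the directions 1 and i divides two-forms by |m|². -/
lemma IsModelSlice.energyDensity_eq (h : IsModelSlice lam J ι) (hp : w ζ ∈ Metric.ball 0 20)
    (hw : DifferentiableAt ℝ w ζ) (hm : m ≠ 0) (ha' : ∀ η, fderiv ℝ a ζ (m * η) = f * η.re)
    (hw' : ∀ η : ℂ, fderiv ℝ w ζ (m * η) = η.re • ws + η.im • wt)
    (hpair : (ws, wt - f • modelReeb modelF (w ζ)) ∈ modelPairs (w ζ)) (φ : ℝ → ℝ) :
    energyDensity lam a (ι ∘ w) φ ζ = (‖m‖ ^ 2)⁻¹ * (deriv φ (a ζ) * f ^ 2 +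
      φ (a ζ) * dform (fun p => Real.exp (modelF p) • stdForm p) (w ζ) ws wt) := by
  obtain ⟨h1, h2⟩ := h.lam_tangent hp hpair
  have hη : (1 : ℂ) = m * m⁻¹ := (mul_inv_cancel₀ hm).symm
  have hIη : Complex.I = m * (Complex.I * m⁻¹) := by
    rw [mul_left_comm, mul_inv_cancel₀ hm, mul_one]
  have hn : (‖m‖ ^ 2)⁻¹ = m⁻¹.re ^ 2 + m⁻¹.im ^ 2 := by
    rw [← normSq_eq_re_im, norm_inv, inv_pow]
  have hre : (Complex.I * m⁻¹).re = -m⁻¹.im := by simp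
  have him : (Complex.I * m⁻¹).im = m⁻¹.re := by simp
  have hL : ∀ x y : ℝ, lam (ι (w ζ)) (sliceD ι (w ζ) (x • ws + y • wt)) = y * f := fun x y => by
    have : lam (ι (w ζ)) (sliceD ι (w ζ) (x • ws + y • wt)) =
        x * lam (ι (w ζ)) (sliceD ι (w ζ) ws) + y * lam (ι (w ζ)) (sliceD ι (w ζ) wt) := by
      rw [h.lam_sliceD hp, h.lam_sliceD hp, h.lam_sliceD hp, map_add, map_smul, map_smul,
        smul_eq_mul, smul_eq_mul]
      ring
    rw [this, h1, h2]
    ring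
  have ha1 : fderiv ℝ a ζ 1 = f * m⁻¹.re := by rw [hη, ha']
  have haI : fderiv ℝ a ζ Complex.I = f * -m⁻¹.im := by rw [hIη, ha', hre]
  have hw1 : fderiv ℝ w ζ 1 = m⁻¹.re • ws + m⁻¹.im • wt := by rw [hη, hw']
  have hwI : fderiv ℝ w ζ Complex.I = (-m⁻¹.im) • ws + m⁻¹.re • wt := by rw [hIη, hw', hre, him]
  rw [energyDensity, ha1, haI, h.du_comp hp hw, h.du_comp hp hw, hw1, hwI, hn]
  have h5 := h.extD_sliceD hp (m⁻¹.re • ws + m⁻¹.im • wt) ((-m⁻¹.im) • ws + m⁻¹.re • wt)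
  have h6 := dform_swap (fun p => Real.exp (modelF p) • stdForm p) (w ζ)
  have h7 : ∀ v, dform (fun p => Real.exp (modelF p) • stdForm p) (w ζ) v v = 0 := fun v => by
    linarith [h6 v v]
  have h8 : dform (fun p => Real.exp (modelF p) • stdForm p) (w ζ) (m⁻¹.re • ws + m⁻¹.im • wt)
      ((-m⁻¹.im) • ws + m⁻¹.re • wt) = (m⁻¹.re ^ 2 + m⁻¹.im ^ 2) *
        dform (fun p => Real.exp (modelF p) • stdForm p) (w ζ) ws wt := by
    simp only [map_add, map_smul, add_apply, smul_apply,
      smul_eq_mul, h7, h6 wt ws]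
    ring
  have hx := hL m⁻¹.re m⁻¹.im
  have hy := hL (-m⁻¹.im) m⁻¹.re
  rw [h8] at h5
  refine (congrArg₂ (fun (p q : ℝ) => deriv φ (a ζ) * (f * m⁻¹.re * p - f * -m⁻¹.im * q) +
    φ (a ζ) * extD lam (ι (w ζ)) (sliceD ι (w ζ) (m⁻¹.re • ws + m⁻¹.im • wt))
      (sliceD ι (w ζ) ((-m⁻¹.im) • ws + m⁻¹.re • wt))) hy hx).trans ?_
  rw [h5]
  ring

end Slice

/-! ### The plane and the cylinder -/

section Slice

variable {n : ℕ} {M : Type*} [TopologicalSpace M] [ChartedSpace (Euc (2 * n + 1)) M]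
  [IsManifold (𝓡 (2 * n + 1)) ∞ M]
  {lam : OneForm (2 * n + 1) M} {J : TangentEnd (2 * n + 1) M} {ι : ℂ × ℝ → M} {P : ℝ → ℝ}

lemma IsProfile.surface_mem_ball (hP : IsProfile P) {ζ : ℂ} (hζ : ζ ≠ 0) :
    profSurface P ζ ∈ Metric.ball 0 20 := modelCore_subset (hP.surface_mem hζ)

lemma IsProfile.contDiffAt_lift (hP : IsProfile P) {ζ : ℂ} (hζ : ζ ≠ 0) :
    ContDiffAt ℝ ∞ (fun ζ : ℂ => profLift P (Real.log ‖ζ‖)) ζ :=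
  hP.lift.1.contDiffAt.comp ζ ((contDiffAt_norm ℝ hζ).log (norm_ne_zero_iff.2 hζ))

lemma IsProfile.fderiv_lift (hP : IsProfile P) {ζ : ℂ} (hζ : ζ ≠ 0) {a : ℂ → ℝ}
    (ha : a =ᶠ[𝓝 ζ] fun ζ => profLift P (Real.log ‖ζ‖)) (η : ℂ) :
    fderiv ℝ a ζ (ζ * η) = Real.exp (profAction (P (Real.log ‖ζ‖))) * η.re := by
  have h0 := hP.lift.2 (Real.log ‖ζ‖)
  have h1 : HasFDerivAt (profLift P ∘ fun ζ : ℂ => Real.log ‖ζ‖) _ ζ :=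
    h0.comp_hasFDerivAt ζ (hasFDerivAt_log_norm hζ)
  rw [ha.fderiv_eq]
  refine (congrArg (fun L => L (ζ * η)) h1.fderiv).trans ?_
  have h2 : (ζ⁻¹ * (ζ * η)).re = η.re := by rw [inv_mul_cancel_left₀ hζ]
  show _ * (ζ⁻¹ * (ζ * η)).re = _
  rw [h2]

lemma IsProfile.sub_mem_modelPairs (hP : IsProfile P) {ζ : ℂ} (hζ : ζ ≠ 0) :
    (profTangent P ζ, (Complex.I * (profSurface P ζ).1, (0 : ℝ)) -
      Real.exp (profAction (P (Real.log ‖ζ‖))) • modelReeb modelF (profSurface P ζ)) ∈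
        modelPairs (profSurface P ζ) := by
  have h := hP.mem_modelPairs hζ
  rwa [rotField, hP.exp_modelF (hP.surface_eq hζ)] at h

lemma IsModelSlice.symplJ_surface (h : IsModelSlice lam J ι) (hP : IsProfile P) {ζ : ℂ} (hζ : ζ ≠ 0)
    {a : ℂ → ℝ} (ha : a =ᶠ[𝓝 ζ] fun ζ => profLift P (Real.log ‖ζ‖)) (η : ℂ) :
    (fderiv ℝ a ζ (Complex.I * η), du (d := 2 * n + 1) (ι ∘ profSurface P) ζ (Complex.I * η)) =
      symplJ lam J ((ι ∘ profSurface P) ζ)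
        (fderiv ℝ a ζ η, du (d := 2 * n + 1) (ι ∘ profSurface P) ζ η) :=
  h.symplJ_eq (hP.surface_mem_ball hζ) ((hP.contDiffAt_surface hζ).differentiableAt (by simp)) hζ
    (hP.fderiv_lift hζ ha) (hP.fderiv_surface hζ) (hP.sub_mem_modelPairs hζ) η

lemma IsModelSlice.hoferEnergy_surface (h : IsModelSlice lam J ι) (hP : IsProfile P) {Ω : Set ℂ}
    (hΩ : MeasurableSet Ω) {a : ℂ → ℝ}
    (ha : ∀ ζ ≠ 0, a =ᶠ[𝓝 ζ] fun ζ => profLift P (Real.log ‖ζ‖)) :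
    hoferEnergy lam Ω a (ι ∘ profSurface P) < ⊤ := by
  refine hoferEnergy_lt_top hP.lift.2 hP.hasDerivAt_action (fun s => (Real.exp_pos _).le)
    hP.growth_nonneg hP.action_le (fun φ ζ _ hζ => ?_) hΩ
  rw [h.energyDensity_eq (hP.surface_mem_ball hζ)
    ((hP.contDiffAt_surface hζ).differentiableAt (by simp)) hζ
    (hP.fderiv_lift hζ (ha ζ hζ)) (hP.fderiv_surface hζ) (hP.sub_mem_modelPairs hζ),
    hP.dform_surface hζ, (ha ζ hζ).eq_of_nhds]

lemma IsModelSlice.contMDiffAt_surface (h : IsModelSlice lam J ι) (hP : IsProfile P) {ζ : ℂ}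
    (hζ : ζ ≠ 0) : ContMDiffAt 𝓘(ℝ, ℂ) (𝓡 (2 * n + 1)) ∞ (ι ∘ profSurface P) ζ :=
  (h.smooth _ (hP.surface_mem_ball hζ)).comp ζ (hP.contDiffAt_surface hζ).contMDiffAt

theorem IsModelSlice.isFiniteEnergyCurve_cylinder (h : IsModelSlice lam J ι) (hP : IsProfile P) :
    IsFiniteEnergyCurve lam J {0}ᶜ (fun ζ => profLift P (Real.log ‖ζ‖)) (ι ∘ profSurface P) :=
  ⟨⟨fun _ hζ => (hP.contDiffAt_lift hζ).contDiffWithinAt,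
    fun _ hζ => (h.contMDiffAt_surface hP hζ).contMDiffWithinAt,
    fun _ hζ => h.symplJ_surface hP hζ (EventuallyEq.refl _ _)⟩,
    h.hoferEnergy_surface hP (measurableSet_singleton 0).compl fun _ _ => EventuallyEq.refl _ _⟩

lemma profCurve_of_nonpos (hexp : ∀ s ≤ 0, P s = 7 - Real.exp s) {s : ℝ} (hs : s ≤ 0) : profCurve (P s) = (Real.exp s, 0) := by
  have h1 : Real.exp s ≤ 1 := Real.exp_le_one_iff.2 hs
  rw [hexp s hs, profCurve_of_ge (by linarith), sub_sub_cancel]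

lemma IsProfile.vel_snd_of_nonpos (hP : IsProfile P) (hexp : ∀ s ≤ 0, P s = 7 - Real.exp s)
    {s : ℝ} (hs : s ≤ 0) : (profVel P s).2 = 0 := by
  -- The derivative within the half-line also covers s = 0, beyond which nothing is known about the
  -- curve.
  have h1 : HasDerivWithinAt (profHeight P) 0 (Iic 0) s :=
    (hasDerivWithinAt_const s (Iic 0) (0 : ℝ)).congr
      (fun t ht => by rw [profHeight, profCurve_of_nonpos hexp ht])
      (by rw [profHeight, profCurve_of_nonpos hexp hs])
  exact (uniqueDiffOn_Iic (0 : ℝ) s hs).eq_deriv _ (hP.hasDerivAt_height s).hasDerivWithinAt h1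

lemma IsProfile.amp_of_nonpos (hP : IsProfile P) (hexp : ∀ s ≤ 0, P s = 7 - Real.exp s)
    {s : ℝ} (hs : s ≤ 0) : profAmp P s = Real.exp s := by
  have h1 : profPhase P s = 0 := by
    rw [profPhase, intervalIntegral.integral_congr (g := fun _ => 0), intervalIntegral.integral_zero]
    intro t ht
    rw [uIcc_of_ge hs] at ht
    simp [hP.vel_snd_of_nonpos hexp ht.2]
  rw [profAmp, h1, profCurve_of_nonpos hexp hs]
  simp

lemma IsProfile.surface_of_norm_le (hP : IsProfile P) (hexp : ∀ s ≤ 0, P s = 7 - Real.exp s)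
    {ζ : ℂ} (hζ : ‖ζ‖ ≤ 1) : profSurface P ζ = (ζ, 0) := by
  have hl : Real.log ‖ζ‖ ≤ 0 := Real.log_nonpos (norm_nonneg ζ) hζ
  have h2 : profHeight P (Real.log ‖ζ‖) = 0 := by rw [profHeight, profCurve_of_nonpos hexp hl]
  rw [profSurface, polarMap, h2, hP.amp_of_nonpos hexp hl]
  refine Prod.ext ?_ rfl
  rcases eq_or_ne ζ 0 with rfl | h0
  · simp
  · have hn : (‖ζ‖ : ℂ) ≠ 0 := by simpa using h0
    simp only [Real.exp_log (norm_pos_iff.2 h0)]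
    field_simp

/-- Where F vanishes the action is r² = exp(2s), and the lift is a primitive of it. The bound 1/2
comes from 7 - exp s ≥ 13/2, the range in which `modelF` is zero. -/
lemma IsProfile.exists_lift_eq (hP : IsProfile P) (hexp : ∀ s ≤ 0, P s = 7 - Real.exp s)
    : ∃ b, ∀ ζ : ℂ, ζ ≠ 0 → ‖ζ‖ < 1 / 2 →
    profLift P (Real.log ‖ζ‖) = b + ‖ζ‖ ^ 2 / 2 := by
  have h1 : ∀ s ∈ Iio (-Real.log 2), HasDerivAt (fun s => profLift P s - Real.exp s ^ 2 / 2) 0 s := by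
    intro s hs
    have hl2 := Real.log_pos one_lt_two
    have hs0 : s ≤ 0 := by linarith [mem_Iio.1 hs]
    have he : Real.exp s < 1 / 2 := by
      rw [one_div, ← Real.exp_log (show (0 : ℝ) < 2⁻¹ by norm_num), Real.log_inv]
      exact Real.exp_lt_exp.2 hs
    have h2 := (hP.lift.2 s).sub (((Real.hasDerivAt_exp s).pow 2).div_const 2)
    refine h2.congr_deriv ?_
    have hc := hP.exp_modelF (x := ((Real.exp s : ℂ), 0)) (s := s) (by
      rw [profCurve_of_nonpos hexp hs0, Complex.norm_real, Real.norm_of_nonneg (Real.exp_pos s).le])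
    rw [← hc, modelF_eq_zero, Real.exp_zero, Complex.norm_real, Real.norm_of_nonneg
      (Real.exp_pos s).le]
    · simp
      ring
    · rw [Complex.norm_real, Real.norm_of_nonneg (Real.exp_pos s).le,
        ← profCurve_of_nonpos hexp hs0, torusDist_profCurve, hexp s hs0]
      · linarith
      · rw [hexp s hs0]
        linarith
  obtain ⟨b, hb⟩ := isOpen_Iio.exists_is_const_of_deriv_eq_zero isPreconnected_Iio
    (fun s hs => (h1 s hs).differentiableAt.differentiableWithinAt) fun s hs => (h1 s hs).deriv
  refine ⟨b, fun ζ h0 hζ => ?_⟩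
  have hlog : Real.log ‖ζ‖ ∈ Iio (-Real.log 2) := by
    rw [mem_Iio, ← Real.log_inv]
    exact Real.log_lt_log (norm_pos_iff.2 h0) (by linarith)
  have := hb _ hlog
  rw [Real.exp_log (norm_pos_iff.2 h0)] at this
  linarith

/-- The puncture at 0 is removed explicitly. Near it the surface is ζ ↦ (ζ, 0) and the lift is b +
|ζ|² / 2, so both extend smoothly. At 0 the equation holds with f = 0 and the pair (1, i), which
`modelPairs` contains for this purpose. -/
theorem IsModelSlice.isFiniteEnergyCurve_plane (hP : IsProfile P) (hexp : ∀ s ≤ 0, P s = 7 - Real.exp s)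
    (h : IsModelSlice lam J ι) :
    ∃ a, IsFiniteEnergyCurve lam J univ a (ι ∘ profSurface P) := by
  classical
  obtain ⟨b, hb⟩ := hP.exists_lift_eq hexp
  set a : ℂ → ℝ := Function.update (fun ζ => profLift P (Real.log ‖ζ‖)) 0 b with ha
  have ha1 : ∀ ζ ≠ 0, a =ᶠ[𝓝 ζ] fun ζ => profLift P (Real.log ‖ζ‖) := fun ζ hζ => by
    filter_upwards [isOpen_ne.mem_nhds hζ] with ξ hξ
    exact Function.update_of_ne hξ _ _
  have ha0 : a =ᶠ[𝓝 0] fun ζ => b + ‖ζ‖ ^ 2 / 2 := by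
    filter_upwards [Metric.ball_mem_nhds (0 : ℂ) (show (0 : ℝ) < 1 / 2 by norm_num)] with ζ hζ
    rcases eq_or_ne ζ 0 with rfl | h0
    · simp [ha]
    · rw [ha, Function.update_of_ne h0, hb ζ h0 (by simpa using hζ)]
  have hw0 : profSurface P =ᶠ[𝓝 0] fun ζ => (ζ, 0) := by
    filter_upwards [Metric.ball_mem_nhds (0 : ℂ) one_pos] with ζ hζ
    exact hP.surface_of_norm_le hexp (le_of_lt (by simpa using hζ))
  have hws : ContDiffAt ℝ ∞ (profSurface P) 0 :=
    (contDiff_id.prodMk contDiff_const).contDiffAt.congr_of_eventuallyEq hw0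
  have hP0 : profSurface P 0 = 0 := hP.surface_of_norm_le hexp (by simp)
  have hball : profSurface P 0 ∈ Metric.ball 0 20 := by simp [hP0]
  have hda : ∀ η, fderiv ℝ a 0 η = 0 := fun η => by
    have h1 : HasFDerivAt (fun ζ : ℂ => b + ‖ζ‖ ^ 2 / 2) (0 : ℂ →L[ℝ] ℝ) 0 := by
      have h2 := ((hasStrictFDerivAt_norm_sq (F := ℂ) 0).hasFDerivAt.mul_const (2⁻¹)).const_add b
      refine (h2.congr_fderiv ?_).congr_of_eventuallyEq (Eventually.of_forall fun ζ => ?_)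
      · simp
      · simp [div_eq_mul_inv]
    rw [ha0.fderiv_eq, h1.fderiv]
    rfl
  have hdw : ∀ η : ℂ, fderiv ℝ (profSurface P) 0 η = (η, 0) := fun η => by
    have h1 : HasFDerivAt (fun ζ : ℂ => (ζ, (0 : ℝ))) _ 0 :=
      (hasFDerivAt_id (𝕜 := ℝ) (0 : ℂ)).prodMk (hasFDerivAt_const (0 : ℝ) (0 : ℂ))
    rw [hw0.fderiv_eq, h1.fderiv]
    rfl
  refine ⟨a, ⟨fun ζ _ => ?_, fun ζ _ => ?_, fun ζ _ => ?_⟩,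
    h.hoferEnergy_surface hP MeasurableSet.univ ha1⟩
  · rcases eq_or_ne ζ 0 with rfl | h0
    · exact ((contDiff_const.add ((contDiff_norm_sq ℝ).div_const 2)).contDiffAt.congr_of_eventuallyEq
        ha0).contDiffWithinAt
    · exact ((hP.contDiffAt_lift h0).congr_of_eventuallyEq (ha1 ζ h0)).contDiffWithinAt
  · rcases eq_or_ne ζ 0 with rfl | h0
    · exact ((h.smooth _ hball).comp 0 hws.contMDiffAt).contMDiffWithinAt
    · exact (h.contMDiffAt_surface hP h0).contMDiffWithinAt
  · rcases eq_or_ne ζ 0 with rfl | h0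
    · refine h.symplJ_eq (m := 1) (f := 0) (ws := (1, 0)) (wt := (Complex.I, 0)) hball
        (hws.differentiableAt (by simp)) one_ne_zero (fun η => by rw [hda, zero_mul])
        (fun η => ?_) (Or.inr ⟨hP0, 1, by simp⟩)
      rw [hdw, one_mul]
      refine Prod.ext ?_ (by simp)
      simp
    · exact h.symplJ_surface hP h0 (ha1 ζ h0)

end Slice

/-! ### Smooth convergence in families of loops -/

section Loops

variable {E : Type*} [NormedAddCommGroup E] [NormedSpace ℝ E]

/-- The derivatives of a smooth family of curves depend continuously on the parameter. -/
lemma exists_iteratedDeriv_eq {F : Type*} [NormedAddCommGroup F] [NormedSpace ℝ F] {g : ℝ × E → F}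
    (hg : ContDiff ℝ ∞ g) (m : ℕ) : ∃ G : ℝ × E → F, ContDiff ℝ ∞ G ∧
      ∀ x t, iteratedDeriv m (fun t => g (t, x)) t = G (t, x) := by
  induction m with
  | zero => exact ⟨g, hg, fun x t => by rw [iteratedDeriv_zero]⟩
  | succ m ih =>
    obtain ⟨G, hG, h⟩ := ih
    refine ⟨fun p => fderiv ℝ G p (1, 0), (hG.fderiv_right (by simp)).clm_apply contDiff_const,
      fun x t => ?_⟩
    rw [iteratedDeriv_succ, funext (h x)]
    have h1 : HasDerivAt (fun t : ℝ => (t, x)) ((1 : ℝ), (0 : E)) t :=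
      (hasDerivAt_id t).prodMk (hasDerivAt_const t x)
    have h2 : HasFDerivAt G (fderiv ℝ G (t, x)) (t, x) :=
      (hG.differentiable (by simp) (t, x)).hasFDerivAt
    exact (HasFDerivAt.comp_hasDerivAt (f := fun t : ℝ => (t, x)) t h2 h1).deriv

variable [FiniteDimensional ℝ E] {d : ℕ} {M : Type*} [TopologicalSpace M] [ChartedSpace (Euc d) M]
  [IsManifold (𝓡 d) ∞ M]

/-- The members of a smooth family of loops converge with all derivatives. -/
lemma loopsTendsto_of_smooth {B : ℝ × E → M} {U : Set (ℝ × E)} (hU : IsOpen U)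
    (hB : ∀ p ∈ U, ContMDiffAt 𝓘(ℝ, ℝ × E) (𝓡 d) ∞ B p) {x : ℕ → E} {y : E}
    (hy : ∀ t, (t, y) ∈ U) (hx : Tendsto x atTop (𝓝 y)) :
    LoopsTendsto (d := d) (fun k t => B (t, x k)) (fun t => B (t, y)) := by
  intro t₀
  set φ := extChartAt (𝓡 d) (B (t₀, y)) with hφ
  have hsrc : ∀ᶠ p in 𝓝 (t₀, y), B p ∈ φ.source :=
    (hB _ (hy t₀)).continuousAt.eventually_mem (extChartAt_source_mem_nhds (B (t₀, y)))
  have hsm : ∀ᶠ p in 𝓝 (t₀, y), ContDiffAt ℝ ∞ (fun p => φ (B p)) p := by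
    filter_upwards [hsrc, hU.mem_nhds (hy t₀)] with p hp hpU
    rw [hφ, extChartAt_source] at hp
    exact ((contMDiffAt_extChartAt' hp).comp p (hB p hpU)).contDiffAt
  -- A global smooth map with the germ of the chart expression: its t-derivatives are jointly
  -- continuous, hence uniformly continuous on compact products.
  obtain ⟨g, hg, hgB⟩ := exists_contDiff_eventuallyEq hsm
  obtain ⟨N, hN, W, hW, hNW⟩ := mem_nhds_prod_iff.1 (hsrc.and hgB)
  obtain ⟨δ, hδ, hδN⟩ := Metric.nhds_basis_closedBall.mem_iff.1 hN
  have hW' : ∀ᶠ k in atTop, x k ∈ W := hx.eventually_mem hW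
  have hmem : ∀ t ∈ Metric.ball t₀ δ, ∀ z ∈ W, B (t, z) ∈ φ.source ∧ g (t, z) = φ (B (t, z)) :=
    fun t ht z hz => hNW (mk_mem_prod (hδN (Metric.ball_subset_closedBall ht)) hz)
  have hder : ∀ m, ∀ z ∈ W, ∀ t ∈ Metric.ball t₀ δ, iteratedDeriv m (fun t => φ (B (t, z))) t =
      iteratedDeriv m (fun t => g (t, z)) t := fun m z hz t ht => by
    refine Filter.EventuallyEq.iteratedDeriv_eq m ?_
    filter_upwards [Metric.isOpen_ball.mem_nhds ht] with s hs
    exact (hmem s hs z hz).2.symm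
  refine ⟨Metric.ball t₀ δ, Metric.isOpen_ball, Metric.mem_ball_self hδ,
    fun t ht => (hmem t ht y (mem_of_mem_nhds hW)).1,
    hW'.mono fun k hk t ht => (hmem t ht _ hk).1, fun m => ?_⟩
  obtain ⟨G, hG, hGm⟩ := exists_iteratedDeriv_eq hg m
  obtain ⟨K, hK, hKy⟩ := exists_compact_mem_nhds y
  have huc : UniformContinuousOn (↿fun (z : E) (t : ℝ) => G (t, z)) (K ×ˢ Metric.closedBall t₀ δ) :=
    (hK.prod (isCompact_closedBall t₀ δ)).uniformContinuousOn_of_continuous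
      (hG.continuous.comp (continuous_snd.prodMk continuous_fst)).continuousOn
  have h1 := huc.tendstoUniformlyOn (mem_of_mem_nhds hKy)
  intro V hV
  filter_upwards [hx.eventually (h1 V hV |>.filter_mono (by
    rw [nhdsWithin_eq_nhds.2 hKy])), hW'] with k hk hkW t ht
  have h2 := hk t (Metric.ball_subset_closedBall ht)
  rwa [hder m _ hkW t ht, hder m y (mem_of_mem_nhds hW) t ht, hGm, hGm]

end Loops

/-! ### The limit tori -/

section Torus

/-- The torus of the circles at distance `c` from the point `(7, 0)` of the half plane. -/
def torusSet (c : ℝ) : Set (ℂ × ℝ) := {x | torusDist (‖x.1‖, x.2) = c}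

lemma torusSet_subset_ball {c : ℝ} (hc : c < 7) : torusSet c ⊆ Metric.ball 0 20 := by
  intro x (hx : torusDist _ = c)
  have h2 := norm_sub_le_torusDist x
  rw [mem_ball_zero_iff, Prod.norm_def, max_lt_iff, Real.norm_eq_abs]
  constructor <;> linarith [h2.1, h2.2]

lemma exists_angle_of_mem {c : ℝ} {x : ℂ × ℝ} (hx : x ∈ torusSet c) :
    ∃ φ : ℝ, ‖x.1‖ = 7 - c * Real.cos φ ∧ x.2 = -(c * Real.sin φ) := by
  have hx' : torusDist (‖x.1‖, x.2) = c := hx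
  set y : ℂ := ⟨7 - ‖x.1‖, -x.2⟩ with hy
  have hn : ‖y‖ = c := by
    rw [← hx', ← sq_eq_sq₀ (norm_nonneg y) (torusDist_nonneg _), normSq_eq_re_im, torusDist_sq]
    simp [hy]
  refine ⟨y.arg, ?_, ?_⟩
  · rw [← hn, Complex.norm_mul_cos_arg]
    simp [hy]
  · rw [← hn, Complex.norm_mul_sin_arg]
    simp [hy]

lemma mem_torusSet {c φ : ℝ} (hc : 0 ≤ c) {x : ℂ × ℝ} (h1 : ‖x.1‖ = 7 - c * Real.cos φ)
    (h2 : x.2 = -(c * Real.sin φ)) : x ∈ torusSet c := by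
  show torusDist _ = c
  rw [← sq_eq_sq₀ (torusDist_nonneg _) hc, torusDist_sq, h1, h2]
  have := Real.sin_sq_add_cos_sq φ
  simp only
  linear_combination c ^ 2 * this

/-- The parametrization of the torus. -/
def torusParam (c : ℝ) (p : ℝ × ℝ) : ℂ × ℝ :=
  (((7 - c * Real.cos (2 * Real.pi * p.1) : ℝ) : ℂ) * Complex.exp ((2 * Real.pi * p.2 : ℝ) * Complex.I),
    -(c * Real.sin (2 * Real.pi * p.1)))

lemma norm_torusParam {c : ℝ} (hc : 0 < c) (hc7 : c < 7) (p : ℝ × ℝ) :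
    ‖(torusParam c p).1‖ = 7 - c * Real.cos (2 * Real.pi * p.1) := by
  rw [torusParam, norm_mul, Complex.norm_exp_ofReal_mul_I, mul_one, Complex.norm_real,
    Real.norm_of_nonneg]
  nlinarith [Real.cos_le_one (2 * Real.pi * p.1)]

lemma range_torusParam {c : ℝ} (hc : 0 < c) (hc7 : c < 7) : range (torusParam c) = torusSet c := by
  apply Subset.antisymm
  · rintro _ ⟨p, rfl⟩
    exact mem_torusSet hc.le (norm_torusParam hc hc7 p) rfl
  · intro x hx
    obtain ⟨φ, h1, h2⟩ := exists_angle_of_mem hx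
    have hπ : (2 * Real.pi) ≠ 0 := by positivity
    refine ⟨(φ / (2 * Real.pi), x.1.arg / (2 * Real.pi)), ?_⟩
    rw [torusParam, mul_div_cancel₀ _ hπ, mul_div_cancel₀ _ hπ, ← h1, ← h2,
      Complex.norm_mul_exp_arg_mul_I]

lemma contDiff_torusParam (c : ℝ) : ContDiff ℝ ∞ (torusParam c) := by
  have h1 : ContDiff ℝ ∞ fun p : ℝ × ℝ => 2 * Real.pi * p.1 := contDiff_const.mul contDiff_fst
  have h2 : ContDiff ℝ ∞ fun p : ℝ × ℝ => 2 * Real.pi * p.2 := contDiff_const.mul contDiff_snd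
  exact ((Complex.ofRealCLM.contDiff.comp (contDiff_const.sub (contDiff_const.mul h1.cos))).mul
    ((Complex.ofRealCLM.contDiff.comp h2).mul contDiff_const).cexp).prodMk
      (contDiff_const.mul h1.sin).neg

lemma torusParam_eq_iff {c : ℝ} (hc : 0 < c) (hc7 : c < 7) (p q : ℝ × ℝ) :
    torusParam c p = torusParam c q ↔ ∃ k l : ℤ, q = (p.1 + k, p.2 + l) := by
  have hπ : (0 : ℝ) < 2 * Real.pi := by positivity
  constructor
  · intro h
    have hn : ‖(torusParam c p).1‖ = ‖(torusParam c q).1‖ := by rw [h]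
    have hcos : Real.cos (2 * Real.pi * q.1) = Real.cos (2 * Real.pi * p.1) := by
      rw [norm_torusParam hc hc7, norm_torusParam hc hc7] at hn
      exact mul_left_cancel₀ hc.ne' (by linarith)
    have hsin : Real.sin (2 * Real.pi * q.1) = Real.sin (2 * Real.pi * p.1) := by
      have : (torusParam c p).2 = (torusParam c q).2 := by rw [h]
      simp only [torusParam] at this
      exact mul_left_cancel₀ hc.ne' (by linarith)
    obtain ⟨k, hk⟩ := Real.Angle.angle_eq_iff_two_pi_dvd_sub.1 (Real.Angle.cos_sin_inj hcos hsin)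
    have hexp : Complex.exp ((2 * Real.pi * q.2 : ℝ) * Complex.I) =
        Complex.exp ((2 * Real.pi * p.2 : ℝ) * Complex.I) := by
      have h1 : (torusParam c p).1 = (torusParam c q).1 := by rw [h]
      simp only [torusParam] at h1
      rw [hcos] at h1
      refine (mul_left_cancel₀ ?_ h1).symm
      have : 0 < 7 - c * Real.cos (2 * Real.pi * p.1) := by
        nlinarith [Real.cos_le_one (2 * Real.pi * p.1)]
      exact_mod_cast this.ne'
    obtain ⟨l, hl⟩ := Complex.exp_eq_exp_iff_exists_int.1 hexp
    refine ⟨k, l, Prod.ext ?_ ?_⟩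
    · refine mul_left_cancel₀ hπ.ne' ?_
      linear_combination hk
    · have h3 : (2 * Real.pi * q.2 : ℝ) = 2 * Real.pi * p.2 + l * (2 * Real.pi) := by
        have := congrArg Complex.im hl
        simpa using this
      refine mul_left_cancel₀ hπ.ne' ?_
      linear_combination h3
  · rintro ⟨k, l, rfl⟩
    have h1 : 2 * Real.pi * (p.1 + k) = 2 * Real.pi * p.1 + k * (2 * Real.pi) := by ring
    have h2 : Complex.exp ((2 * Real.pi * (p.2 + l) : ℝ) * Complex.I) =
        Complex.exp ((2 * Real.pi * p.2 : ℝ) * Complex.I) :=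
      Complex.exp_eq_exp_iff_exists_int.2 ⟨l, by push_cast; ring⟩
    simp only [torusParam]
    rw [h1, Real.cos_add_int_mul_two_pi, Real.sin_add_int_mul_two_pi, h2]

/-- After division by the phase, real and imaginary parts separate. The imaginary part is r times
the second component, with r > 0. The real part and the height give sin and cos times the first
component, and these do not vanish together. -/
lemma injective_fderiv_torusParam {c : ℝ} (hc : 0 < c) (hc7 : c < 7) (p : ℝ × ℝ) :
    Function.Injective (fderiv ℝ (torusParam c) p) := by
  refine (injective_iff_map_eq_zero _).2 fun v hv => ?_
  have hπ : (0 : ℝ) < 2 * Real.pi := by positivity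
  have hline : HasDerivAt (fun t : ℝ => p + t • v) v 0 := by
    simpa using ((hasDerivAt_id (0 : ℝ)).smul_const v).const_add p
  have hT : HasFDerivAt (torusParam c) (fderiv ℝ (torusParam c) p) (p + (0 : ℝ) • v) := by
    rw [zero_smul, add_zero]
    exact ((contDiff_torusParam c).differentiable (by simp) p).hasFDerivAt
  have h1 := HasFDerivAt.comp_hasDerivAt (f := fun t : ℝ => p + t • v) 0 hT hline
  rw [hv] at h1
  have ha : HasDerivAt (fun t : ℝ => 2 * Real.pi * (p.1 + t * v.1)) (2 * Real.pi * v.1) 0 := by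
    simpa using (((hasDerivAt_id (0 : ℝ)).mul_const v.1).const_add p.1).const_mul (2 * Real.pi)
  have hb : HasDerivAt (fun t : ℝ => 2 * Real.pi * (p.2 + t * v.2)) (2 * Real.pi * v.2) 0 := by
    simpa using (((hasDerivAt_id (0 : ℝ)).mul_const v.2).const_add p.2).const_mul (2 * Real.pi)
  have h2 := (((ha.cos.const_mul c).const_sub 7).ofReal_comp.mul
    (hb.ofReal_comp.mul_const Complex.I).cexp).prodMk (ha.sin.const_mul c).neg
  have h3 := h1.unique h2
  simp only [zero_mul, add_zero, Prod.ext_iff, Prod.fst_zero, Prod.snd_zero] at h3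
  obtain ⟨h4, h5⟩ := h3
  have hpos : 0 < 7 - c * Real.cos (2 * Real.pi * p.1) := by
    nlinarith [Real.cos_le_one (2 * Real.pi * p.1)]
  have h6 : ((c * Real.sin (2 * Real.pi * p.1) * (2 * Real.pi * v.1) : ℝ) : ℂ) +
      (((7 - c * Real.cos (2 * Real.pi * p.1)) * (2 * Real.pi * v.2) : ℝ) : ℂ) * Complex.I = 0 := by
    refine (mul_eq_zero.1 (Eq.trans ?_ h4.symm)).resolve_left
      (Complex.exp_ne_zero ((2 * Real.pi * p.2 : ℝ) * Complex.I))
    push_cast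
    ring
  have h7 : c * Real.sin (2 * Real.pi * p.1) * (2 * Real.pi * v.1) = 0 := by
    have := congrArg Complex.re h6
    simpa only [Complex.add_re, Complex.ofReal_re, Complex.re_ofReal_mul, Complex.I_re, mul_zero,
      add_zero, Complex.zero_re] using this
  have h8 : (7 - c * Real.cos (2 * Real.pi * p.1)) * (2 * Real.pi * v.2) = 0 := by
    have := congrArg Complex.im h6
    simpa only [Complex.add_im, Complex.ofReal_im, Complex.im_ofReal_mul, Complex.I_im, mul_one,
      zero_add, Complex.zero_im] using this
  have hv2 : v.2 = 0 := by
    have := (mul_eq_zero.1 h8).resolve_left hpos.ne'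
    exact (mul_eq_zero.1 this).resolve_left hπ.ne'
  have hv1 : v.1 = 0 := by
    by_contra h0
    have h9 : 2 * Real.pi * v.1 ≠ 0 := mul_ne_zero hπ.ne' h0
    have hs := (mul_eq_zero.1 ((mul_eq_zero.1 h7).resolve_right h9)).resolve_left hc.ne'
    have h10 : c * (Real.cos (2 * Real.pi * p.1) * (2 * Real.pi * v.1)) = 0 := by linarith
    have hcs := (mul_eq_zero.1 ((mul_eq_zero.1 h10).resolve_left hc.ne')).resolve_right h9
    have := Real.sin_sq_add_cos_sq (2 * Real.pi * p.1)
    rw [hs, hcs] at this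
    norm_num at this
  exact Prod.ext hv1 hv2

end Torus

/-! ### Rotation circles -/

section Circle

/-- The rotation of `ℂ × ℝ` by `t` turns of winding number `ε`. -/
def circRot (ε : ℤ) (t : ℝ) (x : ℂ × ℝ) : ℂ × ℝ :=
  (x.1 * Complex.exp ((2 * Real.pi * ε * t : ℝ) * Complex.I), x.2)

lemma norm_circRot_fst (ε : ℤ) (t : ℝ) (x : ℂ × ℝ) : ‖(circRot ε t x).1‖ = ‖x.1‖ := by
  rw [circRot, norm_mul, Complex.norm_exp_ofReal_mul_I, mul_one]

lemma norm_circRot (ε : ℤ) (t : ℝ) (x : ℂ × ℝ) : ‖circRot ε t x‖ = ‖x‖ := by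
  rw [Prod.norm_def, Prod.norm_def, norm_circRot_fst]
  rfl

lemma contDiff_circRot (ε : ℤ) : ContDiff ℝ ∞ fun p : ℝ × (ℂ × ℝ) => circRot ε p.1 p.2 := by
  have h1 : ContDiff ℝ ∞ fun p : ℝ × (ℂ × ℝ) => 2 * Real.pi * ε * p.1 :=
    contDiff_const.mul contDiff_fst
  exact (contDiff_snd.fst.mul ((Complex.ofRealCLM.contDiff.comp h1).mul contDiff_const).cexp).prodMk
    contDiff_snd.snd

lemma circRot_add_one (ε : ℤ) (t : ℝ) (x : ℂ × ℝ) : circRot ε (t + 1) x = circRot ε t x := by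
  have h : Complex.exp ((2 * Real.pi * ε * (t + 1) : ℝ) * Complex.I) =
      Complex.exp ((2 * Real.pi * ε * t : ℝ) * Complex.I) :=
    Complex.exp_eq_exp_iff_exists_int.2 ⟨ε, by push_cast; ring⟩
  rw [circRot, h, circRot]

lemma hasDerivAt_circRot (ε : ℤ) (t : ℝ) (x : ℂ × ℝ) : HasDerivAt (fun t => circRot ε t x)
    ((2 * Real.pi * ε) • (Complex.I * (circRot ε t x).1, (0 : ℝ))) t := by
  have h1 : HasDerivAt (fun t : ℝ => 2 * Real.pi * ε * t) (2 * Real.pi * ε) t := by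
    simpa using (hasDerivAt_id t).const_mul (2 * Real.pi * ε)
  have h2 := ((h1.ofReal_comp.mul_const Complex.I).cexp.const_mul x.1).prodMk
    (hasDerivAt_const t x.2)
  refine h2.congr_deriv (Prod.ext ?_ (by simp))
  rw [Prod.smul_mk, circRot, Complex.real_smul]
  push_cast
  ring

lemma exists_circRot_eq {ε : ℤ} (hε : ε ≠ 0) {x y : ℂ × ℝ} (h1 : ‖x.1‖ = ‖y.1‖) (h2 : x.2 = y.2) :
    ∃ t, circRot ε t y = x := by
  have hε' : (ε : ℝ) ≠ 0 := by exact_mod_cast hε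
  have hπ := Real.pi_ne_zero
  refine ⟨(x.1.arg - y.1.arg) / (2 * Real.pi * ε), Prod.ext ?_ h2.symm⟩
  rw [circRot, mul_div_cancel₀ _ (by positivity), Complex.ofReal_sub, sub_mul, Complex.exp_sub]
  have h3 := Complex.norm_mul_exp_arg_mul_I x.1
  have h4 := Complex.norm_mul_exp_arg_mul_I y.1
  rw [h1] at h3
  have h5 := Complex.exp_ne_zero (y.1.arg * Complex.I)
  simp only
  rw [mul_div_assoc', div_eq_iff h5]
  linear_combination Complex.exp (y.1.arg * Complex.I) * h3 - Complex.exp (x.1.arg * Complex.I) * h4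

end Circle

/-! ### Limit sets at the punctures -/

section Slice

variable {n : ℕ} {M : Type*} [TopologicalSpace M] [ChartedSpace (Euc (2 * n + 1)) M]
  [IsManifold (𝓡 (2 * n + 1)) ∞ M]
  {lam : OneForm (2 * n + 1) M} {J : TangentEnd (2 * n + 1) M} {ι : ℂ × ℝ → M} {P : ℝ → ℝ}

lemma IsModelSlice.isEmbeddedTorus (h : IsModelSlice lam J ι) {c : ℝ} (hc : 0 < c) (hc7 : c < 7) :
    IsEmbeddedTorus (2 * n + 1) (ι '' torusSet c) := by
  have hb : ∀ p, torusParam c p ∈ Metric.ball 0 20 := fun p =>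
    torusSet_subset_ball hc7 (range_torusParam hc hc7 ▸ mem_range_self p)
  refine ⟨ι ∘ torusParam c, fun p => (h.smooth _ (hb p)).comp p
    (contDiff_torusParam c).contMDiff.contMDiffAt, fun p => ?_, fun p q => ?_, ?_⟩
  · intro v w hvw
    have hd : ∀ v, (mfderiv 𝓘(ℝ, ℝ × ℝ) (𝓡 (2 * n + 1)) (ι ∘ torusParam c) p v : Euc (2 * n + 1)) =
        sliceD (n := n) ι (torusParam c p) (fderiv ℝ (torusParam c) p v) := fun v =>
      mfderiv_comp_vec ((h.smooth _ (hb p)).mdifferentiableAt (by simp))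
        ((contDiff_torusParam c).differentiable (by simp) p) v
    exact injective_fderiv_torusParam hc hc7 p
      (h.injective _ (hb p) ((hd v).symm.trans (hvw.trans (hd w))))
  · rw [← torusParam_eq_iff hc hc7]
    exact ⟨fun hpq => h.injOn (hb p) (hb q) hpq, fun hpq => congrArg ι hpq⟩
  · rw [range_comp, range_torusParam hc hc7]

/-- The coefficients B and C, which make up the gradient of the logarithm of the action there,
vanish at the zeros of the cosine. -/
lemma rotField_of_mem_torusSet {c : ℝ} (hcos : Real.cos c = 0) (hle : Real.pi / 2 ≤ c)
    (hge : c ≤ 3 * Real.pi / 2) {x : ℂ × ℝ} (hx : x ∈ torusSet c) : rotField modelF x = 0 := by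
  have hx' : torusDist (‖x.1‖, x.2) = c := hx
  have h1 := three_halves_lt_of_profDom hle
  have h2 := three_pi_div_two_lt
  rw [rotField_modelF (by rwa [hx']) (by rw [hx']; linarith) (Or.inl (by rwa [hx'])), hx',
    coefB_of_mem h1.le, coefC_of_mem h1.le, flatC_of_eq hcos, flatD_of_eq hcos]
  refine Prod.ext ?_ (by simp [radLift])
  have h0 : (⟨0, 0⟩ : ℂ) = 0 := rfl
  simp [radLift, h0]

/-- Vanishing of the rotation field means ∂_θ = exp(F) r² X_λ, and the factor is constant along the
circle. The period T has the sign of ε. -/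
lemma IsModelSlice.isReebOrbit (h : IsModelSlice lam J ι) {c : ℝ} (hcos : Real.cos c = 0)
    (hle : Real.pi / 2 ≤ c) (hge : c ≤ 3 * Real.pi / 2) {x : ℂ × ℝ} (hx : x ∈ torusSet c)
    {ε : ℤ} (hε : ε ≠ 0) : IsReebOrbit lam fun t => ι (circRot ε t x) := by
  have hε' : (ε : ℝ) ≠ 0 := by exact_mod_cast hε
  have hc7 : c < 7 := by linarith [three_pi_div_two_lt]
  have hmem : ∀ t, circRot ε t x ∈ torusSet c := fun t => by
    show torusDist (‖(circRot ε t x).1‖, x.2) = c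
    rw [norm_circRot_fst]
    exact hx
  have hb : ∀ t, circRot ε t x ∈ Metric.ball 0 20 := fun t => torusSet_subset_ball hc7 (hmem t)
  have hs : ContDiff ℝ ∞ fun t => circRot ε t x :=
    (contDiff_circRot ε).comp (contDiff_id.prodMk contDiff_const)
  have hx0 : x.1 ≠ 0 := fst_ne_zero_of_torusDist_lt (lt_of_eq_of_lt hx hc7)
  refine ⟨fun t => (h.smooth _ (hb t)).comp t hs.contMDiff.contMDiffAt,
    fun t => by simp only [circRot_add_one],
    2 * Real.pi * ε * (Real.exp (modelF x) * ‖x.1‖ ^ 2), ?_, fun t => ?_⟩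
  · have := norm_pos_iff.2 hx0
    have := Real.pi_pos
    positivity
  · have h1 : (mfderiv 𝓘(ℝ, ℝ) (𝓡 (2 * n + 1)) (fun t => ι (circRot ε t x)) t (1 : ℝ) :
        Euc (2 * n + 1)) = sliceD (n := n) ι (circRot ε t x)
          (fderiv ℝ (fun t => circRot ε t x) t 1) :=
      mfderiv_comp_vec (g := fun t => circRot ε t x)
        ((h.smooth _ (hb t)).mdifferentiableAt (by simp)) (hs.differentiable (by simp) t) 1
    have h2 : fderiv ℝ (fun t => circRot ε t x) t 1 =
        (2 * Real.pi * ε * (Real.exp (modelF x) * ‖x.1‖ ^ 2)) •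
          modelReeb modelF (circRot ε t x) := by
      have h3 := rotField_of_mem_torusSet hcos hle hge (hmem t)
      have h4 : modelF (circRot ε t x) = modelF x := by
        rw [modelF, norm_circRot_fst]
        rfl
      rw [rotField, sub_eq_zero, h4, norm_circRot_fst] at h3
      rw [fderiv_apply_one_eq_deriv, (hasDerivAt_circRot ε t x).deriv, h3, smul_smul]
    rw [h2, map_smul] at h1
    exact h1.trans (congrArg (fun r : Euc (2 * n + 1) =>
      (2 * Real.pi * ε * (Real.exp (modelF x) * ‖x.1‖ ^ 2)) • r) (h.reeb_eq _ (hb t)).symm)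

lemma IsModelSlice.loopsTendsto (h : IsModelSlice lam J ι) (ε : ℤ) {x : ℕ → ℂ × ℝ} {y : ℂ × ℝ}
    (hy : y ∈ Metric.ball 0 20) (hx : Tendsto x atTop (𝓝 y)) :
    LoopsTendsto (d := 2 * n + 1) (fun k t => ι (circRot ε t (x k))) fun t => ι (circRot ε t y) :=
  loopsTendsto_of_smooth (B := fun p : ℝ × (ℂ × ℝ) => ι (circRot ε p.1 p.2))
    (Metric.isOpen_ball.preimage (contDiff_circRot ε).continuous)
    (fun p hp => ContMDiffAt.comp p (h.smooth _ hp) (contDiff_circRot ε).contMDiff.contMDiffAt)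
    (fun t => by
      rw [mem_preimage, mem_ball_zero_iff, norm_circRot]
      rwa [mem_ball_zero_iff] at hy) hx

/-- Loops that converge smoothly converge pointwise. -/
lemma LoopsTendsto.tendsto {d : ℕ} {N : Type*} [TopologicalSpace N] [ChartedSpace (Euc d) N]
    {v : ℕ → ℝ → N} {γ : ℝ → N} (h : LoopsTendsto (d := d) v γ) (t : ℝ) :
    Tendsto (fun k => v k t) atTop (𝓝 (γ t)) := by
  obtain ⟨U, -, htU, -, hvU, hconv⟩ := h t
  have h1 := (hconv 0).tendsto_at htU
  simp only [iteratedDeriv_zero] at h1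
  have h2 := (continuousAt_extChartAt_symm (I := 𝓡 d) (γ t)).tendsto.comp h1
  rw [extChartAt_to_inv] at h2
  refine h2.congr' ?_
  filter_upwards [hvU] with k hk
  exact (extChartAt (𝓡 d) (γ t)).left_inv (hk htU)

variable [T2Space M] {l : Filter ℝ} {c : ℝ} {Ω : Set ℂ} {e : Filter ℂ}

/-- Whatever coordinate and sequence are used, the points come from the surface and their distance
to (7, 0) tends to c. Compactness of `modelCore` lifts the convergence from M to ℂ × ℝ. -/
lemma IsModelSlice.mem_of_mem_limitSet (h : IsModelSlice lam J ι) (hP : IsProfile P)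
    (hend : IsSpiralEnd P l c) (hlog : Tendsto (fun ζ : ℂ => Real.log ‖ζ‖) e l)
    (hne : ∀ᶠ ζ in e, ζ ≠ 0) {γ : ℝ → M} (hγ : γ ∈ limitSet lam Ω e (ι ∘ profSurface P)) (t : ℝ) :
    γ t ∈ ι '' torusSet c := by
  obtain ⟨-, ψ, hψ, s, -, hs, hv⟩ := hγ
  have hζ : Tendsto (fun k => ψ (s k + t * Complex.I)) atTop e := by
    refine hψ.lim.comp (tendsto_comap_iff.2 (hs.congr fun k => ?_))
    simp
  have hu := hv.tendsto t
  obtain ⟨x, hx, κ, hκ, hlim⟩ := isCompact_modelCore.tendsto_subseq'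
    (x := fun k => profSurface P (ψ (s k + t * Complex.I)))
    ((hζ.eventually hne).mono fun k hk => hP.surface_mem hk).frequently
  refine ⟨x, ?_, ?_⟩
  · have h1 : Tendsto (fun k => torusDist
        (‖(profSurface P (ψ (s (κ k) + t * Complex.I))).1‖,
          (profSurface P (ψ (s (κ k) + t * Complex.I))).2)) atTop
        (𝓝 (torusDist (‖x.1‖, x.2))) :=
      ((continuous_torusDist.comp continuous_normPair).tendsto x).comp hlim
    have h2 := (hend.tendsto.comp hlog).comp (hζ.comp hκ.tendsto_atTop)
    refine tendsto_nhds_unique h1 (h2.congr' ?_)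
    filter_upwards [(hζ.comp hκ.tendsto_atTop).eventually hne] with k hk
    have := hP.surface_eq hk
    simp only [Function.comp_apply] at this ⊢
    rw [← this, torusDist_profCurve (by linarith [three_halves_lt_of_profDom (hP.mem
      (Real.log ‖ψ (s (κ k) + t * Complex.I)‖)).1.le])]
  · exact tendsto_nhds_unique
      ((h.smooth x (modelCore_subset hx)).continuousAt.tendsto.comp hlim)
      (hu.comp hκ.tendsto_atTop)

-- At the times when the spiral has angle φ, the loops are circles approaching the circle of angle φ
-- on the torus. Their phases need not converge, so a subsequence is taken; the image of the limit
-- does not depend on it.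
omit [T2Space M] in
lemma IsModelSlice.exists_mem_limitSet (h : IsModelSlice lam J ι) (hP : IsProfile P)
    (hend : IsSpiralEnd P l c) {ε : ℤ} (hε : ε ≠ 0)
    (hεl : Tendsto (fun s : ℝ => s / (2 * Real.pi * ε)) l atTop)
    (hψ : IsCylindricalCoord Ω e fun w => Complex.exp (2 * Real.pi * ε * w)) (φ : ℝ) :
    ∃ γ ∈ limitSet lam Ω e (ι ∘ profSurface P),
      range γ = ι '' {x | ‖x.1‖ = 7 - c * Real.cos φ ∧ x.2 = -(c * Real.sin φ)} := by
  have hε' : (ε : ℝ) ≠ 0 := by exact_mod_cast hε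
  have hπε : 2 * Real.pi * (ε : ℝ) ≠ 0 := mul_ne_zero (by positivity) hε'
  obtain ⟨s, hs, hcurve⟩ := hend.exists_seq φ
  have hsurf : ∀ σ t : ℝ, profSurface P (Complex.exp (2 * Real.pi * ε * (σ + t * Complex.I))) =
      circRot ε t (profAmp P (2 * Real.pi * ε * σ), profHeight P (2 * Real.pi * ε * σ)) := by
    intro σ t
    have h1 : (2 * Real.pi * ε * (σ + t * Complex.I) : ℂ) =
        (2 * Real.pi * ε * σ : ℝ) + (2 * Real.pi * ε * t : ℝ) * Complex.I := by
      push_cast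
      ring
    have h2 : ‖Complex.exp (2 * Real.pi * ε * (σ + t * Complex.I))‖ =
        Real.exp (2 * Real.pi * ε * σ) := by
      rw [h1, Complex.norm_exp]
      simp
    have h3 : ((Real.exp (2 * Real.pi * ε * σ) : ℝ) : ℂ) ≠ 0 := by
      exact_mod_cast (Real.exp_pos _).ne'
    rw [profSurface, polarMap, h2, Real.log_exp, circRot, h1, Complex.exp_add, ← Complex.ofReal_exp,
      mul_div_cancel_left₀ _ h3]
  have hcore : ∀ k, (profAmp P (s k), profHeight P (s k)) ∈ modelCore := fun k => by
    have h1 := hsurf (s k / (2 * Real.pi * ε)) 0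
    rw [mul_div_cancel₀ _ hπε] at h1
    have h2 : circRot ε 0 (profAmp P (s k), profHeight P (s k)) =
        (profAmp P (s k), profHeight P (s k)) := by
      simp [circRot]
    rw [← h2, ← h1]
    exact hP.surface_mem (Complex.exp_ne_zero _)
  obtain ⟨y, hy, κ, hκ, hlim⟩ := isCompact_modelCore.tendsto_subseq hcore
  have hyb := modelCore_subset hy
  have hPc : Tendsto (fun k => P (s (κ k))) atTop (𝓝 c) :=
    (hend.tendsto.comp hs).comp hκ.tendsto_atTop
  have hy1 : ‖y.1‖ = 7 - c * Real.cos φ := by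
    have h1 : Tendsto (fun k => ‖profAmp P (s (κ k))‖) atTop (𝓝 ‖y.1‖) :=
      ((continuous_norm.comp continuous_fst).tendsto y).comp hlim
    refine tendsto_nhds_unique h1 (((hPc.mul_const _).const_sub 7).congr fun k => ?_)
    rw [hP.norm_amp, hcurve]
  have hy2 : y.2 = -(c * Real.sin φ) := by
    have h1 : Tendsto (fun k => profHeight P (s (κ k))) atTop (𝓝 y.2) :=
      (continuous_snd.tendsto y).comp hlim
    refine tendsto_nhds_unique h1 ((hPc.mul_const _).neg.congr fun k => ?_)
    rw [profHeight, hcurve]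
  have hc0 : 0 < c := by linarith [three_halves_lt_of_profDom hend.le]
  have hyc : y ∈ torusSet c := mem_torusSet hc0.le hy1 hy2
  have hσ : Tendsto (fun k => s (κ k) / (2 * Real.pi * ε)) atTop atTop :=
    hεl.comp (hs.comp hκ.tendsto_atTop)
  obtain ⟨N, hN⟩ := eventually_atTop.1 (hσ.eventually_ge_atTop 0)
  refine ⟨fun t => ι (circRot ε t y), ⟨h.isReebOrbit hend.cos_eq hend.le hend.ge hyc hε, _, hψ,
    fun k => s (κ (k + N)) / (2 * Real.pi * ε), fun k => hN _ (by omega),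
    hσ.comp (tendsto_add_atTop_nat N), ?_⟩, ?_⟩
  · have h1 := h.loopsTendsto ε hyb (hlim.comp (tendsto_add_atTop_nat N))
    convert h1 using 3 with k t
    simp only [Function.comp_apply]
    rw [hsurf, mul_div_cancel₀ _ hπε]
  · apply Subset.antisymm
    · rintro _ ⟨t, rfl⟩
      exact ⟨_, ⟨(norm_circRot_fst ε t y).trans hy1, hy2⟩, rfl⟩
    · rintro _ ⟨x, ⟨hx1, hx2⟩, rfl⟩
      obtain ⟨t, ht⟩ := exists_circRot_eq hε (hx1.trans hy1.symm) (hx2.trans hy2.symm)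
      exact ⟨t, congrArg ι ht⟩

theorem IsModelSlice.hasTorusLimit (h : IsModelSlice lam J ι) (hP : IsProfile P)
    (hend : IsSpiralEnd P l c) (hlog : Tendsto (fun ζ : ℂ => Real.log ‖ζ‖) e l)
    (hne : ∀ᶠ ζ in e, ζ ≠ 0) {ε : ℤ} (hε : ε ≠ 0)
    (hεl : Tendsto (fun s : ℝ => s / (2 * Real.pi * ε)) l atTop)
    (hψ : IsCylindricalCoord Ω e fun w => Complex.exp (2 * Real.pi * ε * w)) :
    HasTorusLimit lam Ω e (ι ∘ profSurface P) := by
  have hc0 : 0 < c := by linarith [three_halves_lt_of_profDom hend.le]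
  have hc7 : c < 7 := by linarith [three_pi_div_two_lt, hend.ge]
  have hU : ⋃ γ ∈ limitSet lam Ω e (ι ∘ profSurface P), range γ = ι '' torusSet c := by
    apply Subset.antisymm
    · refine iUnion₂_subset fun γ hγ => ?_
      rintro _ ⟨t, rfl⟩
      exact h.mem_of_mem_limitSet hP hend hlog hne hγ t
    · rintro _ ⟨x, hx, rfl⟩
      obtain ⟨φ, h1, h2⟩ := exists_angle_of_mem hx
      obtain ⟨γ, hγ, hr⟩ := h.exists_mem_limitSet hP hend hε hεl hψ φ
      exact mem_iUnion₂.2 ⟨γ, hγ, hr ▸ mem_image_of_mem ι ⟨h1, h2⟩⟩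
  -- The angles 0 and π give the inner and the outer equator, of radii 7 - c and 7 + c.
  obtain ⟨γ₁, h1, hr1⟩ := h.exists_mem_limitSet hP hend hε hεl hψ 0
  obtain ⟨γ₂, h2, hr2⟩ := h.exists_mem_limitSet hP hend hε hεl hψ Real.pi
  refine ⟨hU ▸ h.isEmbeddedTorus hc0 hc7, γ₁, h1, γ₂, h2, fun heq => ?_⟩
  have hx : (((7 - c : ℝ) : ℂ), (0 : ℝ)) ∈
      {x : ℂ × ℝ | ‖x.1‖ = 7 - c * Real.cos 0 ∧ x.2 = -(c * Real.sin 0)} := by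
    refine ⟨?_, by simp⟩
    rw [Complex.norm_real, Real.norm_of_nonneg (by linarith), Real.cos_zero, mul_one]
  have h3 : ι (((7 - c : ℝ) : ℂ), (0 : ℝ)) ∈ range γ₂ := by
    rw [← heq, hr1]
    exact mem_image_of_mem ι hx
  rw [hr2] at h3
  obtain ⟨y, ⟨hy1, hy2⟩, hxy⟩ := h3
  have h4 := h.injOn (torusSet_subset_ball hc7 (mem_torusSet hc0.le hy1 hy2))
    (torusSet_subset_ball hc7 (mem_torusSet hc0.le hx.1 hx.2)) hxy
  rw [h4, hx.1, Real.cos_zero, Real.cos_pi] at hy1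
  linarith

end Slice

/-! ### Cylindrical coordinates at ∞ and at 0 -/

section Ends

/-- The restriction to ε = ±1 makes the exponential injective modulo i. The sign selects the
puncture, ∞ for 1 and 0 for -1. -/
lemma isCylindricalCoord_exp {ε : ℤ} (hε : ε = 1 ∨ ε = -1) {Ω : Set ℂ} {e : Filter ℂ}
    (hΩ : ∀ ζ ≠ 0, ζ ∈ Ω)
    (hlim : Tendsto (fun w : ℂ => Complex.exp (2 * Real.pi * ε * w)) (comap Complex.re atTop) e) :
    IsCylindricalCoord Ω e fun w => Complex.exp (2 * Real.pi * ε * w) := by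
  have hε0 : (ε : ℂ) ≠ 0 := by rcases hε with rfl | rfl <;> simp
  have hπ : (Real.pi : ℂ) ≠ 0 := by exact_mod_cast Real.pi_ne_zero
  have hd : ∀ w, HasDerivAt (fun w : ℂ => Complex.exp (2 * Real.pi * ε * w))
      (Complex.exp (2 * Real.pi * ε * w) * (2 * Real.pi * ε)) w := fun w => by
    simpa using ((hasDerivAt_id w).const_mul (2 * Real.pi * ε : ℂ)).cexp
  refine ⟨fun w _ => ?_, fun w _ => ?_, fun w _ => hΩ _ (Complex.exp_ne_zero _), fun w w' _ _ => ?_,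
    hlim⟩
  · have : Differentiable ℂ fun w : ℂ => Complex.exp (2 * Real.pi * ε * w) := fun w =>
      (hd w).differentiableAt
    exact this.analyticAt w
  · rw [(hd w).deriv]
    exact mul_ne_zero (Complex.exp_ne_zero _)
      (mul_ne_zero (mul_ne_zero two_ne_zero hπ) hε0)
  · rw [eq_comm, Complex.exp_eq_exp_iff_exists_int]
    have key : ∀ k : ℤ, 2 * Real.pi * ε * w' = 2 * Real.pi * ε * w + k * (2 * Real.pi * Complex.I) ↔
        w' = w + ((ε * k : ℤ) : ℂ) * Complex.I := fun k => by
      have hsq : (ε : ℂ) * ε = 1 := by rcases hε with rfl | rfl <;> simp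
      push_cast
      constructor
      · intro h
        refine mul_left_cancel₀ (mul_ne_zero (mul_ne_zero two_ne_zero hπ) hε0) (h.trans ?_)
        linear_combination (-2 * Real.pi * k * Complex.I) * hsq
      · rintro rfl
        linear_combination (2 * Real.pi * k * Complex.I) * hsq
    have hεε : ∀ k : ℤ, ε * (ε * k) = k := fun k => by rcases hε with rfl | rfl <;> simp
    exact ⟨fun ⟨k, hk⟩ => ⟨ε * k, (key k).1 hk⟩,
      fun ⟨k, hk⟩ => ⟨ε * k, (key (ε * k)).2 (by rwa [hεε])⟩⟩

lemma norm_cexp_two_pi_mul (ε : ℤ) (w : ℂ) :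
    ‖Complex.exp (2 * Real.pi * ε * w)‖ = Real.exp (2 * Real.pi * ε * w.re) := by
  rw [Complex.norm_exp]
  simp

lemma tendsto_cexp_cocompact :
    Tendsto (fun w : ℂ => Complex.exp (2 * Real.pi * (1 : ℤ) * w)) (comap Complex.re atTop)
      (cocompact ℂ) := by
  rw [← Metric.cobounded_eq_cocompact, ← tendsto_norm_atTop_iff_cobounded]
  simp only [norm_cexp_two_pi_mul]
  refine Real.tendsto_exp_atTop.comp (tendsto_comap.const_mul_atTop ?_)
  simp [Real.pi_pos]

lemma tendsto_cexp_nhdsNE :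
    Tendsto (fun w : ℂ => Complex.exp (2 * Real.pi * (-1 : ℤ) * w)) (comap Complex.re atTop)
      (𝓝[≠] 0) := by
  refine tendsto_nhdsWithin_iff.2 ⟨tendsto_zero_iff_norm_tendsto_zero.2 ?_,
    Eventually.of_forall fun w => Complex.exp_ne_zero _⟩
  simp only [norm_cexp_two_pi_mul]
  refine Real.tendsto_exp_atBot.comp (tendsto_comap.const_mul_atTop_of_neg ?_)
  simp [Real.pi_pos]

end Ends

/-! ### The main theorem -/

theorem theorem1p1 {n : ℕ} (hn : 1 ≤ n) {M : Type*} [TopologicalSpace M] [T2Space M]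
    [SecondCountableTopology M] [Nonempty M] [ChartedSpace (Euc (2 * n + 1)) M]
    [IsManifold (𝓡 (2 * n + 1)) ∞ M]
    (ξ : ∀ x : M, Submodule ℝ (TangentSpace (𝓡 (2 * n + 1)) x))
    (α : OneForm (2 * n + 1) M) (hα : IsContactForm α)
    (hξ : ∀ x, LinearMap.ker (α x : TangentSpace (𝓡 (2 * n + 1)) x →ₗ[ℝ] ℝ) = ξ x) :
    ∃ (lam : OneForm (2 * n + 1) M) (J : TangentEnd (2 * n + 1) M),
      IsContactForm lam ∧
      (∀ x, LinearMap.ker (lam x : TangentSpace (𝓡 (2 * n + 1)) x →ₗ[ℝ] ℝ) = ξ x) ∧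
      (∀ x v, 0 < α x v → 0 < lam x v) ∧
      IsCompatible lam J ∧
      (∃ (a : ℂ → ℝ) (u : ℂ → M), IsFiniteEnergyCurve lam J univ a u ∧
        HasTorusLimit lam univ (cocompact ℂ) u) ∧
      (∃ (a : ℂ → ℝ) (u : ℂ → M), IsFiniteEnergyCurve lam J {0}ᶜ a u ∧
        HasTorusLimit lam {0}ᶜ (cocompact ℂ) u ∧ HasTorusLimit lam {0}ᶜ (𝓝[≠] 0) u) := by
  -- Together with second countability this gives the σ-compactness needed for the partition of
  -- unity.
  have : LocallyCompactSpace M := ChartedSpace.locallyCompactSpace (Euc (2 * n + 1)) M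
  obtain ⟨k, J, ι, hk, h1, h2, h3, h4, h5⟩ := hα.exists_model_slice hn (Classical.arbitrary M)
    contDiff_modelF (contDiff_modelReeb contDiff_modelF) (exp_mul_stdForm_modelReeb modelF)
    (fun p v => dform_modelReeb (contDiff_modelF.differentiable (by simp) p) v)
    isCompact_modelCore modelCore_subset (fun p hp => modelPairs_eq_empty hp) stdForm_modelPairs
    fun p hp => hasModelFrame hp
  have h : IsModelSlice (fun x => k x • α x) J ι := ⟨h1, h2, h3, fun p hp => (h4 p hp).1,
    fun p hp => (h4 p hp).2.1, fun p hp => (h4 p hp).2.2.1, fun p hp => (h4 p hp).2.2.2, h5⟩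
  have hlog1 : Tendsto (fun ζ : ℂ => Real.log ‖ζ‖) (cocompact ℂ) atTop :=
    Real.tendsto_log_atTop.comp tendsto_norm_cocompact_atTop
  have hlog0 : Tendsto (fun ζ : ℂ => Real.log ‖ζ‖) (𝓝[≠] 0) atBot :=
    Real.tendsto_log_nhdsGT_zero.comp tendsto_norm_nhdsNE_zero
  have hne1 : ∀ᶠ ζ in cocompact ℂ, ζ ≠ (0 : ℂ) :=
    (isCompact_singleton (x := (0 : ℂ))).compl_mem_cocompact
  have hε1 : Tendsto (fun s : ℝ => s / (2 * Real.pi * (1 : ℤ))) atTop atTop :=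
    tendsto_id.atTop_div_const (by simp [Real.pi_pos])
  have hε0 : Tendsto (fun s : ℝ => s / (2 * Real.pi * (-1 : ℤ))) atBot atTop :=
    by
    simp only [div_eq_mul_inv]
    exact tendsto_id.atBot_mul_const_of_neg (by simp [Real.pi_pos])
  obtain ⟨P, hP, hPend, hPexp⟩ := exists_plane_profile
  obtain ⟨Q, hQ, hQ1, hQ0⟩ := exists_cylinder_profile
  obtain ⟨a, ha⟩ := h.isFiniteEnergyCurve_plane hP hPexp
  refine ⟨fun x => k x • α x, J, h1, fun x => ?_, fun x v hv => ?_, h2,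
    ⟨a, _, ha, h.hasTorusLimit hP hPend hlog1 hne1 one_ne_zero hε1
      (isCylindricalCoord_exp (Or.inl rfl) (fun ζ _ => mem_univ ζ) tendsto_cexp_cocompact)⟩,
    ⟨_, _, h.isFiniteEnergyCurve_cylinder hQ, h.hasTorusLimit hQ hQ1 hlog1 hne1 one_ne_zero hε1
      (isCylindricalCoord_exp (Or.inl rfl) (fun ζ hζ => hζ) tendsto_cexp_cocompact),
      h.hasTorusLimit hQ hQ0 hlog0 self_mem_nhdsWithin (by decide) hε0
      (isCylindricalCoord_exp (Or.inr rfl) (fun ζ hζ => hζ) tendsto_cexp_nhdsNE)⟩⟩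
  · rw [← hξ]
    ext v
    simp [(hk x).ne']
  · exact mul_pos (hk x) hv
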